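/- **Setting.** Let $p\ge 0$, $d\ge 2$, with at least one of $p+1$, $d$ even, and put $D=p+1+d$. Let $f_1,f_2,f$ be smooth real functions of $y\in\mathbb R^d$ with $f_1,f_2>0$, and equip $M=\mathbb R^{p+1}\times\mathbb R^d$ (coordinates $x^\mu$, $0\le\mu\le p$, and $y^i$, $1\le i\le d$) with the Lorentzian $p$-brane metric $g=f_1(y)^2\,dx^2+f_2(y)^2\,dy^2$, $dx^2=-(dx^0)^2+\sum_{\mu\ge1}(dx^\mu)^2$. Let $S$ be a complex spinor module of dimension $2^{\lfloor D/2\rfloor}$, with constant matrices $\gamma_{\check A}$ satisfying $\gamma_{\check A}\gamma_{\check B}+\gamma_{\check B}\gamma_{\check A}=-2\eta_{AB}$; the spinor bundle is trivialised by the orthonormal frame $e_{\check\mu}=f_1^{-1}\partial_\mu$, $e_{\check\imath}=f_2^{-1}\partial_i$, and $\gamma_\mu=f_1\gamma_{\check\mu}$, $\gamma_i=f_2\gamma_{\check\imath}$. Multi-index gamma matrices are antisymmetrised with weight one; repeated indices are summed. Let $\gamma^{[d]}$ be the product of the $d$ matrices $\gamma_{\check\imath}$ in order, and $\varepsilon\in\{1,i\}$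 with $(\varepsilon\gamma^{[d]})^2=1$. Let $F_{m_1\dots m_{d-1}}=\epsilon_{m_1\dots m_{d-1}n}\,\partial_n f$ be the magnetic $(d-1)$-form (components with an index in $\mathbb R^{p+1}$ vanish), and let $D^C=\nabla-\mathcal A^C$, where $\nabla$ is the spinorial Levi-Civita connection and, for $\alpha,\beta\in\mathbb C$, $\alpha\ne0$, $$-\mathcal A^C_A=\alpha F_{AA_1\dots A_{d-2}}\gamma^{A_1\dots A_{d-2}}+\beta F_{A_1\dots A_{d-1}}\gamma_A{}^{A_1\dots A_{d-1}} .$$ Assume that for signs $\delta_1=\delta_2\in\{\pm1\}$ $$X_i:=\partial_i(\ln f_1)f_1f_2^{-1}=(-1)^d\delta_1\tfrac2\varepsilon\beta(d-1)!\,(\partial_if)f_1f_2^{1-d},\qquad Y_i:=\partial_i(\ln f_2)=-(-1)^d\delta_2\tfrac2\varepsilon\alpha(d-2)!\,(\partial_if)f_2^{2-d},$$ and put $\Pi=\frac12(1-\delta_1\varepsilon\gamma^{[d]})$. **0. (Form of the connection.)** $$D^C_\mu=\partial_\mu-X_i\gamma_{\check\mu\check\imath}\Pi,\qquad D^C_i=\partial_i-Y_j\gamma_{\check\imath\check\jmath}\Pi+\delta_2\varepsilon\tfrac{(d-1)\beta}{2\alpha}Y_i\gamma^{[d]}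 .$$ **1. (Holonomy.)** Assume that $\beta\ne0$ and that there is a point $y$ at which the symmetric matrix $K_{ij}=\partial_iY_j-2Y_iY_j+|Y|^2\delta_{ij}$ is not of the form $cJ$ with $c\in\mathbb R$ and $J=J^T$, $J^2=1$, $J\ne\pm1$. Let $\mathfrak{hol}_x\subset\mathrm{End}(S)$ be the real Lie algebra of the holonomy group of $D^C$ at $x$. Let $\varphi(M)=-\frac14\sum_{i,j}M_{ij}\gamma_{\check\imath}\gamma_{\check\jmath}\,\Pi$ for $M\in\mathfrak{so}(d)$. Then $\varphi$ is a homomorphism of Lie algebras into the endomorphisms of $\Pi(S)$ (extended by zero on $\ker\Pi$), with trace zero if $d\ge3$ and injective if $d\neq4$, and there is a real vector space $V\subset\mathrm{End}(S)$ of pairwise commuting endomorphisms, with $[\varphi(M),V]\subset V$ for all $M$ and $\varphi(\mathfrak{so}(d))\cap V=0$, such that at every $x$ $$\mathfrak{hol}_x=\varphi(\mathfrak{so}(d))\ltimes V .$$ Let $S_d$ be a complex spinor module of dimension $2^{\lfloor d/2\rfloor}$ of the Clifford algebra of $\mathbb R^d$ and, for even $d$, let $S_d^\pm$ be the half-spinor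 modules. Put $q=p+1$, except that $q=1$ if $p=1$ and $d$ is odd. As complex $\mathfrak{so}(d)$-modules (the action on $V$ being $[\varphi(M),\cdot\,]$), $$V\otimes_{\mathbb R}\mathbb C\;\cong\;\begin{cases} q\,2^{\frac{d-1}2}\,S_d & d\text{ odd},\\ (p+1)\,2^{\frac d2-1}\,\tilde S_d\ \text{ with }\tilde S_d\in\{S_d^+,S_d^-\} & d\equiv0\bmod4,\\ (p+1)\,2^{\frac d2-1}\,(S_d^+\oplus S_d^-) & d\equiv2\bmod4,\end{cases}$$ so that there are $(p+1)2^{\frac d2}$ half-spinor summands in the last case. **2. (Torsion.)** Let $C$ be a charge conjugation on $S$: a nondegenerate bilinear form with $C(\phi,\psi)=\Delta_0C(\psi,\phi)$ and $C(\phi,\gamma_{\check A}\psi)=\Delta_1C(\psi,\gamma_{\check A}\phi)$, $\Delta_0,\Delta_1\in\{\pm1\}$. Put $\Delta_k=(-1)^{k(k-1)/2}\Delta_0^{k+1}\Delta_1^k$ and assume $\Delta_{d-1}\Delta_1=-1$. Let $D$ be the connection for which $D\otimes1+1\otimes D^C$ makes $C$ parallel, let $$(\hat D_A\gamma)_B\,\xi=D_A(\gamma_B\xi)-\gamma(\nabla_A\partial_B)\xi-\gamma_BD^C_A\xi$$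 and let $\mathcal T_{AB}=(\hat D_A\gamma)_B-(\hat D_B\gamma)_A$ be the torsion of $D$. Then $D$ is admissible, i.e. $\hat D\gamma$ is skew symmetric, so $\mathcal T=2\hat D\gamma$, and $$\tfrac12\mathcal T_{\mu\nu}=\delta_1\varepsilon f_1f_2\,X\cdot\gamma_{\check\mu\check\nu}\gamma^{[d]},\qquad \tfrac12\mathcal T_{\mu i}=-\delta_1\varepsilon f_2X_i\gamma_{\check\mu}\gamma^{[d]}=\delta_2\varepsilon(d-1)\beta\alpha^{-1}f_1Y_i\gamma_{\check\mu}\gamma^{[d]},\qquad \tfrac12\mathcal T_{ij}=\delta_2\varepsilon f_2Y_k\gamma_{\check k\check\imath\check\jmath}\gamma^{[d]},$$ where $X\cdot$ is Clifford multiplication with the vector field $g^{ij}X_j\partial_i$. **3. (Parallel spinors.)** Under the assumptions of 2, let $\mathcal K$ be the space of smooth spinor fields $\eta$ with $D^C\eta=0$ that are annihilated by Clifford multiplication with the gradient field of $f$. Then $\mathcal K$ is admissible, i.e. $(\hat D_A\gamma)_B\eta+(\hat D_B\gamma)_A\eta=0$ for all $\eta\in\mathcal K$ and all $A,B$, and torsion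 free, i.e. $\sum_A\big(\gamma^A\varphi\wedge\mathcal T_{AB}\psi+\gamma^A\psi\wedge\mathcal T_{AB}\varphi\big)=0$ in $\Lambda^2S$ for all $\varphi,\psi\in\mathcal K$ and all $B$. -/

import Mathlib

open scoped ContDiff TensorProduct

attribute [local instance 100] LieRing.ofAssociativeRing

noncomputable section

namespace Brane

universe u v

/-! ## Clifford algebra -/

section Clifford

variable {V : Type u} [AddCommGroup V] [Module ℂ V]

/-- The antisymmetrised product `a_{[1} ⋯ a_{k]} = (1 / k!) ∑_π sgn π · a_{π 1} ⋯ a_{π k}`. -/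
def asym {k : ℕ} (a : Fin k → Module.End ℂ V) : Module.End ℂ V :=
  ((k.factorial : ℂ)⁻¹) •
    ∑ π : Equiv.Perm (Fin k), ((Equiv.Perm.sign π : ℤ) : ℂ) • (List.ofFn fun j => a (π j)).prod

/-- The ordered product `γ^{[d]} = γ_1 ⋯ γ_d`. -/
def vol {d : ℕ} (τ : Fin d → Module.End ℂ V) : Module.End ℂ V := (List.ofFn τ).prod

/-- `τ_1, …, τ_d` are the gamma matrices of Euclidean `ℝ^d`, with the convention
`τ_i τ_j + τ_j τ_i = -2 δ_ij`. -/
def IsEuclideanClifford {d : ℕ} (τ : Fin d → Module.End ℂ V) : Prop :=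
  ∀ i j, τ i * τ j + τ j * τ i = if i = j then (-2 : ℂ) • (1 : Module.End ℂ V) else 0

/-- The infinitesimal spin representation `M ↦ -¼ ∑ M_ij τ_i τ_j`.  With `τ_i² = -1` the sign is the
one for which `[spinRep τ M, τ(v)] = τ(M v)` for all skew-symmetric `M`. -/
def spinRep {d : ℕ} (τ : Fin d → Module.End ℂ V) (M : Matrix (Fin d) (Fin d) ℝ) :
    Module.End ℂ V :=
  (-(1 / 4) : ℂ) • ∑ i, ∑ j, ((M i j : ℝ) : ℂ) • (τ i * τ j)

/-- The half-spinors: the `±1`-eigenspace of `ε γ^{[d]}`. -/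
def halfSpin {d : ℕ} (τ : Fin d → Module.End ℂ V) (ε : ℂ) (s : ℤˣ) : Submodule ℂ V :=
  Module.End.eigenspace (ε • vol τ) ((s : ℤ) : ℂ)

end Clifford

/-! ## Holonomy of a connection on a trivial vector bundle over `ℝ^ι` -/

section Holonomy

variable {ι : Type} [Fintype ι] {S : Type u} [NormedAddCommGroup S] [NormedSpace ℂ S]

/-- `IsTransport om x y P`: `P` is the parallel transport, for the connection `∂_A + om_A`, along a
piecewise continuously differentiable path from `x` to `y`.  A single piece is a `C¹` path `c`
on `[0, 1]` (restricted from the real line); `P v` is the end value of the solution `u` of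
`u' + ∑_A c'_A om_A(c) u = 0`, `u(0) = v`. -/
inductive IsTransport (om : ι → (ι → ℝ) → Module.End ℂ S) :
    (ι → ℝ) → (ι → ℝ) → Module.End ℂ S → Prop
  | path (c : ℝ → ι → ℝ) (hc : ContDiff ℝ 1 c) (P : Module.End ℂ S)
      (hP : ∀ v : S, ∃ u : ℝ → S, u 0 = v ∧ u 1 = P v ∧
        ∀ t : ℝ, HasDerivAt u (-∑ A, ((deriv c t A : ℝ) : ℂ) • om A (c t) (u t)) t) :
      IsTransport om (c 0) (c 1) P
  | trans {x y z : ι → ℝ} {P Q : Module.End ℂ S} :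
      IsTransport om x y P → IsTransport om y z Q → IsTransport om x z (Q * P)

/-- The holonomy group at `x`: parallel transports along piecewise `C¹` loops. -/
def holonomyGroup (om : ι → (ι → ℝ) → Module.End ℂ S) (x : ι → ℝ) : Set (Module.End ℂ S) :=
  {P | IsTransport om x x P}

/-- The holonomy algebra at `x`: the (real) Lie algebra of the holonomy group, i.e. the Lie algebra
of the velocities at the identity of `C¹` curves that run in the holonomy group. -/
def holonomyAlgebra (om : ι → (ι → ℝ) → Module.End ℂ S) (x : ι → ℝ) :
    LieSubalgebra ℝ (Module.End ℂ S) :=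
  LieSubalgebra.lieSpan ℝ (Module.End ℂ S)
    {A | ∃ c : ℝ → Module.End ℂ S, (∀ v, ContDiff ℝ 1 fun t => c t v) ∧
      (∀ t, c t ∈ holonomyGroup om x) ∧ c 0 = 1 ∧ ∀ v, deriv (fun t => c t v) 0 = A v}

end Holonomy

/-! ## Brane data -/

/-- Indices: `Sum.inl μ` (`0 ≤ μ ≤ p`) for `ℝ^{p+1}`, `Sum.inr i` for the transversal `ℝ^d`. -/
abbrev Idx (p d : ℕ) : Type := Fin (p + 1) ⊕ Fin d

/-- Points of `ℝ^{p+1} × ℝ^d`. -/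
abbrev Pt (p d : ℕ) : Type := Idx p d → ℝ

/-- The component `y ∈ ℝ^d` of a point. -/
def ypart {p d : ℕ} (x : Pt p d) : Fin d → ℝ := fun i => x (Sum.inr i)

/-- The Lorentzian signs `η_AA`: `-1` for the time index `0`, and `1` otherwise. -/
def eta {p d : ℕ} : Idx p d → ℝ
  | Sum.inl μ => if μ = 0 then -1 else 1
  | Sum.inr _ => 1

/-- The partial derivative `∂_i h` of a function on `ℝ^d`. -/
def pd {d : ℕ} (i : Fin d) (h : (Fin d → ℝ) → ℝ) (y : Fin d → ℝ) : ℝ :=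
  fderiv ℝ h y (Pi.single i 1)

/-- The Levi-Civita symbol `ε_{v_1 … v_k}` (used for `k = d`): the sign of the permutation `v`,
and `0` if two indices agree. -/
def levi {d k : ℕ} (v : Fin k → Fin d) : ℤ :=
  ∏ a, ∏ b ∈ Finset.Ioi a, ((SignType.sign (((v b : ℕ) : ℤ) - ((v a : ℕ) : ℤ)) : SignType) : ℤ)

/-- The raw data: the (constant) gamma matrices `γ_Ǎ` of the orthonormal frame, acting on the
spinor space `S`, the functions `f₁, f₂, f` on `ℝ^d`, the coefficients `α, β`, the factor `ε`
and the two signs. -/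
structure Data (p d : ℕ) (S : Type u) [NormedAddCommGroup S] [NormedSpace ℂ S] where
  /-- gamma matrices of the orthonormal frame -/
  γ : Idx p d → Module.End ℂ S
  /-- warp factor of `ℝ^{p+1}` -/
  f₁ : (Fin d → ℝ) → ℝ
  /-- warp factor of `ℝ^d` -/
  f₂ : (Fin d → ℝ) → ℝ
  /-- potential of the magnetic form -/
  f : (Fin d → ℝ) → ℝ
  /-- coefficient of `X ⌟ F` -/
  α : ℂ
  /-- coefficient of `X ∧ F` -/
  β : ℂ
  /-- the factor with `(ε γ^{[d]})² = 1` -/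
  ε : ℂ
  /-- first sign -/
  δ₁ : ℤˣ
  /-- second sign -/
  δ₂ : ℤˣ

namespace Data

variable {p d : ℕ} {S : Type u} [NormedAddCommGroup S] [NormedSpace ℂ S] (B : Data p d S)

/-! ### Metric, gamma matrices, Levi-Civita connection -/

/-- The factor `f_A` with `∂_A = f_A e_Ǎ` for the orthonormal frame `e_Ǎ`. -/
def scale : Idx p d → Pt p d → ℝ
  | Sum.inl _, x => B.f₁ (ypart x)
  | Sum.inr _, x => B.f₂ (ypart x)

/-- The metric `g = f₁² (-(dx⁰)² + (dx¹)² + ⋯) + f₂² dy²` in coordinates. -/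
def metric (x : Pt p d) : Matrix (Idx p d) (Idx p d) ℝ :=
  Matrix.diagonal fun A => eta A * B.scale A x ^ 2

/-- The partial derivative `∂_A g_{CE}`. -/
def dmetric (A C E : Idx p d) (x : Pt p d) : ℝ :=
  fderiv ℝ (fun z => B.metric z C E) x (Pi.single A 1)

/-- `Γ_{ACE} = ½ (∂_A g_{CE} + ∂_E g_{CA} - ∂_C g_{AE})`, i.e. `g(∂_C, ∇_A ∂_E)`: the middle index is
the lowered upper index. -/
def christoffelLow (A C E : Idx p d) (x : Pt p d) : ℝ :=
  (B.dmetric A C E x + B.dmetric E C A x - B.dmetric C A E x) / 2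

/-- The Christoffel symbols: `∇_A ∂_E = ∑_C christoffel A E C · ∂_C`. -/
def christoffel (A E C : Idx p d) (x : Pt p d) : ℝ :=
  ∑ G, (B.metric x)⁻¹ C G * B.christoffelLow A G E x

/-- Coordinate gamma matrices `γ_A = γ(∂_A)`. -/
def gamLow (A : Idx p d) (x : Pt p d) : Module.End ℂ S := ((B.scale A x : ℝ) : ℂ) • B.γ A

/-- Coordinate gamma matrices with raised index, `γ^A = g^{AE} γ_E`. -/
def gamUp (A : Idx p d) (x : Pt p d) : Module.End ℂ S :=
  ∑ E, (((B.metric x)⁻¹ A E : ℝ) : ℂ) • B.gamLow E x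

/-- Clifford multiplication with the vector `∑_A w_A ∂_A` at `x`. -/
def cliff (w : Idx p d → ℝ) (x : Pt p d) : Module.End ℂ S :=
  ∑ A, ((w A : ℝ) : ℂ) • B.gamLow A x

/-- The vector with covariant components `w_i` in the directions of `ℝ^d` (and `0` in those of
`ℝ^{p+1}`). -/
def raise (w : Fin d → ℝ) (x : Pt p d) : Idx p d → ℝ :=
  fun A => ∑ i, (B.metric x)⁻¹ A (Sum.inr i) * w i

/-- The matrix `γ^{[d]}` of the space factor. -/
def gvol : Module.End ℂ S := vol fun i => B.γ (Sum.inr i)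

/-- The spinorial Levi-Civita connection `∇_A = ∂_A + spinLC A`,
`spinLC A = -¼ ∑ Γ_{ACE} γ^{CE}`; the sign is the one that makes the Clifford multiplication parallel
for the convention `XY + YX = -2 g(X,Y)`. -/
def spinLC (A : Idx p d) (x : Pt p d) : Module.End ℂ S :=
  (-(1 / 4) : ℂ) • ∑ C, ∑ E, ((B.christoffelLow A C E x : ℝ) : ℂ) •
    asym ![B.gamUp C x, B.gamUp E x]

/-! ### The magnetic form and the connections -/

/-- The components of the magnetic form, `F_{m_1 … m_{d-1}} = ε_{m_1 … m_{d-1} n} δ^{nk} ∂_k f`; all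
components with an index in `ℝ^{p+1}` vanish.  Used for `k = d - 1`. -/
def magneticForm {k : ℕ} (m : Fin k → Idx p d) (x : Pt p d) : ℝ :=
  ∑ w : Fin k → Fin d, if m = (fun j => Sum.inr (w j)) then
    ∑ n, ((levi (Fin.snoc w n : Fin (k + 1) → Fin d) : ℤ) : ℝ) * pd n B.f (ypart x) else 0

/-- The potential `-𝒜^C_A = α F_{A C_1 … C_{d-2}} γ^{C_1 … C_{d-2}} +
β F_{C_1 … C_{d-1}} γ_A^{C_1 … C_{d-1}}`. -/
def negAC (A : Idx p d) (x : Pt p d) : Module.End ℂ S :=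
  B.α • ∑ m : Fin (d - 2) → Idx p d,
      ((B.magneticForm (Fin.cons A m : Fin (d - 2 + 1) → Idx p d) x : ℝ) : ℂ) •
        asym (fun j => B.gamUp (m j) x) +
    B.β • ∑ m : Fin (d - 1) → Idx p d, ((B.magneticForm m x : ℝ) : ℂ) •
        asym (Fin.cons (B.gamLow A x) (fun j => B.gamUp (m j) x) :
          Fin (d - 1 + 1) → Module.End ℂ S)

/-- The connection `D^C = ∇ - 𝒜^C`, as `D^C_A = ∂_A + connC A`. -/
def connC (A : Idx p d) (x : Pt p d) : Module.End ℂ S := B.spinLC A x + B.negAC A x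

/-- `X_i = ∂_i (ln f₁) f₁ f₂⁻¹`. -/
def X (i : Fin d) (y : Fin d → ℝ) : ℝ :=
  pd i (fun z => Real.log (B.f₁ z)) y * B.f₁ y * (B.f₂ y)⁻¹

/-- `Y_i = ∂_i (ln f₂)`. -/
def Y (i : Fin d) (y : Fin d → ℝ) : ℝ := pd i (fun z => Real.log (B.f₂ z)) y

/-- The projection `½ (1 - δ₁ ε γ^{[d]})`. -/
def proj : Module.End ℂ S := (1 / 2 : ℂ) • (1 - (((B.δ₁ : ℤ) : ℂ) * B.ε) • B.gvol)

/-- The covariant derivative `∂_A ξ + om_A ξ` of a spinor field. -/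
def cov (om : Idx p d → Pt p d → Module.End ℂ S) (A : Idx p d) (ξ : Pt p d → S) (x : Pt p d) : S :=
  fderiv ℝ ξ x (Pi.single A 1) + om A x (ξ x)

/-- The standing assumptions on a brane. -/
structure IsBrane : Prop where
  two_le : 2 ≤ d
  /-- at least one of the two factors is even dimensional -/
  parity : Even d ∨ Even (p + 1)
  /-- Clifford relation `γ_A γ_C + γ_C γ_A = -2 η_AC` -/
  clifford : ∀ A C, B.γ A * B.γ C + B.γ C * B.γ A =
    if A = C then ((-2 * eta A : ℝ) : ℂ) • (1 : Module.End ℂ S) else 0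
  /-- `S` is the complex spinor module of dimension `2^⌊D/2⌋`, `D = p + 1 + d` -/
  dim : Module.finrank ℂ S = 2 ^ ((p + 1 + d) / 2)
  smooth₁ : ContDiff ℝ ∞ B.f₁
  smooth₂ : ContDiff ℝ ∞ B.f₂
  smooth : ContDiff ℝ ∞ B.f
  pos₁ : ∀ y, 0 < B.f₁ y
  pos₂ : ∀ y, 0 < B.f₂ y
  eps : B.ε = 1 ∨ B.ε = Complex.I
  eps_sq : (B.ε • B.gvol) * (B.ε • B.gvol) = 1
  /-- the two signs agree, so that the same projection occurs in all components of `D^C` -/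
  signs : B.δ₁ = B.δ₂
  α_ne : B.α ≠ 0
  /-- compatibility of `f₁, f₂` with `f`, first part -/
  choice₁ : ∀ i y, ((B.X i y : ℝ) : ℂ) =
    (-1) ^ d * ((B.δ₁ : ℤ) : ℂ) * (2 / B.ε) * B.β * ((d - 1).factorial : ℂ) *
      ((pd i B.f y * B.f₁ y * B.f₂ y ^ (1 - (d : ℤ)) : ℝ) : ℂ)
  /-- compatibility of `f₁, f₂` with `f`, second part -/
  choice₂ : ∀ i y, ((B.Y i y : ℝ) : ℂ) =
    -(-1) ^ d * ((B.δ₂ : ℤ) : ℂ) * (2 / B.ε) * B.α * ((d - 2).factorial : ℂ) *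
      ((pd i B.f y * B.f₂ y ^ (2 - (d : ℤ)) : ℝ) : ℂ)

/-- The symmetric matrix `K_ij = ∂_i Y_j - 2 Y_i Y_j + |Y|² δ_ij`, which determines the curvature of
the conformally flat metric `f₂⁴ dy²`. -/
def K (y : Fin d → ℝ) : Matrix (Fin d) (Fin d) ℝ := Matrix.of fun i j =>
  pd i (B.Y j) y - 2 * B.Y i y * B.Y j y + if i = j then ∑ k, B.Y k y ^ 2 else 0

/-- Genericity of the warp factor at `y`: `K(y)` is not a real multiple (zero included) of an
orthogonal involution `J ≠ ±1`. -/
def IsGenericAt (y : Fin d → ℝ) : Prop :=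
  ¬ ∃ (c : ℝ) (J : Matrix (Fin d) (Fin d) ℝ),
    J.IsSymm ∧ J * J = 1 ∧ J ≠ 1 ∧ J ≠ -1 ∧ B.K y = c • J

/-- The smooth spinor fields `η` with `D^C η = 0` that are annihilated by the Clifford multiplication
with the gradient field of `f`. -/
def parallelKernel : Submodule ℂ (Pt p d → S) where
  carrier := {η | ContDiff ℝ ∞ η ∧ (∀ A x, cov B.connC A η x = 0) ∧
    ∀ x, B.cliff (B.raise (fun i => pd i B.f (ypart x)) x) x (η x) = 0}
  zero_mem' := by
    refine ⟨contDiff_const, fun A x => ?_, fun x => by simp⟩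
    have h : fderiv ℝ (0 : Pt p d → S) x = 0 := by
      simp
    simp [cov, h]
  add_mem' := by
    rintro a b ⟨ha, ha1, ha2⟩ ⟨hb, hb1, hb2⟩
    refine ⟨ha.add hb, fun A x => ?_, fun x => by simp [ha2 x, hb2 x]⟩
    have h := fderiv_add (ha.differentiable (by simp) x) (hb.differentiable (by simp) x)
    have h1 := ha1 A x
    have h2 := hb1 A x
    unfold cov at h1 h2 ⊢
    rw [h]
    simp only [_root_.add_apply, Pi.add_apply, map_add]
    rw [add_add_add_comm, h1, h2, add_zero]
  smul_mem' := by
    rintro c a ⟨ha, ha1, ha2⟩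
    refine ⟨contDiff_const.smul ha, fun A x => ?_, fun x => by simp [ha2 x]⟩
    have h := fderiv_const_smul (ha.differentiable (by simp) x) c
    have h1 := ha1 A x
    unfold cov at h1 ⊢
    rw [h]
    simp only [_root_.smul_apply, Pi.smul_apply, map_smul]
    rw [← smul_add, h1, smul_zero]

/-! ### Charge conjugation, `D`, torsion -/

/-- `C` is a charge conjugation with symmetries `Δ₀`, `Δ₁`: a nondegenerate bilinear form such that
`C(φ, ψ) = Δ₀ C(ψ, φ)` and `C(φ, γ_A ψ) = Δ₁ C(ψ, γ_A φ)`. -/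
structure IsChargeConjugation (C : LinearMap.BilinForm ℂ S) (Δ₀ Δ₁ : ℤˣ) : Prop where
  nondeg : C.Nondegenerate
  symm₀ : ∀ φ ψ, C φ ψ = ((Δ₀ : ℤ) : ℂ) * C ψ φ
  symm₁ : ∀ A φ ψ, C φ (B.γ A ψ) = ((Δ₁ : ℤ) : ℂ) * C ψ (B.γ A φ)

end Data

/-- The symmetry `Δ_k = (-1)^{k(k-1)/2} Δ₀^{k+1} Δ₁^k` of `C_k(φ ⊗ ψ) = C(φ, γ_{A_1 … A_k} ψ)`. -/
def Delta (Δ₀ Δ₁ : ℤˣ) (k : ℕ) : ℤˣ := (-1) ^ (k * (k - 1) / 2) * Δ₀ ^ (k + 1) * Δ₁ ^ k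

namespace Data

variable {p d : ℕ} {S : Type u} [NormedAddCommGroup S] [NormedSpace ℂ S] [FiniteDimensional ℂ S]
  (B : Data p d S) (C : LinearMap.BilinForm ℂ S) (hC : C.Nondegenerate)

/-- The connection `D`, as `D_A = ∂_A + conn A`: the connection for which `D ⊗ 1 + 1 ⊗ D^C` makes `C`
parallel, i.e. `conn A = -(connC A)^C`, where `C(Φ^C φ, ψ) = C(φ, Φ ψ)`. -/
def conn (A : Idx p d) (x : Pt p d) : Module.End ℂ S :=
  -LinearMap.BilinForm.leftAdjointOfNondegenerate C hC (B.connC A x)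

/-- The components of `D̂γ`, applied to a spinor field:
`(D̂_A γ)(∂_E) ξ = D_A (γ_E ξ) - γ(∇_A ∂_E) ξ - γ_E D^C_A ξ`. -/
def hatD (A E : Idx p d) (ξ : Pt p d → S) (x : Pt p d) : S :=
  cov (B.conn C hC) A (fun z => B.gamLow E z (ξ z)) x
    - B.cliff (fun G => B.christoffel A E G x) x (ξ x)
    - B.gamLow E x (cov B.connC A ξ x)

/-- The torsion of `D`: two times the skew symmetrisation of `D̂γ`. -/
def torsion (A E : Idx p d) (ξ : Pt p d → S) (x : Pt p d) : S :=
  B.hatD C hC A E ξ x - B.hatD C hC E A ξ x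

/-- `D` is admissible: `D̂γ` is skew symmetric. -/
def IsAdmissible : Prop := ∀ A E (ξ : Pt p d → S), ContDiff ℝ ∞ ξ → ∀ x,
  B.hatD C hC A E ξ x + B.hatD C hC E A ξ x = 0

/-- A set `𝒦` of spinor fields is admissible: the symmetric part of `D̂γ` acts trivially on it. -/
def IsAdmissibleSet (𝒦 : Set (Pt p d → S)) : Prop := ∀ ξ ∈ 𝒦, ∀ A E x,
  B.hatD C hC A E ξ x + B.hatD C hC E A ξ x = 0

/-- `𝒦` is torsion free: `∑_A (γ^A φ ∧ 𝒯_{AE} ψ + γ^A ψ ∧ 𝒯_{AE} φ) = 0` in `Λ² S` for all `E` and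
all `φ, ψ ∈ 𝒦`. -/
def IsTorsionFreeSet (𝒦 : Set (Pt p d → S)) : Prop := ∀ φ ∈ 𝒦, ∀ ψ ∈ 𝒦, ∀ E x,
  ∑ A, (ExteriorAlgebra.ι ℂ (B.gamUp A x (φ x)) * ExteriorAlgebra.ι ℂ (B.torsion C hC A E ψ x) +
    ExteriorAlgebra.ι ℂ (B.gamUp A x (ψ x)) * ExteriorAlgebra.ι ℂ (B.torsion C hC A E φ x)) = 0

end Data

/-! ## Shape of the holonomy algebra -/

section Shape

variable {d : ℕ} {S : Type u} [NormedAddCommGroup S] [NormedSpace ℂ S]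
  {T : Type v} [AddCommGroup T] [Module ℂ T]

/-- The complexification of the real `𝔰𝔬(d)`-module `V` (on which `M ∈ 𝔰𝔬(d)` acts by the commutator
`[φ(M), ·]`) is
isomorphic, as a complex `𝔰𝔬(d)`-module, to the direct sum of the submodules `W k`, `k : κ`, of the
spin representation of `𝔰𝔬(d)` on `T`. -/
def ComplexificationIsSum (φ : LieAlgebra.Orthogonal.so (Fin d) ℝ →ₗ⁅ℝ⁆ Module.End ℂ S)
    (V : Submodule ℝ (Module.End ℂ S)) (τ : Fin d → Module.End ℂ T)
    {κ : Type} (W : κ → Submodule ℂ T) : Prop :=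
  ∃ Ψ : (ℂ ⊗[ℝ] V) ≃ₗ[ℂ] ((k : κ) → W k),
    ∀ (M : LieAlgebra.Orthogonal.so (Fin d) ℝ) (v w : V),
      (w : Module.End ℂ S) = φ M * (v : Module.End ℂ S) - (v : Module.End ℂ S) * φ M →
        ∀ k, ((Ψ (1 ⊗ₜ[ℝ] w) k : W k) : T) = spinRep τ M (Ψ (1 ⊗ₜ[ℝ] v) k : T)

/-- The number of independent matrices `γ_μ` (`0 ≤ μ ≤ p`) on the image of the projection: `p + 1`,
except that for `p = 1` and odd `d` one has `γ_1 = ± γ_0` there. -/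
def spaceTimeMult (p d : ℕ) : ℕ := if p = 1 ∧ Odd d then 1 else p + 1

end Shape

end Brane

end

/-!
Write `g = γ^{[d]}` for the product of the transversal gamma matrices.

*The form of the connection.* In the orthonormal frame the Levi-Civita connection of a brane metric
has only the coefficients `X` and `Y`, paired with the bivectors `γ_{μi}` and `γ_{ij}`. The
antisymmetrised products contracted with `ε_{m₁…m_d}` are, up to sign and factorial, a gamma matrix
or a bivector times `g` (`sum_levi_asym_cons`, `sum_levi_cons_asym`). Under the relation between
`f₁, f₂, f` the potential therefore has the same shape as the Levi-Civita part, multiplied by `g`,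
and the two add up to the projection `Π` (`connC_inl`, `connC_inr`). What is left over is a multiple
of `Y_i g`, hence of `Y_i (1 - 2Π)` and a scalar.

*Holonomy, upper bound.* The connection form lies in the sum of `φ(so(d)) ⋉ V` and the span of
`1 - 2Π` (`connC_mem`), where `V` consists of the maps `∑ γ_μ b_μ Π` with odd Clifford elements
`b_μ`. A parallel transport normalises this algebra, and on the complement of `Π` it acts by
the exponential of a function, since the leftover term is a logarithmic derivative; so a loop acts
there trivially. In the even block a transport normalises `φ(so(d))`, and the normaliser of the
bivectors in the even Clifford algebra is found by double commutators: it consists of the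
bivectors and the scalars (`mem_soHom_range`). Determinants remove the scalars, which gives
`holonomyAlgebra_le`.

*Holonomy, lower bound.* Small coordinate rectangles show that the curvature lies in the holonomy
algebra (`curvature_mem_holonomyAlgebra`). The transversal curvature is, up to a part in `V`, the
bivector `e_j ∧ K e_i - e_i ∧ K e_j`. When `K` is not a multiple of an involution other than
`±1`, these generate `so(d)` (`eq_top_of_curvature`). Brackets with the mixed curvature then produce
all of `V` (`odd_le_of_mul_spinEl`), and transport carries the result to the other points
(`holonomyAlgebra_eq`).

*The module `V`.* The bracket with `φ(M)` acts on the coefficients `b_μ` by one-sided Clifford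
multiplication with bivectors. After complexification the even and odd Clifford elements fill the
full endomorphism algebras of the spinor modules (`span_rep_odd_eq_top`, `span_rep_eq_top`), so the
coefficients decompose into copies of the dual of a spinor module, which is identified with a spinor
module through the reversal. The coefficients of different `γ_μ` are independent
(`separate_even`, `separate_odd`), except that for `p = 1` and odd `d` one of the two `γ_μ` is
expressed through the other on `Π(S)` (`exists_gamma_one`); this is the origin of `q = 1`. Dimension
counts then give `complexification_odd`, `complexification_mod_two` and `complexification_mod_zero`.

*Torsion and parallel spinors.* The dual connection is expressed through adjoints with respect to
`C`. The sign assumption fixes the adjoint of `g` (`adj_gvol`), so that the derivatives cancel and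
`D̂γ` is algebraic in `X`, `Y` and `g` (`hatD_eq`); skew symmetry (`hatD_skew`) uses the relation
`X_eq_Y`. The gradient of `f` is a multiple of `Y`, and Clifford multiplication by a nonzero
vector is injective. Hence a spinor field annihilated by the gradient of `f` vanishes wherever
`Y ≠ 0`, while `D̂γ` vanishes wherever `Y = 0`, and all conditions of the last part hold
(`hatD_eq_zero`).
-/

/-! ### Linear differential equations: existence, bounds and derivatives in the initial data -/

namespace Brane

section LinearODE

variable {E : Type*} [NormedAddCommGroup E] [NormedSpace ℝ E]

/-- The terms of the Picard series of the initial value problem `u' = a u`, `u(0) = e₀`. -/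
noncomputable def picardTerm (a : ℝ → E →L[ℝ] E) (e₀ : E) : ℕ → ℝ → E
  | 0 => fun _ => e₀
  | n + 1 => fun t => ∫ r in (0 : ℝ)..t, a r (picardTerm a e₀ n r)

theorem picardTerm_continuous {a : ℝ → E →L[ℝ] E} (ha : Continuous a) (e₀ : E) (n : ℕ) :
    Continuous (picardTerm a e₀ n) := by
  induction n with
  | zero => exact continuous_const
  | succ n ih =>
    exact intervalIntegral.continuous_primitive
      (fun _ _ => (ha.clm_apply ih).intervalIntegrable _ _) 0

/-- The bound `‖e₀‖ (M |t|)ⁿ / n!` that makes the Picard series converge on `[-R, R]`. -/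
theorem picardTerm_norm_le {a : ℝ → E →L[ℝ] E} (e₀ : E) {R M : ℝ}
    (hM : ∀ t, |t| ≤ R → ‖a t‖ ≤ M) (n : ℕ) :
    ∀ t, |t| ≤ R → ‖picardTerm a e₀ n t‖ ≤ ‖e₀‖ * ((M * |t|) ^ n / n.factorial) := by
  induction n with
  | zero => intro t _; simp [picardTerm]
  | succ n ih =>
    intro t ht
    have hM0 : 0 ≤ M := (norm_nonneg _).trans (hM t ht)
    have key : ∀ r, |r| ≤ |t| → ‖a r (picardTerm a e₀ n r)‖ ≤
        ‖e₀‖ * M ^ (n + 1) / n.factorial * |r| ^ n := by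
      intro r hr
      calc _ ≤ ‖a r‖ * ‖picardTerm a e₀ n r‖ := (a r).le_opNorm _
        _ ≤ M * (‖e₀‖ * ((M * |r|) ^ n / n.factorial)) :=
          mul_le_mul (hM r (hr.trans ht)) (ih r (hr.trans ht)) (norm_nonneg _) hM0
        _ = _ := by rw [mul_pow]; ring
    have hint : ∀ c : ℝ, ∫ r in (0 : ℝ)..c, r ^ n = c ^ (n + 1) / (n + 1) := by
      intro c; simp
    have hfac : ((n + 1).factorial : ℝ) = (n + 1) * n.factorial := by
      rw [Nat.factorial_succ]; push_cast; ring
    have hn1 : (0 : ℝ) < n + 1 := by positivity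
    have hnf : (0 : ℝ) < n.factorial := by positivity
    have goal_eq : ‖e₀‖ * ((M * |t|) ^ (n + 1) / (n + 1).factorial) =
        ‖e₀‖ * M ^ (n + 1) / n.factorial * (|t| ^ (n + 1) / (n + 1)) := by
      rw [hfac, mul_pow]; field_simp
    rw [goal_eq, ← hint |t|, ← intervalIntegral.integral_const_mul]
    rcases le_total 0 t with h0 | h0
    · rw [abs_of_nonneg h0]
      refine intervalIntegral.norm_integral_le_of_norm_le h0 ?_ ?_
      · refine Filter.Eventually.of_forall fun r hr => ?_
        have := key r (by rw [abs_of_nonneg h0, abs_of_pos hr.1]; exact hr.2)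
        rwa [abs_of_pos hr.1] at this
      · exact (by fun_prop : Continuous fun r : ℝ =>
          ‖e₀‖ * M ^ (n + 1) / n.factorial * r ^ n).intervalIntegrable _ _
    · rw [abs_of_nonpos h0]
      have hrev : picardTerm a e₀ (n + 1) t =
          -∫ r in (0 : ℝ)..(-t), a (-r) (picardTerm a e₀ n (-r)) := by
        rw [intervalIntegral.integral_comp_neg (fun r => a r (picardTerm a e₀ n r))]
        rw [neg_neg, neg_zero, ← intervalIntegral.integral_symm]; rfl
      rw [hrev, norm_neg]
      refine intervalIntegral.norm_integral_le_of_norm_le (by linarith) ?_ ?_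
      · refine Filter.Eventually.of_forall fun r hr => ?_
        have := key (-r) (by rw [abs_neg, abs_of_nonpos h0, abs_of_pos hr.1]; exact hr.2)
        rwa [abs_neg, abs_of_pos hr.1] at this
      · exact (by fun_prop : Continuous fun r : ℝ =>
          ‖e₀‖ * M ^ (n + 1) / n.factorial * r ^ n).intervalIntegrable _ _

theorem exists_norm_le_of_continuous {F : Type*} [NormedAddCommGroup F] {a : ℝ → F}
    (ha : Continuous a) (R : ℝ) : ∃ M, 0 ≤ M ∧ ∀ t, |t| ≤ R → ‖a t‖ ≤ M := by
  obtain ⟨M, hM⟩ := (isCompact_Icc (a := -R) (b := R)).exists_bound_of_continuousOn ha.continuousOn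
  exact ⟨max M 0, le_max_right _ _, fun t ht => (hM t (abs_le.mp ht)).trans (le_max_left _ _)⟩

/-- Linear initial value problems have global solutions; the solution is the Picard series. -/
theorem exists_linearODE_solution [CompleteSpace E] {a : ℝ → E →L[ℝ] E} (ha : Continuous a)
    (e₀ : E) : ∃ u : ℝ → E, u 0 = e₀ ∧ ∀ t, HasDerivAt u (a t (u t)) t := by
  have hsucc0 : ∀ n, picardTerm a e₀ (n + 1) 0 = 0 := fun n => by simp [picardTerm]
  refine ⟨fun t => ∑' n, picardTerm a e₀ n t, ?_, fun t => ?_⟩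
  · refine (tsum_eq_single 0 fun n hn => ?_).trans ?_
    · obtain ⟨m, rfl⟩ := Nat.exists_eq_succ_of_ne_zero hn
      exact hsucc0 m
    · rfl
  · set R := |t| + 1 with hR
    obtain ⟨M, hM0, hM⟩ := exists_norm_le_of_continuous ha R
    have hsumm : Summable fun n : ℕ => ‖e₀‖ * ((M * R) ^ n / n.factorial) :=
      (Real.summable_pow_div_factorial _).mul_left _
    have hb : ∀ n, ∀ r, |r| ≤ R → ‖picardTerm a e₀ n r‖ ≤ ‖e₀‖ * ((M * R) ^ n / n.factorial) := by
      intro n r hr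
      refine (picardTerm_norm_le e₀ hM n r hr).trans ?_
      gcongr
    let g' : ℕ → ℝ → E := fun n r => Nat.casesOn n 0 fun m => a r (picardTerm a e₀ m r)
    have hg : ∀ n r, HasDerivAt (picardTerm a e₀ n) (g' n r) r := by
      intro n r
      cases n with
      | zero => exact hasDerivAt_const r e₀
      | succ m =>
        have hc : Continuous fun r => a r (picardTerm a e₀ m r) :=
          ha.clm_apply (picardTerm_continuous ha e₀ m)
        exact intervalIntegral.integral_hasDerivAt_right (hc.intervalIntegrable _ _)
          (hc.stronglyMeasurableAtFilter _ _) hc.continuousAt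
    let b : ℕ → ℝ := fun n => Nat.casesOn n 0 fun m =>
      M * (‖e₀‖ * ((M * R) ^ m / m.factorial))
    have hbs : Summable b := (summable_nat_add_iff 1).mp (hsumm.mul_left M)
    have hmem : ∀ r ∈ Metric.ball (0 : ℝ) R, |r| ≤ R := fun r hr => by
      rw [Metric.mem_ball, dist_zero_right, Real.norm_eq_abs] at hr; exact hr.le
    have htR : t ∈ Metric.ball (0 : ℝ) R := by
      rw [Metric.mem_ball, dist_zero_right, Real.norm_eq_abs, hR]; linarith
    have hgb : ∀ n, ∀ r ∈ Metric.ball (0 : ℝ) R, ‖g' n r‖ ≤ b n := by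
      intro n r hr
      cases n with
      | zero => simp [g', b]
      | succ m =>
        exact ((a r).le_opNorm _).trans
          (mul_le_mul (hM r (hmem r hr)) (hb m r (hmem r hr)) (norm_nonneg _) hM0)
    have hst : Summable fun n => picardTerm a e₀ n t :=
      Summable.of_norm_bounded hsumm fun n => hb n t (hmem t htR)
    have h := hasDerivAt_tsum_of_isPreconnected hbs Metric.isOpen_ball
      (convex_ball (0 : ℝ) R).isPreconnected (fun n r _ => hg n r) hgb htR hst htR
    convert h using 1
    have hgs : Summable fun n => g' n t :=
      Summable.of_norm_bounded hbs fun n => hgb n t htR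
    rw [hgs.tsum_eq_zero_add, (a t).map_tsum hst]
    simp [g']

theorem linearODE_unique {a : ℝ → E →L[ℝ] E} (ha : Continuous a) {u v : ℝ → E}
    (hu : ∀ t, HasDerivAt u (a t (u t)) t) (hv : ∀ t, HasDerivAt v (a t (v t)) t)
    (h0 : u 0 = v 0) : u = v := by
  funext t
  obtain ⟨M, hM0, hM⟩ := exists_norm_le_of_continuous ha (|t| + 1)
  have habs := abs_le.mp (le_refl |t|)
  refine ODE_solution_unique_of_mem_Icc (v := fun t x => a t x) (s := fun _ => Set.univ)
    (K := M.toNNReal) (a := -(|t| + 1)) (b := |t| + 1) (t₀ := 0) ?_ ?_ ?_ ?_ ?_ ?_ ?_ ?_ h0 ?_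
  · intro r hr
    refine ((a r).lipschitz.weaken ?_).lipschitzOnWith
    rw [← NNReal.coe_le_coe, Real.coe_toNNReal _ hM0]
    exact hM r (abs_le.mpr ⟨hr.1.le, hr.2.le⟩)
  · constructor <;> linarith [abs_nonneg t]
  · exact fun r _ => (hu r).continuousAt.continuousWithinAt
  · exact fun r _ => hu r
  · exact fun _ _ => Set.mem_univ _
  · exact fun r _ => (hv r).continuousAt.continuousWithinAt
  · exact fun r _ => hv r
  · exact fun _ _ => Set.mem_univ _
  · constructor <;> linarith

/-- Solutions of a linear differential equation stay in a subspace that is invariant under the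
coefficients. -/
theorem linearODE_mem [FiniteDimensional ℝ E] {a : ℝ → E →L[ℝ] E} (ha : Continuous a)
    (W : Submodule ℝ E) (hW : ∀ t, ∀ w ∈ W, a t w ∈ W) {u : ℝ → E}
    (hu : ∀ t, HasDerivAt u (a t (u t)) t) (h0 : u 0 ∈ W) (t : ℝ) : u t ∈ W := by
  obtain ⟨q, hq⟩ := W.exists_isCompl
  -- the projection along `W`; its value on a solution solves a linear equation again
  let π : E →L[ℝ] E := LinearMap.toContinuousLinearMap
    (q.projection W hq.symm)
  have hπ : ∀ w, π w = 0 ↔ w ∈ W := by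
    intro w
    simp [π]
  have hsub : ∀ w, w - π w ∈ W := by
    intro w
    exact Submodule.sub_projection_mem hq.symm w
  have hsol : ∀ t, HasDerivAt (fun t => π (u t)) ((π.comp (a t)) (π (u t))) t := by
    intro t
    have h := π.hasFDerivAt.comp_hasDerivAt t (hu t)
    have h2 : π (a t (u t)) = π (a t (π (u t))) := by
      rw [← sub_eq_zero, ← map_sub, ← map_sub, hπ]
      exact hW t _ (hsub _)
    rw [h2] at h
    exact h
  have hc : Continuous fun t => π.comp (a t) := continuous_const.clm_comp ha
  have := linearODE_unique hc (u := fun t => π (u t)) (v := fun _ => 0) hsol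
    (fun t => by simpa using hasDerivAt_const t (0 : E)) ((hπ _).mpr h0)
  exact (hπ _).mp (congrFun this t)

/-- The partial derivative in the first variable of a smooth function of two real variables. -/
theorem exists_deriv_fst {F : Type*} [NormedAddCommGroup F] [NormedSpace ℝ F] {a : ℝ → ℝ → F}
    (ha : ContDiff ℝ ∞ fun z : ℝ × ℝ => a z.1 z.2) :
    ∃ a₁ : ℝ → ℝ → F, (ContDiff ℝ ∞ fun z : ℝ × ℝ => a₁ z.1 z.2) ∧
      ∀ s t, HasDerivAt (fun s => a s t) (a₁ s t) s := by
  refine ⟨fun s t => fderiv ℝ (fun z : ℝ × ℝ => a z.1 z.2) (s, t) (1, 0), ?_, fun s t => ?_⟩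
  · exact (ha.fderiv_right (m := ∞) (by simp)).clm_apply contDiff_const
  · have h1 : HasDerivAt (fun s : ℝ => (s, t)) ((1 : ℝ), (0 : ℝ)) s :=
      (hasDerivAt_id s).prodMk (hasDerivAt_const s t)
    exact ((ha.differentiable (by simp)) (s, t)).hasFDerivAt.comp_hasDerivAt s h1

theorem exists_norm_le_on_box {F : Type*} [NormedAddCommGroup F] {a : ℝ → ℝ → F}
    (ha : Continuous fun z : ℝ × ℝ => a z.1 z.2) (s₀ t : ℝ) :
    ∃ M, 0 ≤ M ∧ ∀ s ∈ Set.Icc (s₀ - 1) (s₀ + 1), ∀ r ∈ Set.Icc 0 t, ‖a s r‖ ≤ M := by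
  obtain ⟨M, hM⟩ := ((isCompact_Icc (a := s₀ - 1) (b := s₀ + 1)).prod
    (isCompact_Icc (a := (0 : ℝ)) (b := t))).exists_bound_of_continuousOn ha.continuousOn
  exact ⟨max M 0, le_max_right _ _, fun s hs r hr => (hM (s, r) ⟨hs, hr⟩).trans (le_max_left _ _)⟩

/-- Differentiability in the parameter for positive times: by Gronwall, the remainder
`u s - u s₀ - (s - s₀) w s₀` is quadratic in `s - s₀`, since its equation is the one for `u` with a
quadratically small right-hand side. -/
theorem linearODE_hasDerivAt_param_of_nonneg {a a₁ a₂ : ℝ → ℝ → E →L[ℝ] E}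
    (ha : Continuous fun z : ℝ × ℝ => a z.1 z.2) (ha₁ : Continuous fun z : ℝ × ℝ => a₁ z.1 z.2)
    (ha₂ : Continuous fun z : ℝ × ℝ => a₂ z.1 z.2)
    (hd₁ : ∀ s t, HasDerivAt (fun s => a s t) (a₁ s t) s)
    (hd₂ : ∀ s t, HasDerivAt (fun s => a₁ s t) (a₂ s t) s) {u w : ℝ → ℝ → E} {e₀ : E}
    (hu0 : ∀ s, u s 0 = e₀) (hu : ∀ s t, HasDerivAt (u s) (a s t (u s t)) t)
    (hw0 : ∀ s, w s 0 = 0) (hw : ∀ s t, HasDerivAt (w s) (a₁ s t (u s t) + a s t (w s t)) t)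
    (s₀ : ℝ) {t : ℝ} (ht : 0 ≤ t) : HasDerivAt (fun s => u s t) (w s₀ t) s₀ := by
  obtain ⟨M, hM0, hM⟩ := exists_norm_le_on_box ha s₀ t
  obtain ⟨C₁, hC₁0, hC₁⟩ := exists_norm_le_on_box ha₁ s₀ t
  obtain ⟨C₂, hC₂0, hC₂⟩ := exists_norm_le_on_box ha₂ s₀ t
  obtain ⟨Nu, hNu0, hNu⟩ := exists_norm_le_of_continuous
    (continuous_iff_continuousAt.mpr fun r => (hu s₀ r).continuousAt) t
  obtain ⟨Nw, hNw0, hNw⟩ := exists_norm_le_of_continuous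
    (continuous_iff_continuousAt.mpr fun r => (hw s₀ r).continuousAt) t
  have hs₀ : s₀ ∈ Set.Icc (s₀ - 1) (s₀ + 1) := ⟨by linarith, by linarith⟩
  have hconv : Convex ℝ (Set.Icc (s₀ - 1) (s₀ + 1)) := convex_Icc _ _
  -- mean value estimates for the coefficients
  have e1 : ∀ s ∈ Set.Icc (s₀ - 1) (s₀ + 1), ∀ r ∈ Set.Icc 0 t,
      ‖a s r - a s₀ r‖ ≤ C₁ * |s - s₀| := fun s hs r hr =>
    Convex.norm_image_sub_le_of_norm_hasDerivWithin_le
      (fun x _ => (hd₁ x r).hasDerivWithinAt) (fun x hx => hC₁ x hx r hr) hconv hs₀ hs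
  have e1' : ∀ s ∈ Set.Icc (s₀ - 1) (s₀ + 1), ∀ r ∈ Set.Icc 0 t,
      ‖a₁ s r - a₁ s₀ r‖ ≤ C₂ * |s - s₀| := fun s hs r hr =>
    Convex.norm_image_sub_le_of_norm_hasDerivWithin_le
      (fun x _ => (hd₂ x r).hasDerivWithinAt) (fun x hx => hC₂ x hx r hr) hconv hs₀ hs
  have e2 : ∀ s ∈ Set.Icc (s₀ - 1) (s₀ + 1), ∀ r ∈ Set.Icc 0 t,
      ‖a s r - a s₀ r - (s - s₀) • a₁ s₀ r‖ ≤ C₂ * |s - s₀| ^ 2 := by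
    intro s hs r hr
    have hd : ∀ x, HasDerivAt (fun x => a x r - (x - s₀) • a₁ s₀ r) (a₁ x r - a₁ s₀ r) x := by
      intro x
      have := (hd₁ x r).fun_sub (((hasDerivAt_id x).sub_const s₀).smul_const (a₁ s₀ r))
      simpa using this
    have hsub : Set.uIcc s₀ s ⊆ Set.Icc (s₀ - 1) (s₀ + 1) :=
      Set.uIcc_subset_Icc hs₀ hs
    have := Convex.norm_image_sub_le_of_norm_hasDerivWithin_le (C := C₂ * |s - s₀|)
      (fun x _ => (hd x).hasDerivWithinAt) (fun x hx => (e1' x (hsub hx) r hr).trans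
        (show C₂ * |x - s₀| ≤ C₂ * |s - s₀| from
          mul_le_mul_of_nonneg_left (Set.abs_sub_left_of_mem_uIcc hx) hC₂0))
      (convex_uIcc s₀ s) Set.left_mem_uIcc Set.right_mem_uIcc
    calc _ = ‖a s r - (s - s₀) • a₁ s₀ r - (a s₀ r - (s₀ - s₀) • a₁ s₀ r)‖ := by
          congr 1; simp; abel
      _ ≤ _ := this
      _ = _ := by rw [Real.norm_eq_abs]; ring
  set M' := M + 1 with hM'
  have hM'0 : M' ≠ 0 := by positivity
  set G := 1 / M' * (Real.exp (M' * t) - 1) with hG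
  have key : ∀ s ∈ Set.Icc (s₀ - 1) (s₀ + 1),
      ‖u s t - u s₀ t - (s - s₀) • w s₀ t‖ ≤ (C₂ * Nu + C₁ * Nw) * G * ‖s - s₀‖ ^ 2 := by
    intro s hs
    have hR : ∀ r, HasDerivAt (fun r => u s r - u s₀ r - (s - s₀) • w s₀ r)
        (a s r (u s r) - a s₀ r (u s₀ r) - (s - s₀) • (a₁ s₀ r (u s₀ r) + a s₀ r (w s₀ r))) r :=
      fun r => ((hu s r).sub (hu s₀ r)).sub ((hw s₀ r).const_smul _)
    have := norm_le_gronwallBound_of_norm_deriv_right_le (a := 0) (b := t) (δ := 0) (K := M')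
      (ε := (C₂ * Nu + C₁ * Nw) * |s - s₀| ^ 2)
      (fun r _ => (hR r).continuousAt.continuousWithinAt) (fun r _ => (hR r).hasDerivWithinAt)
      (by simp [hu0, hw0]) (fun r hr => ?_) t ⟨ht, le_rfl⟩
    · rw [gronwallBound_of_K_ne_0 hM'0] at this
      refine this.trans (le_of_eq ?_)
      simp only [sub_zero, zero_mul, zero_add, hG, Real.norm_eq_abs]
      ring
    · have hr' : r ∈ Set.Icc 0 t := ⟨hr.1, hr.2.le⟩
      have hrt : |r| ≤ t := by rw [abs_of_nonneg hr.1]; exact hr.2.le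
      have hsplit : a s r (u s r) - a s₀ r (u s₀ r)
            - (s - s₀) • (a₁ s₀ r (u s₀ r) + a s₀ r (w s₀ r)) =
          a s r (u s r - u s₀ r - (s - s₀) • w s₀ r)
            + ((a s r - a s₀ r - (s - s₀) • a₁ s₀ r) (u s₀ r)
              + (s - s₀) • (a s r - a s₀ r) (w s₀ r)) := by
        simp only [map_sub, map_smul, _root_.sub_apply,
          _root_.smul_apply, smul_add, smul_sub]
        abel
      rw [hsplit]
      refine (norm_add_le _ _).trans (add_le_add ?_ ((norm_add_le _ _).trans ?_))
      · refine ((a s r).le_opNorm _).trans (mul_le_mul_of_nonneg_right ?_ (norm_nonneg _))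
        linarith [hM s hs r hr']
      · rw [norm_smul, Real.norm_eq_abs]
        have b1 : ‖(a s r - a s₀ r - (s - s₀) • a₁ s₀ r) (u s₀ r)‖ ≤ C₂ * |s - s₀| ^ 2 * Nu :=
          (ContinuousLinearMap.le_opNorm _ _).trans
            (mul_le_mul (e2 s hs r hr') (hNu r hrt) (norm_nonneg _) (by positivity))
        have b2 : ‖(a s r - a s₀ r) (w s₀ r)‖ ≤ C₁ * |s - s₀| * Nw :=
          (ContinuousLinearMap.le_opNorm _ _).trans
            (mul_le_mul (e1 s hs r hr') (hNw r hrt) (norm_nonneg _) (by positivity))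
        have b3 := mul_le_mul_of_nonneg_left b2 (abs_nonneg (s - s₀))
        calc _ ≤ C₂ * |s - s₀| ^ 2 * Nu + |s - s₀| * (C₁ * |s - s₀| * Nw) := add_le_add b1 b3
          _ = _ := by ring
  rw [hasDerivAt_iff_isLittleO]
  refine Asymptotics.IsBigO.trans_isLittleO
    (Asymptotics.IsBigO.of_bound ((C₂ * Nu + C₁ * Nw) * G) ?_)
    (Asymptotics.isLittleO_pow_sub_sub s₀ one_lt_two)
  have : Set.Icc (s₀ - 1) (s₀ + 1) ∈ nhds s₀ := Icc_mem_nhds (by linarith) (by linarith)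
  filter_upwards [this] with s hs
  simpa using key s hs

/-- The solution of a linear differential equation is differentiable in a parameter; the derivative
solves the linearised equation. -/
theorem linearODE_hasDerivAt_param {a a₁ : ℝ → ℝ → E →L[ℝ] E}
    (ha : ContDiff ℝ ∞ fun z : ℝ × ℝ => a z.1 z.2)
    (ha₁ : ContDiff ℝ ∞ fun z : ℝ × ℝ => a₁ z.1 z.2)
    (hd₁ : ∀ s t, HasDerivAt (fun s => a s t) (a₁ s t) s) {u w : ℝ → ℝ → E} {e₀ : E}
    (hu0 : ∀ s, u s 0 = e₀) (hu : ∀ s t, HasDerivAt (u s) (a s t (u s t)) t)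
    (hw0 : ∀ s, w s 0 = 0) (hw : ∀ s t, HasDerivAt (w s) (a₁ s t (u s t) + a s t (w s t)) t)
    (s₀ t : ℝ) : HasDerivAt (fun s => u s t) (w s₀ t) s₀ := by
  obtain ⟨a₂, ha₂, hd₂⟩ := exists_deriv_fst ha₁
  rcases le_total 0 t with ht | ht
  · exact linearODE_hasDerivAt_param_of_nonneg ha.continuous ha₁.continuous ha₂.continuous hd₁ hd₂
      hu0 hu hw0 hw s₀ ht
  · -- for negative times reverse the time
    have hrev : Continuous fun z : ℝ × ℝ => (z.1, -z.2) := by fun_prop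
    have hneg : ∀ t : ℝ, HasDerivAt (fun t : ℝ => -t) (-1) t := fun t => (hasDerivAt_id t).neg
    have := linearODE_hasDerivAt_param_of_nonneg (a := fun s t => -a s (-t))
      (a₁ := fun s t => -a₁ s (-t)) (a₂ := fun s t => -a₂ s (-t))
      (u := fun s t => u s (-t)) (w := fun s t => w s (-t)) (e₀ := e₀)
      (ha.continuous.comp hrev).neg (ha₁.continuous.comp hrev).neg (ha₂.continuous.comp hrev).neg
      (fun s t => (hd₁ s (-t)).neg) (fun s t => (hd₂ s (-t)).neg) (fun s => by simpa using hu0 s)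
      (fun s t => by simpa [Function.comp_def] using (hu s (-t)).scomp t (hneg t)) (fun s => by simpa using hw0 s)
      (fun s t => by
        have := (hw s (-t)).scomp t (hneg t)
        simpa [Function.comp_def, neg_add, add_comm] using this) s₀ (t := -t) (by linarith)
    simpa using this

/-- Existence and continuously differentiable dependence on a parameter `s` of the solution of a
linear initial value problem; `w` is the derivative in `s`. -/
theorem exists_linearODE_param [CompleteSpace E] {a a₁ : ℝ → ℝ → E →L[ℝ] E}
    (ha : ContDiff ℝ ∞ fun z : ℝ × ℝ => a z.1 z.2)
    (ha₁ : ContDiff ℝ ∞ fun z : ℝ × ℝ => a₁ z.1 z.2)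
    (hd₁ : ∀ s t, HasDerivAt (fun s => a s t) (a₁ s t) s) (e₀ : E) :
    ∃ u w : ℝ → ℝ → E, (∀ s, u s 0 = e₀) ∧ (∀ s t, HasDerivAt (u s) (a s t (u s t)) t) ∧
      (∀ s, w s 0 = 0) ∧ (∀ s t, HasDerivAt (w s) (a₁ s t (u s t) + a s t (w s t)) t) ∧
      (∀ s t, HasDerivAt (fun s => u s t) (w s t) s) ∧ ∀ t, Continuous fun s => w s t := by
  -- the pair `(u, w)` solves a linear equation with triangular coefficient `T a a₁`
  let T : (E →L[ℝ] E) → (E →L[ℝ] E) → (E × E →L[ℝ] E × E) := fun p q =>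
    (ContinuousLinearMap.inl ℝ E E).comp (p.comp (ContinuousLinearMap.fst ℝ E E)) +
      (ContinuousLinearMap.inr ℝ E E).comp (q.comp (ContinuousLinearMap.fst ℝ E E) +
        p.comp (ContinuousLinearMap.snd ℝ E E))
  have hT : ∀ {p q : ℝ → ℝ → E →L[ℝ] E}, (ContDiff ℝ ∞ fun z : ℝ × ℝ => p z.1 z.2) →
      (ContDiff ℝ ∞ fun z : ℝ × ℝ => q z.1 z.2) →
      ContDiff ℝ ∞ fun z : ℝ × ℝ => T (p z.1 z.2) (q z.1 z.2) := fun hp hq =>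
    (contDiff_const.clm_comp (hp.clm_comp contDiff_const)).add
      (contDiff_const.clm_comp ((hq.clm_comp contDiff_const).add (hp.clm_comp contDiff_const)))
  obtain ⟨a₂, ha₂, hd₂⟩ := exists_deriv_fst ha₁
  obtain ⟨b₁, hb₁, hdb₁⟩ := exists_deriv_fst (a := fun s t => T (a s t) (a₁ s t)) (hT ha ha₁)
  have hline : ∀ s : ℝ, Continuous fun t : ℝ => (s, t) := fun s => by fun_prop
  have hTc : ∀ s, Continuous fun t => T (a s t) (a₁ s t) := fun s =>
    (hT ha ha₁).continuous.comp (hline s)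
  choose U hU0 hU using fun s => exists_linearODE_solution (hTc s) (e₀, (0 : E))
  have hTTc : ∀ s, Continuous fun t =>
      (ContinuousLinearMap.inl ℝ (E × E) (E × E)).comp ((T (a s t) (a₁ s t)).comp
        (ContinuousLinearMap.fst ℝ (E × E) (E × E))) +
      (ContinuousLinearMap.inr ℝ (E × E) (E × E)).comp ((b₁ s t).comp
        (ContinuousLinearMap.fst ℝ (E × E) (E × E)) + (T (a s t) (a₁ s t)).comp
        (ContinuousLinearMap.snd ℝ (E × E) (E × E))) := fun s =>
    (continuous_const.clm_comp ((hTc s).clm_comp continuous_const)).add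
      (continuous_const.clm_comp (((hb₁.continuous.comp (hline s)).clm_comp continuous_const).add
        ((hTc s).clm_comp continuous_const)))
  choose Z hZ0 hZ using fun s => exists_linearODE_solution (hTTc s) ((e₀, (0 : E)), (0 : E × E))
  have hfst : ∀ s, (fun t => (Z s t).1) = U s := by
    intro s
    refine linearODE_unique (hTc s) (fun t => ?_) (hU s) ?_
    · have := (ContinuousLinearMap.fst ℝ (E × E) (E × E)).hasFDerivAt.comp_hasDerivAt t (hZ s t)
      simpa [Function.comp_def] using this
    · simp [hZ0, hU0]
  have hUd : ∀ s t, HasDerivAt (fun s => U s t) (Z s t).2 s := by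
    refine fun s t => linearODE_hasDerivAt_param (hT ha ha₁) hb₁ hdb₁ hU0 hU
      (w := fun s t => (Z s t).2) (fun s => by simp [hZ0]) (fun s t => ?_) s t
    have := (ContinuousLinearMap.snd ℝ (E × E) (E × E)).hasFDerivAt.comp_hasDerivAt t (hZ s t)
    rw [← congrFun (hfst s) t]
    simpa [Function.comp_def] using this
  refine ⟨fun s t => (U s t).1, fun s t => (U s t).2, fun s => by simp [hU0], fun s t => ?_,
    fun s => by simp [hU0], fun s t => ?_, ?_, fun t => ?_⟩
  · have := (ContinuousLinearMap.fst ℝ E E).hasFDerivAt.comp_hasDerivAt t (hU s t)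
    simpa [Function.comp_def, T] using this
  · have := (ContinuousLinearMap.snd ℝ E E).hasFDerivAt.comp_hasDerivAt t (hU s t)
    simpa [Function.comp_def, T] using this
  · refine fun s t => linearODE_hasDerivAt_param ha ha₁ hd₁ (u := fun s t => (U s t).1) (e₀ := e₀)
      (w := fun s t => (U s t).2) (fun s => by simp [hU0])
      (fun s t => ?_) (fun s => by simp [hU0]) (fun s t => ?_) s t
    · have := (ContinuousLinearMap.fst ℝ E E).hasFDerivAt.comp_hasDerivAt t (hU s t)
      simpa [Function.comp_def, T] using this
    · have := (ContinuousLinearMap.snd ℝ E E).hasFDerivAt.comp_hasDerivAt t (hU s t)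
      simpa [Function.comp_def, T] using this
  · exact (continuous_iff_continuousAt.mpr fun s => (hUd s t).continuousAt).snd

end LinearODE

end Brane

/-! ### Fundamental solutions and parallel transport -/

namespace Brane

section Fundamental

variable {𝔸 : Type*} [NormedRing 𝔸] [NormedAlgebra ℝ 𝔸]

theorem contDiff_one_of_hasDerivAt {E : Type*} [NormedAddCommGroup E] [NormedSpace ℝ E]
    {f f' : ℝ → E} (hf : ∀ t, HasDerivAt f (f' t) t) (hf' : Continuous f') : ContDiff ℝ 1 f := by
  rw [contDiff_one_iff_deriv]
  refine ⟨fun t => (hf t).differentiableAt, ?_⟩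
  rwa [show deriv f = f' from funext fun t => (hf t).deriv]

theorem hasDerivAt_mem {E : Type*} [NormedAddCommGroup E] [NormedSpace ℝ E]
    [FiniteDimensional ℝ E] (W : Submodule ℝ E) {u : ℝ → E} {u' : E} {t : ℝ}
    (hu : HasDerivAt u u' t) (hW : ∀ᶠ r in nhds t, u r ∈ W) : u' ∈ W := by
  refine (W.closed_of_finiteDimensional).mem_of_tendsto (hasDerivAt_iff_tendsto_slope.mp hu) ?_
  filter_upwards [hW.filter_mono nhdsWithin_le_nhds] with r hr
  exact W.smul_mem _ (W.sub_mem hr hW.self_of_nhds)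

/-- The inverse of a fundamental solution of `U' = -b U`. -/
theorem exists_inverse_fundamental [CompleteSpace 𝔸] {b U : ℝ → 𝔸} (hb : Continuous b)
    (hU0 : U 0 = 1) (hU : ∀ t, HasDerivAt U (-(b t * U t)) t) :
    ∃ Ui : ℝ → 𝔸, Ui 0 = 1 ∧ (∀ t, HasDerivAt Ui (Ui t * b t) t) ∧ (∀ t, Ui t * U t = 1) ∧
      ∀ t, U t * Ui t = 1 := by
  obtain ⟨Ui, h0, h1⟩ := exists_linearODE_solution
    (a := fun t => (ContinuousLinearMap.mul ℝ 𝔸).flip (b t))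
    ((ContinuousLinearMap.mul ℝ 𝔸).flip.continuous.comp hb) 1
  have h1' : ∀ t, HasDerivAt Ui (Ui t * b t) t := fun t => by simpa using h1 t
  refine ⟨Ui, h0, h1', fun t => ?_, fun t => ?_⟩
  · have hd : ∀ t, HasDerivAt (fun t => Ui t * U t) 0 t := fun t => by
      have := (h1' t).fun_mul (hU t)
      simpa [mul_assoc] using this
    have := is_const_of_deriv_eq_zero (fun t => (hd t).differentiableAt) (fun t => (hd t).deriv) t 0
    simpa [h0, hU0] using this
  · -- both sides solve `y' = -b y + y b`
    have hc : Continuous fun t => -(ContinuousLinearMap.mul ℝ 𝔸 (b t)) +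
        (ContinuousLinearMap.mul ℝ 𝔸).flip (b t) :=
      ((ContinuousLinearMap.mul ℝ 𝔸).continuous.comp hb).neg.add
        ((ContinuousLinearMap.mul ℝ 𝔸).flip.continuous.comp hb)
    refine congrFun (linearODE_unique hc (u := fun t => U t * Ui t) (v := fun _ => 1)
      (fun t => ?_) (fun t => ?_) (by simp [h0, hU0])) t
    · have := (hU t).fun_mul (h1' t)
      simpa [mul_assoc] using this
    · simpa using hasDerivAt_const t (1 : 𝔸)

theorem exists_fundamental [CompleteSpace 𝔸] {b : ℝ → 𝔸} (hb : Continuous b) :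
    ∃ U : ℝ → 𝔸, U 0 = 1 ∧ ∀ t, HasDerivAt U (-(b t * U t)) t := by
  obtain ⟨U, h0, h1⟩ := exists_linearODE_solution
    (a := fun t => -(ContinuousLinearMap.mul ℝ 𝔸 (b t)))
    ((ContinuousLinearMap.mul ℝ 𝔸).continuous.comp hb).neg 1
  exact ⟨U, h0, fun t => by simpa using h1 t⟩

/-- Fundamental solutions of `U' = -b U` that depend on a parameter `s`, with their derivative `w`
in `s`. -/
theorem exists_fundamental_param [CompleteSpace 𝔸] {b : ℝ → ℝ → 𝔸}
    (hb : ContDiff ℝ ∞ fun z : ℝ × ℝ => b z.1 z.2) :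
    ∃ b₁ U w : ℝ → ℝ → 𝔸, (∀ s t, HasDerivAt (fun s => b s t) (b₁ s t) s) ∧ (∀ s, U s 0 = 1) ∧
      (∀ s t, HasDerivAt (U s) (-(b s t * U s t)) t) ∧ (∀ s, w s 0 = 0) ∧
      (∀ s t, HasDerivAt (w s) (-(b₁ s t * U s t) - b s t * w s t) t) ∧
      (∀ s t, HasDerivAt (fun s => U s t) (w s t) s) ∧ ∀ t, Continuous fun s => w s t := by
  obtain ⟨b₁, hb₁, hbd⟩ := exists_deriv_fst hb
  obtain ⟨U, w, hU0, hU, hw0, hw, hUw, hwc⟩ := exists_linearODE_param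
    (a := fun s t => -(ContinuousLinearMap.mul ℝ 𝔸 (b s t)))
    (a₁ := fun s t => -(ContinuousLinearMap.mul ℝ 𝔸 (b₁ s t)))
    ((ContinuousLinearMap.contDiff (ContinuousLinearMap.mul ℝ 𝔸)).comp hb).neg
    ((ContinuousLinearMap.contDiff (ContinuousLinearMap.mul ℝ 𝔸)).comp hb₁).neg
    (fun s t => ((ContinuousLinearMap.mul ℝ 𝔸).hasFDerivAt.comp_hasDerivAt s (hbd s t)).neg) 1
  refine ⟨b₁, U, w, hbd, hU0, fun s t => by simpa using hU s t, hw0, fun s t => ?_, hUw, hwc⟩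
  simpa [sub_eq_add_neg] using hw s t

end Fundamental

section Transport

variable {ι : Type} [Fintype ι] {S : Type*} [NormedAddCommGroup S] [NormedSpace ℂ S]
  [FiniteDimensional ℂ S] {om : ι → (ι → ℝ) → Module.End ℂ S}

/-- An endomorphism as a continuous linear map. -/
noncomputable def clm (f : Module.End ℂ S) : S →L[ℂ] S := LinearMap.toContinuousLinearMap f

@[simp] theorem clm_apply (f : Module.End ℂ S) (v : S) : clm f v = f v := rfl

@[simp] theorem coe_clm (f : Module.End ℂ S) : ((clm f : S →L[ℂ] S) : Module.End ℂ S) = f := rfl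

/-- The inverse of `clm`, as a real linear map. -/
def endOfClm : (S →L[ℂ] S) →ₗ[ℝ] Module.End ℂ S where
  toFun f := (f : S →ₗ[ℂ] S)
  map_add' _ _ := rfl
  map_smul' _ _ := rfl

@[simp] theorem endOfClm_apply (f : S →L[ℂ] S) : endOfClm f = (f : S →ₗ[ℂ] S) := rfl

theorem clm_endOfClm (f : S →L[ℂ] S) : clm (endOfClm f) = f := rfl

theorem clm_eq_sum (f : Module.End ℂ S) :
    clm f = ∑ k, (ContinuousLinearMap.smulRightL ℂ S S
      (LinearMap.toContinuousLinearMap ((Module.finBasis ℂ S).coord k))) (f (Module.finBasis ℂ S k)) := by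
  ext v
  have h := congrArg f ((Module.finBasis ℂ S).sum_repr v)
  simp only [map_sum, map_smul] at h
  rw [clm_apply, ← h]
  simp [_root_.sum_apply]

theorem contDiff_clm {X : Type*} [NormedAddCommGroup X] [NormedSpace ℝ X] {n : WithTop ℕ∞}
    {f : X → Module.End ℂ S} (hf : ∀ v, ContDiff ℝ n fun x => f x v) :
    ContDiff ℝ n fun x => clm (f x) := by
  simp only [clm_eq_sum]
  refine ContDiff.sum fun k _ => ?_
  exact ((ContinuousLinearMap.smulRightL ℂ S S
    (LinearMap.toContinuousLinearMap ((Module.finBasis ℂ S).coord k))).restrictScalars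
      ℝ).contDiff.comp (hf _)

theorem clm_apply_hasDerivAt {U : ℝ → S →L[ℂ] S} {U' : S →L[ℂ] S} {t : ℝ}
    (h : HasDerivAt U U' t) (v : S) : HasDerivAt (fun t => U t v) (U' v) t :=
  (((ContinuousLinearMap.apply ℂ S v).restrictScalars ℝ).hasFDerivAt).comp_hasDerivAt t h

theorem continuous_clm_sum (hom : ∀ A v, ContDiff ℝ ∞ fun x => om A x v) {c c' : ℝ → ι → ℝ}
    (hc : Continuous c) (hc' : Continuous c') :
    Continuous fun t => ∑ A, ((c' t A : ℝ) : ℂ) • clm (om A (c t)) := by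
  refine continuous_finsetSum _ fun A _ => ?_
  refine (Complex.continuous_ofReal.comp ((continuous_apply A).comp hc')).smul ?_
  exact (contDiff_clm (hom A)).continuous.comp hc

/-- Parallel transport along a single path is the end value of the fundamental solution. -/
theorem transport_eq_fundamental (hom : ∀ A v, ContDiff ℝ ∞ fun x => om A x v) {c : ℝ → ι → ℝ}
    (hc : ContDiff ℝ 1 c) {P : Module.End ℂ S}
    (hP : ∀ v : S, ∃ u : ℝ → S, u 0 = v ∧ u 1 = P v ∧
        ∀ t : ℝ, HasDerivAt u (-∑ A, ((deriv c t A : ℝ) : ℂ) • om A (c t) (u t)) t) :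
    ∃ U : ℝ → S →L[ℂ] S, U 0 = 1 ∧ U 1 = clm P ∧
      ∀ t, HasDerivAt U (-((∑ A, ((deriv c t A : ℝ) : ℂ) • clm (om A (c t))) * U t)) t := by
  have : CompleteSpace S := FiniteDimensional.complete ℂ S
  have hb := continuous_clm_sum hom hc.continuous (hc.continuous_deriv le_rfl)
  obtain ⟨U, hU0, hU⟩ := exists_fundamental hb
  refine ⟨U, hU0, ?_, hU⟩
  ext v
  obtain ⟨u, hu0, hu1, hu⟩ := hP v
  have hcoef : Continuous fun t => -((∑ A, ((deriv c t A : ℝ) : ℂ) •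
      clm (om A (c t)))).restrictScalars ℝ :=
    ((ContinuousLinearMap.restrictScalarsL ℂ S S ℝ ℝ).continuous.comp hb).neg
  have := linearODE_unique hcoef (u := fun t => U t v) (v := u)
    (fun t => by simpa using clm_apply_hasDerivAt (hU t) v)
    (fun t => by simpa [_root_.sum_apply] using hu t) (by simp [hU0, hu0])
  simpa [hu1] using congrFun this 1

/-- Transport along a straight line, which may be run through from any parameter `s` to any other `t`:
the path is reparametrised affinely to `[0, 1]`. -/
theorem isTransport_line (x v : ι → ℝ) {U Ui : ℝ → S →L[ℂ] S}
    (hU : ∀ t, HasDerivAt U (-((∑ A, ((v A : ℝ) : ℂ) • clm (om A (x + t • v))) * U t)) t)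
    {s : ℝ} (hs : U s * Ui s = 1) (t : ℝ) :
    IsTransport om (x + s • v) (x + t • v) ((U t * Ui s : S →L[ℂ] S) : S →ₗ[ℂ] S) := by
  let c : ℝ → ι → ℝ := fun r => x + (s + r * (t - s)) • v
  have hcd : ∀ r, HasDerivAt c ((t - s) • v) r := by
    intro r
    have h1 : HasDerivAt (fun r : ℝ => s + r * (t - s)) (t - s) r := by
      simpa using ((hasDerivAt_id r).mul_const (t - s)).const_add s
    exact (h1.smul_const v).const_add x
  have hc : ContDiff ℝ 1 c := by fun_prop
  have h := IsTransport.path (om := om) c hc ((U t * Ui s : S →L[ℂ] S) : S →ₗ[ℂ] S) (fun w => ?_)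
  · simpa [c] using h
  · refine ⟨fun r => U (s + r * (t - s)) (Ui s w), ?_, ?_, fun r => ?_⟩
    · have := congrArg (fun f : S →L[ℂ] S => f w) hs
      simpa using this
    · simp
    · have h1 : HasDerivAt (fun r : ℝ => s + r * (t - s)) (t - s) r := by
        simpa using ((hasDerivAt_id r).mul_const (t - s)).const_add s
      have h2 := (clm_apply_hasDerivAt (hU (s + r * (t - s))) (Ui s w)).scomp r h1
      refine h2.congr_deriv ?_
      rw [(hcd r).deriv]
      simp [c, Finset.smul_sum, _root_.sum_apply, smul_smul, ← Complex.coe_smul]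

/-- Any two points are joined by transports that are inverse to each other. -/
theorem exists_transport (hom : ∀ A v, ContDiff ℝ ∞ fun x => om A x v) (x y : ι → ℝ) :
    ∃ P P' : Module.End ℂ S, IsTransport om x y P ∧ IsTransport om y x P' ∧
      P * P' = 1 ∧ P' * P = 1 := by
  have : CompleteSpace S := FiniteDimensional.complete ℂ S
  have hb := continuous_clm_sum (c := fun t : ℝ => x + t • (y - x)) (c' := fun _ => y - x) hom
    (by fun_prop) continuous_const
  obtain ⟨U, hU0, hU⟩ := exists_fundamental hb
  obtain ⟨Ui, hUi0, hUi, h1, h2⟩ := exists_inverse_fundamental hb hU0 hU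
  refine ⟨((U 1 * Ui 0 : S →L[ℂ] S) : S →ₗ[ℂ] S), ((U 0 * Ui 1 : S →L[ℂ] S) : S →ₗ[ℂ] S),
    ?_, ?_, ?_, ?_⟩
  · simpa using isTransport_line x (y - x) hU (h2 0) 1
  · simpa using isTransport_line x (y - x) hU (h2 1) 0
  · have := congrArg (fun f : S →L[ℂ] S => (f : S →ₗ[ℂ] S)) (h2 1)
    simpa [hU0, hUi0] using this
  · have := congrArg (fun f : S →L[ℂ] S => (f : S →ₗ[ℂ] S)) (h1 1)
    simpa [hU0, hUi0] using this

/-- The generators of the holonomy algebra in terms of the norm topology on the endomorphisms. -/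
theorem hasDerivAt_mem_holonomyAlgebra {x : ι → ℝ} {c : ℝ → S →L[ℂ] S} {c' : S →L[ℂ] S}
    (hc : ContDiff ℝ 1 c) (hmem : ∀ t, ((c t : S →L[ℂ] S) : S →ₗ[ℂ] S) ∈ holonomyGroup om x)
    (h0 : c 0 = 1) (h : HasDerivAt c c' 0) :
    ((c' : S →L[ℂ] S) : S →ₗ[ℂ] S) ∈ holonomyAlgebra om x := by
  refine LieSubalgebra.subset_lieSpan ⟨fun t => (c t : S →ₗ[ℂ] S), fun v => ?_, hmem, ?_,
    fun v => ?_⟩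
  · exact ((ContinuousLinearMap.apply ℂ S v).restrictScalars ℝ).contDiff.comp hc
  · simp only [h0]; rfl
  · exact (clm_apply_hasDerivAt h v).deriv

/-- Parallel transport conjugates the holonomy algebras of its end points: conjugation with `P` is a
Lie algebra homomorphism that respects the generators. -/
theorem holonomyAlgebra_conj {x y : ι → ℝ} {P P' : Module.End ℂ S} (hP : IsTransport om x y P)
    (hP' : IsTransport om y x P') (h1 : P * P' = 1) (h2 : P' * P = 1) {A : Module.End ℂ S}
    (hA : A ∈ holonomyAlgebra om y) : P' * A * P ∈ holonomyAlgebra om x := by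
  induction hA using LieSubalgebra.lieSpan_induction with
  | mem A hA =>
    obtain ⟨c, hc, hmem, h0, hd⟩ := hA
    refine LieSubalgebra.subset_lieSpan ⟨fun t => P' * c t * P, fun v => ?_, fun t => ?_, ?_,
      fun v => ?_⟩
    · exact (((clm P').restrictScalars ℝ).contDiff).comp (hc (P v))
    · have := (hP.trans (hmem t)).trans hP'
      rwa [← mul_assoc] at this
    · simp [h0, h2]
    · have := (((clm P').restrictScalars ℝ).hasFDerivAt (x := c 0 (P v))).comp_hasDerivAt 0
        (((hc (P v)).differentiable one_ne_zero 0).hasDerivAt)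
      simpa [Function.comp_def, hd] using this.deriv
  | zero => simp
  | add A B _ _ hA hB => simpa [mul_add, add_mul] using add_mem hA hB
  | smul r A _ hA => simpa using (holonomyAlgebra om x).smul_mem r hA
  | lie A B _ _ hA hB =>
    have := (holonomyAlgebra om x).lie_mem hA hB
    convert this using 1
    simp only [LieRing.of_associative_ring_bracket, mul_sub, sub_mul]
    congr 1
    · calc P' * (A * B) * P = P' * A * 1 * B * P := by simp only [mul_one, mul_assoc]
        _ = _ := by rw [← h1]; simp only [mul_assoc]
    · calc P' * (B * A) * P = P' * B * 1 * A * P := by simp only [mul_one, mul_assoc]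
        _ = _ := by rw [← h1]; simp only [mul_assoc]

theorem sum_single_smul [DecidableEq ι] (A : ι) (f : ι → S →L[ℂ] S) :
    ∑ C, (((Pi.single A 1 : ι → ℝ) C : ℝ) : ℂ) • f C = f A := by
  rw [Finset.sum_eq_single A] <;> simp +contextual

/-- The curvature of a smooth connection lies in its holonomy algebra: the holonomies of the
rectangles with sides `s` and `t` are differentiated at `s = 0`, and then at `t = 0`. -/
theorem curvature_mem_holonomyAlgebra [DecidableEq ι]
    (hom : ∀ A v, ContDiff ℝ ∞ fun x => om A x v) (x : ι → ℝ) (A B : ι) {F : Module.End ℂ S}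
    (hF : ∀ v, F v = fderiv ℝ (fun z => om B z v) x (Pi.single A 1) -
      fderiv ℝ (fun z => om A z v) x (Pi.single B 1) + om A x (om B x v) - om B x (om A x v)) :
    F ∈ holonomyAlgebra om x := by
  have : CompleteSpace S := FiniteDimensional.complete ℂ S
  have : FiniteDimensional ℝ S := FiniteDimensional.complexToReal S
  have : FiniteDimensional ℝ (S →L[ℂ] S) := by
    have : FiniteDimensional ℂ (S →L[ℂ] S) := inferInstance
    exact FiniteDimensional.complexToReal _
  set eA : ι → ℝ := Pi.single A 1 with heA
  set eB : ι → ℝ := Pi.single B 1 with heB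
  have hsm : ∀ C, ContDiff ℝ ∞ fun z => clm (om C z) := fun C => contDiff_clm (hom C)
  -- vertical transports, depending on the horizontal position `s`
  have hβ : ContDiff ℝ ∞ fun z : ℝ × ℝ => clm (om B (x + z.1 • eA + z.2 • eB)) :=
    (hsm B).comp (by fun_prop)
  obtain ⟨β₁, U, w, hβd, hU0, hU', hw0, hw', hUw, hwc⟩ := exists_fundamental_param
    (b := fun s t => clm (om B (x + s • eA + t • eB))) hβ
  have hcB : ∀ s : ℝ, Continuous fun t : ℝ => clm (om B (x + s • eA + t • eB)) := fun s =>
    (hsm B).continuous.comp (by fun_prop)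
  have hcA : ∀ t : ℝ, Continuous fun s : ℝ => clm (om A (x + t • eB + s • eA)) := fun s =>
    (hsm A).continuous.comp (by fun_prop)
  obtain ⟨Ui, hUi0, hUi, hUi1, hUi2⟩ := exists_inverse_fundamental (hcB 0) (hU0 0) (hU' 0)
  -- horizontal transports at height `t`
  choose H hH0 hH using fun t => exists_fundamental (hcA t)
  choose Hi hHi0 hHi hHi1 hHi2 using fun t => exists_inverse_fundamental (hcA t) (hH0 t) (hH t)
  have hline : ∀ (C : ι) (y : ι → ℝ) (V V' : ℝ → S →L[ℂ] S),
      (∀ t, HasDerivAt V (-(clm (om C (y + t • (Pi.single C 1 : ι → ℝ))) * V t)) t) →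
      ∀ s t : ℝ, V s * V' s = 1 → IsTransport om (y + s • (Pi.single C 1 : ι → ℝ))
        (y + t • (Pi.single C 1 : ι → ℝ)) ((V t * V' s : S →L[ℂ] S) : S →ₗ[ℂ] S) := by
    intro C y V V' hV s t hs
    refine isTransport_line y _ (fun t => ?_) hs t
    rw [sum_single_smul]
    exact hV t
  let c : ℝ → ℝ → S →L[ℂ] S := fun t s => Ui t * Hi t s * U s t * H 0 s
  have hcmem : ∀ t s, ((c t s : S →L[ℂ] S) : S →ₗ[ℂ] S) ∈ holonomyGroup om x := by
    intro t s
    have t1 := hline A x (H 0) (Hi 0) (fun s => by simpa using hH 0 s) 0 s (hHi2 0 0)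
    have t2 := hline B (x + s • eA) (U s) (fun _ => 1) (hU' s) 0 t (by simp [hU0])
    have t3 := hline A (x + t • eB) (H t) (Hi t) (hH t) s 0 (hHi2 t s)
    have t4 := hline B x (U 0) Ui (fun t => by simpa using hU' 0 t) t 0 (hUi2 t)
    simp only [zero_smul, add_zero, hHi0, mul_one, hH0, one_mul, hU0] at t1 t2 t3 t4
    rw [← heA] at t1 t3
    rw [← heB] at t2 t4
    rw [add_right_comm] at t3
    have := ((t1.trans t2).trans t3).trans t4
    simpa [c, mul_assoc, holonomyGroup] using this
  have hcd : ∀ t s, HasDerivAt (c t) (((Ui t * (Hi t s * clm (om A (x + t • eB + s • eA)))) *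
      U s t + Ui t * Hi t s * w s t) * H 0 s + Ui t * Hi t s * U s t *
        (-(clm (om A (x + (0 : ℝ) • eB + s • eA)) * H 0 s))) s := fun t s =>
    ((((hHi t s).const_mul (Ui t)).fun_mul (hUw s t)).fun_mul (hH 0 s))
  have hcont : ∀ {f f' : ℝ → S →L[ℂ] S}, (∀ t, HasDerivAt f (f' t) t) → Continuous f := fun h =>
    continuous_iff_continuousAt.mpr fun t => (h t).continuousAt
  have hcc : ∀ t, ContDiff ℝ 1 (c t) := fun t => by
    refine contDiff_one_of_hasDerivAt (hcd t) ?_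
    have k1 := hcont (hHi t)
    have k2 := hcont (hH 0)
    have k3 := hcont fun s => hUw s t
    have k4 := hcA t
    have k5 := hcA 0
    have k6 := hwc t
    exact ((((continuous_const.mul (k1.mul k4)).mul k3).add
      ((continuous_const.mul k1).mul k6)).mul k2).add
      (((continuous_const.mul k1).mul k3).mul (k5.mul k2).neg)
  let Z : ℝ → S →L[ℂ] S := fun t =>
    Ui t * (clm (om A (x + t • eB)) * U 0 t + w 0 t - U 0 t * clm (om A x))
  have hZ : ∀ t, Z t ∈ (holonomyAlgebra om x).toSubmodule.comap endOfClm := by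
    intro t
    have hc0 : c t 0 = 1 := by simp [c, hHi0, hH0, hUi1]
    have := hasDerivAt_mem_holonomyAlgebra (hcc t) (hcmem t) hc0 (hcd t 0)
    have e : Z t = ((Ui t * (Hi t 0 * clm (om A (x + t • eB + (0 : ℝ) • eA)))) *
      U 0 t + Ui t * Hi t 0 * w 0 t) * H 0 0 + Ui t * Hi t 0 * U 0 t *
        (-(clm (om A (x + (0 : ℝ) • eB + (0 : ℝ) • eA)) * H 0 0)) := by
      simp [Z, hHi0, hH0, mul_add, sub_eq_add_neg, mul_assoc]
    rw [Submodule.mem_comap, endOfClm_apply, e]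
    exact this
  have hdiff : ∀ C v, DifferentiableAt ℝ (fun z => om C z v) x := fun C v =>
    (hom C v).differentiable (by simp) x
  -- the derivative of `Z` at `t = 0` is minus the curvature
  have hαd : HasDerivAt (fun t : ℝ => clm (om A (x + t • eB)))
      (fderiv ℝ (fun z => clm (om A z)) x eB) 0 := by
    have h1 : HasDerivAt (fun t : ℝ => x + t • eB) eB 0 := by
      simpa using ((hasDerivAt_id (0 : ℝ)).smul_const eB).const_add x
    have h2 : HasFDerivAt (fun z => clm (om A z)) (fderiv ℝ (fun z => clm (om A z)) x)
        (x + (0 : ℝ) • eB) := by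
      simpa using ((hsm A).differentiable (by simp) x).hasFDerivAt
    exact h2.comp_hasDerivAt 0 h1
  have hβ₁0 : β₁ 0 0 = fderiv ℝ (fun z => clm (om B z)) x eA := by
    have h1 : HasDerivAt (fun t : ℝ => x + t • eA + (0 : ℝ) • eB) eA 0 := by
      simpa using ((hasDerivAt_id (0 : ℝ)).smul_const eA).const_add x
    have h2 : HasFDerivAt (fun z => clm (om B z)) (fderiv ℝ (fun z => clm (om B z)) x)
        (x + (0 : ℝ) • eA + (0 : ℝ) • eB) := by
      simpa using ((hsm B).differentiable (by simp) x).hasFDerivAt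
    have h3 : HasDerivAt (fun s : ℝ => clm (om B (x + s • eA + (0 : ℝ) • eB)))
        (fderiv ℝ (fun z => clm (om B z)) x eA) 0 :=
      HasFDerivAt.comp_hasDerivAt (f := fun t : ℝ => x + t • eA + (0 : ℝ) • eB) (0 : ℝ) h2 h1
    exact (hβd 0 0).unique h3
  have hZd : HasDerivAt Z (fderiv ℝ (fun z => clm (om A z)) x eB -
      fderiv ℝ (fun z => clm (om B z)) x eA + clm (om B x) * clm (om A x) -
        clm (om A x) * clm (om B x)) 0 := by
    have := (hUi 0).fun_mul (((hαd.fun_mul (hU' 0 0)).fun_add (hw' 0 0)).fun_sub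
      ((hU' 0 0).mul_const (clm (om A x))))
    refine this.congr_deriv ?_
    simp [hUi0, hU0, hw0, hβ₁0]
    abel
  have hmem := hasDerivAt_mem _ hZd (Filter.Eventually.of_forall hZ)
  rw [Submodule.mem_comap] at hmem
  have hFe : F = -endOfClm (fderiv ℝ (fun z => clm (om A z)) x eB -
      fderiv ℝ (fun z => clm (om B z)) x eA + clm (om B x) * clm (om A x) -
        clm (om A x) * clm (om B x)) := by
    ext v
    have hfd : ∀ C e, (fderiv ℝ (fun z => clm (om C z)) x e) v =
        fderiv ℝ (fun z => om C z v) x e := by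
      intro C e
      have := ((ContinuousLinearMap.apply ℂ S v).restrictScalars ℝ).hasFDerivAt.comp x
        ((hsm C).differentiable (by simp) x).hasFDerivAt
      have h3 := congrArg (fun f : (ι → ℝ) →L[ℝ] S => f e) this.fderiv
      exact h3.symm
    simp only [hF, LinearMap.neg_apply, endOfClm_apply, ContinuousLinearMap.coe_coe,
      _root_.sub_apply, _root_.add_apply, mul_apply_eq_comp, hfd, clm_apply]
    abel
  rw [hFe]
  exact neg_mem hmem

end Transport

end Brane

/-! ### The real Clifford algebra of `ℝ^d` and its monomials -/

namespace Brane

section AnticommutingProducts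

variable {R : Type*} [Ring R]

theorem prod_ofFn_mul_of_anticomm {n : ℕ} {x : R} {f : Fin n → R} (h : ∀ i, f i * x = -(x * f i)) :
    (List.ofFn f).prod * x = (-1) ^ n * (x * (List.ofFn f).prod) := by
  induction n with
  | zero => simp
  | succ n ih =>
    have h1 := ih (f := fun i => f i.succ) fun i => h i.succ
    have h2 : f 0 * (-1 : R) ^ n = (-1) ^ n * f 0 := ((Commute.neg_one_left _).pow_left n).eq.symm
    rw [List.ofFn_succ, List.prod_cons, mul_assoc, h1, ← mul_assoc, h2, mul_assoc, ← mul_assoc (f 0),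
      h 0]
    simp [pow_succ, mul_assoc]

theorem prod_reverse_ofFn_of_anticomm {n : ℕ} {f : Fin n → R}
    (h : ∀ i j, i ≠ j → f i * f j = -(f j * f i)) :
    (List.ofFn f).reverse.prod = (-1) ^ (n * (n - 1) / 2) * (List.ofFn f).prod := by
  induction n with
  | zero => simp
  | succ n ih =>
    have h1 := ih (f := fun i => f i.succ) fun i j hij => h _ _ (by simpa using hij)
    have h2 := prod_ofFn_mul_of_anticomm (x := f 0) (f := fun i : Fin n => f i.succ)
      fun i => h _ _ (Fin.succ_ne_zero i)
    have h3 : (n + 1) * (n + 1 - 1) / 2 = n * (n - 1) / 2 + n := by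
      have := Nat.triangle_succ n
      simpa using this
    rw [List.ofFn_succ, List.reverse_cons, List.prod_append, h1, h3, pow_add]
    simp only [List.prod_cons, List.prod_nil, mul_one]
    rw [mul_assoc, h2, mul_assoc]

theorem prod_ofFn_mul_reverse {n : ℕ} {f : Fin n → R} (h : ∀ i, f i * f i = -1) :
    (List.ofFn f).prod * (List.ofFn f).reverse.prod = (-1) ^ n := by
  induction n with
  | zero => simp
  | succ n ih =>
    have h1 := ih (f := fun i => f i.succ) fun i => h _
    rw [List.ofFn_succ, List.reverse_cons, List.prod_append, List.prod_cons]
    simp only [List.prod_cons, List.prod_nil, mul_one]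
    calc _ = f 0 * ((List.ofFn fun i : Fin n => f i.succ).prod *
          (List.ofFn fun i : Fin n => f i.succ).reverse.prod) * f 0 := by simp only [mul_assoc]
      _ = _ := by
        rw [h1, ((Commute.neg_one_right (f 0)).pow_right n).eq, mul_assoc, h 0, pow_succ]

theorem neg_one_pow_triangle_mul_self (n : ℕ) :
    (-1 : R) ^ (n * (n - 1) / 2) * (-1) ^ (n * (n - 1) / 2) = 1 := by
  rw [← pow_add, ← two_mul, pow_mul]; simp

theorem prod_ofFn_sq {n : ℕ} {f : Fin n → R} (h : ∀ i, f i * f i = -1)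
    (h' : ∀ i j, i ≠ j → f i * f j = -(f j * f i)) :
    (List.ofFn f).prod * (List.ofFn f).prod = (-1) ^ (n * (n - 1) / 2) * (-1) ^ n := by
  have h1 := prod_ofFn_mul_reverse h
  rw [prod_reverse_ofFn_of_anticomm h'] at h1
  have hc : ∀ x : R, x * (-1) ^ (n * (n - 1) / 2) = (-1) ^ (n * (n - 1) / 2) * x := fun x =>
    ((Commute.neg_one_right x).pow_right _).eq
  rw [← mul_assoc, hc, mul_assoc] at h1
  rw [← h1, ← mul_assoc, neg_one_pow_triangle_mul_self, one_mul]

end AnticommutingProducts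

section CliffordAlgebra

/-- The negative definite quadratic form `-∑ x_i²` of `ℝ^d`. -/
noncomputable def negForm (d : ℕ) : QuadraticForm ℝ (Fin d → ℝ) :=
  QuadraticMap.weightedSumSquares ℝ fun _ : Fin d => (-1 : ℝ)

/-- The real Clifford algebra of `ℝ^d` with the convention `x² = -|x|²`. -/
abbrev Cl (d : ℕ) : Type := CliffordAlgebra (negForm d)

variable {d : ℕ}

/-- The generators of the Clifford algebra. -/
noncomputable def gen (i : Fin d) : Cl d := CliffordAlgebra.ι (negForm d) (Pi.single i 1)

theorem ι_eq_sum (v : Fin d → ℝ) : CliffordAlgebra.ι (negForm d) v = ∑ i, v i • gen i := by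
  conv_lhs => rw [← Finset.univ_sum_single v]
  rw [map_sum]
  refine Finset.sum_congr rfl fun i _ => ?_
  rw [gen, ← map_smul]
  congr 1
  ext j
  by_cases h : j = i <;> simp [h]

theorem gen_sq (i : Fin d) : gen i * gen i = -1 := by
  rw [gen, CliffordAlgebra.ι_sq_scalar]
  have : negForm d (Pi.single i 1) = -1 := by
    simp [negForm, QuadraticMap.weightedSumSquares_apply, Pi.single_apply]
  rw [this]; simp

theorem gen_anticomm {i j : Fin d} (h : i ≠ j) : gen i * gen j = -(gen j * gen i) := by
  refine CliffordAlgebra.ι_mul_ι_comm_of_isOrtho ?_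
  rw [QuadraticMap.isOrtho_def]
  simp only [negForm, QuadraticMap.weightedSumSquares_apply, Pi.add_apply, smul_eq_mul]
  rw [← Finset.sum_add_distrib]
  refine Finset.sum_congr rfl fun k _ => ?_
  by_cases h1 : k = i <;> by_cases h2 : k = j <;> simp_all

/-- The product, over the list `l`, of the generators with index in `I`. -/
noncomputable def monL (l : List (Fin d)) (I : Finset (Fin d)) : Cl d :=
  (l.map fun i => if i ∈ I then gen i else 1).prod

/-- The monomial `e_{i_1} ⋯ e_{i_k}` of the set `I = {i_1 < ⋯ < i_k}`. -/
noncomputable def mon (I : Finset (Fin d)) : Cl d := monL (List.finRange d) I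

theorem monL_cons (a : Fin d) (l : List (Fin d)) (I : Finset (Fin d)) :
    monL (a :: l) I = (if a ∈ I then gen a else 1) * monL l I := by
  simp [monL]

theorem gen_mul_monL (i : Fin d) (l : List (Fin d)) (I : Finset (Fin d)) :
    gen i * monL l I = (-1) ^ (l.filter fun j => j ∈ I ∧ j ≠ i).length * (monL l I * gen i) := by
  induction l with
  | nil => simp [monL]
  | cons a l ih =>
    have hc : ∀ (x : Cl d) (n : ℕ), x * (-1) ^ n = (-1) ^ n * x := fun x n =>
      ((Commute.neg_one_right x).pow_right _).eq
    rw [monL_cons, List.filter_cons]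
    by_cases ha : a ∈ I
    · by_cases hai : a = i
      · subst hai
        simp only [ha, if_true, ne_eq, not_true_eq_false, and_false, decide_false]
        rw [mul_assoc, ih, ← mul_assoc, hc]
        simp [mul_assoc]
      · simp only [ha, if_true, ne_eq, hai, not_false_eq_true, and_self, decide_true,
          List.length_cons]
        rw [← mul_assoc, gen_anticomm (Ne.symm hai), neg_mul, mul_assoc, ih, ← mul_assoc, hc]
        simp [mul_assoc, pow_succ]
    · simp only [ha, if_false, false_and, decide_false, one_mul]
      exact ih

theorem gen_mul_mon (i : Fin d) (I : Finset (Fin d)) :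
    gen i * mon I = (-1) ^ (I.erase i).card * (mon I * gen i) := by
  rw [mon, gen_mul_monL]
  congr 2
  rw [← List.toFinset_card_of_nodup ((List.nodup_finRange d).filter _)]
  congr 1
  ext j
  simp [and_comm]

theorem mon_empty : mon (∅ : Finset (Fin d)) = 1 := by
  simp [mon, monL]

theorem monL_congr {l : List (Fin d)} {I J : Finset (Fin d)} (h : ∀ i ∈ l, i ∈ I ↔ i ∈ J) :
    monL l I = monL l J := by
  unfold monL
  congr 1
  exact List.map_congr_left fun i hi => by simp [h i hi]

/-- Multiplication with `e_i` inserts the index `i` into a monomial or removes it, up to the sign. -/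
theorem gen_mul_monL_of_mem (i : Fin d) (I : Finset (Fin d)) :
    ∀ l : List (Fin d), l.Nodup → i ∈ l →
      gen i * monL l I = monL l (symmDiff I {i}) ∨ gen i * monL l I = -monL l (symmDiff I {i}) := by
  intro l
  induction l with
  | nil => simp
  | cons a l ih =>
    intro hnd hi
    rw [List.nodup_cons] at hnd
    rw [monL_cons, monL_cons]
    by_cases hai : a = i
    · subst hai
      have h1 : monL l (symmDiff I {a}) = monL l I := monL_congr fun j hj => by
        have : j ≠ a := fun h => hnd.1 (h ▸ hj)
        simp [Finset.mem_symmDiff, this]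
      rw [h1]
      by_cases ha : a ∈ I
      · right
        simp [Finset.mem_symmDiff, ha, ← mul_assoc, gen_sq]
      · left
        simp [Finset.mem_symmDiff, ha]
    · have hil : i ∈ l := by simpa [Ne.symm hai] using hi
      have h2 : (a ∈ symmDiff I {i}) ↔ a ∈ I := by simp [Finset.mem_symmDiff, hai]
      simp only [h2]
      by_cases ha : a ∈ I
      · simp only [ha, if_true]
        rw [← mul_assoc, gen_anticomm (Ne.symm hai), neg_mul, mul_assoc]
        rcases ih hnd.2 hil with h | h <;> rw [h] <;> simp
      · simp only [ha, if_false, one_mul]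
        exact ih hnd.2 hil

theorem gen_mul_mon_eq (i : Fin d) (I : Finset (Fin d)) :
    gen i * mon I = mon (symmDiff I {i}) ∨ gen i * mon I = -mon (symmDiff I {i}) :=
  gen_mul_monL_of_mem i I _ (List.nodup_finRange d) (List.mem_finRange i)

/-- The product of two monomials is, up to the sign, the monomial of the symmetric difference. -/
theorem mon_mul_mon (I J : Finset (Fin d)) :
    mon I * mon J = mon (symmDiff I J) ∨ mon I * mon J = -mon (symmDiff I J) := by
  have key : ∀ l : List (Fin d), l.Nodup →
      monL l I * mon J = mon (symmDiff (I ∩ l.toFinset) J) ∨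
        monL l I * mon J = -mon (symmDiff (I ∩ l.toFinset) J) := by
    intro l
    induction l with
    | nil =>
      intro _
      left
      simp [monL, symmDiff]
    | cons a l ih =>
      intro hnd
      rw [List.nodup_cons] at hnd
      rw [monL_cons]
      by_cases ha : a ∈ I
      · have hset : symmDiff (I ∩ (a :: l).toFinset) J =
            symmDiff (symmDiff (I ∩ l.toFinset) J) {a} := by
          ext j
          have : j = a → j ∉ l := fun h => h ▸ hnd.1
          simp only [Finset.mem_symmDiff, Finset.mem_inter, List.mem_toFinset, List.mem_cons,
            Finset.mem_singleton]
          by_cases hja : j = a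
          · subst hja; simp [ha, hnd.1]
          · simp [hja]
        simp only [ha, if_true]
        rw [mul_assoc, hset]
        rcases ih hnd.2 with h | h <;> rw [h]
        · exact gen_mul_mon_eq a _
        · rw [mul_neg]
          rcases gen_mul_mon_eq a (symmDiff (I ∩ l.toFinset) J) with h | h <;> rw [h] <;> simp
      · have hset : I ∩ (a :: l).toFinset = I ∩ l.toFinset := by
          ext j
          by_cases hja : j = a
          · subst hja; simp [ha]
          · simp [hja]
        simp only [ha, if_false, one_mul, hset]
        exact ih hnd.2
  have := key _ (List.nodup_finRange d)
  simpa [mon, Finset.inter_univ] using this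

theorem mon_mul_self (I : Finset (Fin d)) : mon I * mon I = 1 ∨ mon I * mon I = -1 := by
  simpa [mon_empty] using mon_mul_mon I I

theorem mon_singleton (i : Fin d) : gen i = mon {i} ∨ gen i = -mon {i} := by
  have := gen_mul_mon_eq i ∅
  simpa [mon_empty, symmDiff] using this

theorem gen_mul_gen_eq {i j : Fin d} (h : i ≠ j) :
    gen i * gen j = mon {i, j} ∨ gen i * gen j = -mon {i, j} := by
  have hset : symmDiff ({j} : Finset (Fin d)) {i} = {i, j} := by
    ext k; simp only [Finset.mem_symmDiff, Finset.mem_singleton, Finset.mem_insert]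
    constructor
    · tauto
    · rintro (rfl | rfl)
      · exact Or.inr ⟨rfl, h⟩
      · exact Or.inl ⟨rfl, Ne.symm h⟩
  have h1 := gen_mul_mon_eq i {j}
  rw [hset] at h1
  rcases mon_singleton j with h2 | h2 <;> rw [h2]
  · exact h1
  · rw [mul_neg]
    rcases h1 with h1 | h1 <;> rw [h1] <;> simp

/-- The monomials span the Clifford algebra: their span contains the unit and is stable under the
multiplication with the generators. -/
theorem span_mon : Submodule.span ℝ (Set.range (mon (d := d))) = ⊤ := by
  rw [eq_top_iff]
  -- the span is stable under left multiplication by vectors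
  let N := Submodule.span ℝ (Set.range (mon (d := d)))
  have hgen : ∀ i, ∀ x ∈ N, gen i * x ∈ N := by
    intro i x hx
    induction hx using Submodule.span_induction with
    | mem x hx =>
      obtain ⟨I, rfl⟩ := hx
      rcases gen_mul_mon_eq i I with h | h <;> rw [h]
      · exact Submodule.subset_span ⟨_, rfl⟩
      · exact N.neg_mem (Submodule.subset_span ⟨_, rfl⟩)
    | zero => simp
    | add x y _ _ hx hy => rw [mul_add]; exact N.add_mem hx hy
    | smul r x _ hx => rw [mul_smul_comm]; exact N.smul_mem r hx
  have hleft : ∀ a : Cl d, ∀ x ∈ N, a * x ∈ N := by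
    intro a
    induction a using CliffordAlgebra.induction with
    | algebraMap r => intro x hx; rw [← Algebra.smul_def]; exact N.smul_mem r hx
    | ι v =>
      intro x hx
      rw [ι_eq_sum, Finset.sum_mul]
      exact N.sum_mem fun i _ => by rw [smul_mul_assoc]; exact N.smul_mem _ (hgen i x hx)
    | mul a b ha hb => intro x hx; rw [mul_assoc]; exact ha _ (hb x hx)
    | add a b ha hb => intro x hx; rw [add_mul]; exact N.add_mem (ha x hx) (hb x hx)
  intro a _
  have := hleft a 1 (Submodule.subset_span ⟨∅, mon_empty⟩)
  rwa [mul_one] at this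

theorem gen_mem_odd (i : Fin d) : gen i ∈ CliffordAlgebra.evenOdd (negForm d) 1 :=
  CliffordAlgebra.ι_mem_evenOdd_one _ _

theorem mul_mem_evenOdd {m n : ZMod 2} {x y : Cl d} (hx : x ∈ CliffordAlgebra.evenOdd (negForm d) m)
    (hy : y ∈ CliffordAlgebra.evenOdd (negForm d) n) :
    x * y ∈ CliffordAlgebra.evenOdd (negForm d) (m + n) :=
  CliffordAlgebra.evenOdd_mul_le _ m n (Submodule.mul_mem_mul hx hy)

theorem one_mem_even : (1 : Cl d) ∈ CliffordAlgebra.evenOdd (negForm d) 0 :=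
  CliffordAlgebra.one_le_evenOdd_zero _ (Submodule.one_le.mp le_rfl)

theorem mon_mem_evenOdd (I : Finset (Fin d)) :
    mon I ∈ CliffordAlgebra.evenOdd (negForm d) (I.card : ZMod 2) := by
  have key : ∀ l : List (Fin d), monL l I ∈
      CliffordAlgebra.evenOdd (negForm d) ((l.filter fun j => j ∈ I).length : ZMod 2) := by
    intro l
    induction l with
    | nil => simpa [monL] using one_mem_even
    | cons a l ih =>
      rw [monL_cons, List.filter_cons]
      by_cases ha : a ∈ I
      · simp only [ha, if_true, decide_true, List.length_cons]
        have := mul_mem_evenOdd (gen_mem_odd a) ih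
        rwa [add_comm, ← Nat.cast_succ] at this
      · simpa [ha] using ih
  have h := key (List.finRange d)
  rw [← List.toFinset_card_of_nodup ((List.nodup_finRange d).filter _)] at h
  have hs : ((List.finRange d).filter fun j => j ∈ I).toFinset = I := by ext; simp
  rwa [hs] at h

theorem even_card_cast {n : ℕ} (h : Even n) : (n : ZMod 2) = 0 := by
  rw [ZMod.natCast_eq_zero_iff]; exact h.two_dvd

theorem odd_card_cast {n : ℕ} (h : Odd n) : (n : ZMod 2) = 1 := ZMod.natCast_eq_one_iff_odd.mpr h

/-- The even elements are spanned by the even monomials, and likewise the odd ones. -/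
theorem evenOdd_le_span (x : Cl d) :
    (x ∈ CliffordAlgebra.evenOdd (negForm d) 0 →
      x ∈ Submodule.span ℝ (mon '' {I : Finset (Fin d) | Even I.card})) ∧
    (x ∈ CliffordAlgebra.evenOdd (negForm d) 1 →
      x ∈ Submodule.span ℝ (mon '' {I : Finset (Fin d) | Odd I.card})) := by
  have hE : Submodule.span ℝ (mon '' {I : Finset (Fin d) | Even I.card}) ≤
      CliffordAlgebra.evenOdd (negForm d) 0 := by
    rw [Submodule.span_le]
    rintro _ ⟨I, hI, rfl⟩
    have := mon_mem_evenOdd I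
    rwa [even_card_cast hI] at this
  have hO : Submodule.span ℝ (mon '' {I : Finset (Fin d) | Odd I.card}) ≤
      CliffordAlgebra.evenOdd (negForm d) 1 := by
    rw [Submodule.span_le]
    rintro _ ⟨I, hI, rfl⟩
    have := mon_mem_evenOdd I
    rwa [odd_card_cast hI] at this
  have htop : Submodule.span ℝ (mon '' {I : Finset (Fin d) | Even I.card}) ⊔
      Submodule.span ℝ (mon '' {I : Finset (Fin d) | Odd I.card}) = ⊤ := by
    rw [← Submodule.span_union, ← Set.image_union, ← span_mon, ← Set.image_univ]
    congr 2
    ext I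
    simpa using Nat.even_or_odd I.card
  have hx : x ∈ Submodule.span ℝ (mon '' {I : Finset (Fin d) | Even I.card}) ⊔
      Submodule.span ℝ (mon '' {I : Finset (Fin d) | Odd I.card}) := htop ▸ Submodule.mem_top
  obtain ⟨a, ha, b, hb, rfl⟩ := Submodule.mem_sup.mp hx
  have hdis := (CliffordAlgebra.evenOdd_isCompl (negForm d)).disjoint
  refine ⟨fun h => ?_, fun h => ?_⟩
  · have : b ∈ CliffordAlgebra.evenOdd (negForm d) 0 := by
      simpa using Submodule.sub_mem _ h (hE ha)
    rw [Submodule.disjoint_def.mp hdis b this (hO hb), add_zero]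
    exact ha
  · have : a ∈ CliffordAlgebra.evenOdd (negForm d) 1 := by
      simpa using Submodule.sub_mem _ h (hO hb)
    rw [Submodule.disjoint_def.mp hdis a (hE ha) this, zero_add]
    exact hb

/-- The volume element `e_1 ⋯ e_d`. -/
noncomputable def volCl (d : ℕ) : Cl d := mon Finset.univ

theorem volCl_eq : volCl d = (List.ofFn (gen (d := d))).prod := by
  simp [volCl, mon, monL, List.ofFn_eq_map]

theorem volCl_mul_mon (I : Finset (Fin d)) :
    mon I * volCl d = mon Iᶜ ∨ mon I * volCl d = -mon Iᶜ := by
  have := mon_mul_mon I Finset.univ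
  have hs : symmDiff I Finset.univ = Iᶜ := by ext; simp [Finset.mem_symmDiff]
  rwa [hs] at this

theorem reverse_volCl : CliffordAlgebra.reverse (volCl d) = (-1) ^ (d * (d - 1) / 2) * volCl d := by
  rw [volCl_eq, ← prod_reverse_ofFn_of_anticomm fun i j h => gen_anticomm h]
  have := CliffordAlgebra.reverse_prod_map_ι (Q := negForm d)
    (List.ofFn fun i : Fin d => (Pi.single i 1 : Fin d → ℝ))
  rw [List.map_ofFn] at this
  exact this

end CliffordAlgebra

end Brane

/-! ### Representations of the Clifford algebra and the density theorem -/

namespace Brane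

section Representation

variable {d : ℕ} {V : Type*} [AddCommGroup V] [Module ℂ V] [Module ℝ V] [IsScalarTower ℝ ℂ V]
  {τ : Fin d → Module.End ℂ V}

theorem eq_zero_of_eq_neg_self {W : Type*} [AddCommGroup W] [Module ℂ W] {x : W} (h : x = -x) :
    x = 0 := by
  have h2 : (2 : ℂ) • x = 0 := by
    rw [two_smul]; nth_rewrite 2 [h]; exact add_neg_cancel x
  exact (smul_eq_zero.mp h2).resolve_left two_ne_zero

theorem IsEuclideanClifford.sq (hτ : IsEuclideanClifford τ) (i : Fin d) : τ i * τ i = -1 := by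
  have h := hτ i i
  rw [if_pos rfl, ← two_smul ℂ (τ i * τ i)] at h
  have h2 : (2 : ℂ) • (τ i * τ i) = (2 : ℂ) • (-1 : Module.End ℂ V) := by rw [h]; simp
  exact smul_right_injective _ (two_ne_zero (α := ℂ)) h2

theorem IsEuclideanClifford.anticomm (hτ : IsEuclideanClifford τ) {i j : Fin d} (h : i ≠ j) :
    τ i * τ j = -(τ j * τ i) := by
  have h1 := hτ i j
  rw [if_neg h] at h1
  exact eq_neg_of_add_eq_zero_left h1

theorem real_smul_end (r : ℝ) (x : Module.End ℂ V) : r • x = (r : ℂ) • x :=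
  (algebraMap_smul ℂ r x).symm

theorem IsEuclideanClifford.sum_mul_sum (hτ : IsEuclideanClifford τ) (v : Fin d → ℝ) :
    (∑ i, v i • τ i) * (∑ i, v i • τ i) = algebraMap ℝ (Module.End ℂ V) (negForm d v) := by
  have h1 : (∑ i, v i • τ i) * (∑ i, v i • τ i) = ∑ i, ∑ j, (v i * v j) • (τ i * τ j) := by
    rw [Finset.sum_mul_sum]
    simp only [smul_mul_smul_comm]
  have h2 : (∑ i, v i • τ i) * (∑ i, v i • τ i) = ∑ i, ∑ j, (v i * v j) • (τ j * τ i) := by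
    rw [h1, Finset.sum_comm]
    exact Finset.sum_congr rfl fun i _ => Finset.sum_congr rfl fun j _ => by
      rw [mul_comm (v j)]
  have h3 : (∑ i, v i • τ i) * (∑ i, v i • τ i) + (∑ i, v i • τ i) * (∑ i, v i • τ i) =
      (2 : ℝ) • algebraMap ℝ (Module.End ℂ V) (negForm d v) := by
    nth_rewrite 1 [h1]
    rw [h2, ← Finset.sum_add_distrib]
    simp only [← Finset.sum_add_distrib, ← smul_add, hτ _ _]
    simp only [smul_ite, smul_zero, Finset.sum_ite_eq, Finset.mem_univ, if_true, negForm,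
      QuadraticMap.weightedSumSquares_apply, map_sum, Finset.smul_sum]
    refine Finset.sum_congr rfl fun i _ => ?_
    rw [real_smul_end, real_smul_end, Algebra.algebraMap_eq_smul_one, real_smul_end, smul_smul,
      smul_smul]
    congr 1
    push_cast
    simp
    ring
  rw [← two_smul ℝ] at h3
  exact smul_right_injective _ (two_ne_zero (α := ℝ)) h3

/-- The representation of the Clifford algebra defined by gamma matrices. -/
noncomputable def rep (hτ : IsEuclideanClifford τ) : Cl d →ₐ[ℝ] Module.End ℂ V :=
  CliffordAlgebra.lift (negForm d)
    ⟨∑ i, (LinearMap.proj i : (Fin d → ℝ) →ₗ[ℝ] ℝ).smulRight (τ i), fun v => by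
      simpa using hτ.sum_mul_sum v⟩

theorem rep_ι (hτ : IsEuclideanClifford τ) (v : Fin d → ℝ) :
    rep hτ (CliffordAlgebra.ι (negForm d) v) = ∑ i, v i • τ i := by
  rw [rep, CliffordAlgebra.lift_ι_apply]
  simp

@[simp] theorem rep_gen (hτ : IsEuclideanClifford τ) (i : Fin d) : rep hτ (gen i) = τ i := by
  rw [gen, rep_ι, Finset.sum_eq_single i] <;> simp +contextual

theorem rep_volCl (hτ : IsEuclideanClifford τ) : rep hτ (volCl d) = vol τ := by
  rw [volCl_eq, map_list_prod, List.map_ofFn, vol]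
  congr 2
  funext i
  simp

/-- The element `-¼ ∑ M_ij e_i e_j` of the Clifford algebra that represents the matrix `M`. -/
noncomputable def spinEl (M : Matrix (Fin d) (Fin d) ℝ) : Cl d :=
  (-(1 / 4) : ℝ) • ∑ i, ∑ j, M i j • (gen i * gen j)

theorem rep_spinEl (hτ : IsEuclideanClifford τ) (M : Matrix (Fin d) (Fin d) ℝ) :
    rep hτ (spinEl M) = spinRep τ M := by
  simp only [spinEl, spinRep, map_smul, map_sum, map_mul, rep_gen, real_smul_end]
  push_cast
  rfl

theorem spinEl_mem_even (M : Matrix (Fin d) (Fin d) ℝ) :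
    spinEl M ∈ CliffordAlgebra.evenOdd (negForm d) 0 :=
  Submodule.smul_mem _ _ (Submodule.sum_mem _ fun _ _ => Submodule.sum_mem _ fun _ _ =>
    Submodule.smul_mem _ _ (CliffordAlgebra.ι_mul_ι_mem_evenOdd_zero _ _ _))

theorem mul_rep_of_anticomm (hτ : IsEuclideanClifford τ) {y : Module.End ℂ V}
    (hy : ∀ i, y * τ i = -(τ i * y)) (x : Cl d) :
    y * rep hτ x = rep hτ (CliffordAlgebra.involute x) * y := by
  induction x using CliffordAlgebra.induction with
  | algebraMap r => simp [Algebra.algebraMap_eq_smul_one]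
  | ι v =>
    rw [CliffordAlgebra.involute_ι, map_neg, rep_ι, Finset.mul_sum, neg_mul, Finset.sum_mul,
      ← Finset.sum_neg_distrib]
    refine Finset.sum_congr rfl fun i _ => ?_
    rw [mul_smul_comm, hy, smul_neg, smul_mul_assoc]
  | mul a b ha hb => rw [map_mul, map_mul, map_mul, ← mul_assoc, ha, mul_assoc, hb, mul_assoc]
  | add a b ha hb => rw [map_add, map_add, map_add, mul_add, add_mul, ha, hb]

theorem mul_rep_even_of_anticomm (hτ : IsEuclideanClifford τ) {y : Module.End ℂ V}
    (hy : ∀ i, y * τ i = -(τ i * y)) {x : Cl d}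
    (hx : x ∈ CliffordAlgebra.evenOdd (negForm d) 0) : y * rep hτ x = rep hτ x * y := by
  rw [mul_rep_of_anticomm hτ hy, CliffordAlgebra.involute_eq_of_mem_even hx]

theorem mul_rep_odd_of_anticomm (hτ : IsEuclideanClifford τ) {y : Module.End ℂ V}
    (hy : ∀ i, y * τ i = -(τ i * y)) {x : Cl d}
    (hx : x ∈ CliffordAlgebra.evenOdd (negForm d) 1) : y * rep hτ x = -(rep hτ x * y) := by
  rw [mul_rep_of_anticomm hτ hy, CliffordAlgebra.involute_eq_of_mem_odd hx, map_neg, neg_mul]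

theorem mul_rep_of_comm (hτ : IsEuclideanClifford τ) {y : Module.End ℂ V}
    (hy : ∀ i, y * τ i = τ i * y) (x : Cl d) : y * rep hτ x = rep hτ x * y := by
  induction x using CliffordAlgebra.induction with
  | algebraMap r => simp [Algebra.algebraMap_eq_smul_one]
  | ι v =>
    rw [rep_ι, Finset.mul_sum, Finset.sum_mul]
    refine Finset.sum_congr rfl fun i _ => ?_
    rw [mul_smul_comm, hy, smul_mul_assoc]
  | mul a b ha hb => rw [map_mul, ← mul_assoc, ha, mul_assoc, hb, mul_assoc]
  | add a b ha hb => rw [map_add, mul_add, add_mul, ha, hb]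

theorem IsEuclideanClifford.mul_vol (hτ : IsEuclideanClifford τ) (i : Fin d) :
    τ i * vol τ = -(-1) ^ d * (vol τ * τ i) := by
  rw [← rep_volCl hτ, ← rep_gen hτ i, ← map_mul, ← map_mul, volCl, gen_mul_mon,
    Finset.card_erase_of_mem (Finset.mem_univ i), Finset.card_univ, Fintype.card_fin]
  obtain ⟨m, rfl⟩ : ∃ m, d = m + 1 := Nat.exists_eq_succ_of_ne_zero fun h => by
    subst h; exact i.elim0
  simp [pow_succ]

theorem IsEuclideanClifford.vol_sq (hτ : IsEuclideanClifford τ) :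
    vol τ * vol τ = (-1) ^ (d * (d - 1) / 2) * (-1) ^ d :=
  prod_ofFn_sq hτ.sq fun _ _ h => hτ.anticomm h

theorem vol_mul_rep_even (hτ : IsEuclideanClifford τ) {x : Cl d}
    (hx : x ∈ CliffordAlgebra.evenOdd (negForm d) 0) : vol τ * rep hτ x = rep hτ x * vol τ := by
  rcases Nat.even_or_odd d with h | h
  · refine mul_rep_even_of_anticomm hτ (fun i => ?_) hx
    rw [hτ.mul_vol]; simp [h.neg_one_pow]
  · refine mul_rep_of_comm hτ (fun i => ?_) x
    rw [hτ.mul_vol]; simp [h.neg_one_pow]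

theorem vol_mul_rep_odd (hτ : IsEuclideanClifford τ) {x : Cl d}
    (hx : x ∈ CliffordAlgebra.evenOdd (negForm d) 1) :
    vol τ * rep hτ x = -(-1) ^ d * (rep hτ x * vol τ) := by
  rcases Nat.even_or_odd d with h | h
  · rw [mul_rep_odd_of_anticomm hτ (fun i => ?_) hx]
    · simp [h.neg_one_pow]
    · rw [hτ.mul_vol]; simp [h.neg_one_pow]
  · rw [mul_rep_of_comm hτ (fun i => ?_) x]
    · simp [h.neg_one_pow]
    · rw [hτ.mul_vol]; simp [h.neg_one_pow]


/-- An endomorphism is trace free if it anticommutes with one whose square is a nonzero scalar. -/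
theorem trace_eq_zero_of_anticomm {W : Type*} [AddCommGroup W] [Module ℂ W]
    {x y : Module.End ℂ W} {c : ℂ} (hc : c ≠ 0) (hy : y * y = c • 1) (h : y * x = -(x * y)) :
    LinearMap.trace ℂ W x = 0 := by
  have h1 : LinearMap.trace ℂ W (x * y * y) = c * LinearMap.trace ℂ W x := by
    rw [mul_assoc, hy]; simp
  have h2 : LinearMap.trace ℂ W (x * y * y) = -LinearMap.trace ℂ W (x * y * y) := by
    nth_rewrite 1 [LinearMap.trace_mul_comm]
    rw [← mul_assoc, h, neg_mul, map_neg]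
  have h3 : c * LinearMap.trace ℂ W x = 0 := by
    rw [← h1]; exact CharZero.eq_neg_self_iff.mp h2
  exact (mul_eq_zero.mp h3).resolve_left hc

theorem trace_rep_mon_even (hτ : IsEuclideanClifford τ) {I : Finset (Fin d)} (hI : I ≠ ∅)
    (he : Even I.card) : LinearMap.trace ℂ V (rep hτ (mon I)) = 0 := by
  obtain ⟨i, hi⟩ := Finset.nonempty_iff_ne_empty.mpr hI
  refine trace_eq_zero_of_anticomm (y := τ i) (c := -1) (by simp) (by rw [hτ.sq]; simp) ?_
  rw [← rep_gen hτ i, ← map_mul, gen_mul_mon, Finset.card_erase_of_mem hi]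
  have : Odd (I.card - 1) := Nat.Even.sub_odd (Finset.card_pos.mpr ⟨i, hi⟩) he odd_one
  simp [this.neg_one_pow]

theorem trace_rep_mon_odd (hτ : IsEuclideanClifford τ) {I : Finset (Fin d)}
    (hI : I ≠ Finset.univ) (ho : Odd I.card) : LinearMap.trace ℂ V (rep hτ (mon I)) = 0 := by
  obtain ⟨i, hi⟩ : ∃ i, i ∉ I := by
    by_contra! h
    exact hI (Finset.eq_univ_iff_forall.mpr h)
  refine trace_eq_zero_of_anticomm (y := τ i) (c := -1) (by simp) (by rw [hτ.sq]; simp) ?_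
  rw [← rep_gen hτ i, ← map_mul, gen_mul_mon, Finset.erase_eq_of_notMem hi]
  simp [ho.neg_one_pow]

theorem trace_rep_mon_of_even_dim (hτ : IsEuclideanClifford τ) (hd : Even d) {I : Finset (Fin d)}
    (hI : I ≠ ∅) : LinearMap.trace ℂ V (rep hτ (mon I)) = 0 := by
  rcases Nat.even_or_odd I.card with h | h
  · exact trace_rep_mon_even hτ hI h
  · refine trace_rep_mon_odd hτ (fun hu => ?_) h
    rw [hu, Finset.card_univ, Fintype.card_fin] at h
    exact (Nat.not_odd_iff_even.mpr hd) h

theorem symmDiff_card_even {I J : Finset (Fin d)} (hIJ : Even (I.card + J.card)) :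
    Even (symmDiff I J).card := by
  have h : (symmDiff I J).card + 2 * (I ∩ J).card = I.card + J.card := by
    rw [symmDiff_eq_sup_sdiff_inf, Finset.sup_eq_union, Finset.inf_eq_inter,
      Finset.card_sdiff_of_subset
      (Finset.inter_subset_left.trans Finset.subset_union_left)]
    have h1 := Finset.card_union_add_card_inter I J
    have h2 : (I ∩ J).card ≤ (I ∪ J).card :=
      Finset.card_le_card (Finset.inter_subset_left.trans Finset.subset_union_left)
    omega
  rw [← h] at hIJ
  exact (Nat.even_add.mp hIJ).mpr (even_two_mul _)

/-- A family of endomorphisms that is orthogonal for the trace form and as large as possible spans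
all endomorphisms. -/
theorem span_eq_top_of_trace {W K : Type*} [AddCommGroup W] [Module ℂ W] [FiniteDimensional ℂ W]
    [Fintype K] (x : K → Module.End ℂ W)
    (h1 : ∀ k l, k ≠ l → LinearMap.trace ℂ W (x k * x l) = 0)
    (h2 : ∀ k, LinearMap.trace ℂ W (x k * x k) ≠ 0)
    (hK : Fintype.card K = Module.finrank ℂ W * Module.finrank ℂ W) :
    Submodule.span ℂ (Set.range x) = ⊤ := by
  have hli : LinearIndependent ℂ x := by
    rw [Fintype.linearIndependent_iff]
    intro g hg k
    have h := congrArg (fun y => LinearMap.trace ℂ W (x k * y)) hg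
    simp only [Finset.mul_sum, mul_smul_comm, map_sum, map_smul, mul_zero, map_zero,
      smul_eq_mul] at h
    rw [Finset.sum_eq_single k] at h
    · exact (mul_eq_zero.mp h).resolve_right (h2 k)
    · intro l _ hl; rw [h1 k l (Ne.symm hl), mul_zero]
    · simp
  refine hli.span_eq_top_of_card_eq_finrank' ?_
  rw [hK]
  exact (Module.finrank_linearMap ℂ ℂ W W).symm

theorem trace_rep_mul_self_ne_zero [FiniteDimensional ℂ V] (hτ : IsEuclideanClifford τ)
    (hV : Module.finrank ℂ V ≠ 0) (I : Finset (Fin d)) :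
    LinearMap.trace ℂ V (rep hτ (mon I) * rep hτ (mon I)) ≠ 0 := by
  rw [← map_mul]
  rcases mon_mul_self I with h | h <;> rw [h] <;> simpa using hV

theorem trace_rep_mul (hτ : IsEuclideanClifford τ) {I J : Finset (Fin d)}
    (h : LinearMap.trace ℂ V (rep hτ (mon (symmDiff I J))) = 0) :
    LinearMap.trace ℂ V (rep hτ (mon I) * rep hτ (mon J)) = 0 := by
  rw [← map_mul]
  rcases mon_mul_mon I J with h1 | h1 <;> simp [h1, h]

theorem symmDiff_ne_empty {I J : Finset (Fin d)} (h : I ≠ J) : symmDiff I J ≠ ∅ := by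
  rwa [← Finset.bot_eq_empty, Ne, symmDiff_eq_bot]

/-- Half of the subsets have odd cardinality: flipping a fixed index exchanges the parities. -/
theorem card_odd_subsets (hd : 0 < d) :
    Fintype.card {I : Finset (Fin d) // Odd I.card} = 2 ^ (d - 1) := by
  have i0 : Fin d := ⟨0, hd⟩
  have hflip : ∀ I : Finset (Fin d), Odd (symmDiff I {i0}).card ↔ ¬ Odd I.card := by
    intro I
    constructor
    · intro h h'
      exact (Nat.not_odd_iff_even.mpr (symmDiff_card_even (J := {i0}) (h'.add_odd (by simp)))) h
    · intro h
      by_contra h'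
      by_cases hi : i0 ∈ I
      · have : symmDiff I {i0} = I.erase i0 := by
          ext j; by_cases hj : j = i0 <;> simp [Finset.mem_symmDiff, hj, hi]
        rw [this, Finset.card_erase_of_mem hi] at h'
        rw [Nat.not_odd_iff_even] at h h'
        have := Finset.card_pos.mpr ⟨i0, hi⟩
        obtain ⟨a, ha⟩ := h
        obtain ⟨b, hb⟩ := h'
        omega
      · have : symmDiff I {i0} = insert i0 I := by
          ext j; by_cases hj : j = i0 <;> simp [Finset.mem_symmDiff, hj, hi]
        rw [this, Finset.card_insert_of_notMem hi] at h'
        rw [Nat.not_odd_iff_even] at h h'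
        obtain ⟨a, ha⟩ := h
        obtain ⟨b, hb⟩ := h'
        omega
  have e : {I : Finset (Fin d) // Odd I.card} ≃ {I : Finset (Fin d) // ¬ Odd I.card} :=
    { toFun := fun I => ⟨symmDiff I.1 {i0}, fun h => (hflip _).mp h I.2⟩
      invFun := fun I => ⟨symmDiff I.1 {i0}, (hflip _).mpr I.2⟩
      left_inv := fun I => by simp
      right_inv := fun I => by simp }
  have h1 := Fintype.card_subtype_compl fun I : Finset (Fin d) => Odd I.card
  rw [← Fintype.card_congr e, Fintype.card_finset, Fintype.card_fin] at h1
  have h2 : Fintype.card {I : Finset (Fin d) // Odd I.card} ≤ 2 ^ d := by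
    have := Fintype.card_subtype_le fun I : Finset (Fin d) => Odd I.card
    simpa using this
  obtain ⟨m, rfl⟩ : ∃ m, d = m + 1 := ⟨d - 1, by omega⟩
  rw [pow_succ] at h1 h2
  simp only [Nat.add_sub_cancel]
  omega

/-- For even `d`, complements preserve oddness and flip the membership of `i0`, so that half of the odd
subsets contain it. -/
theorem card_odd_subsets_mem (hd : 2 ≤ d) (he : Even d) (i0 : Fin d) :
    Fintype.card {I : Finset (Fin d) // Odd I.card ∧ i0 ∈ I} = 2 ^ (d - 2) := by
  have hodd : ∀ I : Finset (Fin d), Odd I.card → Odd Iᶜ.card := by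
    intro I h
    rw [Finset.card_compl, Fintype.card_fin]
    exact Nat.Even.sub_odd ((Finset.card_le_univ I).trans (by simp)) he h
  have e : {I : Finset (Fin d) // Odd I.card ∧ i0 ∈ I} ⊕
      {I : Finset (Fin d) // Odd I.card ∧ i0 ∈ I} ≃ {I : Finset (Fin d) // Odd I.card} :=
    { toFun := Sum.elim (fun I => ⟨I.1, I.2.1⟩) fun I => ⟨I.1ᶜ, hodd _ I.2.1⟩
      invFun := fun I => if h : i0 ∈ I.1 then Sum.inl ⟨I.1, I.2, h⟩
        else Sum.inr ⟨I.1ᶜ, hodd _ I.2, by simpa using h⟩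
      left_inv := by rintro (I | I) <;> simp [I.2.2]
      right_inv := fun I => by by_cases h : i0 ∈ I.1 <;> simp [h] }
  have h1 := Fintype.card_congr e
  rw [Fintype.card_sum, card_odd_subsets (by omega)] at h1
  obtain ⟨m, rfl⟩ : ∃ m, d = m + 2 := ⟨d - 2, by omega⟩
  simp only [Nat.add_sub_cancel, show m + 2 - 1 = m + 1 by omega, pow_succ] at h1 ⊢
  omega

/-- For odd `d`, already the odd elements of the Clifford algebra span all endomorphisms of the spinor
module. -/
theorem span_rep_odd_eq_top [FiniteDimensional ℂ V] (hτ : IsEuclideanClifford τ) (hd : Odd d)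
    (hV : Module.finrank ℂ V = 2 ^ ((d - 1) / 2)) :
    Submodule.span ℂ (rep hτ '' (CliffordAlgebra.evenOdd (negForm d) 1 : Set (Cl d))) = ⊤ := by
  rw [eq_top_iff, ← span_eq_top_of_trace
    (fun I : {I : Finset (Fin d) // Odd I.card} => rep hτ (mon I.1)) ?_ ?_ ?_]
  · refine Submodule.span_mono ?_
    rintro _ ⟨I, rfl⟩
    exact ⟨mon I.1, odd_card_cast I.2 ▸ mon_mem_evenOdd I.1, rfl⟩
  · intro I J h
    refine trace_rep_mul hτ (trace_rep_mon_even hτ (symmDiff_ne_empty fun h' => h (Subtype.ext h'))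
      (symmDiff_card_even (I.2.add_odd J.2)))
  · exact fun I => trace_rep_mul_self_ne_zero hτ (by rw [hV]; positivity) _
  · rw [card_odd_subsets hd.pos, hV, ← pow_add]
    congr 1
    obtain ⟨m, rfl⟩ := hd
    omega

/-- For even `d`, the Clifford algebra spans all endomorphisms of the spinor module. -/
theorem span_rep_eq_top [FiniteDimensional ℂ V] (hτ : IsEuclideanClifford τ) (hd : Even d)
    (hV : Module.finrank ℂ V = 2 ^ (d / 2)) :
    Submodule.span ℂ (Set.range fun I => rep hτ (mon I)) = ⊤ := by
  refine span_eq_top_of_trace _ ?_ ?_ ?_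
  · intro I J h
    exact trace_rep_mul hτ (trace_rep_mon_of_even_dim hτ hd (symmDiff_ne_empty h))
  · exact fun I => trace_rep_mul_self_ne_zero hτ (by rw [hV]; positivity) _
  · rw [Fintype.card_finset, Fintype.card_fin, hV, ← pow_add]
    congr 1
    obtain ⟨m, rfl⟩ := hd
    omega

/-- In even dimensions the endomorphisms that anticommute with the volume element are the complex
combinations of odd elements. -/
theorem mem_span_rep_odd [FiniteDimensional ℂ V] (hτ : IsEuclideanClifford τ) (hd : Even d)
    (hV : Module.finrank ℂ V = 2 ^ (d / 2)) {x : Module.End ℂ V}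
    (hx : vol τ * x = -(x * vol τ)) :
    x ∈ Submodule.span ℂ (rep hτ '' (CliffordAlgebra.evenOdd (negForm d) 1 : Set (Cl d))) := by
  have hsplit : ∀ y : Module.End ℂ V, ∃ a b, y = a + b ∧ vol τ * a = a * vol τ ∧
      vol τ * b = -(b * vol τ) ∧
      b ∈ Submodule.span ℂ (rep hτ '' (CliffordAlgebra.evenOdd (negForm d) 1 : Set (Cl d))) := by
    intro y
    have hy : y ∈ Submodule.span ℂ (Set.range fun I => rep hτ (mon I)) := by
      rw [span_rep_eq_top hτ hd hV]; exact Submodule.mem_top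
    induction hy using Submodule.span_induction with
    | mem y hy =>
      obtain ⟨I, rfl⟩ := hy
      rcases Nat.even_or_odd I.card with h | h
      · exact ⟨rep hτ (mon I), 0, by simp,
          vol_mul_rep_even hτ (even_card_cast h ▸ mon_mem_evenOdd I), by simp,
          Submodule.zero_mem _⟩
      · have ho := odd_card_cast h ▸ mon_mem_evenOdd I
        refine ⟨0, rep hτ (mon I), by simp, by simp, ?_, Submodule.subset_span ⟨_, ho, rfl⟩⟩
        rw [vol_mul_rep_odd hτ ho]; simp [hd.neg_one_pow]
    | zero => exact ⟨0, 0, by simp, by simp, by simp, Submodule.zero_mem _⟩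
    | add y z _ _ hy hz =>
      obtain ⟨a, b, rfl, h1, h2, h3⟩ := hy
      obtain ⟨a', b', rfl, h1', h2', h3'⟩ := hz
      refine ⟨a + a', b + b', by abel, by simp [mul_add, add_mul, h1, h1'], ?_,
        Submodule.add_mem _ h3 h3'⟩
      rw [mul_add, add_mul, h2, h2', neg_add]
    | smul r y _ hy =>
      obtain ⟨a, b, rfl, h1, h2, h3⟩ := hy
      refine ⟨r • a, r • b, by simp, by simp [h1], by simp [h2], Submodule.smul_mem _ r h3⟩
  obtain ⟨a, b, rfl, ha, hb, hbm⟩ := hsplit x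
  rw [mul_add, add_mul, ha, hb, neg_add] at hx
  have hav : a * vol τ = 0 := eq_zero_of_eq_neg_self (add_right_cancel hx)
  have hu : vol τ * vol τ = 1 ∨ vol τ * vol τ = -1 := by
    rw [hτ.vol_sq]
    rcases neg_one_pow_eq_or (Module.End ℂ V) (d * (d - 1) / 2) with h | h <;>
      simp [h, hd.neg_one_pow]
  have ha0 : a = 0 := by
    have h0 : a * (vol τ * vol τ) = 0 := by rw [← mul_assoc, hav, zero_mul]
    rcases hu with h | h <;> simpa [h] using h0
  rw [ha0, zero_add]
  exact hbm

end Representation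

end Brane

/-! ### Antisymmetrised products and the Levi-Civita symbol -/

namespace Brane

section Antisymmetrisation

variable {V : Type*} [AddCommGroup V] [Module ℂ V]

theorem asym_eq_alternatization {k : ℕ} (a : Fin k → Module.End ℂ V) :
    asym a = ((k.factorial : ℂ)⁻¹) •
      MultilinearMap.alternatization (MultilinearMap.mkPiAlgebraFin ℂ k (Module.End ℂ V)) a := by
  rw [asym, MultilinearMap.alternatization_apply]
  congr 1
  refine Finset.sum_congr rfl fun π _ => ?_
  rw [MultilinearMap.domDomCongr_apply, MultilinearMap.mkPiAlgebraFin_apply, Units.smul_def,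
    Int.cast_smul_eq_zsmul]

theorem asym_smul {k : ℕ} (c : Fin k → ℂ) (a : Fin k → Module.End ℂ V) :
    asym (fun j => c j • a j) = (∏ j, c j) • asym a := by
  rw [asym_eq_alternatization, asym_eq_alternatization, smul_comm]
  exact congrArg _ (MultilinearMap.map_smul_univ
    (MultilinearMap.alternatization
      (MultilinearMap.mkPiAlgebraFin ℂ k (Module.End ℂ V))).toMultilinearMap c a)

theorem asym_eq_zero_of_eq {k : ℕ} {a : Fin k → Module.End ℂ V} {i j : Fin k} (h : a i = a j)
    (hij : i ≠ j) : asym a = 0 := by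
  rw [asym_eq_alternatization, AlternatingMap.map_eq_zero_of_eq _ _ h hij, smul_zero]

theorem prod_ofFn_swap {R : Type*} [Ring R] {n : ℕ} (a : Fin (n + 1) → R)
    (h : ∀ i j, i ≠ j → a i * a j = -(a j * a i)) (i : Fin n) :
    (List.ofFn fun j => a (Equiv.swap i.castSucc i.succ j)).prod = -(List.ofFn a).prod := by
  induction n with
  | zero => exact i.elim0
  | succ n ih =>
    induction i using Fin.cases with
    | zero =>
      have h2 : ∀ j : Fin n, Equiv.swap (0 : Fin (n + 2)) (Fin.succ 0) j.succ.succ = j.succ.succ :=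
        fun j => Equiv.swap_apply_of_ne_of_ne (Fin.succ_ne_zero _)
          (fun hh => Fin.succ_ne_zero _ (Fin.succ_injective _ hh))
      simp only [List.ofFn_succ, List.prod_cons, Fin.castSucc_zero, Equiv.swap_apply_left,
        Equiv.swap_apply_right, h2]
      rw [← mul_assoc, ← mul_assoc, h (Fin.succ 0) 0 (Fin.succ_ne_zero _), neg_mul]
    | succ i =>
      have h2 : ∀ j : Fin (n + 1), Equiv.swap i.succ.castSucc i.succ.succ j.succ =
          (Equiv.swap i.castSucc i.succ j).succ := fun j => by
        rw [← Fin.succ_castSucc]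
        simp only [Equiv.swap_apply_def, Fin.succ_inj]
        split_ifs <;> rfl
      have h0 : Equiv.swap i.succ.castSucc i.succ.succ 0 = 0 := by
        rw [← Fin.succ_castSucc]
        exact Equiv.swap_apply_of_ne_of_ne (Fin.succ_ne_zero _).symm (Fin.succ_ne_zero _).symm
      rw [List.ofFn_succ, List.prod_cons, List.ofFn_succ (f := a), List.prod_cons, h0]
      simp only [h2]
      rw [ih (fun j => a j.succ) (fun i j hij => h _ _ fun hh => hij (Fin.succ_injective _ hh)) i,
        mul_neg]

/-- A product of pairwise anticommuting elements changes by the sign of a permutation of the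
factors. -/
theorem prod_ofFn_perm {R : Type*} [Ring R] {n : ℕ} (π : Equiv.Perm (Fin n)) (a : Fin n → R)
    (h : ∀ i j, i ≠ j → a i * a j = -(a j * a i)) :
    (List.ofFn fun j => a (π j)).prod = ((Equiv.Perm.sign π : ℤ) : R) * (List.ofFn a).prod := by
  rcases n with _ | n
  · simp [Subsingleton.elim π 1]
  have hπ : π ∈ Submonoid.closure
      (Set.range fun i : Fin n => Equiv.swap i.castSucc i.succ) := by
    rw [Equiv.Perm.mclosure_swap_castSucc_succ]; trivial
  induction hπ using Submonoid.closure_induction generalizing a with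
  | mem π hπ =>
    obtain ⟨i, rfl⟩ := hπ
    rw [prod_ofFn_swap a h i, Equiv.Perm.sign_swap (by simp [Fin.ext_iff])]
    simp
  | one => simp
  | mul π σ _ _ hπ hσ =>
    have h2 := hσ (fun j => a (π j)) fun i j hij => h _ _ fun hh => hij (π.injective hh)
    simp only [Equiv.Perm.mul_apply] at h2 ⊢
    rw [h2, hπ a h, ← mul_assoc, Equiv.Perm.sign_mul]
    push_cast
    rw [(Int.cast_commute _ _).eq]

theorem asym_of_anticomm {k : ℕ} (a : Fin k → Module.End ℂ V)
    (h : ∀ i j, i ≠ j → a i * a j = -(a j * a i)) : asym a = (List.ofFn a).prod := by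
  rw [asym]
  have h2 : ∀ π : Equiv.Perm (Fin k), ((Equiv.Perm.sign π : ℤ) : ℂ) •
      (List.ofFn fun j => a (π j)).prod = (List.ofFn a).prod := fun π => by
    rw [prod_ofFn_perm π a h, Int.cast_smul_eq_zsmul, zsmul_eq_mul, ← mul_assoc, ← Int.cast_mul,
      ← Units.val_mul, Int.units_mul_self]
    simp
  simp only [h2, Finset.sum_const, Finset.card_univ, Fintype.card_perm, Fintype.card_fin]
  rw [← Nat.cast_smul_eq_nsmul ℂ, smul_smul, inv_mul_cancel₀ (by exact_mod_cast k.factorial_ne_zero),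
    one_smul]

theorem asym_pair (a b : Module.End ℂ V) : asym ![a, b] = (1 / 2 : ℂ) • (a * b - b * a) := by
  have hu : (Finset.univ : Finset (Equiv.Perm (Fin 2))) = {1, Equiv.swap 0 1} := by decide
  rw [asym, hu, Finset.sum_pair (by decide)]
  simp [Equiv.Perm.sign_swap, sub_eq_add_neg]

end Antisymmetrisation

section LeviCivita

theorem levi_eq_zero {d k : ℕ} {v : Fin k → Fin d} (h : ¬ Function.Injective v) : levi v = 0 := by
  simp only [Function.Injective, not_forall] at h
  obtain ⟨i, j, hij, hne⟩ := h
  wlog hlt : i < j generalizing i j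
  · exact this j i hij.symm (Ne.symm hne) (lt_of_le_of_ne (not_lt.mp hlt) (Ne.symm hne))
  refine Finset.prod_eq_zero (Finset.mem_univ i) (Finset.prod_eq_zero (Finset.mem_Ioi.mpr hlt) ?_)
  simp [hij]

theorem levi_perm {d : ℕ} (π : Equiv.Perm (Fin d)) : levi π = (Equiv.Perm.sign π : ℤ) := by
  rw [levi, Equiv.Perm.sign_eq_prod_prod_Ioi]
  push_cast
  refine Finset.prod_congr rfl fun i _ => Finset.prod_congr rfl fun j hj => ?_
  have hne : π i ≠ π j := fun h => (Finset.mem_Ioi.mp hj).ne (π.injective h)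
  rcases lt_or_gt_of_ne hne with h | h
  · rw [if_pos h, sign_pos (by have : (π i : ℕ) < π j := h
                               omega)]
    rfl
  · rw [if_neg h.not_gt, sign_neg (by have : (π j : ℕ) < π i := h
                                      omega)]
    rfl

theorem levi_mul_self {d : ℕ} {v : Fin d → Fin d} (h : Function.Injective v) :
    levi v * levi v = 1 := by
  obtain ⟨π, rfl⟩ : ∃ π : Equiv.Perm (Fin d), ⇑π = v :=
    ⟨Equiv.ofBijective v (Finite.injective_iff_bijective.mp h), rfl⟩
  rw [levi_perm, ← Units.val_mul, Int.units_mul_self]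
  rfl

/-- `γ_{v 1} ⋯ γ_{v d} = ε_{v 1 … v d} γ^{[d]}` for distinct indices. -/
theorem prod_ofFn_eq_levi {V : Type*} [AddCommGroup V] [Module ℂ V] {d : ℕ}
    {τ : Fin d → Module.End ℂ V} (h : ∀ i j, i ≠ j → τ i * τ j = -(τ j * τ i))
    {v : Fin d → Fin d} (hv : Function.Injective v) :
    (List.ofFn fun j => τ (v j)).prod = (levi v : ℂ) • vol τ := by
  obtain ⟨π, rfl⟩ : ∃ π : Equiv.Perm (Fin d), ⇑π = v :=
    ⟨Equiv.ofBijective v (Finite.injective_iff_bijective.mp hv), rfl⟩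
  rw [levi_perm, prod_ofFn_perm π τ h, vol, Int.cast_smul_eq_zsmul, zsmul_eq_mul]

open Classical in
theorem card_injective_avoiding {d k : ℕ} (s : Finset (Fin d)) :
    (Finset.univ.filter fun w : Fin k → Fin d =>
      Function.Injective w ∧ ∀ j, w j ∉ s).card = (d - s.card).descFactorial k := by
  rw [← Fintype.card_subtype]
  have e : {w : Fin k → Fin d // Function.Injective w ∧ ∀ j, w j ∉ s} ≃
      (Fin k ↪ {x : Fin d // x ∉ s}) :=
    { toFun := fun w => ⟨fun j => ⟨w.1 j, w.2.2 j⟩, fun i j h => w.2.1 (congrArg Subtype.val h)⟩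
      invFun := fun w => ⟨fun j => (w j).1,
        fun i j h => w.injective (Subtype.ext h), fun j => (w j).2⟩
      left_inv := fun w => rfl
      right_inv := fun w => rfl }
  rw [Fintype.card_congr e, Fintype.card_embedding_eq, Fintype.card_subtype_compl]
  simp

end LeviCivita

end Brane

/-! ### The explicit form of the connection -/

namespace Brane

section EpsilonSums

variable {V : Type*} [AddCommGroup V] [Module ℂ V] {m : ℕ}
  {τ : Fin (m + 2) → Module.End ℂ V}

/-- `∑_w ε_{w n} c_{[} γ_{w 1} ⋯ γ_{w (d-1)]}` for `c` anticommuting with the `γ_j`, `j ≠ n`: each of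
the `(d - 1)!` nonzero terms is `-c γ^{[d]} γ_n`. -/
theorem sum_levi_asym_cons (hs : ∀ i, τ i * τ i = -1)
    (ha : ∀ i j, i ≠ j → τ i * τ j = -(τ j * τ i)) (n : Fin (m + 2)) {c : Module.End ℂ V}
    (hc : ∀ j, j ≠ n → c * τ j = -(τ j * c)) :
    ∑ w : Fin (m + 1) → Fin (m + 2),
      ((levi (Fin.snoc w n : Fin (m + 1 + 1) → Fin (m + 2)) : ℤ) : ℂ) •
        asym (Fin.cons c (fun j => τ (w j)) : Fin (m + 1 + 1) → Module.End ℂ V) =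
      (-((m + 1).factorial : ℂ)) • (c * vol τ * τ n) := by
  classical
  have hterm : ∀ w : Fin (m + 1) → Fin (m + 2),
      ((levi (Fin.snoc w n : Fin (m + 1 + 1) → Fin (m + 2)) : ℤ) : ℂ) •
        asym (Fin.cons c (fun j => τ (w j)) : Fin (m + 1 + 1) → Module.End ℂ V) =
      if Function.Injective w ∧ ∀ j, w j ∉ ({n} : Finset (Fin (m + 2))) then
        -(c * vol τ * τ n) else 0 := by
    intro w
    have hiff : (Function.Injective w ∧ ∀ j, w j ∉ ({n} : Finset (Fin (m + 2)))) ↔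
        Function.Injective (Fin.snoc w n : Fin (m + 1 + 1) → Fin (m + 2)) := by
      rw [Fin.snoc_injective_iff]
      simp
    split_ifs with h
    · have hinj := hiff.mp h
      have h1 : asym (Fin.cons c (fun j => τ (w j)) : Fin (m + 1 + 1) → Module.End ℂ V) =
          c * (List.ofFn fun j => τ (w j)).prod := by
        rw [asym_of_anticomm, List.ofFn_succ, List.prod_cons]
        · rfl
        · have h0 : ∀ j, w j ≠ n := fun j => by simpa using h.2 j
          intro a b hab
          induction a using Fin.cases with
          | zero =>
            induction b using Fin.cases with
            | zero => exact absurd rfl hab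
            | succ b => exact hc _ (h0 b)
          | succ a =>
            induction b using Fin.cases with
            | zero => exact (neg_eq_iff_eq_neg.mpr (hc _ (h0 a))).symm
            | succ b => exact ha _ _ fun hh => hab (congrArg _ (h.1 hh))
      have h2 := prod_ofFn_eq_levi ha hinj
      rw [List.ofFn_succ', List.prod_concat] at h2
      simp only [Fin.snoc_castSucc, Fin.snoc_last] at h2
      have h3 : (List.ofFn fun j => τ (w j)).prod =
          (-(levi (Fin.snoc w n : Fin (m + 1 + 1) → Fin (m + 2)) : ℂ)) • (vol τ * τ n) := by
        have h4 := congrArg (· * τ n) h2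
        simp only [mul_assoc, hs, smul_mul_assoc, mul_neg, mul_one] at h4
        rw [neg_smul, ← h4, neg_neg]
      rw [h1, h3, mul_smul_comm, smul_smul, mul_neg, ← Int.cast_mul, levi_mul_self hinj]
      simp [mul_assoc]
    · rw [levi_eq_zero (fun hh => h (hiff.mpr hh))]
      simp
  rw [Finset.sum_congr rfl fun w _ => hterm w, ← Finset.sum_filter, Finset.sum_const,
    card_injective_avoiding]
  simp only [Finset.card_singleton]
  rw [show m + 2 - 1 = m + 1 from rfl, Nat.descFactorial_self, ← Nat.cast_smul_eq_nsmul ℂ,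
    smul_neg, neg_smul]

/-- For `n ≠ i` every injective `(w, n)` takes the value `i` inside `w`, so that two factors of the
antisymmetrised product agree. -/
theorem sum_levi_asym_cons_of_ne {n i : Fin (m + 2)} (hni : n ≠ i) :
    ∑ w : Fin (m + 1) → Fin (m + 2),
      ((levi (Fin.snoc w n : Fin (m + 1 + 1) → Fin (m + 2)) : ℤ) : ℂ) •
        asym (Fin.cons (τ i) (fun j => τ (w j)) : Fin (m + 1 + 1) → Module.End ℂ V) = 0 := by
  refine Finset.sum_eq_zero fun w _ => ?_
  by_cases h : Function.Injective (Fin.snoc w n : Fin (m + 1 + 1) → Fin (m + 2))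
  · obtain ⟨k, hk⟩ := Finite.injective_iff_surjective.mp h i
    induction k using Fin.lastCases with
    | last => exact absurd (by simpa using hk) hni
    | cast k =>
      rw [Fin.snoc_castSucc] at hk
      rw [asym_eq_zero_of_eq (i := 0) (j := k.succ) _ (Fin.succ_ne_zero k).symm, smul_zero]
      simp [hk]
  · rw [levi_eq_zero h]
    simp

/-- `∑_w ε_{i w n} γ_{w 1} ⋯ γ_{w (d-2)}` is `(d - 2)! γ_i γ^{[d]} γ_n` for `n ≠ i`, and zero for
`n = i`. -/
theorem sum_levi_cons_asym (hs : ∀ i, τ i * τ i = -1)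
    (ha : ∀ i j, i ≠ j → τ i * τ j = -(τ j * τ i)) (i n : Fin (m + 2)) :
    ∑ w : Fin m → Fin (m + 2),
      ((levi (Fin.snoc (Fin.cons i w : Fin (m + 1) → Fin (m + 2)) n :
        Fin (m + 1 + 1) → Fin (m + 2)) : ℤ) : ℂ) • asym (fun j => τ (w j)) =
      if n = i then 0 else (m.factorial : ℂ) • (τ i * vol τ * τ n) := by
  classical
  split_ifs with hni
  · refine Finset.sum_eq_zero fun w _ => ?_
    rw [levi_eq_zero]
    · simp
    · rw [Fin.snoc_injective_iff]
      exact fun h => h.2 ⟨0, by simp [hni]⟩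
  have hterm : ∀ w : Fin m → Fin (m + 2),
      ((levi (Fin.snoc (Fin.cons i w : Fin (m + 1) → Fin (m + 2)) n :
        Fin (m + 1 + 1) → Fin (m + 2)) : ℤ) : ℂ) • asym (fun j => τ (w j)) =
      if Function.Injective w ∧ ∀ j, w j ∉ ({n, i} : Finset (Fin (m + 2))) then
        τ i * vol τ * τ n else 0 := by
    intro w
    have hiff : (Function.Injective w ∧ ∀ j, w j ∉ ({n, i} : Finset (Fin (m + 2)))) ↔
        Function.Injective (Fin.snoc (Fin.cons i w : Fin (m + 1) → Fin (m + 2)) n :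
          Fin (m + 1 + 1) → Fin (m + 2)) := by
      rw [Fin.snoc_injective_iff, Fin.cons_injective_iff]
      simp only [Finset.mem_insert, Finset.mem_singleton, not_or, Set.mem_range, not_exists,
        Fin.forall_fin_succ, Fin.cons_zero, Fin.cons_succ]
      constructor
      · exact fun h => ⟨⟨fun j => (h.2 j).2, h.1⟩, Ne.symm hni, fun j => (h.2 j).1⟩
      · exact fun h => ⟨h.1.2, fun j => ⟨h.2.2 j, h.1.1 j⟩⟩
    split_ifs with h
    · have hinj := hiff.mp h
      have h1 : asym (fun j => τ (w j)) = (List.ofFn fun j => τ (w j)).prod :=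
        asym_of_anticomm _ fun a b hab => ha _ _ fun hh => hab (h.1 hh)
      have h2 := prod_ofFn_eq_levi ha hinj
      rw [List.ofFn_succ', List.prod_concat, List.ofFn_succ, List.prod_cons] at h2
      simp only [Fin.snoc_castSucc, Fin.snoc_last, Fin.cons_zero, Fin.cons_succ] at h2
      have h3 : (List.ofFn fun j => τ (w j)).prod =
          ((levi (Fin.snoc (Fin.cons i w : Fin (m + 1) → Fin (m + 2)) n :
            Fin (m + 1 + 1) → Fin (m + 2)) : ℤ) : ℂ) • (τ i * vol τ * τ n) := by
        have h4 := congrArg (fun z => τ i * (z * τ n)) h2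
        simp only [mul_assoc, hs, smul_mul_assoc, mul_smul_comm, mul_neg, mul_one] at h4
        rw [← mul_assoc, hs, neg_mul, one_mul, neg_neg] at h4
        rw [h4, mul_assoc]
      rw [h1, h3, smul_smul, ← Int.cast_mul, levi_mul_self hinj]
      simp
    · rw [levi_eq_zero (fun hh => h (hiff.mpr hh))]
      simp
  rw [Finset.sum_congr rfl fun w _ => hterm w, ← Finset.sum_filter, Finset.sum_const,
    card_injective_avoiding, Finset.card_pair hni]
  rw [show m + 2 - 2 = m from rfl, Nat.descFactorial_self, ← Nat.cast_smul_eq_nsmul ℂ]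

end EpsilonSums

namespace Data

variable {p d : ℕ} {S : Type*} [NormedAddCommGroup S] [NormedSpace ℂ S] {B : Data p d S}

theorem eta_mul_self (A : Idx p d) : eta A * eta A = 1 := by
  cases A <;> simp only [eta]
  · split_ifs <;> norm_num
  · norm_num

theorem eta_ne_zero (A : Idx p d) : eta A ≠ 0 := fun h => by
  have := eta_mul_self A; rw [h] at this; simp at this

namespace IsBrane

theorem anticomm (hB : B.IsBrane) {A E : Idx p d} (h : A ≠ E) : B.γ A * B.γ E = -(B.γ E * B.γ A) := by
  have := hB.clifford A E
  rw [if_neg h] at this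
  exact eq_neg_of_add_eq_zero_left this

theorem sq (hB : B.IsBrane) (A : Idx p d) : B.γ A * B.γ A = ((-eta A : ℝ) : ℂ) • 1 := by
  have h := hB.clifford A A
  rw [if_pos rfl, ← two_smul ℂ (B.γ A * B.γ A)] at h
  refine smul_right_injective _ (two_ne_zero (α := ℂ)) ?_
  dsimp only
  rw [h, smul_smul]
  push_cast
  ring_nf

theorem space (hB : B.IsBrane) : IsEuclideanClifford fun i => B.γ (Sum.inr i) := fun i j => by
  rw [hB.clifford]
  simp only [Sum.inr.injEq, eta]
  push_cast
  norm_num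

theorem scale_pos (hB : B.IsBrane) (A : Idx p d) (x : Pt p d) : 0 < B.scale A x := by
  cases A
  · exact hB.pos₁ _
  · exact hB.pos₂ _

theorem inv_metric (hB : B.IsBrane) (x : Pt p d) (A E : Idx p d) :
    (B.metric x)⁻¹ A E = if A = E then (eta A * B.scale A x ^ 2)⁻¹ else 0 := by
  have h : (B.metric x)⁻¹ = Matrix.diagonal fun A => (eta A * B.scale A x ^ 2)⁻¹ := by
    refine Matrix.inv_eq_left_inv ?_
    rw [metric, Matrix.diagonal_mul_diagonal, ← Matrix.diagonal_one]
    congr 1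
    funext A
    exact inv_mul_cancel₀ (mul_ne_zero (eta_ne_zero A) (pow_ne_zero _ (hB.scale_pos A x).ne'))
  rw [h, Matrix.diagonal_apply]

theorem gamUp_eq (hB : B.IsBrane) (A : Idx p d) (x : Pt p d) :
    B.gamUp A x = (((eta A * B.scale A x)⁻¹ : ℝ) : ℂ) • B.γ A := by
  rw [gamUp, Finset.sum_eq_single A]
  · rw [hB.inv_metric, if_pos rfl, gamLow, smul_smul, ← Complex.ofReal_mul]
    congr 2
    have := (hB.scale_pos A x).ne'
    have := eta_ne_zero A
    field_simp
  · intro E _ hE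
    rw [hB.inv_metric, if_neg (Ne.symm hE)]
    simp
  · simp

end IsBrane

/-- The partial derivative `∂_A` of the scale factor `f_C`. -/
noncomputable def dscale (B : Data p d S) (A C : Idx p d) (x : Pt p d) : ℝ :=
  fderiv ℝ (B.scale C) x (Pi.single A 1)

/-- The projection `x ↦ y` as a continuous linear map. -/
noncomputable def yproj (p d : ℕ) : Pt p d →L[ℝ] (Fin d → ℝ) :=
  ContinuousLinearMap.pi fun i => ContinuousLinearMap.proj (Sum.inr i)

theorem yproj_single_inl (μ : Fin (p + 1)) : yproj p d (Pi.single (Sum.inl μ) 1) = 0 := by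
  funext i
  simp [yproj]

theorem yproj_single_inr (i : Fin d) : yproj p d (Pi.single (Sum.inr i) 1) = Pi.single i 1 := by
  funext j
  simp only [yproj, ContinuousLinearMap.coe_pi', ContinuousLinearMap.proj_apply, Pi.single_apply,
    Sum.inr.injEq]

theorem fderiv_comp_ypart {E : Type*} [NormedAddCommGroup E] [NormedSpace ℝ E]
    {h : (Fin d → ℝ) → E} {x : Pt p d} (hh : DifferentiableAt ℝ h (ypart x)) (w : Pt p d) :
    fderiv ℝ (fun z : Pt p d => h (ypart z)) x w = fderiv ℝ h (ypart x) (yproj p d w) := by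
  have h1 : HasFDerivAt (fun z : Pt p d => h (yproj p d z))
      ((fderiv ℝ h (ypart x)).comp (yproj p d)) x :=
    HasFDerivAt.comp x (f := yproj p d) hh.hasFDerivAt (yproj p d).hasFDerivAt
  exact congrArg (fun L => L w) h1.fderiv

theorem fderiv_ypart_inl {E : Type*} [NormedAddCommGroup E] [NormedSpace ℝ E]
    {h : (Fin d → ℝ) → E} {x : Pt p d} (hh : DifferentiableAt ℝ h (ypart x)) (μ : Fin (p + 1)) :
    fderiv ℝ (fun z : Pt p d => h (ypart z)) x (Pi.single (Sum.inl μ) 1) = 0 := by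
  rw [fderiv_comp_ypart hh, yproj_single_inl, map_zero]

theorem fderiv_ypart_inr {h : (Fin d → ℝ) → ℝ} {x : Pt p d}
    (hh : DifferentiableAt ℝ h (ypart x)) (i : Fin d) :
    fderiv ℝ (fun z : Pt p d => h (ypart z)) x (Pi.single (Sum.inr i) 1) = pd i h (ypart x) := by
  rw [fderiv_comp_ypart hh, yproj_single_inr, pd]

namespace IsBrane

theorem differentiable_scale (hB : B.IsBrane) (A : Idx p d) : Differentiable ℝ (B.scale A) := by
  cases A with
  | inl μ => exact (hB.smooth₁.differentiable (by simp)).comp (yproj p d).differentiable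
  | inr i => exact (hB.smooth₂.differentiable (by simp)).comp (yproj p d).differentiable

theorem dscale_inl (hB : B.IsBrane) (μ : Fin (p + 1)) (C : Idx p d) (x : Pt p d) :
    B.dscale (Sum.inl μ) C x = 0 := by
  cases C with
  | inl ν => exact fderiv_ypart_inl (hB.smooth₁.differentiable (by simp) _) μ
  | inr i => exact fderiv_ypart_inl (hB.smooth₂.differentiable (by simp) _) μ

theorem dmetric_eq (hB : B.IsBrane) (A C E : Idx p d) (x : Pt p d) :
    B.dmetric A C E x = if C = E then eta C * (2 * B.scale C x * B.dscale A C x) else 0 := by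
  rw [dmetric]
  split_ifs with h
  · subst h
    have h1 : (fun z => B.metric z C C) = fun z => eta C * B.scale C z ^ 2 := by
      funext z; rw [metric, Matrix.diagonal_apply_eq]
    have h2 := (hB.differentiable_scale C x).hasFDerivAt
    rw [h1, ((h2.pow 2).const_mul (eta C)).fderiv]
    simp [dscale]
  · have h1 : (fun z => B.metric z C E) = fun _ => 0 := by
      funext z; rw [metric, Matrix.diagonal_apply_ne _ h]
    rw [h1]
    simp

theorem pd_log {h : (Fin d → ℝ) → ℝ} {y : Fin d → ℝ} (hh : DifferentiableAt ℝ h y) (hy : h y ≠ 0)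
    (i : Fin d) : pd i (fun z => Real.log (h z)) y = pd i h y / h y := by
  rw [pd, (hh.hasFDerivAt.log hy).fderiv, pd]
  simp [div_eq_inv_mul]

theorem X_eq (hB : B.IsBrane) (i : Fin d) (y : Fin d → ℝ) :
    B.X i y = pd i B.f₁ y / B.f₂ y := by
  rw [X, pd_log (hB.smooth₁.differentiable (by simp) _) (hB.pos₁ y).ne', div_mul_cancel₀ _
    (hB.pos₁ y).ne', div_eq_mul_inv]

theorem Y_eq (hB : B.IsBrane) (i : Fin d) (y : Fin d → ℝ) :
    B.Y i y = pd i B.f₂ y / B.f₂ y :=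
  pd_log (hB.smooth₂.differentiable (by simp) _) (hB.pos₂ y).ne' _

theorem asym_gamUp (hB : B.IsBrane) (A E : Idx p d) (x : Pt p d) :
    asym ![B.gamUp A x, B.gamUp E x] =
      (((eta A * B.scale A x)⁻¹ * (eta E * B.scale E x)⁻¹ : ℝ) : ℂ) • asym ![B.γ A, B.γ E] := by
  rw [hB.gamUp_eq, hB.gamUp_eq, asym_pair, asym_pair]
  simp only [smul_mul_smul_comm]
  rw [mul_comm (((eta E * B.scale E x)⁻¹ : ℝ) : ℂ), ← smul_sub, smul_comm]
  push_cast
  rfl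

/-- The Levi-Civita connection of a diagonal metric: `∇_A = ∂_A - ½ ∑_k (∂_k f_A) f₂⁻¹ γ_{A k}`, in
terms of the orthonormal gamma matrices. -/
theorem spinLC_eq (hB : B.IsBrane) (A : Idx p d) (x : Pt p d) :
    B.spinLC A x = (-(1 / 2) : ℂ) • ∑ k : Fin d,
      ((B.dscale (Sum.inr k) A x / B.f₂ (ypart x) : ℝ) : ℂ) •
        asym ![B.γ A, B.γ (Sum.inr k)] := by
  set G : Idx p d → Idx p d → Module.End ℂ S := fun C E => asym ![B.gamUp C x, B.gamUp E x] with hG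
  have hanti : ∀ C E, G C E = -G E C := fun C E => by
    simp only [hG, asym_pair]; rw [← smul_neg, neg_sub]
  have hself : ∀ C, G C C = 0 := fun C => by simp [hG, asym_pair]
  -- only the terms with `C = A` or `E = A` survive the antisymmetrisation
  have h1 : ∑ C, ∑ E, ((B.christoffelLow A C E x : ℝ) : ℂ) • G C E =
      (2 : ℂ) • ∑ E, ((eta A * B.scale A x * B.dscale E A x : ℝ) : ℂ) • G A E := by
    have ht : ∀ C E, ((B.christoffelLow A C E x : ℝ) : ℂ) • G C E =
        (if C = A then ((eta A * B.scale A x * B.dscale E A x : ℝ) : ℂ) • G A E else 0) +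
        (if E = A then ((eta A * B.scale A x * B.dscale C A x : ℝ) : ℂ) • G A C else 0) := by
      intro C E
      rw [christoffelLow, hB.dmetric_eq, hB.dmetric_eq, hB.dmetric_eq]
      by_cases hCE : C = E
      · subst hCE
        rw [hself]
        by_cases hC : C = A
        · subst hC; simp [hself]
        · simp [hC]
      · by_cases hC : C = A
        · subst hC
          simp only [if_neg hCE, if_pos, if_neg (Ne.symm hCE)]
          rw [add_zero]
          congr 2
          ring
        · by_cases hE : E = A
          · subst hE
            simp only [if_neg hCE, if_pos]
            rw [hanti C E]
            push_cast
            module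
          · simp [hCE, hC, hE, Ne.symm hE]
    simp only [ht, Finset.sum_add_distrib]
    rw [Finset.sum_comm]
    simp only [Finset.sum_ite_eq', Finset.mem_univ, if_true]
    rw [two_smul]
  rw [spinLC, h1, smul_smul, Fintype.sum_sum_type]
  simp only [hB.dscale_inl, mul_zero, Complex.ofReal_zero, zero_smul, zero_mul,
    Finset.sum_const_zero, zero_add, hG, hB.asym_gamUp, smul_smul]
  congr 1
  · norm_num
  refine Finset.sum_congr rfl fun k _ => ?_
  rw [← Complex.ofReal_mul]
  congr 2
  have h2 := (hB.scale_pos A x).ne'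
  have h3 := (hB.pos₂ (ypart x)).ne'
  have h4 := eta_ne_zero A
  rw [show eta (Sum.inr k : Idx p d) = 1 from rfl, show B.scale (Sum.inr k) x = B.f₂ (ypart x) from rfl]
  field_simp

theorem spinLC_inl (hB : B.IsBrane) (μ : Fin (p + 1)) (x : Pt p d) :
    B.spinLC (Sum.inl μ) x = (-(1 / 2) : ℂ) • ∑ k : Fin d, ((B.X k (ypart x) : ℝ) : ℂ) •
        asym ![B.γ (Sum.inl μ), B.γ (Sum.inr k)] := by
  rw [hB.spinLC_eq]
  simp only [hB.X_eq]
  have : ∀ k, B.dscale (Sum.inr k) (Sum.inl μ) x = pd k B.f₁ (ypart x) := fun k =>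
    fderiv_ypart_inr (hB.smooth₁.differentiable (by simp) _) k
  simp only [this]

theorem spinLC_inr (hB : B.IsBrane) (i : Fin d) (x : Pt p d) :
    B.spinLC (Sum.inr i) x = (-(1 / 2) : ℂ) • ∑ k : Fin d, ((B.Y k (ypart x) : ℝ) : ℂ) •
        asym ![B.γ (Sum.inr i), B.γ (Sum.inr k)] := by
  rw [hB.spinLC_eq]
  simp only [hB.Y_eq]
  have : ∀ k, B.dscale (Sum.inr k) (Sum.inr i) x = pd k B.f₂ (ypart x) := fun k =>
    fderiv_ypart_inr (hB.smooth₂.differentiable (by simp) _) k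
  simp only [this]

theorem mul_gvol (hB : B.IsBrane) (i : Fin d) :
    B.gvol * B.γ (Sum.inr i) = (-(-1) ^ d : ℂ) • (B.γ (Sum.inr i) * B.gvol) := by
  have h := hB.space.mul_vol i
  rw [gvol, h]
  rcases Nat.even_or_odd d with hd | hd <;> simp [hd.neg_one_pow]

end IsBrane

theorem magneticForm_inr {k : ℕ} (w : Fin k → Fin d) (x : Pt p d) :
    B.magneticForm (fun j => Sum.inr (w j)) x =
      ∑ n, ((levi (Fin.snoc w n : Fin (k + 1) → Fin d) : ℤ) : ℝ) * pd n B.f (ypart x) := by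
  rw [magneticForm, Finset.sum_eq_single w]
  · simp
  · intro w' _ hw
    refine if_neg fun h => hw ?_
    funext j
    exact (Sum.inr_injective (congrFun h j)).symm
  · simp

theorem magneticForm_of_ne {k : ℕ} {m : Fin k → Idx p d}
    (h : ∀ w : Fin k → Fin d, m ≠ fun j => Sum.inr (w j)) (x : Pt p d) :
    B.magneticForm m x = 0 :=
  Finset.sum_eq_zero fun w _ => if_neg (h w)

theorem inr_comp_injective {k : ℕ} :
    Function.Injective fun (w : Fin k → Fin d) (j : Fin k) => (Sum.inr (w j) : Idx p d) :=
  fun _ _ h => funext fun j => Sum.inr_injective (congrFun h j)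

namespace IsBrane

/-- The second term of the potential, reduced to sums over the directions of `ℝ^d`. -/
theorem sum_magneticForm_asym_cons (hB : B.IsBrane) {k : ℕ} (A : Idx p d) (x : Pt p d) :
    ∑ m : Fin k → Idx p d, ((B.magneticForm m x : ℝ) : ℂ) •
        asym (Fin.cons (B.gamLow A x) (fun j => B.gamUp (m j) x) :
          Fin (k + 1) → Module.End ℂ S) =
      ∑ n, ((B.scale A x * (B.f₂ (ypart x))⁻¹ ^ k * pd n B.f (ypart x) : ℝ) : ℂ) •
        ∑ w : Fin k → Fin d, ((levi (Fin.snoc w n : Fin (k + 1) → Fin d) : ℤ) : ℂ) •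
          asym (Fin.cons (B.γ A) (fun j => B.γ (Sum.inr (w j))) :
            Fin (k + 1) → Module.End ℂ S) := by
  have hasym : ∀ w : Fin k → Fin d,
      asym (Fin.cons (B.gamLow A x) (fun j => B.gamUp (Sum.inr (w j)) x) :
          Fin (k + 1) → Module.End ℂ S) =
        ((B.scale A x * (B.f₂ (ypart x))⁻¹ ^ k : ℝ) : ℂ) •
          asym (Fin.cons (B.γ A) (fun j => B.γ (Sum.inr (w j))) :
            Fin (k + 1) → Module.End ℂ S) := by
    intro w
    have h1 : (Fin.cons (B.gamLow A x) (fun j => B.gamUp (Sum.inr (w j)) x) :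
          Fin (k + 1) → Module.End ℂ S) = fun j =>
        (Fin.cons ((B.scale A x : ℝ) : ℂ) (fun _ => (((B.f₂ (ypart x))⁻¹ : ℝ) : ℂ)) :
          Fin (k + 1) → ℂ) j •
        (Fin.cons (B.γ A) (fun j => B.γ (Sum.inr (w j))) : Fin (k + 1) → Module.End ℂ S) j := by
      funext j
      induction j using Fin.cases with
      | zero => rfl
      | succ j =>
        simp only [Fin.cons_succ]
        rw [hB.gamUp_eq]
        simp [eta, scale]
    rw [h1, asym_smul, Fin.prod_univ_succ]
    simp
  rw [← Fintype.sum_of_injective _ inr_comp_injective (fun w : Fin k → Fin d =>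
    ((B.magneticForm (fun j => Sum.inr (w j)) x : ℝ) : ℂ) •
        asym (Fin.cons (B.gamLow A x) (fun j => B.gamUp (Sum.inr (w j)) x) :
          Fin (k + 1) → Module.End ℂ S))]
  · simp only [magneticForm_inr, hasym, Finset.smul_sum, Complex.ofReal_sum, Finset.sum_smul]
    rw [Finset.sum_comm]
    refine Finset.sum_congr rfl fun n _ => Finset.sum_congr rfl fun w _ => ?_
    rw [smul_smul, smul_smul]
    congr 1
    push_cast
    ring
  · intro m hm
    rw [magneticForm_of_ne fun w hw => hm ⟨w, hw.symm⟩]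
    simp
  · intro w; rfl

/-- The first term of the potential in the directions of `ℝ^d`. -/
theorem sum_magneticForm_cons_asym (hB : B.IsBrane) {k : ℕ} (i : Fin d) (x : Pt p d) :
    ∑ m : Fin k → Idx p d,
      ((B.magneticForm (Fin.cons (Sum.inr i) m : Fin (k + 1) → Idx p d) x : ℝ) : ℂ) •
        asym (fun j => B.gamUp (m j) x) =
      ∑ n, (((B.f₂ (ypart x))⁻¹ ^ k * pd n B.f (ypart x) : ℝ) : ℂ) •
        ∑ w : Fin k → Fin d, ((levi (Fin.snoc (Fin.cons i w : Fin (k + 1) → Fin d) n :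
          Fin (k + 1 + 1) → Fin d) : ℤ) : ℂ) • asym (fun j => B.γ (Sum.inr (w j))) := by
  have hasym : ∀ w : Fin k → Fin d,
      asym (fun j => B.gamUp (Sum.inr (w j)) x) =
        (((B.f₂ (ypart x))⁻¹ ^ k : ℝ) : ℂ) • asym (fun j => B.γ (Sum.inr (w j))) := by
    intro w
    have h1 : (fun j => B.gamUp (Sum.inr (w j)) x) = fun j =>
        (fun _ => (((B.f₂ (ypart x))⁻¹ : ℝ) : ℂ)) j • (fun j => B.γ (Sum.inr (w j))) j := by
      funext j
      rw [hB.gamUp_eq]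
      simp [eta, scale]
    rw [h1, asym_smul]
    simp
  have hcons : ∀ w : Fin k → Fin d,
      (Fin.cons (Sum.inr i) (fun j => Sum.inr (w j)) : Fin (k + 1) → Idx p d) =
        fun j => Sum.inr ((Fin.cons i w : Fin (k + 1) → Fin d) j) := fun w => by
    funext j
    induction j using Fin.cases <;> rfl
  rw [← Fintype.sum_of_injective _ inr_comp_injective (fun w : Fin k → Fin d =>
    ((B.magneticForm (Fin.cons (Sum.inr i) (fun j => Sum.inr (w j)) :
      Fin (k + 1) → Idx p d) x : ℝ) : ℂ) • asym (fun j => B.gamUp (Sum.inr (w j)) x))]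
  · simp only [hcons, magneticForm_inr, hasym, Finset.smul_sum, Complex.ofReal_sum,
      Finset.sum_smul]
    rw [Finset.sum_comm]
    refine Finset.sum_congr rfl fun n _ => Finset.sum_congr rfl fun w _ => ?_
    rw [smul_smul, smul_smul]
    congr 1
    push_cast
    ring
  · intro m hm
    rw [magneticForm_of_ne]
    · simp
    · intro w hw
      refine hm ⟨fun j => w j.succ, funext fun j => ?_⟩
      exact (congrFun hw j.succ).symm
  · intro w; rfl

theorem magneticForm_cons_inl {k : ℕ} (μ : Fin (p + 1)) (m : Fin k → Idx p d) (x : Pt p d) :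
    B.magneticForm (Fin.cons (Sum.inl μ) m : Fin (k + 1) → Idx p d) x = 0 :=
  magneticForm_of_ne (fun w hw => by
    have := congrFun hw 0
    simp at this) x

theorem eps_ne_zero (hB : B.IsBrane) : B.ε ≠ 0 := by
  rcases hB.eps with h | h <;> rw [h]
  · exact one_ne_zero
  · exact Complex.I_ne_zero

theorem unit_sq (s : ℤˣ) : ((s : ℤ) : ℂ) * ((s : ℤ) : ℂ) = 1 := by
  rw [← Int.cast_mul, ← Units.val_mul, Int.units_mul_self]
  simp

/-- The potential along `ℝ^{p+1}`. Only the term with `β` contributes, and the first compatibility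
condition turns its coefficient into `½ δ₁ ε X`. -/
theorem negAC_inl (hB : B.IsBrane) (μ : Fin (p + 1)) (x : Pt p d) :
    B.negAC (Sum.inl μ) x = ((B.δ₁ : ℤ) * B.ε / 2 : ℂ) • ∑ i,
      ((B.X i (ypart x) : ℝ) : ℂ) • (B.γ (Sum.inl μ) * B.γ (Sum.inr i) * B.gvol) := by
  rw [negAC]
  simp only [magneticForm_cons_inl, Complex.ofReal_zero, zero_smul, Finset.sum_const_zero,
    smul_zero, zero_add]
  rw [hB.sum_magneticForm_asym_cons]
  obtain ⟨m, rfl⟩ : ∃ m, d = m + 2 := ⟨d - 2, by have := hB.two_le; omega⟩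
  have hs := hB.space
  have key := fun n => sum_levi_asym_cons (m := m) (τ := fun i => B.γ (Sum.inr i))
    (fun i => hs.sq i) (fun i j hij => hs.anticomm hij) n (c := B.γ (Sum.inl μ))
    (fun j _ => hB.anticomm (by simp))
  rw [Finset.smul_sum, Finset.smul_sum]
  refine Finset.sum_congr rfl fun n _ => ?_
  rw [show m + 2 - 1 = m + 1 from rfl, key n, mul_assoc (B.γ _), mul_assoc (B.γ _)]
  have h1 : vol (fun i => B.γ (Sum.inr i)) * B.γ (Sum.inr n) = _ := hB.mul_gvol n
  rw [h1, mul_smul_comm, smul_smul, smul_smul, smul_smul, smul_smul]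
  congr 1
  rw [hB.choice₁]
  have hε := hB.eps_ne_zero
  have hδ := unit_sq B.δ₁
  have hz : B.f₂ (ypart x) ^ (1 - ((m + 2 : ℕ) : ℤ)) = (B.f₂ (ypart x))⁻¹ ^ (m + 1) := by
    rw [inv_pow, ← zpow_natCast, ← zpow_neg]
    congr 1
  rw [hz, show m + 2 - 1 = m + 1 from rfl]
  push_cast
  simp only [scale]
  field_simp
  linear_combination (-((m + 1).factorial : ℂ) * (pd n B.f (ypart x) : ℂ) * B.β *
    (B.f₁ (ypart x) : ℂ) * (B.f₂ (ypart x) : ℂ)⁻¹ ^ (m + 1)) * hδ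

/-- The potential along `ℝ^d`. The second compatibility condition turns the term with `α` into
`½ δ₁ ε Y_j γ_{ij} γ^{[d]}`; of the term with `β` only the summand `n = i` survives, a multiple of
`γ^{[d]}`. -/
theorem negAC_inr (hB : B.IsBrane) (i : Fin d) (x : Pt p d) :
    B.negAC (Sum.inr i) x = ((B.δ₁ : ℤ) * B.ε / 2 : ℂ) • ∑ j,
      ((B.Y j (ypart x) : ℝ) : ℂ) •
        (asym ![B.γ (Sum.inr i), B.γ (Sum.inr j)] * B.gvol) +
      (((B.δ₂ : ℤ) : ℂ) * B.ε * (((d : ℂ) - 1) * B.β / (2 * B.α)) *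
          ((B.Y i (ypart x) : ℝ) : ℂ)) • B.gvol := by
  rw [negAC, hB.sum_magneticForm_asym_cons, hB.sum_magneticForm_cons_asym]
  obtain ⟨m, rfl⟩ : ∃ m, d = m + 2 := ⟨d - 2, by have := hB.two_le; omega⟩
  have hs := hB.space
  have hε := hB.eps_ne_zero
  have hα := hB.α_ne
  have hδ := unit_sq B.δ₂
  have hz : B.f₂ (ypart x) ^ (2 - ((m + 2 : ℕ) : ℤ)) = (B.f₂ (ypart x))⁻¹ ^ m := by
    rw [inv_pow, ← zpow_natCast, ← zpow_neg]
    congr 1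
    push_cast
    ring
  have hY := fun n => hB.choice₂ n (ypart x)
  rw [hz, show m + 2 - 2 = m from rfl] at hY
  have h1 : ∀ n, vol (fun i => B.γ (Sum.inr i)) * B.γ (Sum.inr n) = _ := hB.mul_gvol
  congr 1
  · rw [Finset.smul_sum, Finset.smul_sum]
    refine Finset.sum_congr rfl fun n _ => ?_
    rw [show m + 2 - 2 = m from rfl, sum_levi_cons_asym (m := m) (τ := fun i => B.γ (Sum.inr i))
      (fun i => hs.sq i) (fun i j hij => hs.anticomm hij) i n]
    split_ifs with hn
    · subst hn
      simp [asym_pair]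
    · have h2 : asym ![B.γ (Sum.inr i), B.γ (Sum.inr n)] = B.γ (Sum.inr i) * B.γ (Sum.inr n) := by
        rw [asym_of_anticomm]
        · simp
        · have h3 := hB.anticomm (A := Sum.inr i) (E := Sum.inr n) (by simpa using Ne.symm hn)
          intro a b hab
          fin_cases a <;> fin_cases b <;> simp_all
      rw [h2, mul_assoc (B.γ _), mul_assoc (B.γ _), h1, mul_smul_comm, smul_smul, smul_smul,
        smul_smul, smul_smul, hY]
      congr 1
      rw [hB.signs]
      push_cast
      field_simp
      linear_combination ((m.factorial : ℂ) * (pd n B.f (ypart x) : ℂ) *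
        (B.f₂ (ypart x) : ℂ)⁻¹ ^ m) * hδ
  · rw [Finset.sum_eq_single i]
    · rw [show m + 2 - 1 = m + 1 from rfl, sum_levi_asym_cons (m := m)
        (τ := fun i => B.γ (Sum.inr i)) (fun i => hs.sq i) (fun i j hij => hs.anticomm hij) i
        (fun j hj => hs.anticomm (Ne.symm hj)), mul_assoc (B.γ _), h1, mul_smul_comm, ← mul_assoc,
        hB.sq, hY, smul_mul_assoc, one_mul]
      simp only [smul_smul]
      congr 1
      have hf : (B.f₂ (ypart x) : ℂ) ≠ 0 := by exact_mod_cast (hB.pos₂ _).ne'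
      rw [Nat.factorial_succ]
      push_cast
      simp only [scale, eta]
      push_cast
      field_simp
      linear_combination (((m : ℂ) + 1) * (m.factorial : ℂ) * (pd i B.f (ypart x) : ℂ) *
        B.β * (B.f₂ (ypart x) : ℂ)⁻¹ ^ m) * (hδ - mul_inv_cancel₀ hf)
    · intro n _ hn
      rw [show m + 2 - 1 = m + 1 from rfl, sum_levi_asym_cons_of_ne (m := m)
        (τ := fun i => B.γ (Sum.inr i)) hn, smul_zero]
    · simp

theorem asym_inl_inr (hB : B.IsBrane) (μ : Fin (p + 1)) (i : Fin d) :
    asym ![B.γ (Sum.inl μ), B.γ (Sum.inr i)] = B.γ (Sum.inl μ) * B.γ (Sum.inr i) := by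
  rw [asym_pair, hB.anticomm (A := Sum.inr i) (by simp)]
  module

/-- The Levi-Civita part `-½ X_i γ_{μ i}` and the potential `½ δ₁ ε X_i γ_{μ i} γ^{[d]}` combine to
`-X_i γ_{μ i} Π`. -/
theorem connC_inl (hB : B.IsBrane) (μ : Fin (p + 1)) (x : Pt p d) :
    B.connC (Sum.inl μ) x = -∑ i, ((B.X i (ypart x) : ℝ) : ℂ) •
      (asym ![B.γ (Sum.inl μ), B.γ (Sum.inr i)] * B.proj) := by
  rw [connC, hB.spinLC_inl, hB.negAC_inl, Finset.smul_sum, Finset.smul_sum,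
    ← Finset.sum_add_distrib, ← Finset.sum_neg_distrib]
  refine Finset.sum_congr rfl fun i _ => ?_
  rw [proj, hB.asym_inl_inr, mul_smul_comm, mul_sub, mul_one, mul_smul_comm]
  module

theorem connC_inr (hB : B.IsBrane) (i : Fin d) (x : Pt p d) :
    B.connC (Sum.inr i) x = -∑ j, ((B.Y j (ypart x) : ℝ) : ℂ) •
        (asym ![B.γ (Sum.inr i), B.γ (Sum.inr j)] * B.proj) +
      (((B.δ₂ : ℤ) : ℂ) * B.ε * (((d : ℂ) - 1) * B.β / (2 * B.α)) *
        ((B.Y i (ypart x) : ℝ) : ℂ)) • B.gvol := by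
  rw [connC, hB.spinLC_inr, hB.negAC_inr, ← add_assoc, Finset.smul_sum, Finset.smul_sum,
    ← Finset.sum_add_distrib, ← Finset.sum_neg_distrib]
  congr 1
  refine Finset.sum_congr rfl fun j _ => ?_
  rw [proj, mul_smul_comm, mul_sub, mul_one, mul_smul_comm]
  module

end IsBrane

end Data

end Brane

/-! ### Adjoints with respect to the charge conjugation -/

namespace Brane

namespace Data

variable {p d : ℕ} {S : Type*} [NormedAddCommGroup S] [NormedSpace ℂ S] {B : Data p d S}

namespace IsBrane

theorem gvol_mul_inl (hB : B.IsBrane) (μ : Fin (p + 1)) :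
    B.gvol * B.γ (Sum.inl μ) = ((-1) ^ d : ℂ) • (B.γ (Sum.inl μ) * B.gvol) := by
  rw [gvol, vol, prod_ofFn_mul_of_anticomm fun i => hB.anticomm (by simp)]
  rcases Nat.even_or_odd d with hd | hd <;> simp [hd.neg_one_pow]

theorem sign_sq (d : ℕ) : ((-1) ^ d : ℂ) * (-1) ^ d = 1 := by
  rw [← mul_pow]; simp

theorem gvol_sandwich (hB : B.IsBrane) {x : Module.End ℂ S} {i : Fin d} (μ : Fin (p + 1))
    (hx : x = B.γ (Sum.inl μ) * B.γ (Sum.inr i)) : B.gvol * x = -(x * B.gvol) := by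
  rw [hx, ← mul_assoc, hB.gvol_mul_inl, smul_mul_assoc, mul_assoc, hB.mul_gvol, mul_smul_comm,
    smul_smul, mul_neg, sign_sq, neg_one_smul, mul_assoc]

theorem gvol_mul_pair (hB : B.IsBrane) (i j : Fin d) :
    B.gvol * asym ![B.γ (Sum.inr i), B.γ (Sum.inr j)] =
      asym ![B.γ (Sum.inr i), B.γ (Sum.inr j)] * B.gvol := by
  have h : ∀ i j, B.gvol * (B.γ (Sum.inr i) * B.γ (Sum.inr j)) =
      B.γ (Sum.inr i) * B.γ (Sum.inr j) * B.gvol := fun i j => by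
    rw [← mul_assoc, hB.mul_gvol, smul_mul_assoc, mul_assoc, hB.mul_gvol, mul_smul_comm,
      smul_smul, neg_mul_neg, sign_sq, one_smul, mul_assoc]
  rw [asym_pair, mul_smul_comm, smul_mul_assoc, mul_sub, sub_mul, h, h]

/-- The commutators `[γ_{AG}, γ_E]`: bivectors act on vectors by infinitesimal rotations. -/
theorem asym_pair_comm (hB : B.IsBrane) (A G E : Idx p d) :
    asym ![B.γ A, B.γ G] * B.γ E - B.γ E * asym ![B.γ A, B.γ G] =
      (if G = E then ((-2 * eta G : ℝ) : ℂ) • B.γ A else 0) -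
        if A = E then ((-2 * eta A : ℝ) : ℂ) • B.γ G else 0 := by
  have h : ∀ A G, B.γ A * B.γ G * B.γ E - B.γ E * (B.γ A * B.γ G) =
      (if G = E then ((-2 * eta G : ℝ) : ℂ) • B.γ A else 0) -
        if A = E then ((-2 * eta A : ℝ) : ℂ) • B.γ G else 0 := fun A G => by
    have h1 := congrArg (B.γ A * ·) (hB.clifford G E)
    have h2 := congrArg (· * B.γ G) (hB.clifford A E)
    simp only [mul_add, add_mul, mul_ite, ite_mul, mul_smul_comm, smul_mul_assoc, mul_one, one_mul,
      mul_zero, zero_mul] at h1 h2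
    rw [← h1, ← h2]
    noncomm_ring
  rw [asym_pair, mul_smul_comm, smul_mul_assoc, ← smul_sub]
  have h3 : (B.γ A * B.γ G - B.γ G * B.γ A) * B.γ E - B.γ E * (B.γ A * B.γ G - B.γ G * B.γ A) =
      (B.γ A * B.γ G * B.γ E - B.γ E * (B.γ A * B.γ G)) -
        (B.γ G * B.γ A * B.γ E - B.γ E * (B.γ G * B.γ A)) := by noncomm_ring
  rw [h3, h, h]
  module

/-- The spinorial Levi-Civita connection makes the Clifford multiplication parallel. -/
theorem cliff_christoffel (hB : B.IsBrane) (A E : Idx p d) (x : Pt p d) :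
    B.cliff (fun G => B.christoffel A E G x) x = ((B.dscale A E x : ℝ) : ℂ) • B.γ E +
      (B.spinLC A x * B.gamLow E x - B.gamLow E x * B.spinLC A x) := by
  have h1 : B.cliff (fun G => B.christoffel A E G x) x =
      ((B.dscale A E x : ℝ) : ℂ) • B.γ E + (((B.dscale E A x : ℝ) : ℂ) • B.γ A -
        if A = E then ∑ k : Fin d, ((eta A * B.scale A x * B.dscale (Sum.inr k) A x /
          B.f₂ (ypart x) : ℝ) : ℂ) • B.γ (Sum.inr k) else 0) := by
    have ht : ∀ G, ((B.christoffel A E G x : ℝ) : ℂ) • B.gamLow G x =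
        (if G = E then ((B.dscale A E x : ℝ) : ℂ) • B.γ E else 0) +
        ((if G = A then ((B.dscale E A x : ℝ) : ℂ) • B.γ A else 0) -
        if A = E then ((eta A * B.scale A x * B.dscale G A x * (eta G * B.scale G x)⁻¹ : ℝ) : ℂ) •
          B.γ G else 0) := by
      intro G
      rw [christoffel, Finset.sum_eq_single G (fun H _ hH => by
        rw [hB.inv_metric, if_neg (Ne.symm hH), zero_mul]) (by simp), hB.inv_metric, if_pos rfl,
        christoffelLow, hB.dmetric_eq, hB.dmetric_eq, hB.dmetric_eq, gamLow, smul_smul]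
      have hs := (hB.scale_pos G x).ne'
      have he := eta_ne_zero G
      have hs' : (B.scale G x : ℂ) ≠ 0 := by exact_mod_cast hs
      have he' : (eta G : ℂ) ≠ 0 := by exact_mod_cast he
      by_cases h1 : G = E <;> by_cases h2 : G = A
      · subst h1; subst h2
        simp only [if_true, ← add_smul, ← sub_smul]
        congr 1
        push_cast
        field_simp
        ring
      · subst h1
        have h3 : A ≠ G := Ne.symm h2
        simp only [if_true, if_neg h2, if_neg h3, zero_sub, neg_zero, add_zero]
        congr 1
        push_cast
        field_simp
        ring
      · subst h2
        simp only [if_true, if_neg h1, zero_add, sub_zero]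
        congr 1
        push_cast
        field_simp
      · simp only [if_neg h1, if_neg h2, zero_add, zero_sub]
        split_ifs with h3
        · rw [← neg_smul]
          congr 1
          push_cast
          field_simp
        · simp
    rw [cliff]
    simp only [ht, Finset.sum_add_distrib, Finset.sum_sub_distrib, Finset.sum_ite_eq',
      Finset.mem_univ, if_true]
    congr 2
    split_ifs with h
    · rw [Fintype.sum_sum_type]
      simp only [hB.dscale_inl, mul_zero, zero_mul, Complex.ofReal_zero, zero_smul,
        Finset.sum_const_zero, zero_add]
      refine Finset.sum_congr rfl fun k _ => ?_
      simp [eta, scale, div_eq_mul_inv]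
    · simp
  rw [h1, hB.spinLC_eq, gamLow]
  congr 1
  have ht : ∀ k : Fin d, ∀ a : ℂ, (-(1 / 2) : ℂ) • (a • asym ![B.γ A, B.γ (Sum.inr k)]) *
        ((B.scale E x : ℝ) : ℂ) • B.γ E -
      ((B.scale E x : ℝ) : ℂ) • B.γ E * (-(1 / 2) : ℂ) • (a • asym ![B.γ A, B.γ (Sum.inr k)]) =
      (-(1 / 2) * a * B.scale E x : ℂ) •
        (if (Sum.inr k : Idx p d) = E then ((-2 * eta (Sum.inr k : Idx p d) : ℝ) : ℂ) • B.γ A else 0)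
      - (-(1 / 2) * a * B.scale E x : ℂ) •
        if A = E then ((-2 * eta A : ℝ) : ℂ) • B.γ (Sum.inr k) else 0 := fun k a => by
    rw [← smul_sub, ← hB.asym_pair_comm]
    simp only [smul_mul_assoc, mul_smul_comm]
    module
  simp only [Finset.smul_sum, Finset.sum_mul, Finset.mul_sum, ← Finset.sum_sub_distrib, ht]
  rw [Finset.sum_sub_distrib]
  have hs2 : (B.f₂ (ypart x) : ℂ) ≠ 0 := by exact_mod_cast (hB.pos₂ (ypart x)).ne'
  congr 1
  · cases E with
    | inl ν => simp [hB.dscale_inl]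
    | inr j =>
      simp only [Sum.inr.injEq, smul_ite, smul_zero, Finset.sum_ite_eq', Finset.mem_univ, if_true,
        smul_smul]
      congr 1
      simp only [scale, eta]
      push_cast
      field_simp
  · split_ifs with h
    · subst h
      simp only [Finset.smul_sum, smul_smul]
      refine Finset.sum_congr rfl fun k _ => ?_
      congr 1
      push_cast
      field_simp
    · simp

end IsBrane

theorem fderiv_gamLow_apply [FiniteDimensional ℂ S] (hB : B.IsBrane) (A E : Idx p d)
    {ξ : Pt p d → S} (hξ : ContDiff ℝ ∞ ξ) (x : Pt p d) :
    fderiv ℝ (fun z => B.gamLow E z (ξ z)) x (Pi.single A 1) =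
      ((B.dscale A E x : ℝ) : ℂ) • B.γ E (ξ x) +
        B.gamLow E x (fderiv ℝ ξ x (Pi.single A 1)) := by
  have h1 := (hB.differentiable_scale E x).hasFDerivAt
  have h2 := (hξ.differentiable (by simp) x).hasFDerivAt
  have h3 := (((clm (B.γ E)).restrictScalars ℝ).hasFDerivAt (x := ξ x)).comp x h2
  have h4 := h1.smul h3
  have h5 : (fun z => B.gamLow E z (ξ z)) =
      fun z => B.scale E z • ((clm (B.γ E)).restrictScalars ℝ ∘ ξ) z := by
    funext z
    simp [gamLow]
  rw [h5]
  erw [h4.fderiv]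
  simp [gamLow, dscale, add_comm]

section Torsion

variable [FiniteDimensional ℂ S] {C : LinearMap.BilinForm ℂ S} {Δ₀ Δ₁ : ℤˣ}

/-- `D̂γ` is an algebraic expression in the potential: the derivatives drop out since the
Levi-Civita connection preserves the charge conjugation and the Clifford multiplication. -/
theorem hatD_eq (hB : B.IsBrane) (hC : C.Nondegenerate) {A : Idx p d} {x : Pt p d}
    {N : Module.End ℂ S}
    (hN : LinearMap.BilinForm.leftAdjointOfNondegenerate C hC (B.connC A x) = -B.spinLC A x + N)
    (E : Idx p d) {ξ : Pt p d → S} (hξ : ContDiff ℝ ∞ ξ) :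
    B.hatD C hC A E ξ x = -((B.scale E x : ℝ) : ℂ) •
      (N * B.γ E + B.γ E * B.negAC A x) (ξ x) := by
  rw [hatD, cov, cov, fderiv_gamLow_apply hB A E hξ, hB.cliff_christoffel, conn, hN, connC]
  simp only [gamLow, LinearMap.add_apply, LinearMap.sub_apply, LinearMap.neg_apply,
    LinearMap.smul_apply, map_add, map_smul, Module.End.mul_apply, smul_add, neg_add, neg_smul]
  module

theorem leftAdjoint_eq_of_adj (hC : C.Nondegenerate) {Φ Ψ : Module.End ℂ S}
    (h : ∀ φ ψ, C (Ψ φ) ψ = C φ (Φ ψ)) :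
    LinearMap.BilinForm.leftAdjointOfNondegenerate C hC Φ = Ψ :=
  ((LinearMap.BilinForm.isAdjointPair_iff_eq_of_nondegenerate C hC Ψ Φ).mp h).symm

end Torsion

end Data

end Brane

/-! ### The values of `D̂γ` -/

namespace Brane

namespace Data

variable {p d : ℕ} {S : Type*} [NormedAddCommGroup S] [NormedSpace ℂ S] {B : Data p d S}

section Torsion

variable {C : LinearMap.BilinForm ℂ S} {Δ₀ Δ₁ : ℤˣ}

namespace IsChargeConjugation

theorem adj_gamma (hC : B.IsChargeConjugation C Δ₀ Δ₁) (A : Idx p d) (φ ψ : S) :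
    C (((((Δ₀ * Δ₁ : ℤˣ) : ℤ) : ℂ) • B.γ A) φ) ψ = C φ (B.γ A ψ) := by
  rw [hC.symm₁, LinearMap.smul_apply, map_smul, LinearMap.smul_apply, hC.symm₀ (B.γ A φ), smul_eq_mul]
  push_cast
  linear_combination (((Δ₁ : ℤ) : ℂ) * C ψ (B.γ A φ)) * IsBrane.unit_sq Δ₀

theorem adj_prod (hC : B.IsChargeConjugation C Δ₀ Δ₁) (l : List (Idx p d)) (φ ψ : S) :
    C (((((Δ₀ * Δ₁ : ℤˣ) : ℤ) : ℂ) ^ l.length • ((l.map B.γ).reverse.prod)) φ) ψ =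
      C φ ((l.map B.γ).prod ψ) := by
  induction l generalizing φ with
  | nil => simp
  | cons A l ih =>
    rw [List.map_cons, List.prod_cons, Module.End.mul_apply, ← hC.adj_gamma, ← ih,
      List.reverse_cons, List.prod_append, List.prod_singleton, List.length_cons, pow_succ]
    congr 2
    simp only [LinearMap.smul_apply, Module.End.mul_apply, map_smul, smul_smul, mul_comm]

/-- The assumption on the signs `Δ` fixes the adjoint of `γ^{[d]}`. -/
theorem adj_gvol (hB : B.IsBrane) (hC : B.IsChargeConjugation C Δ₀ Δ₁)
    (hΔ : Delta Δ₀ Δ₁ (d - 1) * Δ₁ = -1) (φ ψ : S) :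
    C ((((-1) ^ d : ℂ) • B.gvol) φ) ψ = C φ (B.gvol ψ) := by
  have h := hC.adj_prod ((List.ofFn fun i : Fin d => (Sum.inr i : Idx p d))) φ ψ
  have h1 : (List.ofFn fun i : Fin d => (Sum.inr i : Idx p d)).map B.γ =
      List.ofFn fun i : Fin d => B.γ (Sum.inr i) := by
    rw [List.map_ofFn]; rfl
  rw [h1, prod_reverse_ofFn_of_anticomm (fun i j hij => hB.anticomm (by simpa using hij)),
    List.length_ofFn] at h
  rw [show B.gvol = (List.ofFn fun i : Fin d => B.γ (Sum.inr i)).prod from rfl, ← h]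
  congr 2
  obtain ⟨m, rfl⟩ : ∃ m, d = m + 1 := ⟨d - 1, by have := hB.two_le; omega⟩
  have h2 : ((Delta Δ₀ Δ₁ m * Δ₁ : ℤˣ) : ℤ) = -1 := by rw [Nat.add_sub_cancel] at hΔ; rw [hΔ]; rfl
  have h3 : ((-1) ^ (m * (m - 1) / 2) : ℂ) * (((Δ₀ * Δ₁ : ℤˣ) : ℤ) : ℂ) ^ (m + 1) = -1 := by
    have := congrArg (Int.cast : ℤ → ℂ) h2
    rw [Delta] at this
    push_cast at this ⊢
    linear_combination this
  have h4 : (m + 1) * (m + 1 - 1) / 2 = m * (m - 1) / 2 + m := by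
    rcases m with _ | m
    · rfl
    · simp only [Nat.add_sub_cancel]
      rw [show (m + 1 + 1) * (m + 1) = (m + 1) * m + (m + 1) * 2 by ring,
        Nat.add_mul_div_right _ _ two_pos]
  have h5 : ((((Δ₀ * Δ₁ : ℤˣ) : ℤ) : ℂ) ^ (m + 1)) * (-1) ^ ((m + 1) * (m + 1 - 1) / 2) =
      (-1) ^ (m + 1) := by
    rw [h4, pow_add (-1 : ℂ)]
    linear_combination (-1) ^ m * h3
  rw [← h5, mul_smul]
  congr 2
  rw [show ((-1 : Module.End ℂ S) ^ ((m + 1) * (m + 1 - 1) / 2)) =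
    algebraMap ℂ (Module.End ℂ S) ((-1) ^ ((m + 1) * (m + 1 - 1) / 2)) by simp,
    ← Algebra.smul_def]

theorem adj_mul {Φ Φ' Ψ Ψ' : Module.End ℂ S} (h : ∀ φ ψ, C (Φ' φ) ψ = C φ (Φ ψ))
    (h' : ∀ φ ψ, C (Ψ' φ) ψ = C φ (Ψ ψ)) (φ ψ : S) :
    C ((Ψ' * Φ') φ) ψ = C φ ((Φ * Ψ) ψ) := by
  rw [Module.End.mul_apply, Module.End.mul_apply, h', h]

theorem adj_add {Φ Φ' Ψ Ψ' : Module.End ℂ S} (h : ∀ φ ψ, C (Φ' φ) ψ = C φ (Φ ψ))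
    (h' : ∀ φ ψ, C (Ψ' φ) ψ = C φ (Ψ ψ)) (φ ψ : S) :
    C ((Φ' + Ψ') φ) ψ = C φ ((Φ + Ψ) ψ) := by
  simp [h, h']

theorem adj_smul {Φ Φ' : Module.End ℂ S} (h : ∀ φ ψ, C (Φ' φ) ψ = C φ (Φ ψ)) (a : ℂ)
    (φ ψ : S) : C ((a • Φ') φ) ψ = C φ ((a • Φ) ψ) := by
  simp [h]

theorem adj_sum {ι : Type*} (s : Finset ι) {Φ Φ' : ι → Module.End ℂ S}
    (h : ∀ i φ ψ, C (Φ' i φ) ψ = C φ (Φ i ψ)) (φ ψ : S) :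
    C ((∑ i ∈ s, Φ' i) φ) ψ = C φ ((∑ i ∈ s, Φ i) ψ) := by
  simp [h]

theorem adj_pair (hC : B.IsChargeConjugation C Δ₀ Δ₁) (A E : Idx p d) (φ ψ : S) :
    C ((-asym ![B.γ A, B.γ E]) φ) ψ = C φ (asym ![B.γ A, B.γ E] ψ) := by
  have h : ∀ A E φ ψ, C ((B.γ E * B.γ A) φ) ψ = C φ ((B.γ A * B.γ E) ψ) := fun A E φ ψ => by
    rw [← adj_mul (hC.adj_gamma A) (hC.adj_gamma E), smul_mul_smul_comm, IsBrane.unit_sq, one_smul]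
  rw [asym_pair, ← smul_neg]
  refine adj_smul (fun φ ψ => ?_) _ φ ψ
  simp only [LinearMap.neg_apply, LinearMap.sub_apply, map_neg, map_sub, h]
  ring

theorem adj_spinLC (hB : B.IsBrane) (hC : B.IsChargeConjugation C Δ₀ Δ₁) (A : Idx p d)
    (x : Pt p d) (φ ψ : S) : C ((-B.spinLC A x) φ) ψ = C φ (B.spinLC A x ψ) := by
  rw [hB.spinLC_eq, ← smul_neg, ← Finset.sum_neg_distrib]
  simp only [← smul_neg]
  exact adj_smul (adj_sum _ fun k => adj_smul (hC.adj_pair _ _) _) _ φ ψ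

theorem adj_pair_gvol (hB : B.IsBrane) (hC : B.IsChargeConjugation C Δ₀ Δ₁)
    (hΔ : Delta Δ₀ Δ₁ (d - 1) * Δ₁ = -1) (i j : Fin d) (φ ψ : S) :
    C (((-(-1) ^ d : ℂ) • (asym ![B.γ (Sum.inr i), B.γ (Sum.inr j)] * B.gvol)) φ) ψ =
      C φ ((asym ![B.γ (Sum.inr i), B.γ (Sum.inr j)] * B.gvol) ψ) := by
  rw [← adj_mul (hC.adj_pair _ _) (hC.adj_gvol hB hΔ), smul_mul_assoc, mul_neg, hB.gvol_mul_pair,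
    smul_neg, neg_smul]

theorem adj_mixed_gvol (hB : B.IsBrane) (hC : B.IsChargeConjugation C Δ₀ Δ₁)
    (hΔ : Delta Δ₀ Δ₁ (d - 1) * Δ₁ = -1) (μ : Fin (p + 1)) (i : Fin d) (φ ψ : S) :
    C ((((-1) ^ d : ℂ) • (B.γ (Sum.inl μ) * B.γ (Sum.inr i) * B.gvol)) φ) ψ =
      C φ ((B.γ (Sum.inl μ) * B.γ (Sum.inr i) * B.gvol) ψ) := by
  have h := hC.adj_pair (Sum.inl μ) (Sum.inr i)
  rw [hB.asym_inl_inr] at h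
  rw [← adj_mul h (hC.adj_gvol hB hΔ), smul_mul_assoc, mul_neg, hB.gvol_sandwich μ rfl, neg_neg]

variable [FiniteDimensional ℂ S]

/-- `D̂γ` along `ℝ^{p+1}`, from the adjoints of the terms of the potential. -/
theorem hatD_inl (hB : B.IsBrane) (hC : B.IsChargeConjugation C Δ₀ Δ₁)
    (hΔ : Delta Δ₀ Δ₁ (d - 1) * Δ₁ = -1) (μ : Fin (p + 1)) (E : Idx p d) {ξ : Pt p d → S}
    (hξ : ContDiff ℝ ∞ ξ) (x : Pt p d) :
    B.hatD C hC.nondeg (Sum.inl μ) E ξ x = -(((B.δ₁ : ℤ) : ℂ) * B.ε / 2) •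
      ∑ i, ((B.scale E x * B.X i (ypart x) : ℝ) : ℂ) •
        (((-1) ^ d : ℂ) • (B.γ (Sum.inl μ) * B.γ (Sum.inr i) * B.gvol * B.γ E) +
          B.γ E * (B.γ (Sum.inl μ) * B.γ (Sum.inr i) * B.gvol)) (ξ x) := by
  rw [hatD_eq hB hC.nondeg (N := ((B.δ₁ : ℤ) * B.ε / 2 : ℂ) • ∑ i,
      ((B.X i (ypart x) : ℝ) : ℂ) • ((-1) ^ d : ℂ) •
        (B.γ (Sum.inl μ) * B.γ (Sum.inr i) * B.gvol)) _ E hξ, hB.negAC_inl]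
  · simp only [Finset.smul_sum, Finset.sum_mul, Finset.mul_sum, LinearMap.add_apply,
      LinearMap.sum_apply, ← Finset.sum_add_distrib]
    refine Finset.sum_congr rfl fun i _ => ?_
    simp only [smul_mul_assoc, mul_smul_comm, LinearMap.smul_apply]
    push_cast
    module
  · refine leftAdjoint_eq_of_adj hC.nondeg fun φ ψ => ?_
    rw [connC, hB.negAC_inl]
    exact adj_add (hC.adj_spinLC hB _ _) (adj_smul (adj_sum _ fun i => adj_smul
      (hC.adj_mixed_gvol hB hΔ μ i) _) _) φ ψ

/-- `D̂γ` along `ℝ^d`, from the adjoints of the terms of the potential. -/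
theorem hatD_inr (hB : B.IsBrane) (hC : B.IsChargeConjugation C Δ₀ Δ₁)
    (hΔ : Delta Δ₀ Δ₁ (d - 1) * Δ₁ = -1) (i : Fin d) (E : Idx p d) {ξ : Pt p d → S}
    (hξ : ContDiff ℝ ∞ ξ) (x : Pt p d) :
    B.hatD C hC.nondeg (Sum.inr i) E ξ x =
      -(((B.δ₁ : ℤ) : ℂ) * B.ε / 2) •
      ∑ j, ((B.scale E x * B.Y j (ypart x) : ℝ) : ℂ) •
        ((-(-1) ^ d : ℂ) • (asym ![B.γ (Sum.inr i), B.γ (Sum.inr j)] * B.gvol * B.γ E) +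
          B.γ E * (asym ![B.γ (Sum.inr i), B.γ (Sum.inr j)] * B.gvol)) (ξ x) -
      (((B.δ₂ : ℤ) : ℂ) * B.ε * (((d : ℂ) - 1) * B.β / (2 * B.α)) *
          ((B.scale E x * B.Y i (ypart x) : ℝ) : ℂ)) •
        (((-1) ^ d : ℂ) • (B.gvol * B.γ E) + B.γ E * B.gvol) (ξ x) := by
  rw [hatD_eq hB hC.nondeg (N := ((B.δ₁ : ℤ) * B.ε / 2 : ℂ) • ∑ j,
      ((B.Y j (ypart x) : ℝ) : ℂ) • (-(-1) ^ d : ℂ) •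
        (asym ![B.γ (Sum.inr i), B.γ (Sum.inr j)] * B.gvol) +
      (((B.δ₂ : ℤ) : ℂ) * B.ε * (((d : ℂ) - 1) * B.β / (2 * B.α)) *
          ((B.Y i (ypart x) : ℝ) : ℂ)) • ((-1) ^ d : ℂ) • B.gvol) _ E hξ, hB.negAC_inr]
  · rw [add_mul, mul_add, add_add_add_comm, LinearMap.add_apply, smul_add,
      sub_eq_add_neg (_ : S) _]
    congr 1
    · simp only [Finset.smul_sum, Finset.sum_mul, Finset.mul_sum, LinearMap.add_apply,
        LinearMap.sum_apply, ← Finset.sum_add_distrib]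
      refine Finset.sum_congr rfl fun j _ => ?_
      simp only [smul_mul_assoc, mul_smul_comm, LinearMap.smul_apply]
      push_cast
      module
    · simp only [smul_mul_assoc, mul_smul_comm, LinearMap.smul_apply, LinearMap.add_apply]
      push_cast
      module
  · refine leftAdjoint_eq_of_adj hC.nondeg fun φ ψ => ?_
    rw [connC, hB.negAC_inr]
    exact adj_add (hC.adj_spinLC hB _ _) (adj_add (adj_smul (adj_sum _ fun j => adj_smul
      (hC.adj_pair_gvol hB hΔ i j) _) _) (adj_smul (hC.adj_gvol hB hΔ) _)) φ ψ

end IsChargeConjugation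

theorem cliff_raise (hB : B.IsBrane) (w : Fin d → ℝ) (x : Pt p d) :
    B.cliff (B.raise w x) x =
      ∑ i, ((w i / B.f₂ (ypart x) : ℝ) : ℂ) • B.γ (Sum.inr i) := by
  have h1 : ∀ μ, B.raise w x (Sum.inl μ) = 0 := fun μ =>
    Finset.sum_eq_zero fun i _ => by rw [hB.inv_metric, if_neg (by simp), zero_mul]
  have h2 : ∀ i, B.raise w x (Sum.inr i) = (B.f₂ (ypart x) ^ 2)⁻¹ * w i := fun i => by
    rw [raise, Finset.sum_eq_single i (fun j _ hj => by
      rw [hB.inv_metric, if_neg (by simpa using Ne.symm hj), zero_mul]) (by simp),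
      hB.inv_metric, if_pos rfl]
    simp [eta, scale]
  rw [cliff, Fintype.sum_sum_type]
  simp only [h1, h2, Complex.ofReal_zero, zero_smul, Finset.sum_const_zero, zero_add]
  refine Finset.sum_congr rfl fun i _ => ?_
  rw [gamLow, smul_smul, ← Complex.ofReal_mul]
  congr 2
  have := (hB.pos₂ (ypart x)).ne'
  simp only [scale]
  field_simp

/-- The compatibility of the two warp factors. -/
theorem X_eq_Y (hB : B.IsBrane) (i : Fin d) (y : Fin d → ℝ) :
    ((B.f₂ y * B.X i y : ℝ) : ℂ) =
      -(((d : ℂ) - 1) * B.β * B.α⁻¹ * ((B.f₁ y * B.Y i y : ℝ) : ℂ)) := by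
  push_cast
  rw [hB.choice₁, hB.choice₂, ← hB.signs]
  obtain ⟨m, rfl⟩ : ∃ m, d = m + 2 := ⟨d - 2, by have := hB.two_le; omega⟩
  rw [show m + 2 - 1 = m + 1 from rfl, show m + 2 - 2 = m from rfl, Nat.factorial_succ]
  have h2 := (hB.pos₂ y).ne'
  have hz : B.f₂ y ^ (2 - ((m + 2 : ℕ) : ℤ)) = B.f₂ y * B.f₂ y ^ (1 - ((m + 2 : ℕ) : ℤ)) := by
    rw [← zpow_one_add₀ h2]
    congr 1
    ring
  rw [hz]
  have hα := hB.α_ne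
  have hε := hB.eps_ne_zero
  push_cast
  field_simp
  ring

section Values

variable [FiniteDimensional ℂ S]

theorem hatD_inl_inl (hB : B.IsBrane) (hC : B.IsChargeConjugation C Δ₀ Δ₁)
    (hΔ : Delta Δ₀ Δ₁ (d - 1) * Δ₁ = -1) (μ ν : Fin (p + 1)) {ξ : Pt p d → S}
    (hξ : ContDiff ℝ ∞ ξ) (x : Pt p d) :
    B.hatD C hC.nondeg (Sum.inl μ) (Sum.inl ν) ξ x = (((B.δ₁ : ℤ) : ℂ) * B.ε *
            ((B.f₁ (ypart x) * B.f₂ (ypart x) : ℝ) : ℂ)) •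
            (B.cliff (B.raise (fun i => B.X i (ypart x)) x) x *
              asym ![B.γ (Sum.inl μ), B.γ (Sum.inl ν)] * B.gvol) (ξ x) := by
  have key : ∀ i, ((-1) ^ d : ℂ) • (B.γ (Sum.inl μ) * B.γ (Sum.inr i) * B.gvol * B.γ (Sum.inl ν)) +
      B.γ (Sum.inl ν) * (B.γ (Sum.inl μ) * B.γ (Sum.inr i) * B.gvol) =
      (-2 : ℂ) • (B.γ (Sum.inr i) * asym ![B.γ (Sum.inl μ), B.γ (Sum.inl ν)] * B.gvol) := by
    intro i
    have h1 := hB.anticomm (A := Sum.inr i) (E := Sum.inl μ) (by simp)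
    have h2 := hB.anticomm (A := Sum.inr i) (E := Sum.inl ν) (by simp)
    have h3 : B.γ (Sum.inr i) * asym ![B.γ (Sum.inl μ), B.γ (Sum.inl ν)] =
        (1 / 2 : ℂ) • (B.γ (Sum.inl ν) * B.γ (Sum.inl μ) * B.γ (Sum.inr i) * (-1) -
          B.γ (Sum.inl μ) * B.γ (Sum.inr i) * B.γ (Sum.inl ν)) := by
      rw [asym_pair, mul_smul_comm, mul_sub, ← mul_assoc, h1, ← mul_assoc (B.γ (Sum.inr i)), h2,
        neg_mul, neg_mul, mul_assoc, h2, mul_assoc (B.γ (Sum.inl ν)), h1]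
      noncomm_ring
    rw [mul_assoc _ B.gvol, hB.gvol_mul_inl, mul_smul_comm, smul_smul, IsBrane.sign_sq, one_smul, h3,
      smul_mul_assoc, smul_smul]
    norm_num
    noncomm_ring
  rw [hC.hatD_inl hB hΔ _ _ hξ]
  simp only [key]
  rw [cliff_raise hB, Finset.sum_mul, Finset.sum_mul, LinearMap.sum_apply, Finset.smul_sum,
    Finset.smul_sum]
  refine Finset.sum_congr rfl fun i _ => ?_
  have h2 : (B.f₂ (ypart x) : ℂ) ≠ 0 := by exact_mod_cast (hB.pos₂ (ypart x)).ne'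
  simp only [smul_mul_assoc, LinearMap.smul_apply, smul_smul]
  congr 1
  simp only [scale]
  push_cast
  field_simp

theorem hatD_inl_inr (hB : B.IsBrane) (hC : B.IsChargeConjugation C Δ₀ Δ₁)
    (hΔ : Delta Δ₀ Δ₁ (d - 1) * Δ₁ = -1) (μ : Fin (p + 1)) (j : Fin d) {ξ : Pt p d → S}
    (hξ : ContDiff ℝ ∞ ξ) (x : Pt p d) :
    B.hatD C hC.nondeg (Sum.inl μ) (Sum.inr j) ξ x = -(((B.δ₁ : ℤ) : ℂ) * B.ε *
            ((B.f₂ (ypart x) * B.X j (ypart x) : ℝ) : ℂ)) •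
            (B.γ (Sum.inl μ) * B.gvol) (ξ x) := by
  have key : ∀ i, ((-1) ^ d : ℂ) • (B.γ (Sum.inl μ) * B.γ (Sum.inr i) * B.gvol * B.γ (Sum.inr j)) +
      B.γ (Sum.inr j) * (B.γ (Sum.inl μ) * B.γ (Sum.inr i) * B.gvol) =
      if i = j then (2 : ℂ) • (B.γ (Sum.inl μ) * B.gvol) else 0 := by
    intro i
    have h1 := hB.anticomm (A := Sum.inr j) (E := Sum.inl μ) (by simp)
    have h2 := hB.space i j
    have h3 : ((-1) ^ d : ℂ) • (B.γ (Sum.inl μ) * B.γ (Sum.inr i) * B.gvol * B.γ (Sum.inr j)) +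
      B.γ (Sum.inr j) * (B.γ (Sum.inl μ) * B.γ (Sum.inr i) * B.gvol) =
      -(B.γ (Sum.inl μ) * (B.γ (Sum.inr i) * B.γ (Sum.inr j) + B.γ (Sum.inr j) * B.γ (Sum.inr i)) *
        B.gvol) := by
      rw [mul_assoc _ B.gvol, hB.mul_gvol, mul_smul_comm, smul_smul, mul_neg, IsBrane.sign_sq,
        neg_one_smul, ← mul_assoc (B.γ (Sum.inr j)), ← mul_assoc (B.γ (Sum.inr j)), h1]
      noncomm_ring
    rw [h3, h2]
    split_ifs
    · rw [mul_smul_comm, mul_one, smul_mul_assoc]; module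
    · simp
  rw [hC.hatD_inl hB hΔ _ _ hξ]
  simp only [key]
  rw [Finset.sum_eq_single j (fun i _ hi => by simp [hi]) (by simp), if_pos rfl]
  simp only [LinearMap.smul_apply, smul_smul]
  congr 1
  simp only [scale]
  ring

theorem hatD_inr_inl (hB : B.IsBrane) (hC : B.IsChargeConjugation C Δ₀ Δ₁)
    (hΔ : Delta Δ₀ Δ₁ (d - 1) * Δ₁ = -1) (i : Fin d) (μ : Fin (p + 1)) {ξ : Pt p d → S}
    (hξ : ContDiff ℝ ∞ ξ) (x : Pt p d) :
    B.hatD C hC.nondeg (Sum.inr i) (Sum.inl μ) ξ x = -(((B.δ₂ : ℤ) : ℂ) * B.ε *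
      ((d : ℂ) - 1) * B.β * B.α⁻¹ * ((B.f₁ (ypart x) * B.Y i (ypart x) : ℝ) : ℂ)) •
            (B.γ (Sum.inl μ) * B.gvol) (ξ x) := by
  have key : ∀ j, (-(-1) ^ d : ℂ) • (asym ![B.γ (Sum.inr i), B.γ (Sum.inr j)] * B.gvol *
      B.γ (Sum.inl μ)) + B.γ (Sum.inl μ) * (asym ![B.γ (Sum.inr i), B.γ (Sum.inr j)] * B.gvol) =
      0 := by
    intro j
    have h1 := hB.asym_pair_comm (Sum.inr i) (Sum.inr j) (Sum.inl μ)
    rw [if_neg (by simp), if_neg (by simp), sub_zero, sub_eq_zero] at h1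
    rw [mul_assoc _ B.gvol, hB.gvol_mul_inl, mul_smul_comm, smul_smul, neg_mul, IsBrane.sign_sq,
      neg_one_smul, ← mul_assoc, ← mul_assoc, h1]
    simp
  rw [hC.hatD_inr hB hΔ _ _ hξ]
  simp only [key, LinearMap.zero_apply, smul_zero, Finset.sum_const_zero, zero_sub]
  rw [hB.gvol_mul_inl, smul_smul, IsBrane.sign_sq, one_smul, ← two_smul ℂ, LinearMap.smul_apply,
    smul_smul, ← neg_smul]
  congr 1
  have hα := hB.α_ne
  simp only [scale]
  field_simp

theorem hatD_inr_inr (hB : B.IsBrane) (hC : B.IsChargeConjugation C Δ₀ Δ₁)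
    (hΔ : Delta Δ₀ Δ₁ (d - 1) * Δ₁ = -1) (i j : Fin d) {ξ : Pt p d → S}
    (hξ : ContDiff ℝ ∞ ξ) (x : Pt p d) :
    B.hatD C hC.nondeg (Sum.inr i) (Sum.inr j) ξ x =
      ∑ k, (((B.δ₂ : ℤ) : ℂ) * B.ε * ((B.f₂ (ypart x) * B.Y k (ypart x) : ℝ) : ℂ)) •
        (asym ![B.γ (Sum.inr k), B.γ (Sum.inr i), B.γ (Sum.inr j)] * B.gvol) (ξ x) := by
  have hsq : ∀ i : Fin d, B.γ (Sum.inr i) * B.γ (Sum.inr i) = -1 := hB.space.sq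
  have h3 : ∀ k, (-2 : ℂ) • asym ![B.γ (Sum.inr k), B.γ (Sum.inr i), B.γ (Sum.inr j)] =
      asym ![B.γ (Sum.inr i), B.γ (Sum.inr k)] * B.γ (Sum.inr j) +
      B.γ (Sum.inr j) * asym ![B.γ (Sum.inr i), B.γ (Sum.inr k)] := by
    intro k
    have hne : ∀ {a b : Fin d}, a ≠ b → B.γ (Sum.inr a) * B.γ (Sum.inr b) =
        -(B.γ (Sum.inr b) * B.γ (Sum.inr a)) := fun h => hB.anticomm (by simpa using h)
    by_cases hki : k = i
    · subst hki
      rw [asym_eq_zero_of_eq (i := 0) (j := 1) (by simp) (by decide)]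
      simp [asym_pair]
    have hp : asym ![B.γ (Sum.inr i), B.γ (Sum.inr k)] = B.γ (Sum.inr i) * B.γ (Sum.inr k) := by
      rw [asym_pair, hne hki]; module
    rw [hp]
    by_cases hkj : k = j
    · subst hkj
      rw [asym_eq_zero_of_eq (i := 0) (j := 2) (by simp) (by decide), smul_zero, ← mul_assoc,
        hne hki, mul_assoc, neg_mul, mul_assoc]
      simp
    by_cases hij : i = j
    · subst hij
      rw [asym_eq_zero_of_eq (i := 1) (j := 2) (by simp) (by decide), smul_zero, ← mul_assoc,
        mul_assoc, hne hki, mul_neg, ← mul_assoc]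
      simp
    have hp3 : asym ![B.γ (Sum.inr k), B.γ (Sum.inr i), B.γ (Sum.inr j)] =
        B.γ (Sum.inr k) * B.γ (Sum.inr i) * B.γ (Sum.inr j) := by
      rw [asym_of_anticomm]
      · simp [mul_assoc]
      · have hf : ![B.γ (Sum.inr k), B.γ (Sum.inr i), B.γ (Sum.inr j)] =
            fun a => B.γ (Sum.inr (![k, i, j] a)) := by
          funext a; fin_cases a <;> rfl
        have hinj : Function.Injective ![k, i, j] := by
          intro a b hab
          fin_cases a <;> fin_cases b <;> simp_all
        rw [hf]
        exact fun a b hab => hne fun h => hab (hinj h)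
    rw [hp3, ← mul_assoc, hne (Ne.symm hij), neg_mul, mul_assoc (B.γ (Sum.inr i)) (B.γ (Sum.inr j)),
      hne (Ne.symm hkj), hne hki]
    rw [neg_mul, mul_neg, neg_neg, mul_assoc, ← two_smul ℂ, smul_neg, neg_smul, neg_neg]
  have key : ∀ k, (-(-1) ^ d : ℂ) • (asym ![B.γ (Sum.inr i), B.γ (Sum.inr k)] * B.gvol *
      B.γ (Sum.inr j)) + B.γ (Sum.inr j) * (asym ![B.γ (Sum.inr i), B.γ (Sum.inr k)] * B.gvol) =
      (-2 : ℂ) • (asym ![B.γ (Sum.inr k), B.γ (Sum.inr i), B.γ (Sum.inr j)] * B.gvol) := by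
    intro k
    rw [mul_assoc _ B.gvol, hB.mul_gvol, mul_smul_comm, smul_smul, neg_mul_neg, IsBrane.sign_sq,
      one_smul, ← smul_mul_assoc, h3, add_mul, mul_assoc, mul_assoc]
  rw [hC.hatD_inr hB hΔ _ _ hξ]
  simp only [key]
  rw [hB.mul_gvol, smul_smul, mul_neg, IsBrane.sign_sq, neg_one_smul, neg_add_cancel,
    LinearMap.zero_apply, smul_zero, sub_zero, Finset.smul_sum]
  refine Finset.sum_congr rfl fun k _ => ?_
  simp only [LinearMap.smul_apply, smul_smul, hB.signs]
  congr 1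
  simp only [scale]
  ring

end Values

end Torsion

end Data

end Brane

/-! ### Torsion and parallel spinors -/

namespace Brane

namespace Data

variable {p d : ℕ} {S : Type*} [NormedAddCommGroup S] [NormedSpace ℂ S] {B : Data p d S}
  [FiniteDimensional ℂ S] {C : LinearMap.BilinForm ℂ S} {Δ₀ Δ₁ : ℤˣ}

/-- The components of `D̂γ` are skew symmetric; for the mixed ones this is the relation between `X`
and `Y`. -/
theorem hatD_skew (hB : B.IsBrane) (hC : B.IsChargeConjugation C Δ₀ Δ₁)
    (hΔ : Delta Δ₀ Δ₁ (d - 1) * Δ₁ = -1) (A E : Idx p d) {ξ : Pt p d → S}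
    (hξ : ContDiff ℝ ∞ ξ) (x : Pt p d) :
    B.hatD C hC.nondeg A E ξ x = -B.hatD C hC.nondeg E A ξ x := by
  have hswap : ∀ a b : Module.End ℂ S, asym ![a, b] = -asym ![b, a] := fun a b => by
    rw [asym_pair, asym_pair]; module
  have hmixed : ∀ (μ : Fin (p + 1)) (i : Fin d), B.hatD C hC.nondeg (Sum.inl μ) (Sum.inr i) ξ x =
      -B.hatD C hC.nondeg (Sum.inr i) (Sum.inl μ) ξ x := fun μ i => by
    rw [hatD_inl_inr hB hC hΔ _ _ hξ, hatD_inr_inl hB hC hΔ _ _ hξ, X_eq_Y hB, hB.signs,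
      ← neg_smul]
    congr 1
    ring
  cases A with
  | inl μ =>
    cases E with
    | inl ν =>
      rw [hatD_inl_inl hB hC hΔ _ _ hξ, hatD_inl_inl hB hC hΔ _ _ hξ, hswap (B.γ (Sum.inl μ)),
        mul_neg, neg_mul, LinearMap.neg_apply, smul_neg]
    | inr i => exact hmixed μ i
  | inr i =>
    cases E with
    | inl μ => rw [hmixed, neg_neg]
    | inr j =>
      rw [hatD_inr_inr hB hC hΔ _ _ hξ, hatD_inr_inr hB hC hΔ _ _ hξ, ← Finset.sum_neg_distrib]
      refine Finset.sum_congr rfl fun k _ => ?_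
      have h3 : asym ![B.γ (Sum.inr k), B.γ (Sum.inr i), B.γ (Sum.inr j)] =
          -asym ![B.γ (Sum.inr k), B.γ (Sum.inr j), B.γ (Sum.inr i)] := by
        rw [asym_eq_alternatization, asym_eq_alternatization, ← smul_neg,
          ← AlternatingMap.map_swap _ _ (show (1 : Fin 3) ≠ 2 by decide)]
        congr 2
        funext a
        fin_cases a <;> rfl
      rw [h3, neg_mul, LinearMap.neg_apply, smul_neg]

theorem torsion_eq (hB : B.IsBrane) (hC : B.IsChargeConjugation C Δ₀ Δ₁)
    (hΔ : Delta Δ₀ Δ₁ (d - 1) * Δ₁ = -1) (A E : Idx p d) {ξ : Pt p d → S}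
    (hξ : ContDiff ℝ ∞ ξ) (x : Pt p d) :
    B.torsion C hC.nondeg A E ξ x = (2 : ℂ) • B.hatD C hC.nondeg A E ξ x := by
  rw [torsion, hatD_skew hB hC hΔ E A hξ, sub_neg_eq_add, two_smul]

theorem isAdmissible (hB : B.IsBrane) (hC : B.IsChargeConjugation C Δ₀ Δ₁)
    (hΔ : Delta Δ₀ Δ₁ (d - 1) * Δ₁ = -1) : B.IsAdmissible C hC.nondeg := fun A E ξ hξ x => by
  rw [hatD_skew hB hC hΔ A E hξ, neg_add_cancel]

/-- `D̂γ` vanishes on a spinor at the points where `Y` vanishes, and where the spinor does. -/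
theorem hatD_eq_zero (hB : B.IsBrane) (hC : B.IsChargeConjugation C Δ₀ Δ₁)
    (hΔ : Delta Δ₀ Δ₁ (d - 1) * Δ₁ = -1) (A E : Idx p d) {ξ : Pt p d → S}
    (hξ : ContDiff ℝ ∞ ξ) (x : Pt p d) (h : (∀ i, B.Y i (ypart x) = 0) ∨ ξ x = 0) :
    B.hatD C hC.nondeg A E ξ x = 0 := by
  rcases h with h | h
  · have hX : ∀ i, B.X i (ypart x) = 0 := fun i => by
      have h1 := X_eq_Y hB i (ypart x)
      rw [h i, mul_zero, Complex.ofReal_zero, mul_zero, neg_zero, Complex.ofReal_eq_zero] at h1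
      exact (mul_eq_zero.mp h1).resolve_left (hB.pos₂ _).ne'
    cases A with
    | inl μ => rw [hC.hatD_inl hB hΔ _ _ hξ]; simp [hX]
    | inr i => rw [hC.hatD_inr hB hΔ _ _ hξ]; simp [h]
  · cases A with
    | inl μ => rw [hC.hatD_inl hB hΔ _ _ hξ]; simp [h]
    | inr i => rw [hC.hatD_inr hB hΔ _ _ hξ]; simp [h]

/-- A spinor annihilated by the gradient of `f` vanishes wherever the gradient does not. -/
theorem eq_zero_of_cliff_grad (hB : B.IsBrane) {x : Pt p d} {v : S}
    (hv : B.cliff (B.raise (fun i => pd i B.f (ypart x)) x) x v = 0) :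
    (∀ i, B.Y i (ypart x) = 0) ∨ v = 0 := by
  rw [or_iff_not_imp_left]
  intro hY
  push Not at hY
  obtain ⟨i, hi⟩ := hY
  have hpd : pd i B.f (ypart x) ≠ 0 := fun h => hi (by
    have := hB.choice₂ i (ypart x)
    rwa [h, zero_mul, Complex.ofReal_zero, mul_zero, Complex.ofReal_eq_zero] at this)
  have h2 := congrArg (∑ i, (pd i B.f (ypart x) / B.f₂ (ypart x)) • B.γ (Sum.inr i) :
    Module.End ℂ S) hv
  rw [cliff_raise hB] at h2
  simp only [← real_smul_end] at h2
  rw [← Module.End.mul_apply, hB.space.sum_mul_sum, map_zero, Algebra.algebraMap_eq_smul_one,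
    LinearMap.smul_apply, Module.End.one_apply, smul_eq_zero] at h2
  refine h2.resolve_left ?_
  rw [negForm, QuadraticMap.weightedSumSquares_apply]
  simp only [smul_eq_mul, neg_one_mul, Finset.sum_neg_distrib, neg_eq_zero]
  refine (Finset.sum_pos' (fun j _ => mul_self_nonneg _) ⟨i, Finset.mem_univ _, ?_⟩).ne'
  exact mul_self_pos.mpr (div_ne_zero hpd (hB.pos₂ _).ne')

theorem isAdmissibleSet_parallelKernel (hB : B.IsBrane) (hC : B.IsChargeConjugation C Δ₀ Δ₁)
    (hΔ : Delta Δ₀ Δ₁ (d - 1) * Δ₁ = -1) :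
    B.IsAdmissibleSet C hC.nondeg (B.parallelKernel : Set (Pt p d → S)) :=
  fun ξ hξ A E x => isAdmissible hB hC hΔ A E ξ hξ.1 x

theorem isTorsionFreeSet_parallelKernel (hB : B.IsBrane) (hC : B.IsChargeConjugation C Δ₀ Δ₁)
    (hΔ : Delta Δ₀ Δ₁ (d - 1) * Δ₁ = -1) :
    B.IsTorsionFreeSet C hC.nondeg (B.parallelKernel : Set (Pt p d → S)) := by
  have h0 : ∀ η ∈ (B.parallelKernel : Set (Pt p d → S)), ∀ A E x,
      B.torsion C hC.nondeg A E η x = 0 := fun η hη A E x => by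
    rw [torsion_eq hB hC hΔ A E hη.1, hatD_eq_zero hB hC hΔ A E hη.1 x
      (eq_zero_of_cliff_grad hB (hη.2.2 x)), smul_zero]
  intro φ hφ ψ hψ E x
  simp [h0 φ hφ, h0 ψ hψ]

end Data

end Brane

/-! ### Determinants of parallel transports and invariant subspaces -/

namespace Brane

section Determinant

variable {S : Type*} [NormedAddCommGroup S] [NormedSpace ℂ S] [FiniteDimensional ℂ S]

theorem differentiable_det :
    Differentiable ℝ fun F : S →L[ℂ] S => LinearMap.det (F : S →ₗ[ℂ] S) := by
  have hfin : FiniteDimensional ℝ (S →L[ℂ] S) := FiniteDimensional.trans ℝ ℂ _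
  let b := Module.finBasis ℂ S
  have hentry : ∀ i j, Differentiable ℝ fun F : S →L[ℂ] S =>
      LinearMap.toMatrix b b (F : S →ₗ[ℂ] S) i j := fun i j => by
    let L : (S →L[ℂ] S) →ₗ[ℝ] ℂ :=
      { toFun := fun F => LinearMap.toMatrix b b (F : S →ₗ[ℂ] S) i j
        map_add' := fun F G => by simp [LinearMap.toMatrix_apply]
        map_smul' := fun r F => by
          simp only [LinearMap.toMatrix_apply, RingHom.id_apply]
          rw [ContinuousLinearMap.coe_coe, ContinuousLinearMap.coe_coe, _root_.smul_apply,
            ← Complex.coe_smul, map_smul]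
          simp }
    exact (LinearMap.toContinuousLinearMap L).differentiable
  have h : (fun F : S →L[ℂ] S => LinearMap.det (F : S →ₗ[ℂ] S)) = fun F : S →L[ℂ] S =>
      ∑ σ : Equiv.Perm (Fin (Module.finrank ℂ S)), ((Equiv.Perm.sign σ : ℤ) : ℂ) *
        ∏ i, LinearMap.toMatrix b b (F : S →ₗ[ℂ] S) (σ i) i := by
    funext F
    rw [← LinearMap.det_toMatrix b, Matrix.det_apply']
  rw [h]
  fun_prop

/-- The derivative of the determinant at the identity is the trace. -/
theorem fderiv_det_one (X : S →L[ℂ] S) :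
    fderiv ℝ (fun F : S →L[ℂ] S => LinearMap.det (F : S →ₗ[ℂ] S)) 1 X =
      LinearMap.trace ℂ S (X : S →ₗ[ℂ] S) := by
  let b := Module.finBasis ℂ S
  have hl : HasDerivAt (fun r : ℝ => (1 : S →L[ℂ] S) + r • X) X 0 := by
    simpa using ((hasDerivAt_id (0 : ℝ)).smul_const X).const_add 1
  have h0 : (1 : S →L[ℂ] S) + (0 : ℝ) • X = 1 := by simp
  have h1 := (differentiable_det (S := S) ((1 : S →L[ℂ] S) + (0 : ℝ) • X)).hasFDerivAt.comp_hasDerivAt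
    (0 : ℝ) hl
  rw [h0] at h1
  set A := LinearMap.toMatrix b b (X : S →ₗ[ℂ] S) with hA
  set q : Polynomial ℂ := (1 + (Polynomial.X : Polynomial ℂ) • A.map ⇑(Polynomial.C : ℂ →+* Polynomial ℂ)).det.divX.divX
  have h2 : (fun F : S →L[ℂ] S => LinearMap.det (F : S →ₗ[ℂ] S)) ∘
      (fun r : ℝ => (1 : S →L[ℂ] S) + r • X) = fun r : ℝ =>
        1 + A.trace * (r : ℂ) + Polynomial.eval (r : ℂ) q * (r : ℂ) ^ 2 := by
    funext r
    rw [← Matrix.det_one_add_smul, Function.comp_apply, ← LinearMap.det_toMatrix b]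
    have e : (((1 : S →L[ℂ] S) + r • X : S →L[ℂ] S) : S →ₗ[ℂ] S) =
        LinearMap.id + (r : ℂ) • (X : S →ₗ[ℂ] S) := by
      ext v
      simp
    rw [e, map_add, map_smul, LinearMap.toMatrix_id]
  have h3 : HasDerivAt (fun z : ℂ => 1 + A.trace * z + Polynomial.eval z q * z ^ 2) A.trace 0 := by
    have h4 := (((hasDerivAt_id (0 : ℂ)).const_mul A.trace).const_add 1).add
      ((q.hasDerivAt 0).mul ((hasDerivAt_id (0 : ℂ)).pow 2))
    refine h4.congr_deriv ?_
    simp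
  have h5 : HasDerivAt (fun r : ℝ => 1 + A.trace * (r : ℂ) + Polynomial.eval (r : ℂ) q * (r : ℂ) ^ 2)
      A.trace 0 := by
    have := HasDerivAt.comp_ofReal (z := (0 : ℝ)) (by simpa using h3)
    simpa using this
  rw [h2] at h1
  rw [h1.unique h5, hA, ← LinearMap.trace_eq_matrix_trace]

/-- Jacobi's formula along a curve of invertible endomorphisms. -/
theorem hasDerivAt_det {U : ℝ → S →L[ℂ] S} {X V : S →L[ℂ] S} {t : ℝ}
    (hU : HasDerivAt U (X * U t) t) (h1 : U t * V = 1) (h2 : V * U t = 1) :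
    HasDerivAt (fun s => LinearMap.det (U s : S →ₗ[ℂ] S))
      (LinearMap.trace ℂ S (X : S →ₗ[ℂ] S) * LinearMap.det (U t : S →ₗ[ℂ] S)) t := by
  have h3 : HasDerivAt (fun s => U s * V) X t := by
    have := hU.mul_const V
    rwa [mul_assoc, h1, mul_one] at this
  have h4 := (differentiable_det (S := S) (U t * V)).hasFDerivAt.comp_hasDerivAt t h3
  rw [h1, fderiv_det_one] at h4
  have h5 := h4.mul_const (LinearMap.det (U t : S →ₗ[ℂ] S))
  have h6 : (fun s => LinearMap.det (U s : S →ₗ[ℂ] S)) = fun s =>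
      ((fun F : S →L[ℂ] S => LinearMap.det (F : S →ₗ[ℂ] S)) ∘ fun s => U s * V) s *
        LinearMap.det (U t : S →ₗ[ℂ] S) := by
    funext s
    rw [Function.comp_apply, ← LinearMap.det_comp]
    congr 1
    have : U s * V * U t = U s := by rw [mul_assoc, h2, mul_one]
    conv_lhs => rw [← this]
    rfl
  rw [h6]
  exact h5

/-- A solution of `D' = τ D` with imaginary `τ` has constant modulus. -/
theorem hasDerivAt_norm_sq_eq_zero {D : ℝ → ℂ} {τ : ℂ} {t : ℝ} (hτ : τ.re = 0)
    (hD : HasDerivAt D (τ * D t) t) : HasDerivAt (fun s => Complex.normSq (D s)) 0 t := by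
  have hre : HasDerivAt (fun s => (D s).re) (τ * D t).re t :=
    Complex.reCLM.hasFDerivAt.comp_hasDerivAt t hD
  have him : HasDerivAt (fun s => (D s).im) (τ * D t).im t :=
    Complex.imCLM.hasFDerivAt.comp_hasDerivAt t hD
  have := (hre.mul hre).add (him.mul him)
  refine (this.congr_deriv ?_)
  simp only [Complex.mul_re, Complex.mul_im, hτ]
  ring

end Determinant

section TransportInvariants

variable {ι : Type} [Fintype ι] {S : Type*} [NormedAddCommGroup S] [NormedSpace ℂ S]
  [FiniteDimensional ℂ S] {om : ι → (ι → ℝ) → Module.End ℂ S}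

theorem endOfClm_sum_mul (a : ι → ℝ) (x : ι → ℝ) (F : S →L[ℂ] S) :
    endOfClm ((∑ A, ((a A : ℝ) : ℂ) • clm (om A x)) * F) = ∑ A, a A • (om A x * endOfClm F) := by
  rw [Finset.sum_mul, map_sum]
  refine Finset.sum_congr rfl fun A _ => ?_
  rw [real_smul_end]
  ext v
  simp [clm]

theorem endOfClm_mul_sum (a : ι → ℝ) (x : ι → ℝ) (F : S →L[ℂ] S) :
    endOfClm (F * (∑ A, ((a A : ℝ) : ℂ) • clm (om A x))) = ∑ A, a A • (endOfClm F * om A x) := by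
  rw [Finset.mul_sum, map_sum]
  refine Finset.sum_congr rfl fun A _ => ?_
  rw [real_smul_end]
  ext v
  simp [clm]

/-- A space of endomorphisms that is stable under left multiplication with the connection form is
stable under left multiplication with the transports. -/
theorem IsTransport.mul_mem (hom : ∀ A v, ContDiff ℝ ∞ fun x => om A x v)
    {W : Submodule ℝ (Module.End ℂ S)} (hW : ∀ A x, ∀ w ∈ W, om A x * w ∈ W) {x y : ι → ℝ}
    {T : Module.End ℂ S} (hT : IsTransport om x y T) : ∀ R ∈ W, T * R ∈ W := by
  have hfin : FiniteDimensional ℝ (S →L[ℂ] S) := FiniteDimensional.trans ℝ ℂ _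
  induction hT with
  | path c hc P hP =>
    intro R hR
    obtain ⟨U, hU0, hU1, hU⟩ := transport_eq_fundamental hom hc hP
    have hb := continuous_clm_sum hom hc.continuous (hc.continuous_deriv le_rfl)
    have h := linearODE_mem (a := fun t => -(ContinuousLinearMap.mul ℝ (S →L[ℂ] S)
        (∑ A, ((deriv c t A : ℝ) : ℂ) • clm (om A (c t)))))
      ((ContinuousLinearMap.mul ℝ (S →L[ℂ] S)).continuous.comp hb).neg (W.comap endOfClm)
      (fun t w hw => by
        have h1 := endOfClm_sum_mul (om := om) (deriv c t) (c t) w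
        rw [Submodule.mem_comap] at hw ⊢
        rw [_root_.neg_apply, ContinuousLinearMap.mul_apply', map_neg, h1]
        exact W.neg_mem (W.sum_mem fun A _ => W.smul_mem _ (hW A _ _ hw)))
      (u := fun t => U t * clm R)
      (fun t => ((hU t).mul_const (clm R)).congr_deriv (by
        rw [_root_.neg_apply, ContinuousLinearMap.mul_apply', neg_mul, mul_assoc]))
      (by rw [hU0, one_mul]; exact hR) 1
    rw [hU1] at h
    exact h
  | trans _ _ ih1 ih2 =>
    intro R hR
    rw [mul_assoc]
    exact ih2 _ (ih1 R hR)

/-- Transports intertwine a space `W` of endomorphisms with itself if the connection form acts on `W`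
by commutators. -/
theorem IsTransport.normalises (hom : ∀ A v, ContDiff ℝ ∞ fun x => om A x v)
    {W : Submodule ℝ (Module.End ℂ S)} (hW : ∀ A x, ∀ w ∈ W, om A x * w - w * om A x ∈ W)
    {x y : ι → ℝ} {T : Module.End ℂ S} (hT : IsTransport om x y T) :
    ∀ w ∈ W, ∃ w' ∈ W, T * w = w' * T := by
  have hfin : FiniteDimensional ℝ (S →L[ℂ] S) := FiniteDimensional.trans ℝ ℂ _
  have hcomp : CompleteSpace S := FiniteDimensional.complete ℂ S
  induction hT with
  | path c hc P hP =>
    intro w hw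
    obtain ⟨U, hU0, hU1, hU⟩ := transport_eq_fundamental hom hc hP
    have hb := continuous_clm_sum hom hc.continuous (hc.continuous_deriv le_rfl)
    set b : ℝ → S →L[ℂ] S := fun t => ∑ A, ((deriv c t A : ℝ) : ℂ) • clm (om A (c t)) with hbdef
    -- the solution of `Z' = -[b, Z]` stays in `W` and intertwines
    have hcZ : Continuous fun t => -(ContinuousLinearMap.mul ℝ (S →L[ℂ] S) (b t)) +
        (ContinuousLinearMap.mul ℝ (S →L[ℂ] S)).flip (b t) :=
      ((ContinuousLinearMap.mul ℝ (S →L[ℂ] S)).continuous.comp hb).neg.add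
        ((ContinuousLinearMap.mul ℝ (S →L[ℂ] S)).flip.continuous.comp hb)
    obtain ⟨Z, hZ0, hZ⟩ := exists_linearODE_solution hcZ (clm w)
    have hmem := linearODE_mem hcZ (W.comap endOfClm) (fun t z hz => by
        have h1 := endOfClm_sum_mul (om := om) (deriv c t) (c t) z
        have h2 := endOfClm_mul_sum (om := om) (deriv c t) (c t) z
        rw [Submodule.mem_comap] at hz ⊢
        rw [_root_.add_apply, _root_.neg_apply, ContinuousLinearMap.mul_apply',
          ContinuousLinearMap.flip_apply, ContinuousLinearMap.mul_apply', map_add, map_neg, h1, h2,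
          neg_add_eq_sub, ← neg_sub, ← Finset.sum_sub_distrib]
        simp only [← smul_sub]
        exact W.neg_mem (W.sum_mem fun A _ => W.smul_mem _ (hW A _ _ hz))) hZ
      (by rw [hZ0]; exact hw) 1
    have heq := linearODE_unique (a := fun t => -(ContinuousLinearMap.mul ℝ (S →L[ℂ] S) (b t)))
      ((ContinuousLinearMap.mul ℝ (S →L[ℂ] S)).continuous.comp hb).neg
      (u := fun t => U t * clm w) (v := fun t => Z t * U t)
      (fun t => ((hU t).mul_const (clm w)).congr_deriv (by
        rw [_root_.neg_apply, ContinuousLinearMap.mul_apply', neg_mul, mul_assoc]))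
      (fun t => by
        refine ((hZ t).mul (hU t)).congr_deriv ?_
        rw [_root_.add_apply, _root_.neg_apply, ContinuousLinearMap.mul_apply',
          ContinuousLinearMap.flip_apply, ContinuousLinearMap.mul_apply', _root_.neg_apply,
          ContinuousLinearMap.mul_apply']
        noncomm_ring)
      (by simp [hU0, hZ0])
    refine ⟨endOfClm (Z 1), hmem, ?_⟩
    have h := congrArg endOfClm (congrFun heq 1)
    simp only [hU1] at h
    exact h
  | trans _ _ ih1 ih2 =>
    intro w hw
    obtain ⟨w1, hw1, h1⟩ := ih1 w hw
    obtain ⟨w2, hw2, h2⟩ := ih2 w1 hw1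
    exact ⟨w2, hw2, by rw [mul_assoc, h1, ← mul_assoc, h2, mul_assoc]⟩

/-- Determinants of transports have modulus one if the traces of the connection form are imaginary,
and are equal to one if these traces vanish. -/
theorem IsTransport.det (hom : ∀ A v, ContDiff ℝ ∞ fun x => om A x v)
    (htr : ∀ A x, (LinearMap.trace ℂ S (om A x)).re = 0) {x y : ι → ℝ} {T : Module.End ℂ S}
    (hT : IsTransport om x y T) : Complex.normSq (LinearMap.det T) = 1 ∧
      ((∀ A x, LinearMap.trace ℂ S (om A x) = 0) → LinearMap.det T = 1) := by
  have hcomp : CompleteSpace S := FiniteDimensional.complete ℂ S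
  induction hT with
  | path c hc P hP =>
    obtain ⟨U, hU0, hU1, hU⟩ := transport_eq_fundamental hom hc hP
    have hb := continuous_clm_sum hom hc.continuous (hc.continuous_deriv le_rfl)
    obtain ⟨V, -, -, hV1, hV2⟩ := exists_inverse_fundamental hb hU0 hU
    have htrace : ∀ t, LinearMap.trace ℂ S ((-∑ A, ((deriv c t A : ℝ) : ℂ) • clm (om A (c t)) :
        S →L[ℂ] S) : S →ₗ[ℂ] S) = -∑ A, ((deriv c t A : ℝ) : ℂ) * LinearMap.trace ℂ S (om A (c t)) := by
      intro t
      have h := endOfClm_sum_mul (om := om) (deriv c t) (c t) 1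
      rw [mul_one] at h
      simp only [endOfClm_apply] at h
      rw [ContinuousLinearMap.toLinearMap_neg, h, map_neg, map_sum]
      congr 1
      refine Finset.sum_congr rfl fun A _ => ?_
      rw [real_smul_end, map_smul, smul_eq_mul]
      congr 2
    have hD : ∀ t, HasDerivAt (fun s => LinearMap.det (U s : S →ₗ[ℂ] S))
        ((-∑ A, ((deriv c t A : ℝ) : ℂ) * LinearMap.trace ℂ S (om A (c t))) *
          LinearMap.det (U t : S →ₗ[ℂ] S)) t := fun t => by
      rw [← htrace]
      exact hasDerivAt_det ((hU t).congr_deriv (by rw [neg_mul])) (hV2 t) (hV1 t)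
    have h0 : LinearMap.det (U 0 : S →ₗ[ℂ] S) = 1 := by
      rw [hU0]; exact LinearMap.det_id
    have h1 : LinearMap.det (U 1 : S →ₗ[ℂ] S) = LinearMap.det P := by
      rw [hU1]; rfl
    refine ⟨?_, fun hz => ?_⟩
    · have hn : ∀ t, HasDerivAt (fun s => Complex.normSq (LinearMap.det (U s : S →ₗ[ℂ] S))) 0 t :=
        fun t => hasDerivAt_norm_sq_eq_zero (by simp [htr]) (hD t)
      have := is_const_of_deriv_eq_zero (fun t => (hn t).differentiableAt)
        (fun t => (hn t).deriv) 1 0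
      simpa [h0, h1] using this
    · have hn : ∀ t, HasDerivAt (fun s => LinearMap.det (U s : S →ₗ[ℂ] S)) 0 t :=
        fun t => (hD t).congr_deriv (by simp [hz])
      have := is_const_of_deriv_eq_zero (fun t => (hn t).differentiableAt)
        (fun t => (hn t).deriv) 1 0
      simpa [h0, h1] using this
  | trans _ _ ih1 ih2 =>
    refine ⟨?_, fun hz => ?_⟩
    · rw [map_mul, map_mul, ih1.1, ih2.1, one_mul]
    · rw [map_mul, ih1.2 hz, ih2.2 hz, one_mul]

/-- If the connection acts on the image of `Q` by the scalars `∂_A (ln r)`, then so does the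
transport, by the quotient of the values of `r`. -/
theorem IsTransport.scalar (hom : ∀ A v, ContDiff ℝ ∞ fun x => om A x v) {Q : Module.End ℂ S}
    {r : (ι → ℝ) → ℝ} (hr : ContDiff ℝ 1 r) (hr0 : ∀ x, r x ≠ 0)
    (hQ : ∀ (x w : ι → ℝ), ∑ A, w A • (om A x * Q) = (fderiv ℝ r x w / r x) • Q)
    {x y : ι → ℝ} {T : Module.End ℂ S} (hT : IsTransport om x y T) :
    T * Q = (r x / r y) • Q := by
  induction hT with
  | path c hc P hP =>
    obtain ⟨U, hU0, hU1, hU⟩ := transport_eq_fundamental hom hc hP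
    have hb := continuous_clm_sum hom hc.continuous (hc.continuous_deriv le_rfl)
    have heq := linearODE_unique (a := fun t => -(ContinuousLinearMap.mul ℝ (S →L[ℂ] S)
        (∑ A, ((deriv c t A : ℝ) : ℂ) • clm (om A (c t)))))
      ((ContinuousLinearMap.mul ℝ (S →L[ℂ] S)).continuous.comp hb).neg
      (u := fun t => U t * clm Q) (v := fun t => (r (c 0) / r (c t)) • clm Q)
      (fun t => ((hU t).mul_const (clm Q)).congr_deriv (by
        rw [_root_.neg_apply, ContinuousLinearMap.mul_apply', neg_mul, mul_assoc]))
      (fun t => by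
        have hc1 : HasDerivAt c (deriv c t) t :=
          (hc.differentiable one_ne_zero t).hasDerivAt
        have hrc := (hr.differentiable one_ne_zero (c t)).hasFDerivAt.comp_hasDerivAt t hc1
        have h1 := ((hasDerivAt_const t (r (c 0))).div hrc (hr0 _)).smul_const (clm Q)
        refine h1.congr_deriv ?_
        have h2 : (∑ A, ((deriv c t A : ℝ) : ℂ) • clm (om A (c t))) * clm Q =
            (fderiv ℝ r (c t) (deriv c t) / r (c t)) • clm Q := by
          have h3 := endOfClm_sum_mul (om := om) (deriv c t) (c t) (clm Q)
          have h4 : endOfClm (clm Q) = Q := rfl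
          rw [h4, hQ] at h3
          have h5 := congrArg clm h3
          rw [clm_endOfClm] at h5
          exact h5
        rw [_root_.neg_apply, ContinuousLinearMap.mul_apply', mul_smul_comm, h2, smul_smul,
          ← neg_smul]
        congr 1
        have := hr0 (c t)
        simp only [Function.comp_apply]
        field_simp
        ring)
      (by rw [hU0, one_mul, div_self (hr0 _), one_smul])
    have h := congrArg endOfClm (congrFun heq 1)
    simp only [hU1] at h
    exact h
  | @trans x y z P Q' _ _ ih1 ih2 =>
    rw [mul_assoc, ih1, mul_smul_comm, ih2, smul_smul]
    congr 1
    have := hr0 y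
    have := hr0 z
    field_simp

end TransportInvariants

end Brane

/-! ### The spin Lie algebra inside the Clifford algebra -/

namespace Brane

section SpinAlgebra

variable {d : ℕ}

theorem ι_mul_ι_add_swap' (u v : Fin d → ℝ) :
    CliffordAlgebra.ι (negForm d) u * CliffordAlgebra.ι (negForm d) v +
      CliffordAlgebra.ι (negForm d) v * CliffordAlgebra.ι (negForm d) u =
      (-2 * (u ⬝ᵥ v)) • (1 : Cl d) := by
  rw [CliffordAlgebra.ι_mul_ι_add_swap, Algebra.algebraMap_eq_smul_one]
  congr 1
  rw [QuadraticMap.polar]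
  simp only [negForm, QuadraticMap.weightedSumSquares_apply, dotProduct, Finset.mul_sum,
    ← Finset.sum_sub_distrib]
  refine Finset.sum_congr rfl fun i _ => ?_
  simp only [Pi.add_apply, smul_eq_mul]
  ring

theorem ι_sq (u : Fin d → ℝ) :
    CliffordAlgebra.ι (negForm d) u * CliffordAlgebra.ι (negForm d) u = (-(u ⬝ᵥ u)) • (1 : Cl d) := by
  rw [CliffordAlgebra.ι_sq_scalar, Algebra.algebraMap_eq_smul_one]
  congr 1
  simp [negForm, QuadraticMap.weightedSumSquares_apply, dotProduct]

/-- The skew-symmetric matrix `u vᵀ - v uᵀ`. -/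
def wedgeMat (u v : Fin d → ℝ) : Matrix (Fin d) (Fin d) ℝ :=
  Matrix.vecMulVec u v - Matrix.vecMulVec v u

theorem wedgeMat_apply (u v : Fin d → ℝ) (i j : Fin d) :
    wedgeMat u v i j = u i * v j - v i * u j := rfl

theorem wedgeMat_transpose (u v : Fin d → ℝ) : (wedgeMat u v).transpose = -wedgeMat u v := by
  ext i j
  simp only [Matrix.transpose_apply, Matrix.neg_apply, wedgeMat_apply]
  ring

theorem wedgeMat_mem (u v : Fin d → ℝ) :
    wedgeMat u v ∈ LieAlgebra.Orthogonal.so (Fin d) ℝ := by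
  rw [LieAlgebra.Orthogonal.mem_so]
  exact wedgeMat_transpose u v

theorem spinEl_add (M N : Matrix (Fin d) (Fin d) ℝ) : spinEl (M + N) = spinEl M + spinEl N := by
  simp only [spinEl, Matrix.add_apply, add_smul, Finset.sum_add_distrib, smul_add]

theorem spinEl_smul (r : ℝ) (M : Matrix (Fin d) (Fin d) ℝ) : spinEl (r • M) = r • spinEl M := by
  simp only [spinEl, Matrix.smul_apply, smul_eq_mul, mul_smul, ← Finset.smul_sum]
  rw [smul_comm]

/-- The linear map `M ↦ -¼ ∑ M_ij e_i e_j` into the Clifford algebra. -/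
noncomputable def spinElₗ : Matrix (Fin d) (Fin d) ℝ →ₗ[ℝ] Cl d where
  toFun := spinEl
  map_add' := spinEl_add
  map_smul' := spinEl_smul

/-- The commutator with a spin element acts on vectors by the matrix. -/
theorem spinEl_comm_gen {M : Matrix (Fin d) (Fin d) ℝ} (hM : M.transpose = -M) (k : Fin d) :
    spinEl M * gen k - gen k * spinEl M = ∑ i, M i k • gen i := by
  have hskew : ∀ i, M k i = -M i k := fun i => by
    have := congrFun (congrFun hM i) k
    simpa using this
  have h : ∀ i j : Fin d, gen i * gen j * gen k - gen k * (gen i * gen j) =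
      (if j = k then (-2 : ℝ) • gen i else 0) - if i = k then (-2 : ℝ) • gen j else 0 := by
    have h0 : ∀ i : Fin d, gen i * gen k + gen k * gen i = if i = k then (-2 : ℝ) • 1 else 0 := by
      intro i
      split_ifs with hik
      · subst hik
        rw [gen_sq]; module
      · rw [gen_anticomm hik, neg_add_cancel]
    intro i j
    have h1 := congrArg (gen i * ·) (h0 j)
    have h2 := congrArg (· * gen j) (h0 i)
    simp only [mul_add, add_mul, mul_ite, ite_mul, mul_smul_comm, smul_mul_assoc, mul_one, one_mul,
      mul_zero, zero_mul] at h1 h2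
    rw [← h1, ← h2]
    noncomm_ring
  rw [spinEl, smul_mul_assoc, mul_smul_comm, ← smul_sub, Finset.sum_mul, Finset.mul_sum,
    ← Finset.sum_sub_distrib]
  simp only [Finset.sum_mul, Finset.mul_sum, ← Finset.sum_sub_distrib, smul_mul_assoc,
    mul_smul_comm, ← smul_sub, h]
  simp only [smul_sub, Finset.sum_sub_distrib, smul_ite, smul_zero, Finset.sum_ite_eq',
    Finset.mem_univ, if_true]
  rw [Finset.sum_comm]
  simp only [Finset.sum_ite_eq', Finset.mem_univ, if_true]
  rw [← smul_sub, ← Finset.sum_sub_distrib, Finset.smul_sum]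
  refine Finset.sum_congr rfl fun i _ => ?_
  rw [hskew]
  module

/-- `M ↦ spinEl M` is a homomorphism of Lie algebras on skew-symmetric matrices. -/
theorem spinEl_lie {M N : Matrix (Fin d) (Fin d) ℝ} (hM : M.transpose = -M) :
    spinEl M * spinEl N - spinEl N * spinEl M = spinEl (M * N - N * M) := by
  have hskew : ∀ i k, M k i = -M i k := fun i k => by
    have := congrFun (congrFun hM i) k
    simpa using this
  have h : ∀ k l : Fin d, spinEl M * (gen k * gen l) - gen k * gen l * spinEl M =
      ∑ i, (M i k • (gen i * gen l) + M i l • (gen k * gen i)) := by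
    intro k l
    have h1 := congrArg (· * gen l) (spinEl_comm_gen hM k)
    have h2 := congrArg (gen k * ·) (spinEl_comm_gen hM l)
    simp only [Finset.sum_mul, Finset.mul_sum, smul_mul_assoc, mul_smul_comm] at h1 h2
    rw [Finset.sum_add_distrib, ← h1, ← h2]
    noncomm_ring
  have hL : spinEl M * spinEl N - spinEl N * spinEl M =
      (-(1 / 4) : ℝ) • ∑ k, ∑ l, N k l • ∑ i, (M i k • (gen i * gen l) + M i l • (gen k * gen i)) := by
    rw [show spinEl N = (-(1 / 4) : ℝ) • ∑ k, ∑ l, N k l • (gen k * gen l) from rfl, mul_smul_comm,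
      smul_mul_assoc, ← smul_sub]
    rw [Finset.mul_sum, Finset.sum_mul, ← Finset.sum_sub_distrib]
    congr 1
    refine Finset.sum_congr rfl fun k _ => ?_
    rw [Finset.mul_sum, Finset.sum_mul, ← Finset.sum_sub_distrib]
    refine Finset.sum_congr rfl fun l _ => ?_
    rw [← h, mul_smul_comm, smul_mul_assoc, ← smul_sub]
  rw [hL, spinEl]
  congr 1
  simp only [Matrix.sub_apply, Matrix.mul_apply, sub_smul, Finset.sum_smul, Finset.sum_sub_distrib,
    smul_add, Finset.sum_add_distrib, Finset.smul_sum, smul_smul]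
  rw [sub_eq_add_neg]
  congr 1
  · rw [Finset.sum_comm]
    rw [Finset.sum_congr rfl fun l _ => Finset.sum_comm]
    rw [Finset.sum_comm]
    simp only [mul_comm]
  · rw [← Finset.sum_neg_distrib]
    refine Finset.sum_congr rfl fun k _ => ?_
    rw [Finset.sum_comm, ← Finset.sum_neg_distrib]
    refine Finset.sum_congr rfl fun i _ => ?_
    rw [← Finset.sum_neg_distrib]
    refine Finset.sum_congr rfl fun l _ => ?_
    rw [hskew i l, mul_neg, neg_smul, neg_neg]

theorem spinEl_wedgeMat (u v : Fin d → ℝ) :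
    spinEl (wedgeMat u v) = (-(1 / 4) : ℝ) • (CliffordAlgebra.ι (negForm d) u *
      CliffordAlgebra.ι (negForm d) v - CliffordAlgebra.ι (negForm d) v *
      CliffordAlgebra.ι (negForm d) u) := by
  rw [spinEl]
  congr 1
  simp only [ι_eq_sum, Finset.sum_mul_sum, wedgeMat_apply, sub_smul, Finset.sum_sub_distrib,
    smul_mul_smul_comm]

theorem ι_mul_ι_eq (u v : Fin d → ℝ) :
    CliffordAlgebra.ι (negForm d) u * CliffordAlgebra.ι (negForm d) v =
      (-2 : ℝ) • spinEl (wedgeMat u v) - (u ⬝ᵥ v) • (1 : Cl d) := by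
  have h := ι_mul_ι_add_swap' u v
  rw [spinEl_wedgeMat, smul_smul, eq_sub_of_add_eq' h]
  module

theorem spinEl_reverse {M : Matrix (Fin d) (Fin d) ℝ} (hM : M.transpose = -M) :
    CliffordAlgebra.reverse (spinEl M) = -spinEl M := by
  have hskew : ∀ i k, M k i = -M i k := fun i k => by
    have := congrFun (congrFun hM i) k
    simpa using this
  rw [spinEl, map_smul, map_sum, ← smul_neg, ← Finset.sum_neg_distrib]
  simp only [map_sum, map_smul, CliffordAlgebra.reverse.map_mul, gen, CliffordAlgebra.reverse_ι]
  rw [Finset.sum_comm]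
  congr 1
  refine Finset.sum_congr rfl fun i _ => ?_
  rw [← Finset.sum_neg_distrib]
  refine Finset.sum_congr rfl fun j _ => ?_
  rw [hskew, neg_smul]

end SpinAlgebra

end Brane

/-! ### The Lie algebra `φ(𝔰𝔬(d)) ⋉ V` -/

namespace Brane

namespace Data

variable {p d : ℕ} {S : Type*} [NormedAddCommGroup S] [NormedSpace ℂ S] {B : Data p d S}

namespace IsBrane

/-- The representation of the Clifford algebra of the transversal space on the spinors. -/
noncomputable abbrev ρ (hB : B.IsBrane) : Cl d →ₐ[ℝ] Module.End ℂ S := rep hB.space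

theorem proj_eq (_ : B.IsBrane) :
    B.proj = (1 / 2 : ℂ) • (1 - (((B.δ₁ : ℤ) : ℂ) * B.ε) • vol fun i => B.γ (Sum.inr i)) := rfl

theorem invol_sq (hB : B.IsBrane) :
    ((((B.δ₁ : ℤ) : ℂ) * B.ε) • B.gvol) * ((((B.δ₁ : ℤ) : ℂ) * B.ε) • B.gvol) = 1 := by
  have h := hB.eps_sq
  rw [smul_mul_smul_comm] at h ⊢
  rw [mul_mul_mul_comm, unit_sq, one_mul, h]

theorem proj_mul_self (hB : B.IsBrane) : B.proj * B.proj = B.proj := by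
  have h := hB.invol_sq
  rw [proj]
  set w := (((B.δ₁ : ℤ) : ℂ) * B.ε) • B.gvol
  rw [smul_mul_smul_comm, sub_mul, mul_sub, mul_sub, h, mul_one, mul_one, one_mul]
  module

theorem compl_mul_compl (hB : B.IsBrane) : (1 - B.proj) * (1 - B.proj) = 1 - B.proj := by
  rw [sub_mul, mul_sub, mul_sub, hB.proj_mul_self]
  noncomm_ring

theorem proj_mul_compl (hB : B.IsBrane) : B.proj * (1 - B.proj) = 0 := by
  rw [mul_sub, hB.proj_mul_self]; noncomm_ring

theorem even_mul_proj (hB : B.IsBrane) {x : Cl d}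
    (hx : x ∈ CliffordAlgebra.evenOdd (negForm d) 0) : hB.ρ x * B.proj = B.proj * hB.ρ x := by
  have h := vol_mul_rep_even hB.space hx
  rw [hB.proj_eq, mul_smul_comm, smul_mul_assoc, mul_sub, sub_mul, mul_smul_comm, smul_mul_assoc, h,
    mul_one, one_mul]

theorem gamma_odd_gvol (hB : B.IsBrane) (μ : Fin (p + 1)) {x : Cl d}
    (hx : x ∈ CliffordAlgebra.evenOdd (negForm d) 1) :
    B.gvol * (B.γ (Sum.inl μ) * hB.ρ x) = -(B.γ (Sum.inl μ) * hB.ρ x * B.gvol) := by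
  have h : B.gvol * hB.ρ x = _ := vol_mul_rep_odd hB.space hx
  rw [← mul_assoc, hB.gvol_mul_inl, smul_mul_assoc, mul_assoc, h, show
    (-(-1) ^ d : Module.End ℂ S) = algebraMap ℂ (Module.End ℂ S) (-(-1) ^ d) by simp,
    ← Algebra.smul_def, mul_smul_comm, smul_smul, mul_neg, sign_sq, neg_one_smul, mul_assoc]
  rfl

theorem gamma_odd_mul_proj (hB : B.IsBrane) (μ : Fin (p + 1)) {x : Cl d}
    (hx : x ∈ CliffordAlgebra.evenOdd (negForm d) 1) :
    B.γ (Sum.inl μ) * hB.ρ x * B.proj = (1 - B.proj) * (B.γ (Sum.inl μ) * hB.ρ x) := by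
  rw [proj, mul_smul_comm, mul_sub, sub_mul, smul_mul_assoc, sub_mul, smul_mul_assoc, one_mul,
    hB.gamma_odd_gvol μ hx, mul_smul_comm, mul_one]
  module

/-- The homomorphism `φ(M) = -¼ ∑ M_ij γ_i γ_j Π`. -/
noncomputable def soHom (hB : B.IsBrane) :
    LieAlgebra.Orthogonal.so (Fin d) ℝ →ₗ⁅ℝ⁆ Module.End ℂ S where
  toFun M := hB.ρ (spinEl (M : Matrix (Fin d) (Fin d) ℝ)) * B.proj
  map_add' M N := by
    change hB.ρ (spinEl ((M : Matrix (Fin d) (Fin d) ℝ) + N)) * B.proj = _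
    rw [spinEl_add, map_add, add_mul]
  map_smul' r M := by
    change hB.ρ (spinEl (r • (M : Matrix (Fin d) (Fin d) ℝ))) * B.proj = _
    rw [spinEl_smul, map_smul, smul_mul_assoc, RingHom.id_apply]
  map_lie' := by
    rintro ⟨M, hM⟩ ⟨N, hN⟩
    rw [LieAlgebra.Orthogonal.mem_so] at hM
    simp only [LieSubalgebra.coe_bracket, Ring.lie_def]
    rw [← spinEl_lie hM, map_sub, map_mul, map_mul, sub_mul]
    have h : ∀ M N : Matrix (Fin d) (Fin d) ℝ,
        hB.ρ (spinEl M) * B.proj * (hB.ρ (spinEl N) * B.proj) =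
          hB.ρ (spinEl M) * hB.ρ (spinEl N) * B.proj := fun M N => by
      rw [mul_assoc, ← mul_assoc B.proj, ← hB.even_mul_proj (spinEl_mem_even N), mul_assoc,
        hB.proj_mul_self, mul_assoc]
    rw [h, h]

theorem soHom_apply (hB : B.IsBrane) (M : LieAlgebra.Orthogonal.so (Fin d) ℝ) :
    hB.soHom M = hB.ρ (spinEl (M : Matrix (Fin d) (Fin d) ℝ)) * B.proj := rfl

theorem proj_mul_soHom (hB : B.IsBrane) (M : LieAlgebra.Orthogonal.so (Fin d) ℝ) :
    B.proj * hB.soHom M = hB.soHom M := by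
  rw [soHom_apply, ← mul_assoc, ← hB.even_mul_proj (spinEl_mem_even _), mul_assoc, hB.proj_mul_self]

theorem soHom_mul_proj (hB : B.IsBrane) (M : LieAlgebra.Orthogonal.so (Fin d) ℝ) :
    hB.soHom M * B.proj = hB.soHom M := by
  rw [soHom_apply, mul_assoc, hB.proj_mul_self]

/-- `(b_μ) ↦ ∑ γ_μ b_μ Π` for odd elements `b_μ` of the Clifford algebra of `ℝ^d`. -/
noncomputable def nilMap (hB : B.IsBrane) :
    (Fin (p + 1) → CliffordAlgebra.evenOdd (negForm d) 1) →ₗ[ℝ] Module.End ℂ S where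
  toFun b := ∑ μ, B.γ (Sum.inl μ) * hB.ρ (b μ) * B.proj
  map_add' b c := by
    simp only [Pi.add_apply, Submodule.coe_add, map_add, mul_add, add_mul, Finset.sum_add_distrib]
  map_smul' r b := by
    simp only [Pi.smul_apply, Submodule.coe_smul, map_smul, mul_smul_comm, smul_mul_assoc,
      Finset.smul_sum, RingHom.id_apply]

theorem nilMap_apply (hB : B.IsBrane) (b : Fin (p + 1) → CliffordAlgebra.evenOdd (negForm d) 1) :
    hB.nilMap b = ∑ μ, B.γ (Sum.inl μ) * hB.ρ (b μ) * B.proj := rfl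

/-- The nilpotent part `V` of the holonomy algebra. -/
noncomputable def nil (hB : B.IsBrane) : Submodule ℝ (Module.End ℂ S) := LinearMap.range hB.nilMap

theorem gamma_odd_mem_nil (hB : B.IsBrane) (μ : Fin (p + 1)) {x : Cl d}
    (hx : x ∈ CliffordAlgebra.evenOdd (negForm d) 1) :
    B.γ (Sum.inl μ) * hB.ρ x * B.proj ∈ hB.nil := by
  refine ⟨Pi.single μ ⟨x, hx⟩, ?_⟩
  rw [nilMap_apply, Finset.sum_eq_single μ]
  · simp
  · intro ν _ hν
    simp [hν]
  · simp

theorem nil_induction (hB : B.IsBrane) {W : Submodule ℝ (Module.End ℂ S)}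
    (h : ∀ (μ : Fin (p + 1)) (x : Cl d), x ∈ CliffordAlgebra.evenOdd (negForm d) 1 →
      B.γ (Sum.inl μ) * hB.ρ x * B.proj ∈ W) : hB.nil ≤ W := by
  rintro _ ⟨b, rfl⟩
  rw [nilMap_apply]
  exact W.sum_mem fun μ _ => h μ _ (b μ).2

theorem nil_mul_proj (hB : B.IsBrane) {v : Module.End ℂ S} (hv : v ∈ hB.nil) : v * B.proj = v := by
  obtain ⟨b, rfl⟩ := hv
  rw [nilMap_apply, Finset.sum_mul]
  simp only [mul_assoc, hB.proj_mul_self]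

theorem compl_mul_nil (hB : B.IsBrane) {v : Module.End ℂ S} (hv : v ∈ hB.nil) :
    (1 - B.proj) * v = v := by
  obtain ⟨b, rfl⟩ := hv
  rw [nilMap_apply, Finset.mul_sum]
  refine Finset.sum_congr rfl fun μ _ => ?_
  rw [hB.gamma_odd_mul_proj μ (b μ).2, ← mul_assoc, hB.compl_mul_compl]

theorem proj_mul_nil (hB : B.IsBrane) {v : Module.End ℂ S} (hv : v ∈ hB.nil) : B.proj * v = 0 := by
  rw [← hB.compl_mul_nil hv, ← mul_assoc, hB.proj_mul_compl, zero_mul]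

theorem nil_mul_even (hB : B.IsBrane) {v : Module.End ℂ S} (hv : v ∈ hB.nil) {x : Cl d}
    (hx : x ∈ CliffordAlgebra.evenOdd (negForm d) 0) : v * hB.ρ x ∈ hB.nil := by
  obtain ⟨b, rfl⟩ := hv
  rw [nilMap_apply, Finset.sum_mul]
  refine Submodule.sum_mem _ fun μ _ => ?_
  rw [mul_assoc, ← hB.even_mul_proj hx, ← mul_assoc, mul_assoc (B.γ _), ← map_mul]
  refine hB.gamma_odd_mem_nil μ ?_
  simpa using mul_mem_evenOdd (b μ).2 hx

theorem nil_mul_nil (hB : B.IsBrane) {v w : Module.End ℂ S} (hv : v ∈ hB.nil) (hw : w ∈ hB.nil) :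
    v * w = 0 := by
  rw [← hB.nil_mul_proj hv, mul_assoc, hB.proj_mul_nil hw, mul_zero]

theorem soHom_mul_nil (hB : B.IsBrane) (M : LieAlgebra.Orthogonal.so (Fin d) ℝ)
    {v : Module.End ℂ S} (hv : v ∈ hB.nil) : hB.soHom M * v = 0 := by
  rw [← hB.soHom_mul_proj, mul_assoc, hB.proj_mul_nil hv, mul_zero]

theorem nil_mul_soHom (hB : B.IsBrane) (M : LieAlgebra.Orthogonal.so (Fin d) ℝ)
    {v : Module.End ℂ S} (hv : v ∈ hB.nil) :
    v * hB.soHom M = v * hB.ρ (spinEl (M : Matrix (Fin d) (Fin d) ℝ)) := by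
  rw [soHom_apply, hB.even_mul_proj (spinEl_mem_even _), ← mul_assoc, hB.nil_mul_proj hv]

theorem lie_nil_mem (hB : B.IsBrane) (M : LieAlgebra.Orthogonal.so (Fin d) ℝ)
    {v : Module.End ℂ S} (hv : v ∈ hB.nil) : hB.soHom M * v - v * hB.soHom M ∈ hB.nil := by
  rw [hB.soHom_mul_nil M hv, zero_sub, hB.nil_mul_soHom M hv]
  exact hB.nil.neg_mem (hB.nil_mul_even hv (spinEl_mem_even _))

theorem disjoint_soHom_nil (hB : B.IsBrane) :
    Disjoint hB.soHom.range.toSubmodule hB.nil := by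
  rw [Submodule.disjoint_def]
  rintro _ ⟨M, rfl⟩ h
  have h1 := hB.proj_mul_nil h
  exact (hB.proj_mul_soHom M).symm.trans h1

/-- The semidirect sum `φ(𝔰𝔬(d)) ⋉ V`. -/
noncomputable def holo (hB : B.IsBrane) : Submodule ℝ (Module.End ℂ S) :=
  hB.soHom.range.toSubmodule ⊔ hB.nil

theorem soHom_mem_holo (hB : B.IsBrane) (M : LieAlgebra.Orthogonal.so (Fin d) ℝ) :
    hB.soHom M ∈ hB.holo := Submodule.mem_sup_left ⟨M, rfl⟩

theorem nil_le_holo (hB : B.IsBrane) : hB.nil ≤ hB.holo := le_sup_right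

theorem mem_holo (hB : B.IsBrane) {x : Module.End ℂ S} :
    x ∈ hB.holo ↔ ∃ M, ∃ v ∈ hB.nil, x = hB.soHom M + v := by
  rw [holo, Submodule.mem_sup]
  constructor
  · rintro ⟨_, ⟨M, rfl⟩, v, hv, rfl⟩
    exact ⟨M, v, hv, rfl⟩
  · rintro ⟨M, v, hv, rfl⟩
    exact ⟨_, ⟨M, rfl⟩, v, hv, rfl⟩

/-- The commutator of two elements: `V` is an abelian ideal. -/
theorem holo_lie (hB : B.IsBrane) {x y : Module.End ℂ S} (hx : x ∈ hB.holo) (hy : y ∈ hB.holo) :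
    x * y - y * x ∈ hB.holo := by
  obtain ⟨M, v, hv, rfl⟩ := hB.mem_holo.mp hx
  obtain ⟨N, w, hw, rfl⟩ := hB.mem_holo.mp hy
  have h : (hB.soHom M + v) * (hB.soHom N + w) - (hB.soHom N + w) * (hB.soHom M + v) =
      hB.soHom ⁅M, N⁆ + ((hB.soHom M * w - w * hB.soHom M) - (hB.soHom N * v - v * hB.soHom N) +
        (v * w - w * v)) := by
    rw [LieHom.map_lie, Ring.lie_def]
    noncomm_ring
  rw [h]
  refine hB.holo.add_mem (hB.soHom_mem_holo _) (hB.nil_le_holo (hB.nil.add_mem (hB.nil.sub_mem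
    (hB.lie_nil_mem M hw) (hB.lie_nil_mem N hv)) ?_))
  rw [hB.nil_mul_nil hv hw, hB.nil_mul_nil hw hv, sub_zero]
  exact hB.nil.zero_mem

/-- The semidirect sum as a Lie algebra. -/
noncomputable def holoLie (hB : B.IsBrane) : LieSubalgebra ℝ (Module.End ℂ S) where
  toSubmodule := hB.holo
  lie_mem' := by
    intro x y hx hy
    exact hB.holo_lie hx hy

end IsBrane

end Data

end Brane

namespace Brane

namespace Data

variable {p d : ℕ} {S : Type*} [NormedAddCommGroup S] [NormedSpace ℂ S] {B : Data p d S}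
  [FiniteDimensional ℂ S]

namespace IsBrane

/-! ### Traces -/

theorem trace_gvol (hB : B.IsBrane) : LinearMap.trace ℂ S B.gvol = 0 := by
  rcases Nat.even_or_odd d with hd | hd
  · have h : B.gvol = hB.ρ (mon Finset.univ) := (rep_volCl hB.space).symm
    rw [h]
    have hne : (Finset.univ : Finset (Fin d)) ≠ ∅ := by
      have : 0 < d := by have := hB.two_le; omega
      have : Nonempty (Fin d) := ⟨⟨0, this⟩⟩
      exact Finset.univ_nonempty.ne_empty
    exact trace_rep_mon_even hB.space hne (by simpa using hd)
  · refine trace_eq_zero_of_anticomm (y := B.γ (Sum.inl 0))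
      (c := ((-eta (Sum.inl 0 : Idx p d) : ℝ) : ℂ)) ?_ (hB.sq _) ?_
    · exact_mod_cast neg_ne_zero.mpr (eta_ne_zero _)
    · rw [hB.gvol_mul_inl, hd.neg_one_pow, neg_one_smul, neg_neg]

theorem trace_proj (hB : B.IsBrane) :
    LinearMap.trace ℂ S B.proj = (2 : ℂ) ^ ((p + 1 + d) / 2) / 2 := by
  rw [proj, map_smul, map_sub, map_smul, hB.trace_gvol, LinearMap.trace_one, hB.dim]
  simp
  ring

theorem trace_proj_ne_zero (hB : B.IsBrane) : LinearMap.trace ℂ S B.proj ≠ 0 := by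
  rw [hB.trace_proj]
  exact div_ne_zero (pow_ne_zero _ two_ne_zero) two_ne_zero

/-- On `Π(S)` the even monomials other than `1` and `γ^{[d]}` are trace free. -/
theorem trace_mon_proj (hB : B.IsBrane) {I : Finset (Fin d)} (h0 : I ≠ ∅) (h1 : I ≠ Finset.univ)
    (hI : Even I.card) : LinearMap.trace ℂ S (hB.ρ (mon I) * B.proj) = 0 := by
  have hc : LinearMap.trace ℂ S (hB.ρ (mon Iᶜ)) = 0 := by
    rcases Nat.even_or_odd Iᶜ.card with h | h
    · exact trace_rep_mon_even hB.space (by simpa using h1) h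
    · exact trace_rep_mon_odd hB.space (by simpa using h0) h
  have hg : LinearMap.trace ℂ S (hB.ρ (mon I) * B.gvol) = 0 := by
    rw [show B.gvol = hB.ρ (volCl d) from (rep_volCl hB.space).symm, ← map_mul]
    rcases volCl_mul_mon I with h | h
    · rw [h, hc]
    · rw [h, map_neg, map_neg, hc, neg_zero]
  rw [proj, mul_smul_comm, mul_sub, mul_one, mul_smul_comm, map_smul, map_sub, map_smul, hg,
    trace_rep_mon_even hB.space h0 hI]
  simp

/-- On `Π(S)` the matrix `γ^{[d]}` is a scalar. -/
theorem gvol_mul_proj (hB : B.IsBrane) :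
    B.gvol * B.proj = (-(((B.δ₁ : ℤ) : ℂ) * B.ε)⁻¹) • B.proj := by
  have h := hB.invol_sq
  have hδ : (((B.δ₁ : ℤ) : ℂ) * B.ε) ≠ 0 := by
    refine mul_ne_zero ?_ hB.eps_ne_zero
    intro h0
    have := unit_sq B.δ₁
    rw [h0] at this
    simp at this
  set a := (((B.δ₁ : ℤ) : ℂ) * B.ε)
  have h2 : (a • B.gvol) * B.proj = -B.proj := by
    rw [proj, mul_smul_comm, mul_sub, h, mul_one]
    module
  rw [smul_mul_assoc] at h2
  have h3 := congrArg (a⁻¹ • ·) h2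
  simp only [smul_smul, inv_mul_cancel₀ hδ, one_smul] at h3
  rw [h3, smul_neg, neg_smul]

theorem trace_nil (hB : B.IsBrane) {v : Module.End ℂ S} (hv : v ∈ hB.nil) :
    LinearMap.trace ℂ S v = 0 := by
  rw [← hB.nil_mul_proj hv, LinearMap.trace_mul_comm, hB.proj_mul_nil hv, map_zero]

theorem soHom_eq_sum (hB : B.IsBrane) (M : LieAlgebra.Orthogonal.so (Fin d) ℝ) :
    hB.soHom M = (-(1 / 4) : ℝ) • ∑ i, ∑ j, (M : Matrix (Fin d) (Fin d) ℝ) i j •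
      (hB.ρ (gen i * gen j) * B.proj) := by
  rw [soHom_apply, spinEl, map_smul, map_sum, smul_mul_assoc, Finset.sum_mul]
  simp only [map_sum, Finset.sum_mul, map_smul, smul_mul_assoc]

theorem so_diag (M : LieAlgebra.Orthogonal.so (Fin d) ℝ) (i : Fin d) :
    (M : Matrix (Fin d) (Fin d) ℝ) i i = 0 := by
  have h := congrFun (congrFun ((LieAlgebra.Orthogonal.mem_so (Fin d) ℝ _).mp M.2) i) i
  simp only [Matrix.transpose_apply, Matrix.neg_apply] at h
  linarith

/-- For `d ≥ 3` no bivector is a multiple of `1` or `γ^{[d]}`, so that `φ(M)` is trace free. -/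
theorem trace_soHom (hB : B.IsBrane) (hd : 3 ≤ d) (M : LieAlgebra.Orthogonal.so (Fin d) ℝ) :
    LinearMap.trace ℂ S (hB.soHom M) = 0 := by
  rw [hB.soHom_eq_sum, real_smul_end, map_smul, map_sum]
  refine smul_eq_zero_of_right _ (Finset.sum_eq_zero fun i _ => ?_)
  rw [map_sum]
  refine Finset.sum_eq_zero fun j _ => ?_
  rw [real_smul_end, map_smul]
  by_cases hij : i = j
  · subst hij
    rw [so_diag]; simp
  · refine smul_eq_zero_of_right _ ?_
    have h2 : ({i, j} : Finset (Fin d)).card = 2 := Finset.card_pair hij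
    have h0 := hB.trace_mon_proj (I := {i, j}) (by simp) (fun h => by
      rw [h, Finset.card_univ, Fintype.card_fin] at h2; omega) (by rw [h2]; exact even_two)
    rcases gen_mul_gen_eq hij with h | h
    · rw [h, h0]
    · rw [h, map_neg, neg_mul, map_neg, h0, neg_zero]

theorem eps_of_two (hB : B.IsBrane) (hd : d = 2) : B.ε = Complex.I := by
  refine hB.eps.resolve_left fun h => ?_
  have h1 := hB.eps_sq
  have h2 : B.gvol * B.gvol = _ := hB.space.vol_sq
  subst hd
  rw [h, one_smul, h2] at h1
  have h3 := congrArg (LinearMap.trace ℂ S) h1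
  norm_num at h3
  rw [hB.dim] at h3
  have h4 : ((2 ^ ((p + 1 + 2) / 2) : ℕ) : ℂ) ≠ 0 := by
    exact_mod_cast (pow_pos two_pos _).ne'
  refine h4 ?_
  linear_combination (-1 / 2 : ℂ) * h3

/-- The trace of `φ(M)` is imaginary; it vanishes unless `d = 2`. -/
theorem trace_soHom_re (hB : B.IsBrane) (M : LieAlgebra.Orthogonal.so (Fin d) ℝ) :
    (LinearMap.trace ℂ S (hB.soHom M)).re = 0 := by
  rcases Nat.lt_or_ge d 3 with hd | hd
  swap
  · rw [hB.trace_soHom hd]; rfl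
  have hd2 : d = 2 := by have := hB.two_le; omega
  have hε := hB.eps_of_two hd2
  have hg : (LinearMap.trace ℂ S (B.gvol * B.proj)).re = 0 := by
    rw [hB.gvol_mul_proj, map_smul, hB.trace_proj, hε, smul_eq_mul]
    rcases Int.units_eq_one_or B.δ₁ with h | h
    · rw [h]
      have : (2 : ℂ) ^ ((p + 1 + d) / 2) / 2 = (((2 : ℝ) ^ ((p + 1 + d) / 2) / 2 : ℝ) : ℂ) := by
        push_cast; rfl
      rw [this, Complex.re_mul_ofReal]
      simp
    · rw [h]
      have : (2 : ℂ) ^ ((p + 1 + d) / 2) / 2 = (((2 : ℝ) ^ ((p + 1 + d) / 2) / 2 : ℝ) : ℂ) := by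
        push_cast; rfl
      rw [this, Complex.re_mul_ofReal]
      simp
  rw [hB.soHom_eq_sum, real_smul_end, map_smul, map_sum, smul_eq_mul, Complex.re_ofReal_mul,
    Complex.re_sum]
  refine mul_eq_zero_of_right _ (Finset.sum_eq_zero fun i _ => ?_)
  rw [map_sum, Complex.re_sum]
  refine Finset.sum_eq_zero fun j _ => ?_
  rw [real_smul_end, map_smul, smul_eq_mul, Complex.re_ofReal_mul]
  by_cases hij : i = j
  · subst hij
    rw [so_diag]; simp
  · refine mul_eq_zero_of_right _ ?_
    have hu : ({i, j} : Finset (Fin d)) = Finset.univ := by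
      rw [← Finset.card_eq_iff_eq_univ, Finset.card_pair hij, Fintype.card_fin, hd2]
    have hv : hB.ρ (mon Finset.univ) = B.gvol := rep_volCl hB.space
    rcases gen_mul_gen_eq hij with h | h
    · rw [h, hu, hv, hg]
    · rw [h, hu, map_neg, hv, neg_mul, map_neg, Complex.neg_re, hg, neg_zero]

/-- The trace form pairs `φ(e_i ∧ e_j)` with `γ_l γ_k` nontrivially only for equal pairs of indices,
except for `d = 4`, where complementary bivectors agree up to the sign on `Π(S)`. -/
theorem soHom_injective (hB : B.IsBrane) (hd : d ≠ 4) : Function.Injective hB.soHom := by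
  rw [injective_iff_map_eq_zero]
  intro M hM
  have hskew : ∀ i k, (M : Matrix (Fin d) (Fin d) ℝ) k i = -(M : Matrix (Fin d) (Fin d) ℝ) i k :=
    fun i k => by
      have := congrFun (congrFun ((LieAlgebra.Orthogonal.mem_so (Fin d) ℝ _).mp M.2) i) k
      simpa using this
  refine Subtype.ext (Matrix.ext fun k l => ?_)
  by_cases hkl : k = l
  · subst hkl; exact so_diag M k
  -- pair with `γ_l γ_k`: only the entries `M_kl` and `M_lk` contribute to the trace
  have hterm : ∀ i j, i ≠ j → LinearMap.trace ℂ S (hB.ρ (gen l * gen k) *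
      (hB.ρ (gen i * gen j) * B.proj)) =
        (if i = k ∧ j = l then LinearMap.trace ℂ S B.proj else 0) -
          if i = l ∧ j = k then LinearMap.trace ℂ S B.proj else 0 := by
    intro i j hij
    by_cases h1 : i = k ∧ j = l
    · obtain ⟨rfl, rfl⟩ := h1
      rw [if_pos ⟨rfl, rfl⟩, if_neg (fun h => hij h.1), ← mul_assoc, ← map_mul]
      have : gen j * gen i * (gen i * gen j) = (1 : Cl d) := by
        rw [mul_assoc, ← mul_assoc (gen i), gen_sq, neg_one_mul, mul_neg, gen_sq, neg_neg]
      rw [this, map_one, one_mul, sub_zero]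
    by_cases h2 : i = l ∧ j = k
    · obtain ⟨rfl, rfl⟩ := h2
      rw [if_neg h1, if_pos ⟨rfl, rfl⟩, ← mul_assoc, ← map_mul]
      have : gen i * gen j * (gen i * gen j) = (-1 : Cl d) := by
        calc gen i * gen j * (gen i * gen j) = gen i * (gen j * gen i) * gen j := by noncomm_ring
          _ = -(gen i * gen i * (gen j * gen j)) := by
            rw [gen_anticomm (Ne.symm hij)]; noncomm_ring
          _ = -1 := by rw [gen_sq, gen_sq, neg_one_mul, neg_neg]
      rw [this, map_neg, map_one, neg_one_mul, map_neg, zero_sub]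
    rw [if_neg h1, if_neg h2, sub_zero, ← mul_assoc, ← map_mul]
    have hI : symmDiff ({l, k} : Finset (Fin d)) {i, j} ≠ ∅ := by
      intro h
      have h3 : ({l, k} : Finset (Fin d)) = {i, j} := symmDiff_eq_bot.mp h
      have hi : i ∈ ({l, k} : Finset (Fin d)) := by rw [h3]; simp
      have hj : j ∈ ({l, k} : Finset (Fin d)) := by rw [h3]; simp
      simp only [Finset.mem_insert, Finset.mem_singleton] at hi hj
      rcases hi with hi | hi <;> rcases hj with hj | hj
      · exact hij (hi.trans hj.symm)
      · exact h2 ⟨hi, hj⟩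
      · exact h1 ⟨hi, hj⟩
      · exact hij (hi.trans hj.symm)
    have he : Even (symmDiff ({l, k} : Finset (Fin d)) {i, j}).card :=
      symmDiff_card_even (by rw [Finset.card_pair (Ne.symm hkl), Finset.card_pair hij]; decide)
    have hu : symmDiff ({l, k} : Finset (Fin d)) {i, j} ≠ Finset.univ := by
      intro h
      have h3 : (symmDiff ({l, k} : Finset (Fin d)) {i, j}).card = d := by rw [h]; simp
      have h4 : (symmDiff ({l, k} : Finset (Fin d)) {i, j}).card ≤ 4 := by
        refine (Finset.card_le_card (show symmDiff ({l, k} : Finset (Fin d)) {i, j} ⊆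
          {l, k} ∪ {i, j} from symmDiff_le_sup)).trans ((Finset.card_union_le _ _).trans ?_)
        rw [Finset.card_pair (Ne.symm hkl), Finset.card_pair hij]
      have h5 := hB.two_le
      rw [h3] at h4 he
      have hd2 : d = 2 := by
        obtain ⟨r, hr⟩ := he
        omega
      -- for `d = 2` both pairs are the whole index set
      refine hI ?_
      have hp : ∀ a b : Fin d, a ≠ b → ({a, b} : Finset (Fin d)) = Finset.univ := fun a b hab => by
        rw [← Finset.card_eq_iff_eq_univ, Finset.card_pair hab, Fintype.card_fin, hd2]
      rw [hp _ _ (Ne.symm hkl), hp _ _ hij]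
      exact symmDiff_self _
    have h0 := hB.trace_mon_proj hI hu he
    have hm : gen l * gen k * (gen i * gen j) = mon (symmDiff ({l, k} : Finset (Fin d)) {i, j}) ∨
        gen l * gen k * (gen i * gen j) = -mon (symmDiff ({l, k} : Finset (Fin d)) {i, j}) := by
      have h3 := mon_mul_mon ({l, k} : Finset (Fin d)) {i, j}
      rcases gen_mul_gen_eq (Ne.symm hkl) with ha | ha <;> rcases gen_mul_gen_eq hij with hb | hb <;>
        rcases h3 with h3 | h3 <;> rw [ha, hb] <;> simp [h3]
    rcases hm with h | h
    · rw [h, h0]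
    · rw [h, map_neg, neg_mul, map_neg, h0, neg_zero]
  have h := congrArg (fun z => LinearMap.trace ℂ S (hB.ρ (gen l * gen k) * z)) hM
  simp only [mul_zero, map_zero] at h
  rw [hB.soHom_eq_sum, mul_smul_comm, real_smul_end, map_smul, smul_eq_mul, Finset.mul_sum,
    map_sum] at h
  have h1 : ∀ i, LinearMap.trace ℂ S (hB.ρ (gen l * gen k) * ∑ j,
      (M : Matrix (Fin d) (Fin d) ℝ) i j • (hB.ρ (gen i * gen j) * B.proj)) =
      ∑ j, (((M : Matrix (Fin d) (Fin d) ℝ) i j : ℝ) : ℂ) *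
        ((if i = k ∧ j = l then LinearMap.trace ℂ S B.proj else 0) -
          if i = l ∧ j = k then LinearMap.trace ℂ S B.proj else 0) := by
    intro i
    rw [Finset.mul_sum, map_sum]
    refine Finset.sum_congr rfl fun j _ => ?_
    rw [mul_smul_comm, real_smul_end, map_smul, smul_eq_mul]
    by_cases hij : i = j
    · subst hij
      rw [so_diag]; simp
    · rw [hterm i j hij]
  simp only [h1, mul_sub, Finset.sum_sub_distrib, ite_and, mul_ite, mul_zero] at h
  simp only [Finset.sum_ite_irrel, Finset.sum_const_zero, Finset.sum_ite_eq', Finset.mem_univ,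
    if_true] at h
  rw [hskew k l] at h
  have h2 : (((M : Matrix (Fin d) (Fin d) ℝ) k l : ℝ) : ℂ) * LinearMap.trace ℂ S B.proj = 0 := by
    push_cast at h
    linear_combination (-2 : ℂ) * h
  exact_mod_cast (mul_eq_zero.mp h2).resolve_right hB.trace_proj_ne_zero

end IsBrane

end Data

end Brane

/-! ### The connection form along `φ(𝔰𝔬(d)) ⋉ V` -/

namespace Brane

namespace Data

variable {p d : ℕ} {S : Type*} [NormedAddCommGroup S] [NormedSpace ℂ S] {B : Data p d S}

/-- The gradient `(Y_1, …, Y_d)` of `ln f₂`. -/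
noncomputable def Yvec (B : Data p d S) (y : Fin d → ℝ) : Fin d → ℝ := fun i => B.Y i y

theorem contDiff_pd {h : (Fin d → ℝ) → ℝ} (hh : ContDiff ℝ ∞ h) (i : Fin d) :
    ContDiff ℝ ∞ (pd i h) :=
  (hh.fderiv_right (m := ∞) (by simp)).clm_apply contDiff_const

theorem contDiff_ypart : ContDiff ℝ ∞ (ypart : Pt p d → Fin d → ℝ) := (yproj p d).contDiff

theorem pd_comm {h : (Fin d → ℝ) → ℝ} (hh : ContDiff ℝ ∞ h) (i j : Fin d) (y : Fin d → ℝ) :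
    pd i (pd j h) y = pd j (pd i h) y := by
  have hd : DifferentiableAt ℝ (fderiv ℝ h) y :=
    (hh.fderiv_right (m := ∞) (by simp)).differentiable (by simp) y
  have h1 : ∀ i j, pd i (pd j h) y = fderiv ℝ (fderiv ℝ h) y (Pi.single i 1) (Pi.single j 1) := by
    intro i j
    have h2 : pd j h = fun z => fderiv ℝ h z (Pi.single j 1) := rfl
    rw [pd, h2, fderiv_clm_apply hd (differentiableAt_const _)]
    simp
  have hs : IsSymmSndFDerivAt ℝ h y := hh.contDiffAt.isSymmSndFDerivAt (by
    rw [minSmoothness_of_isRCLikeNormedField]; exact WithTop.coe_le_coe.mpr le_top)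
  rw [h1, h1]
  exact hs.eq _ _

namespace IsBrane

theorem contDiff_log (hB : B.IsBrane) : ContDiff ℝ ∞ fun z => Real.log (B.f₂ z) :=
  hB.smooth₂.log fun z => (hB.pos₂ z).ne'

theorem contDiff_Y (hB : B.IsBrane) (i : Fin d) : ContDiff ℝ ∞ (B.Y i) := contDiff_pd hB.contDiff_log i

theorem pd_Y_comm (hB : B.IsBrane) (i j : Fin d) (y : Fin d → ℝ) :
    pd i (B.Y j) y = pd j (B.Y i) y := pd_comm hB.contDiff_log i j y

theorem K_symm (hB : B.IsBrane) (y : Fin d → ℝ) : (B.K y).IsSymm := by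
  ext i j
  simp only [K, Matrix.transpose_apply, Matrix.of_apply, hB.pd_Y_comm j i, eq_comm (a := j)]
  ring

variable {k : ℝ}

theorem X_eq_real (hB : B.IsBrane) (hk : ((d : ℂ) - 1) * B.β / (2 * B.α) = (k : ℂ)) (i : Fin d)
    (y : Fin d → ℝ) : B.X i y = -(2 * k * (B.f₁ y / B.f₂ y)) * B.Y i y := by
  have h := X_eq_Y hB i y
  have hα := hB.α_ne
  have h2 : ((d : ℂ) - 1) * B.β * B.α⁻¹ = 2 * k := by
    rw [← hk]; field_simp
  rw [h2] at h
  have h3 : B.f₂ y * B.X i y = -(2 * k * (B.f₁ y * B.Y i y)) := by exact_mod_cast h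
  have := (hB.pos₂ y).ne'
  field_simp
  linarith

/-- The form of the connection along `ℝ^{p+1}` if the coefficient `(d - 1) β / (2 α)` is the real
number `k`; then `X` is a real multiple of `Y`. -/
theorem connC_inl_real (hB : B.IsBrane) (hk : ((d : ℂ) - 1) * B.β / (2 * B.α) = (k : ℂ))
    (μ : Fin (p + 1)) (x : Pt p d) :
    B.connC (Sum.inl μ) x = (2 * k * (B.f₁ (ypart x) / B.f₂ (ypart x))) •
      (B.γ (Sum.inl μ) * hB.ρ (CliffordAlgebra.ι (negForm d) (B.Yvec (ypart x))) * B.proj) := by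
  rw [hB.connC_inl, rep_ι, Finset.mul_sum, Finset.sum_mul, Finset.smul_sum,
    ← Finset.sum_neg_distrib]
  refine Finset.sum_congr rfl fun i _ => ?_
  rw [hB.X_eq_real hk, hB.asym_inl_inr, mul_smul_comm, smul_mul_assoc, smul_smul, real_smul_end,
    ← neg_smul, Yvec]
  congr 1
  push_cast
  ring

theorem delta_eps_gvol (_ : B.IsBrane) :
    (((B.δ₁ : ℤ) : ℂ) * B.ε) • B.gvol = 1 - (2 : ℝ) • B.proj := by
  rw [real_smul_end, proj, smul_smul]
  norm_num

/-- The bivector `γ_i ∧ u` as a spin element. -/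
theorem asym_eq_spinEl (hB : B.IsBrane) (i : Fin d) (u : Fin d → ℝ) :
    ∑ j, u j • asym ![B.γ (Sum.inr i), B.γ (Sum.inr j)] =
      (-2 : ℝ) • hB.ρ (spinEl (wedgeMat (Pi.single i 1) u)) := by
  rw [spinEl_wedgeMat, map_smul, map_sub, map_mul, map_mul, rep_ι, rep_ι, smul_smul]
  have h1 : ∑ j, (Pi.single i (1 : ℝ) : Fin d → ℝ) j • B.γ (Sum.inr j) = B.γ (Sum.inr i) := by
    rw [Finset.sum_eq_single i (fun j _ hj => by simp [hj]) (by simp)]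
    simp
  rw [h1, Finset.mul_sum, Finset.sum_mul, ← Finset.sum_sub_distrib, Finset.smul_sum]
  refine Finset.sum_congr rfl fun j _ => ?_
  rw [asym_pair, mul_smul_comm, smul_mul_assoc, ← smul_sub, smul_smul, real_smul_end,
    real_smul_end, smul_smul]
  congr 1
  push_cast
  ring

/-- The form of the connection along `ℝ^d` if the coefficient `(d - 1) β / (2 α)` is the real number
`k`; note that `1 - 2 Π = δ₁ ε γ^{[d]}`. -/
theorem connC_inr_real (hB : B.IsBrane) (hk : ((d : ℂ) - 1) * B.β / (2 * B.α) = (k : ℂ))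
    (i : Fin d) (x : Pt p d) :
    B.connC (Sum.inr i) x =
      (2 : ℝ) • (hB.ρ (spinEl (wedgeMat (Pi.single i 1) (B.Yvec (ypart x)))) * B.proj) +
        (k * B.Y i (ypart x)) • (1 - (2 : ℝ) • B.proj) := by
  have h := hB.asym_eq_spinEl i (B.Yvec (ypart x))
  rw [hB.connC_inr]
  congr 1
  · have h2 : ∑ j, ((B.Y j (ypart x) : ℝ) : ℂ) •
        (asym ![B.γ (Sum.inr i), B.γ (Sum.inr j)] * B.proj) =
        (∑ j, B.Yvec (ypart x) j • asym ![B.γ (Sum.inr i), B.γ (Sum.inr j)]) * B.proj := by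
      rw [Finset.sum_mul]
      refine Finset.sum_congr rfl fun j _ => ?_
      rw [real_smul_end, smul_mul_assoc, Yvec]
    rw [h2, h, smul_mul_assoc]
    module
  · rw [hk, ← hB.delta_eps_gvol, real_smul_end, smul_smul, hB.signs]
    congr 1
    push_cast
    ring

/-- The connection form takes values in `φ(𝔰𝔬(d)) ⋉ V ⊕ ℝ (1 - 2Π)`. -/
theorem connC_mem (hB : B.IsBrane) (hk : ((d : ℂ) - 1) * B.β / (2 * B.α) = (k : ℂ)) (A : Idx p d)
    (x : Pt p d) : ∃ e ∈ hB.holo, B.connC A x = e +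
      (Sum.elim (fun _ => 0) (fun i => k * B.Y i (ypart x)) A : ℝ) • (1 - (2 : ℝ) • B.proj) := by
  cases A with
  | inl μ =>
    refine ⟨B.connC (Sum.inl μ) x, ?_, by simp⟩
    rw [hB.connC_inl_real hk]
    exact hB.holo.smul_mem _ (hB.nil_le_holo (hB.gamma_odd_mem_nil μ
      (CliffordAlgebra.ι_mem_evenOdd_one _ _)))
  | inr i =>
    refine ⟨_, ?_, hB.connC_inr_real hk i x⟩
    exact hB.holo.smul_mem _ (hB.soHom_mem_holo ⟨_, wedgeMat_mem _ _⟩)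

theorem contDiff_connC (hB : B.IsBrane) (A : Idx p d) (v : S) :
    ContDiff ℝ ∞ fun x => B.connC A x v := by
  have hX : ∀ i, ContDiff ℝ ∞ (B.X i) := fun i => by
    have h : B.X i = fun y => pd i B.f₁ y / B.f₂ y := funext fun y => hB.X_eq i y
    rw [h]
    exact (contDiff_pd hB.smooth₁ i).div hB.smooth₂ fun y => (hB.pos₂ y).ne'
  cases A with
  | inl μ =>
    simp only [hB.connC_inl, LinearMap.neg_apply, LinearMap.sum_apply, LinearMap.smul_apply]
    refine (ContDiff.sum fun i _ => ?_).neg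
    exact (Complex.ofRealCLM.contDiff.comp ((hX i).comp contDiff_ypart)).smul contDiff_const
  | inr i =>
    simp only [hB.connC_inr, LinearMap.add_apply, LinearMap.neg_apply, LinearMap.sum_apply,
      LinearMap.smul_apply]
    refine (ContDiff.sum fun j _ => ?_).neg.add ?_
    · exact (Complex.ofRealCLM.contDiff.comp ((hB.contDiff_Y j).comp contDiff_ypart)).smul
        contDiff_const
    · exact (contDiff_const.mul (Complex.ofRealCLM.contDiff.comp
        ((hB.contDiff_Y i).comp contDiff_ypart))).smul contDiff_const

theorem holo_mul_compl (hB : B.IsBrane) {e : Module.End ℂ S} (he : e ∈ hB.holo) :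
    e * (1 - B.proj) = 0 := by
  obtain ⟨M, v, hv, rfl⟩ := hB.mem_holo.mp he
  rw [← hB.soHom_mul_proj, ← hB.nil_mul_proj hv, ← add_mul, mul_assoc, hB.proj_mul_compl, mul_zero]

/-- On the complement of `Π(S)` the connection form acts by scalars. -/
theorem connC_mul_compl (hB : B.IsBrane) (hk : ((d : ℂ) - 1) * B.β / (2 * B.α) = (k : ℂ))
    (A : Idx p d) (x : Pt p d) : B.connC A x * (1 - B.proj) =
      (Sum.elim (fun _ => 0) (fun i => k * B.Y i (ypart x)) A : ℝ) • (1 - B.proj) := by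
  obtain ⟨e, he, h⟩ := hB.connC_mem hk A x
  rw [h, add_mul, hB.holo_mul_compl he, zero_add, smul_mul_assoc, sub_mul, smul_mul_assoc,
    hB.proj_mul_compl, smul_zero, sub_zero, one_mul]

/-- `φ(𝔰𝔬(d)) ⋉ V` is normalised by the connection form, since `1 - 2 Π` acts on `φ(𝔰𝔬(d))` by zero
and on `V` by the scalar `2`. -/
theorem connC_lie_holo (hB : B.IsBrane) (hk : ((d : ℂ) - 1) * B.β / (2 * B.α) = (k : ℂ))
    (A : Idx p d) (x : Pt p d) {w : Module.End ℂ S} (hw : w ∈ hB.holo) :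
    B.connC A x * w - w * B.connC A x ∈ hB.holo := by
  obtain ⟨e, he, h⟩ := hB.connC_mem hk A x
  have h1 : (1 - (2 : ℝ) • B.proj) * w - w * (1 - (2 : ℝ) • B.proj) ∈ hB.holo := by
    obtain ⟨M, v, hv, rfl⟩ := hB.mem_holo.mp hw
    have : (1 - (2 : ℝ) • B.proj) * (hB.soHom M + v) - (hB.soHom M + v) * (1 - (2 : ℝ) • B.proj) =
        (2 : ℝ) • v := by
      have hl : B.proj * (hB.soHom M + v) = hB.soHom M := by
        rw [mul_add, hB.proj_mul_soHom, hB.proj_mul_nil hv, add_zero]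
      have hr : (hB.soHom M + v) * B.proj = hB.soHom M + v := by
        rw [add_mul, hB.soHom_mul_proj, hB.nil_mul_proj hv]
      rw [sub_mul, mul_sub, one_mul, mul_one, smul_mul_assoc, mul_smul_comm, hl, hr]
      module
    rw [this]
    exact hB.holo.smul_mem _ (hB.nil_le_holo hv)
  rw [h]
  have h2 : ∀ c : ℝ, (e + c • (1 - (2 : ℝ) • B.proj)) * w - w * (e + c • (1 - (2 : ℝ) • B.proj)) =
      (e * w - w * e) + c • ((1 - (2 : ℝ) • B.proj) * w - w * (1 - (2 : ℝ) • B.proj)) := fun c => by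
    rw [add_mul, mul_add, smul_mul_assoc, mul_smul_comm, smul_sub]
    abel
  rw [h2]
  exact hB.holo.add_mem (hB.holo_lie he hw) (hB.holo.smul_mem _ h1)

/-- The image of the even Clifford algebra on `Π(S)`. -/
noncomputable def evenPart (hB : B.IsBrane) : Submodule ℝ (Module.End ℂ S) :=
  (CliffordAlgebra.evenOdd (negForm d) 0).map
    ((LinearMap.mulRight ℝ B.proj).comp hB.ρ.toLinearMap)

theorem mem_evenPart (hB : B.IsBrane) {x : Module.End ℂ S} :
    x ∈ hB.evenPart ↔ ∃ a ∈ CliffordAlgebra.evenOdd (negForm d) 0, x = hB.ρ a * B.proj := by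
  constructor
  · rintro ⟨a, ha, rfl⟩
    exact ⟨a, ha, rfl⟩
  · rintro ⟨a, ha, rfl⟩
    exact ⟨a, ha, rfl⟩

/-- The sum of the even part and `V` is stable under left multiplication with the connection form.
Since it contains `Π`, it contains `P Π` for every transport `P`. -/
theorem connC_mul_evenPart (hB : B.IsBrane) (hk : ((d : ℂ) - 1) * B.β / (2 * B.α) = (k : ℂ))
    (A : Idx p d) (x : Pt p d) :
    ∀ w ∈ hB.evenPart ⊔ hB.nil, B.connC A x * w ∈ hB.evenPart ⊔ hB.nil := by
  intro w hw
  obtain ⟨a', ha', v, hv, rfl⟩ := Submodule.mem_sup.mp hw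
  obtain ⟨a, ha, rfl⟩ := hB.mem_evenPart.mp ha'
  obtain ⟨e, he, h⟩ := hB.connC_mem hk A x
  obtain ⟨M, u, hu, rfl⟩ := hB.mem_holo.mp he
  have hPa : B.proj * (hB.ρ a * B.proj) = hB.ρ a * B.proj := by
    rw [← mul_assoc, ← hB.even_mul_proj ha, mul_assoc, hB.proj_mul_self]
  have h1 : hB.soHom M * (hB.ρ a * B.proj) ∈ hB.evenPart := by
    rw [soHom_apply, mul_assoc, hPa, ← mul_assoc, ← map_mul]
    exact hB.mem_evenPart.mpr ⟨_, by simpa using mul_mem_evenOdd (spinEl_mem_even _) ha, rfl⟩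
  have h2 : u * (hB.ρ a * B.proj) ∈ hB.nil := by
    rw [← mul_assoc]
    have h3 := hB.nil_mul_even hu ha
    rw [hB.nil_mul_proj h3]
    exact h3
  have h4 : (1 - (2 : ℝ) • B.proj) * (hB.ρ a * B.proj + v) = -(hB.ρ a * B.proj) + v := by
    rw [sub_mul, one_mul, smul_mul_assoc, mul_add, hPa, hB.proj_mul_nil hv]
    module
  rw [h, add_mul, smul_mul_assoc, h4, mul_add, add_mul, add_mul, hB.soHom_mul_nil M hv,
    hB.nil_mul_nil hu hv]
  refine Submodule.add_mem _ (Submodule.add_mem _ (Submodule.add_mem _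
    (Submodule.mem_sup_left h1) (Submodule.mem_sup_right h2)) ?_) (Submodule.smul_mem _ _ ?_)
  · rw [add_zero]; exact Submodule.zero_mem _
  · exact Submodule.add_mem _ (Submodule.neg_mem _ (Submodule.mem_sup_left
      (hB.mem_evenPart.mpr ⟨a, ha, rfl⟩))) (Submodule.mem_sup_right hv)

/-- The traces of the connection form are those of its component in `φ(𝔰𝔬(d))`. -/
theorem trace_connC (hB : B.IsBrane) [FiniteDimensional ℂ S]
    (hk : ((d : ℂ) - 1) * B.β / (2 * B.α) = (k : ℂ)) (A : Idx p d)
    (x : Pt p d) : (LinearMap.trace ℂ S (B.connC A x)).re = 0 ∧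
      (3 ≤ d → LinearMap.trace ℂ S (B.connC A x) = 0) := by
  obtain ⟨e, he, h⟩ := hB.connC_mem hk A x
  obtain ⟨M, u, hu, rfl⟩ := hB.mem_holo.mp he
  have h1 : LinearMap.trace ℂ S (B.connC A x) = LinearMap.trace ℂ S (hB.soHom M) := by
    rw [h, ← hB.delta_eps_gvol, map_add, map_add, real_smul_end, map_smul, map_smul, hB.trace_gvol,
      hB.trace_nil hu]
    simp
  rw [h1]
  exact ⟨hB.trace_soHom_re M, fun hd => hB.trace_soHom hd M⟩

/-- The function `f₂^k`, by which the transports act on `ker Π`. -/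
noncomputable def rad (_ : B.IsBrane) (k : ℝ) (x : Pt p d) : ℝ :=
  Real.exp (k * Real.log (B.f₂ (ypart x)))

theorem contDiff_rad (hB : B.IsBrane) (k : ℝ) : ContDiff ℝ 1 (hB.rad k) :=
  ((contDiff_const.mul (hB.contDiff_log.comp contDiff_ypart)).exp).of_le (by simp)

/-- The scalars by which the connection form acts on the complement of `Π(S)` are the logarithmic
derivatives of a function; hence loops act there trivially. -/
theorem sum_connC_mul_compl (hB : B.IsBrane) (hk : ((d : ℂ) - 1) * B.β / (2 * B.α) = (k : ℂ))
    (x w : Pt p d) : ∑ A, w A • (B.connC A x * (1 - B.proj)) =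
      (fderiv ℝ (hB.rad k) x w / hB.rad k x) • (1 - B.proj) := by
  have hlog : DifferentiableAt ℝ (fun z => Real.log (B.f₂ z)) (ypart x) :=
    hB.contDiff_log.differentiable (by simp) _
  have hd : DifferentiableAt ℝ (fun z : Pt p d => Real.log (B.f₂ (ypart z))) x :=
    (hB.contDiff_log.comp contDiff_ypart).differentiable (by simp) x
  have h1 : fderiv ℝ (hB.rad k) x w = hB.rad k x * (k * ∑ i, w (Sum.inr i) * B.Y i (ypart x)) := by
    have h2 := (hd.hasFDerivAt.const_mul k).exp.fderiv
    have h3 : hB.rad k = fun z => Real.exp (k * Real.log (B.f₂ (ypart z))) := rfl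
    rw [h3, h2]
    simp only [_root_.smul_apply, smul_eq_mul]
    rw [fderiv_comp_ypart hlog]
    congr 2
    have h4 : yproj p d w = ∑ i, w (Sum.inr i) • (Pi.single i 1 : Fin d → ℝ) := by
      funext j
      simp [yproj, Finset.sum_apply, Pi.single_apply]
    rw [h4, map_sum]
    refine Finset.sum_congr rfl fun i _ => ?_
    rw [map_smul, smul_eq_mul]
    rfl
  have h0 : hB.rad k x ≠ 0 := (Real.exp_pos _).ne'
  rw [h1, mul_div_cancel_left₀ _ h0, Fintype.sum_sum_type]
  simp only [hB.connC_mul_compl hk, Sum.elim_inl, Sum.elim_inr, zero_smul, smul_zero,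
    Finset.sum_const_zero, zero_add, Finset.mul_sum, Finset.sum_smul, smul_smul]
  refine Finset.sum_congr rfl fun i _ => ?_
  congr 1
  ring

end IsBrane

end Data

end Brane

/-! ### The normaliser of `φ(𝔰𝔬(d))` in the even part -/

namespace Brane

variable {d : ℕ}

/-- A bivector commutes or anticommutes with a monomial, according to whether the set of the monomial
contains both or none of its two indices, or exactly one. -/
theorem gen_mul_gen_mul_mon {i j : Fin d} (I : Finset (Fin d)) :
    (gen i * gen j) * mon I =
      (if i ∈ I ↔ j ∈ I then (1 : ℝ) else -1) • (mon I * (gen i * gen j)) := by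
  have h : (gen i * gen j) * mon I =
      (-1) ^ ((I.erase i).card + (I.erase j).card) * (mon I * (gen i * gen j)) := by
    have hc : ∀ (x : Cl d) (n : ℕ), x * (-1) ^ n = (-1) ^ n * x := fun x n =>
      ((Commute.neg_one_left x).pow_left n).eq.symm
    rw [mul_assoc, gen_mul_mon j, ← mul_assoc, hc, mul_assoc, ← mul_assoc (gen i) (mon I),
      gen_mul_mon i, pow_add, mul_assoc, mul_assoc, mul_assoc]
    rw [← mul_assoc, ← pow_add, add_comm, pow_add, mul_assoc]
  rw [h]
  by_cases hi : i ∈ I <;> by_cases hj : j ∈ I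
  · rw [Finset.card_erase_of_mem hi, Finset.card_erase_of_mem hj, ← two_mul, pow_mul]
    simp [hi, hj]
  · obtain ⟨n, hn⟩ := Nat.exists_eq_succ_of_ne_zero (Finset.card_pos.mpr ⟨i, hi⟩).ne'
    rw [Finset.card_erase_of_mem hi, Finset.erase_eq_of_notMem hj, hn, Nat.succ_sub_one,
      Nat.succ_eq_add_one, ← add_assoc, ← two_mul, pow_succ, pow_mul]
    simp [hi, hj]
  · obtain ⟨n, hn⟩ := Nat.exists_eq_succ_of_ne_zero (Finset.card_pos.mpr ⟨j, hj⟩).ne'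
    rw [Finset.card_erase_of_mem hj, Finset.erase_eq_of_notMem hi, hn, Nat.succ_sub_one,
      Nat.succ_eq_add_one, add_right_comm, ← two_mul, pow_succ, pow_mul]
    simp [hi, hj]
  · rw [Finset.erase_eq_of_notMem hi, Finset.erase_eq_of_notMem hj, ← two_mul, pow_mul]
    simp [hi, hj]

/-- The standard basis element `e_i ∧ e_j` of `𝔰𝔬(d)`. -/
def wedgeSo (i j : Fin d) : LieAlgebra.Orthogonal.so (Fin d) ℝ :=
  ⟨wedgeMat (Pi.single i 1) (Pi.single j 1), wedgeMat_mem _ _⟩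

theorem spinEl_wedgeSo {i j : Fin d} (h : i ≠ j) :
    spinEl (wedgeSo i j : Matrix (Fin d) (Fin d) ℝ) = (-(1 / 2) : ℝ) • (gen i * gen j) := by
  change spinEl (wedgeMat _ _) = _
  rw [spinEl_wedgeMat]
  change (-(1 / 4) : ℝ) • (gen i * gen j - gen j * gen i) = _
  rw [gen_anticomm h.symm]
  module

namespace Data

variable {p : ℕ} {S : Type*} [NormedAddCommGroup S] [NormedSpace ℂ S] {B : Data p d S}

namespace IsBrane

theorem soHom_lie_even (hB : B.IsBrane) (M : LieAlgebra.Orthogonal.so (Fin d) ℝ) {a : Cl d}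
    (ha : a ∈ CliffordAlgebra.evenOdd (negForm d) 0) :
    hB.soHom M * (hB.ρ a * B.proj) - hB.ρ a * B.proj * hB.soHom M =
      hB.ρ (spinEl (M : Matrix (Fin d) (Fin d) ℝ) * a -
        a * spinEl (M : Matrix (Fin d) (Fin d) ℝ)) * B.proj := by
  have h1 : B.proj * (hB.ρ a * B.proj) = hB.ρ a * B.proj := by
    rw [← mul_assoc, ← hB.even_mul_proj ha, mul_assoc, hB.proj_mul_self]
  rw [soHom_apply, mul_assoc, h1, ← soHom_apply, mul_assoc (hB.ρ a), hB.proj_mul_soHom, soHom_apply,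
    map_sub, map_mul, map_mul, sub_mul, mul_assoc, mul_assoc]

/-- The double commutator with a basis element of `𝔰𝔬(d)` projects onto the monomials whose set
contains exactly one of the two indices. -/
theorem soHom_double_lie (hB : B.IsBrane) {i j : Fin d} (hij : i ≠ j) {I : Finset (Fin d)}
    (hI : Even I.card) :
    hB.soHom (wedgeSo i j) * (hB.soHom (wedgeSo i j) * (hB.ρ (mon I) * B.proj) -
        hB.ρ (mon I) * B.proj * hB.soHom (wedgeSo i j)) -
      (hB.soHom (wedgeSo i j) * (hB.ρ (mon I) * B.proj) -
        hB.ρ (mon I) * B.proj * hB.soHom (wedgeSo i j)) * hB.soHom (wedgeSo i j) =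
      if i ∈ I ↔ j ∈ I then 0 else -(hB.ρ (mon I) * B.proj) := by
  have hm : mon I ∈ CliffordAlgebra.evenOdd (negForm d) 0 := by
    have := mon_mem_evenOdd I
    rwa [even_card_cast hI] at this
  have hs := spinEl_mem_even (wedgeSo i j : Matrix (Fin d) (Fin d) ℝ)
  have h2 : spinEl (wedgeSo i j : Matrix (Fin d) (Fin d) ℝ) * mon I -
      mon I * spinEl (wedgeSo i j : Matrix (Fin d) (Fin d) ℝ) ∈
        CliffordAlgebra.evenOdd (negForm d) 0 :=
    Submodule.sub_mem _ (by simpa using mul_mem_evenOdd hs hm) (by simpa using mul_mem_evenOdd hm hs)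
  rw [hB.soHom_lie_even _ hm, hB.soHom_lie_even _ h2, spinEl_wedgeSo hij]
  have hg := gen_mul_gen_mul_mon (i := i) (j := j) I
  have hsq : gen i * gen j * (gen i * gen j) = (-1 : Cl d) := by
    nth_rewrite 2 [gen_anticomm hij]
    rw [mul_neg, mul_assoc, ← mul_assoc (gen j), gen_sq, neg_one_mul, mul_neg, gen_sq, neg_neg]
  split_ifs at hg ⊢ with h
  · rw [one_smul] at hg
    have h0 : (-(1 / 2) : ℝ) • (gen i * gen j) * mon I -
        mon I * (-(1 / 2) : ℝ) • (gen i * gen j) = 0 := by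
      rw [smul_mul_assoc, mul_smul_comm, hg, sub_self]
    rw [h0]
    simp
  · generalize gen i * gen j = e at hg hsq
    rw [neg_one_smul] at hg
    have h3 : e * (e * mon I) = -mon I := by rw [← mul_assoc, hsq, neg_one_mul]
    have h4 : mon I * e = -(e * mon I) := by rw [hg, neg_neg]
    rw [← neg_mul, ← map_neg]
    congr 2
    have h5 : e * mon I * e = mon I := by
      rw [mul_assoc, h4, mul_neg, h3, neg_neg]
    simp only [smul_mul_assoc, mul_smul_comm, h4, mul_sub, sub_mul, h3, h5, mul_neg, neg_mul,
      smul_neg, neg_neg, smul_sub]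
    module

theorem soHom_range_lie (hB : B.IsBrane) (M : LieAlgebra.Orthogonal.so (Fin d) ℝ)
    {e : Module.End ℂ S} (he : e ∈ hB.soHom.range.toSubmodule) :
    hB.soHom M * e - e * hB.soHom M ∈ hB.soHom.range.toSubmodule := by
  obtain ⟨N, rfl⟩ := he
  exact ⟨⁅M, N⁆, LieHom.map_lie _ _ _⟩

/-- The span of the even monomials on `Π(S)` whose sets are not split by the pairs in `s`. -/
noncomputable def unsplit (hB : B.IsBrane) (s : Finset (Fin d × Fin d)) :
    Submodule ℝ (Module.End ℂ S) :=
  Submodule.span ℝ ((fun I => hB.ρ (mon I) * B.proj) ''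
    {I : Finset (Fin d) | Even I.card ∧ ∀ q ∈ s, q.1 ∈ I ↔ q.2 ∈ I})

/-- Modulo `φ(𝔰𝔬(d))`, an even element that commutes with `φ(𝔰𝔬(d))` modulo `φ(𝔰𝔬(d))` is a
combination of unsplit monomials: double commutators remove the split ones. -/
theorem exists_unsplit (hB : B.IsBrane) {x : Module.End ℂ S} (hx : x ∈ hB.evenPart)
    (hN : ∀ M, hB.soHom M * x - x * hB.soHom M ∈ hB.soHom.range.toSubmodule)
    (s : Finset (Fin d × Fin d)) :
    ∃ y ∈ hB.unsplit s, x - y ∈ hB.soHom.range.toSubmodule := by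
  classical
  induction s using Finset.induction_on with
  | empty =>
    refine ⟨x, ?_, by simp⟩
    obtain ⟨a, ha, rfl⟩ := hB.mem_evenPart.mp hx
    have h := (evenOdd_le_span a).1 ha
    let L : Cl d →ₗ[ℝ] Module.End ℂ S := (LinearMap.mulRight ℝ B.proj).comp hB.ρ.toLinearMap
    have h2 := Submodule.mem_map_of_mem (f := L) h
    rw [Submodule.map_span, ← Set.image_comp] at h2
    refine Submodule.span_mono ?_ h2
    rintro _ ⟨I, hI, rfl⟩
    exact ⟨I, ⟨hI, by simp⟩, rfl⟩
  | insert q s _ ih =>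
    obtain ⟨y, hy, hxy⟩ := ih
    by_cases hq : q.1 = q.2
    · refine ⟨y, ?_, hxy⟩
      refine Submodule.span_mono (Set.image_mono ?_) hy
      rintro I ⟨h1, h2⟩
      refine ⟨h1, fun r hr => ?_⟩
      rcases Finset.mem_insert.mp hr with rfl | hr
      · rw [hq]
      · exact h2 r hr
    · set φ := hB.soHom (wedgeSo q.1 q.2) with hφ
      let L : Module.End ℂ S →ₗ[ℝ] Module.End ℂ S :=
        LinearMap.mulLeft ℝ φ - LinearMap.mulRight ℝ φ
      have hL : ∀ z, L z = φ * z - z * φ := fun z => rfl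
      have hLy : L y ∈ hB.soHom.range.toSubmodule := by
        have h1 := hB.soHom_range_lie (wedgeSo q.1 q.2) hxy
        have h2 : L y = (φ * x - x * φ) - (φ * (x - y) - (x - y) * φ) := by
          rw [hL]; noncomm_ring
        rw [h2]
        exact Submodule.sub_mem _ (hN _) h1
      have hLLy : L (L y) ∈ hB.soHom.range.toSubmodule := hB.soHom_range_lie _ hLy
      refine ⟨y + L (L y), ?_, ?_⟩
      · have h3 : hB.unsplit s ≤ (hB.unsplit (insert q s)).comap
            (LinearMap.id + L.comp L : Module.End ℂ S →ₗ[ℝ] Module.End ℂ S) := by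
          rw [unsplit, Submodule.span_le]
          rintro _ ⟨I, ⟨hI, hs⟩, rfl⟩
          have h4 : (LinearMap.id + L.comp L : Module.End ℂ S →ₗ[ℝ] Module.End ℂ S) (hB.ρ (mon I) * B.proj) =
              if q.1 ∈ I ↔ q.2 ∈ I then hB.ρ (mon I) * B.proj else 0 := by
            have h5 := hB.soHom_double_lie hq hI
            change hB.ρ (mon I) * B.proj + L (L (hB.ρ (mon I) * B.proj)) = _
            rw [hL, hL, hφ, h5]
            split_ifs <;> simp
          change (LinearMap.id + L.comp L : Module.End ℂ S →ₗ[ℝ] Module.End ℂ S) (hB.ρ (mon I) * B.proj) ∈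
            hB.unsplit (insert q s)
          rw [h4]
          split_ifs with h
          · refine Submodule.subset_span ⟨I, ⟨hI, fun r hr => ?_⟩, rfl⟩
            rcases Finset.mem_insert.mp hr with rfl | hr
            · exact h
            · exact hs r hr
          · exact Submodule.zero_mem _
        exact h3 hy
      · rw [← sub_sub]
        exact Submodule.sub_mem _ hxy hLLy

theorem eps_inv_re (hB : B.IsBrane) [FiniteDimensional ℂ S] (hd : d = 2) (r : ℝ) :
    ((r : ℂ) * -(((B.δ₁ : ℤ) : ℂ) * B.ε)⁻¹).re = 0 := by
  rw [hB.eps_of_two hd]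
  rcases Int.units_eq_one_or B.δ₁ with h | h <;> simp [h]

/-- The normaliser of `φ(𝔰𝔬(d))` in the even part, up to scalars, is `φ(𝔰𝔬(d))`; the scalars are
excluded by the trace. -/
theorem mem_soHom_range (hB : B.IsBrane) [FiniteDimensional ℂ S] {x : Module.End ℂ S}
    (hx : x ∈ hB.evenPart)
    (hN : ∀ M, hB.soHom M * x - x * hB.soHom M ∈ hB.soHom.range.toSubmodule)
    (htr : (LinearMap.trace ℂ S x).re = 0) (htr' : 3 ≤ d → LinearMap.trace ℂ S x = 0) :
    x ∈ hB.soHom.range.toSubmodule := by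
  classical
  obtain ⟨y, hy, hxy⟩ := hB.exists_unsplit hx hN Finset.univ
  have hd := hB.two_le
  -- the only unsplit sets are the empty and the full one
  have hc : ∃ a b : ℝ, y = a • B.proj + b • (B.gvol * B.proj) := by
    refine Submodule.span_induction (p := fun y _ => ∃ a b : ℝ, y = a • B.proj + b • (B.gvol * B.proj))
      ?_ ⟨0, 0, by simp⟩ ?_ ?_ hy
    · rintro _ ⟨I, ⟨-, hI⟩, rfl⟩
      rcases I.eq_empty_or_nonempty with rfl | ⟨i, hi⟩
      · exact ⟨1, 0, by simp [mon_empty]⟩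
      · have : I = Finset.univ := Finset.eq_univ_iff_forall.mpr fun j =>
          (hI (i, j) (Finset.mem_univ _)).mp hi
        refine ⟨0, 1, ?_⟩
        change hB.ρ (mon I) * B.proj = _
        rw [this, show hB.ρ (mon Finset.univ) = B.gvol from rep_volCl hB.space]
        simp
    · rintro _ _ _ _ ⟨a, b, rfl⟩ ⟨a', b', rfl⟩
      exact ⟨a + a', b + b', by module⟩
    · rintro r _ _ ⟨a, b, rfl⟩
      exact ⟨r * a, r * b, by module⟩
  obtain ⟨a, b, rfl⟩ := hc
  obtain ⟨M, hM⟩ := hxy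
  have hM' : x = hB.soHom M + (a • B.proj + b • (B.gvol * B.proj)) := by
    rw [← sub_eq_iff_eq_add]; exact hM.symm
  have hyz : a • B.proj + b • (B.gvol * B.proj) =
      ((a : ℂ) + (b : ℂ) * -(((B.δ₁ : ℤ) : ℂ) * B.ε)⁻¹) • B.proj := by
    rw [hB.gvol_mul_proj, real_smul_end, real_smul_end, smul_smul, add_smul]
  have htrP : LinearMap.trace ℂ S B.proj = ((2 ^ ((p + 1 + d) / 2) / 2 : ℝ) : ℂ) := by
    rw [hB.trace_proj]; push_cast; rfl
  rcases Nat.lt_or_ge d 3 with h3 | h3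
  · -- for `d = 2` the volume element is itself a bivector, and `Re tr` detects the other scalar
    have hd2 : d = 2 := by omega
    have h1 := htr
    rw [hM', map_add, Complex.add_re, hB.trace_soHom_re, zero_add, hyz, map_smul, htrP, smul_eq_mul,
      Complex.re_mul_ofReal, Complex.add_re, hB.eps_inv_re hd2, add_zero, Complex.ofReal_re] at h1
    have ha : a = 0 := (mul_eq_zero.mp h1).resolve_right (by positivity)
    have hg : B.gvol * B.proj ∈ hB.soHom.range.toSubmodule := by
      subst hd2
      refine ⟨(-2 : ℝ) • wedgeSo 0 1, ?_⟩
      change hB.soHom _ = _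
      rw [map_smul, soHom_apply, spinEl_wedgeSo (by decide), map_smul, smul_mul_assoc,
        smul_smul, show B.gvol = hB.ρ (volCl 2) from (rep_volCl hB.space).symm, volCl_eq]
      simp
    rw [hM', ha, zero_smul, zero_add]
    exact Submodule.add_mem _ ⟨M, rfl⟩ (Submodule.smul_mem _ _ hg)
  · have h1 := htr' h3
    rw [hM', map_add, hB.trace_soHom h3, zero_add, hyz, map_smul, smul_eq_mul] at h1
    have h2 := (mul_eq_zero.mp h1).resolve_right hB.trace_proj_ne_zero
    rw [hM', hyz, h2, zero_smul, add_zero]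
    exact ⟨M, rfl⟩

end IsBrane

end Data

end Brane

/-! ### The upper bound for the holonomy algebra -/

namespace Brane

section Velocity

variable {S : Type*} [NormedAddCommGroup S] [NormedSpace ℂ S] [FiniteDimensional ℂ S]

/-- The velocity at the identity of a curve of invertible maps normalising a subspace `W` maps `W`
into itself under the commutator. -/
theorem commutator_mem_of_normalises {c : ℝ → S →L[ℂ] S} {A : S →L[ℂ] S} (hc : HasDerivAt c A 0)
    (h0 : c 0 = 1) (hu : ∀ t, IsUnit (c t)) {W : Submodule ℝ (Module.End ℂ S)}
    (hn : ∀ t, ∀ w ∈ W, ∃ w' ∈ W, endOfClm (c t) * w = w' * endOfClm (c t)) :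
    ∀ w ∈ W, endOfClm A * w - w * endOfClm A ∈ W := by
  have hfin : FiniteDimensional ℝ (S →L[ℂ] S) := FiniteDimensional.trans ℝ ℂ _
  have hcomp : CompleteSpace S := FiniteDimensional.complete ℂ S
  intro w hw
  have hinv : HasDerivAt (fun t => Ring.inverse (c t)) (-A) 0 := by
    have h1 := hasFDerivAt_ringInverse (𝕜 := ℝ) (1 : (S →L[ℂ] S)ˣ)
    rw [Units.val_one, ← h0] at h1
    refine (h1.comp_hasDerivAt (0 : ℝ) hc).congr_deriv ?_
    simp
  have hder := (hc.mul_const (clm w)).mul hinv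
  have hmem := hasDerivAt_mem (W.comap endOfClm) hder (Filter.Eventually.of_forall fun t => by
    obtain ⟨w', hw', h⟩ := hn t w hw
    have h2 : c t * clm w = clm w' * c t := by
      ext v; exact LinearMap.congr_fun h v
    change endOfClm (c t * clm w * Ring.inverse (c t)) ∈ W
    rw [h2, mul_assoc, Ring.mul_inverse_cancel _ (hu t), mul_one]
    exact hw')
  have h3 : A * clm w * Ring.inverse (c 0) + c 0 * clm w * -A = A * clm w - clm w * A := by
    rw [h0, Ring.inverse_one, mul_one, one_mul, mul_neg, sub_eq_add_neg]
  rw [h3] at hmem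
  exact hmem

/-- The derivative at the identity of the determinant is the trace. -/
theorem trace_velocity {c : ℝ → S →L[ℂ] S} {A : S →L[ℂ] S} (hc : HasDerivAt c A 0) (h0 : c 0 = 1)
    (hdet : ∀ t, Complex.normSq (LinearMap.det (endOfClm (c t))) = 1) :
    (LinearMap.trace ℂ S (endOfClm A)).re = 0 ∧
      ((∀ t, LinearMap.det (endOfClm (c t)) = 1) → LinearMap.trace ℂ S (endOfClm A) = 0) := by
  have hD : HasDerivAt (fun t => LinearMap.det (endOfClm (c t))) (LinearMap.trace ℂ S (endOfClm A))
      0 := by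
    have h := hasDerivAt_det (U := c) (X := A) (V := 1) (t := 0) (by rwa [h0, mul_one])
      (by rw [h0, mul_one]) (by rw [h0, mul_one])
    refine h.congr_deriv ?_
    rw [h0]
    change _ * LinearMap.det (1 : S →ₗ[ℂ] S) = _
    simp
  have hD0 : LinearMap.det (endOfClm (c 0)) = 1 := by
    rw [h0]
    change LinearMap.det (1 : S →ₗ[ℂ] S) = _
    simp
  constructor
  · have hre := Complex.reCLM.hasFDerivAt.comp_hasDerivAt (0 : ℝ) hD
    have him := Complex.imCLM.hasFDerivAt.comp_hasDerivAt (0 : ℝ) hD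
    have h1 := (hre.mul hre).add (him.mul him)
    have h2 : HasDerivAt (fun _ : ℝ => (1 : ℝ)) _ 0 := h1.congr_of_eventuallyEq
      (Filter.Eventually.of_forall fun t => by
        have := hdet t
        rw [Complex.normSq_apply] at this
        exact this.symm)
    have h3 := h2.unique (hasDerivAt_const (0 : ℝ) (1 : ℝ))
    simp only [Function.comp, hD0, Complex.reCLM_apply, Complex.imCLM_apply, Complex.one_re,
      Complex.one_im] at h3
    linarith
  · intro h1
    have h2 : HasDerivAt (fun _ : ℝ => (1 : ℂ)) _ 0 := hD.congr_of_eventuallyEq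
      (Filter.Eventually.of_forall fun t => (h1 t).symm)
    exact h2.unique (hasDerivAt_const (0 : ℝ) (1 : ℂ))

end Velocity

namespace Data

variable {p d : ℕ} {S : Type*} [NormedAddCommGroup S] [NormedSpace ℂ S] [FiniteDimensional ℂ S]
  {B : Data p d S} {k : ℝ}

namespace IsBrane

theorem transport_normalises (hB : B.IsBrane)
    (hk : ((d : ℂ) - 1) * B.β / (2 * B.α) = (k : ℂ)) {x y : Pt p d} {T : Module.End ℂ S}
    (hT : IsTransport B.connC x y T) : ∀ w ∈ hB.holo, ∃ w' ∈ hB.holo, T * w = w' * T :=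
  hT.normalises hB.contDiff_connC fun A x _ hw => hB.connC_lie_holo hk A x hw

/-- The velocity `A` of a curve of holonomies lies in `φ(𝔰𝔬(d)) ⋉ V`. It vanishes on the complement of
`Π(S)`, its component in `Hom(Π(S), (1 - Π)(S))` lies in `V`, and its component in `End(Π(S))` comes
from an even element of the Clifford algebra that normalises `φ(𝔰𝔬(d))` and whose trace is restricted
by the determinants of the transports. -/
theorem velocity_mem_holo (hB : B.IsBrane) (hk : ((d : ℂ) - 1) * B.β / (2 * B.α) = (k : ℂ))
    {x : Pt p d} {c : ℝ → Module.End ℂ S} (hc : ∀ v, ContDiff ℝ 1 fun t => c t v)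
    (hmem : ∀ t, c t ∈ holonomyGroup B.connC x) (h0 : c 0 = 1) {A : Module.End ℂ S}
    (hA : ∀ v, deriv (fun t => c t v) 0 = A v) : A ∈ hB.holo := by
  have hfin : FiniteDimensional ℝ (S →L[ℂ] S) := FiniteDimensional.trans ℝ ℂ _
  have hT : ∀ t, IsTransport B.connC x x (c t) := hmem
  have hC : HasDerivAt (fun t => clm (c t)) (clm A) 0 := by
    have h1 : HasDerivAt (fun t => clm (c t)) _ 0 :=
      ((contDiff_clm hc).differentiable (by simp) 0).hasDerivAt
    refine h1.congr_deriv ?_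
    ext v
    rw [clm_apply, ← hA v]
    exact (clm_apply_hasDerivAt h1 v).deriv.symm
  have h0' : clm (c 0) = 1 := by rw [h0]; rfl
  have hdet : ∀ t, Complex.normSq (LinearMap.det (endOfClm (clm (c t)))) = 1 := fun t =>
    ((hT t).det hB.contDiff_connC fun A x => (hB.trace_connC hk A x).1).1
  have hunit : ∀ t, IsUnit (clm (c t)) := fun t => by
    have h1 : LinearMap.det (c t) ≠ 0 := fun h => by
      have := hdet t
      simp only [endOfClm_apply, coe_clm] at this
      rw [h] at this
      simp at this
    have h2 : IsUnit (c t) := by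
      rw [LinearMap.isUnit_iff_isUnit_det]
      exact isUnit_iff_ne_zero.mpr h1
    obtain ⟨u, hu⟩ := h2
    refine ⟨⟨clm (u : Module.End ℂ S), clm ((u⁻¹ : (Module.End ℂ S)ˣ) : Module.End ℂ S), ?_, ?_⟩, ?_⟩
    · ext v; exact LinearMap.congr_fun u.mul_inv v
    · ext v; exact LinearMap.congr_fun u.inv_mul v
    · rw [← hu]
  have hlie := commutator_mem_of_normalises hC h0' hunit (W := hB.holo)
    fun t => hB.transport_normalises hk (hT t)
  obtain ⟨htr, htr'⟩ := trace_velocity hC h0' hdet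
  -- `A` vanishes on the complement of `Π(S)`
  have hQ : A * (1 - B.proj) = 0 := by
    have h1 := hasDerivAt_mem (⊥ : Submodule ℝ (S →L[ℂ] S))
      ((hC.mul_const (clm (1 - B.proj))).sub_const (clm (1 - B.proj)))
      (Filter.Eventually.of_forall fun t => by
        have h2 := (hT t).scalar hB.contDiff_connC (hB.contDiff_rad k)
          (fun x => (Real.exp_pos _).ne') (hB.sum_connC_mul_compl hk)
        rw [div_self (show hB.rad k x ≠ 0 from (Real.exp_pos _).ne'), one_smul] at h2
        rw [Submodule.mem_bot, sub_eq_zero]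
        ext v
        exact LinearMap.congr_fun h2 v)
    ext v
    exact DFunLike.congr_fun ((Submodule.mem_bot ℝ).mp h1) v
  -- the remaining components come from the even part and from `V`
  have hP : A * B.proj ∈ hB.evenPart ⊔ hB.nil := by
    refine hasDerivAt_mem ((hB.evenPart ⊔ hB.nil).comap endOfClm)
      (hC.mul_const (clm B.proj)) (Filter.Eventually.of_forall fun t => ?_)
    exact (hT t).mul_mem hB.contDiff_connC (hB.connC_mul_evenPart hk) _
      (Submodule.mem_sup_left (hB.mem_evenPart.mpr ⟨1, one_mem_even, by simp⟩))
  have hAP : A = A * B.proj := by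
    rw [mul_sub, mul_one, sub_eq_zero] at hQ
    exact hQ
  rw [← hAP] at hP
  obtain ⟨a, ha, v, hv, hav⟩ := Submodule.mem_sup.mp hP
  have hPa : B.proj * a = a := by
    obtain ⟨b, hb, rfl⟩ := hB.mem_evenPart.mp ha
    rw [← mul_assoc, ← hB.even_mul_proj hb, mul_assoc, hB.proj_mul_self]
  have hPA : B.proj * A = a := by
    rw [← hav, mul_add, hPa, hB.proj_mul_nil hv, add_zero]
  have htra : LinearMap.trace ℂ S a = LinearMap.trace ℂ S A := by
    rw [← hav, map_add, hB.trace_nil hv, add_zero]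
  -- `a = Π A` normalises `φ(𝔰𝔬(d))`, as `A` normalises `φ(𝔰𝔬(d)) ⋉ V`
  have hamem : a ∈ hB.soHom.range.toSubmodule := by
    refine hB.mem_soHom_range ha (fun M => ?_) (by rw [htra]; exact htr) fun h3 => ?_
    · obtain ⟨N, w, hw, h1⟩ := hB.mem_holo.mp (hlie _ (hB.soHom_mem_holo M))
      have h2 : B.proj * (A * hB.soHom M - hB.soHom M * A) = hB.soHom N := by
        have h4 : A * hB.soHom M - hB.soHom M * A = hB.soHom N + w := h1
        rw [h4, mul_add, hB.proj_mul_soHom, hB.proj_mul_nil hw, add_zero]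
      refine ⟨-N, ?_⟩
      change hB.soHom (-N) = _
      rw [map_neg, ← h2, mul_sub, ← mul_assoc, hPA, ← mul_assoc, hB.proj_mul_soHom,
        ← hPA, ← mul_assoc, hB.soHom_mul_proj]
      abel
    · rw [htra]
      exact htr' fun t => ((hT t).det hB.contDiff_connC fun A x => (hB.trace_connC hk A x).1).2
        fun A x => (hB.trace_connC hk A x).2 h3
  rw [← hav]
  exact Submodule.add_mem _ (Submodule.mem_sup_left hamem) (hB.nil_le_holo hv)

theorem holonomyAlgebra_le (hB : B.IsBrane) (hk : ((d : ℂ) - 1) * B.β / (2 * B.α) = (k : ℂ))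
    (x : Pt p d) : holonomyAlgebra B.connC x ≤ hB.holoLie :=
  LieSubalgebra.lieSpan_le.mpr fun _ ⟨_, hc, hmem, h0, hA⟩ => hB.velocity_mem_holo hk hc hmem h0 hA

end IsBrane

end Data

end Brane

/-! ### Curvature -/

namespace Brane

variable {d : ℕ}

theorem wedgeMat_add_right (u v w : Fin d → ℝ) : wedgeMat u (v + w) = wedgeMat u v + wedgeMat u w := by
  ext i j
  simp only [wedgeMat_apply, Matrix.add_apply, Pi.add_apply]
  ring

theorem wedgeMat_smul_right (r : ℝ) (u v : Fin d → ℝ) : wedgeMat u (r • v) = r • wedgeMat u v := by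
  ext i j
  simp only [wedgeMat_apply, Matrix.smul_apply, Pi.smul_apply, smul_eq_mul]
  ring

theorem wedgeMat_swap (u v : Fin d → ℝ) : wedgeMat u v = -wedgeMat v u := by
  ext i j
  simp only [wedgeMat_apply, Matrix.neg_apply]
  ring

theorem wedgeMat_lie (a b c : Fin d → ℝ) :
    wedgeMat a b * wedgeMat c b - wedgeMat c b * wedgeMat a b =
      (b ⬝ᵥ c) • wedgeMat a b - (b ⬝ᵥ b) • wedgeMat a c - (a ⬝ᵥ b) • wedgeMat c b := by
  simp only [wedgeMat, sub_mul, mul_sub, Matrix.vecMulVec_mul_vecMulVec]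
  rw [dotProduct_comm a b, dotProduct_comm c b, dotProduct_comm a c]
  ext i j
  simp only [Matrix.sub_apply, Matrix.smul_apply, Matrix.vecMulVec_apply, Pi.smul_apply, smul_eq_mul]
  ring

namespace Data

variable {p : ℕ} {S : Type*} [NormedAddCommGroup S] [NormedSpace ℂ S] [FiniteDimensional ℂ S]
  {B : Data p d S} {k : ℝ}

theorem fderiv_linear_inr (L : (Fin d → ℝ) →ₗ[ℝ] Module.End ℂ S) {G : (Fin d → ℝ) → Fin d → ℝ}
    (hG : ∀ j, Differentiable ℝ fun y => G y j) (x : Pt p d) (i : Fin d) (v : S) :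
    fderiv ℝ (fun z : Pt p d => L (G (ypart z)) v) x (Pi.single (Sum.inr i) 1) =
      L (fun j => pd i (fun y => G y j) (ypart x)) v := by
  let e : (Fin d → ℝ) →L[ℝ] S := LinearMap.toContinuousLinearMap
    ({ toFun := fun u => L u v
       map_add' := fun a b => by rw [map_add]; rfl
       map_smul' := fun r a => by rw [map_smul]; rfl } : (Fin d → ℝ) →ₗ[ℝ] S)
  have hG' : DifferentiableAt ℝ G (ypart x) := differentiableAt_pi.mpr fun j => hG j _
  have h1 : DifferentiableAt ℝ (fun y => e (G y)) (ypart x) := e.differentiableAt.comp _ hG'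
  have h2 := fderiv_comp_ypart h1 (Pi.single (Sum.inr i) 1)
  rw [yproj_single_inr] at h2
  have h3 : fderiv ℝ (fun y => e (G y)) (ypart x) = e.comp (fderiv ℝ G (ypart x)) :=
    (e.hasFDerivAt.comp _ hG'.hasFDerivAt).fderiv
  refine h2.trans ?_
  rw [h3]
  change L _ v = L _ v
  congr 2
  funext j
  rw [pd]
  have h4 := (hasFDerivAt_pi'.mp hG'.hasFDerivAt j).fderiv
  rw [h4]
  rfl

theorem fderiv_linear_inl (L : (Fin d → ℝ) →ₗ[ℝ] Module.End ℂ S) {G : (Fin d → ℝ) → Fin d → ℝ}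
    (hG : ∀ j, Differentiable ℝ fun y => G y j) (x : Pt p d) (μ : Fin (p + 1)) (v : S) :
    fderiv ℝ (fun z : Pt p d => L (G (ypart z)) v) x (Pi.single (Sum.inl μ) 1) = 0 := by
  let e : (Fin d → ℝ) →L[ℝ] S := LinearMap.toContinuousLinearMap
    ({ toFun := fun u => L u v
       map_add' := fun a b => by rw [map_add]; rfl
       map_smul' := fun r a => by rw [map_smul]; rfl } : (Fin d → ℝ) →ₗ[ℝ] S)
  have hG' : DifferentiableAt ℝ G (ypart x) := differentiableAt_pi.mpr fun j => hG j _
  have h1 : DifferentiableAt ℝ (fun y => e (G y)) (ypart x) := e.differentiableAt.comp _ hG'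
  exact fderiv_ypart_inl h1 μ

namespace IsBrane

/-- `u ↦ γ_μ u Π` for vectors `u` of the transversal space. -/
noncomputable def vecMap (hB : B.IsBrane) (μ : Fin (p + 1)) :
    (Fin d → ℝ) →ₗ[ℝ] Module.End ℂ S where
  toFun u := B.γ (Sum.inl μ) * hB.ρ (CliffordAlgebra.ι (negForm d) u) * B.proj
  map_add' u v := by rw [map_add, map_add, mul_add, add_mul]
  map_smul' r u := by
    rw [map_smul, map_smul, mul_smul_comm, smul_mul_assoc, RingHom.id_apply]

/-- The value of the connection form in the direction `i` of the transversal space, as a function of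
the vector `Y`. -/
noncomputable def bivMap (hB : B.IsBrane) (k : ℝ) (i : Fin d) :
    (Fin d → ℝ) →ₗ[ℝ] Module.End ℂ S where
  toFun u := (2 : ℝ) • (hB.ρ (spinEl (wedgeMat (Pi.single i 1) u)) * B.proj) +
    (k * u i) • (1 - (2 : ℝ) • B.proj)
  map_add' u v := by
    rw [wedgeMat_add_right, spinEl_add, map_add, add_mul, Pi.add_apply, mul_add, add_smul, smul_add]
    abel
  map_smul' r u := by
    rw [wedgeMat_smul_right, spinEl_smul, map_smul, smul_mul_assoc, Pi.smul_apply, RingHom.id_apply,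
      smul_eq_mul, smul_add]
    module

theorem connC_inr_eq (hB : B.IsBrane) (hk : ((d : ℂ) - 1) * B.β / (2 * B.α) = (k : ℂ))
    (i : Fin d) (x : Pt p d) : B.connC (Sum.inr i) x = hB.bivMap k i (B.Yvec (ypart x)) :=
  hB.connC_inr_real hk i x

theorem connC_inl_eq (hB : B.IsBrane) (hk : ((d : ℂ) - 1) * B.β / (2 * B.α) = (k : ℂ))
    (μ : Fin (p + 1)) (x : Pt p d) : B.connC (Sum.inl μ) x =
      hB.vecMap μ ((2 * k * (B.f₁ (ypart x) / B.f₂ (ypart x))) • B.Yvec (ypart x)) := by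
  rw [map_smul]
  exact hB.connC_inl_real hk μ x

/-- The derivative of the coefficient `2 k (f₁ / f₂) Y_j`, by `∂_i f₁ = -2 k f₁ Y_i` and
`∂_i f₂ = f₂ Y_i`. -/
theorem pd_ratio (hB : B.IsBrane) (hk : ((d : ℂ) - 1) * B.β / (2 * B.α) = (k : ℂ)) (i j : Fin d)
    (y : Fin d → ℝ) :
    pd i (fun z => 2 * k * (B.f₁ z / B.f₂ z) * B.Y j z) y = 2 * k * (B.f₁ y / B.f₂ y) *
      (pd i (B.Y j) y - (2 * k + 1) * B.Y i y * B.Y j y) := by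
  have h1 := (hB.smooth₁.differentiable (by simp) y).hasFDerivAt
  have h2 := (hB.smooth₂.differentiable (by simp) y).hasFDerivAt
  have h3 := ((hB.contDiff_Y j).differentiable (by simp) y).hasFDerivAt
  have hf := (hB.pos₂ y).ne'
  have h4 := ((((h1.mul ((hasDerivAt_inv hf).comp_hasFDerivAt y h2)).const_mul (2 * k)).mul h3)).fderiv
  have hX := hB.X_eq_real hk i y
  rw [hB.X_eq] at hX
  have hY := hB.Y_eq i y
  have e1 : pd i B.f₁ y = -(2 * k * B.f₁ y) * B.Y i y := by
    field_simp at hX; linarith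
  have e2 : pd i B.f₂ y = B.f₂ y * B.Y i y := by
    rw [hY]; field_simp
  rw [pd]
  simp only [div_eq_mul_inv]
  refine (congrArg (fun L => L (Pi.single i 1)) h4).trans ?_
  simp only [_root_.add_apply, _root_.smul_apply, smul_eq_mul]
  change 2 * k * (B.f₁ y * (B.f₂ y)⁻¹) * (pd i (B.Y j) y) + _ * (2 * k * (B.f₁ y * (_ * pd i B.f₂ y) + (B.f₂ y)⁻¹ * pd i B.f₁ y)) = _
  rw [e1, e2]
  field_simp
  ring

/-- The mixed curvature of the connection is `2 k (f₁ / f₂) γ_μ (K e_i) Π`. -/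
theorem curvature_inr_inl (hB : B.IsBrane) (hk : ((d : ℂ) - 1) * B.β / (2 * B.α) = (k : ℂ))
    (i : Fin d) (μ : Fin (p + 1)) (x : Pt p d) :
    (2 * k * (B.f₁ (ypart x) / B.f₂ (ypart x))) • hB.vecMap μ (B.K (ypart x) i) ∈
      holonomyAlgebra B.connC x := by
  refine curvature_mem_holonomyAlgebra hB.contDiff_connC x (Sum.inr i) (Sum.inl μ) fun v => ?_
  set g := 2 * k * (B.f₁ (ypart x) / B.f₂ (ypart x)) with hg
  have hY : ∀ j, Differentiable ℝ fun y => B.Yvec y j := fun j =>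
    (hB.contDiff_Y j).differentiable (by simp)
  have hG : ∀ j, Differentiable ℝ fun y => ((2 * k * (B.f₁ y / B.f₂ y)) • B.Yvec y) j := fun j => by
    have := (((hB.smooth₁.div hB.smooth₂ fun y => (hB.pos₂ y).ne').const_smul (2 * k)).mul
      (hB.contDiff_Y j)).differentiable (by simp)
    exact this
  simp only [hB.connC_inl_eq hk, hB.connC_inr_eq hk]
  rw [fderiv_linear_inr _ hG, fderiv_linear_inl _ hY, sub_zero]
  have hcomm : hB.bivMap k i (B.Yvec (ypart x)) * hB.vecMap μ (g • B.Yvec (ypart x)) -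
      hB.vecMap μ (g • B.Yvec (ypart x)) * hB.bivMap k i (B.Yvec (ypart x)) =
      g • hB.vecMap μ ((2 * k * B.Y i (ypart x)) • B.Yvec (ypart x) +
        ((B.Yvec (ypart x) ⬝ᵥ B.Yvec (ypart x)) • Pi.single i 1 -
          B.Y i (ypart x) • B.Yvec (ypart x))) := by
    set u := B.Yvec (ypart x) with hu
    have hui : B.Y i (ypart x) = u i := rfl
    have hn : hB.vecMap μ u ∈ hB.nil :=
      hB.gamma_odd_mem_nil μ (CliffordAlgebra.ι_mem_evenOdd_one _ _)
    have h1 : hB.bivMap k i u * hB.vecMap μ u = (k * u i) • hB.vecMap μ u := by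
      change ((2 : ℝ) • hB.soHom ⟨_, wedgeMat_mem _ _⟩ + _) * _ = _
      rw [add_mul, smul_mul_assoc, hB.soHom_mul_nil _ hn, smul_zero, zero_add, smul_mul_assoc,
        sub_mul, smul_mul_assoc, hB.proj_mul_nil hn, smul_zero, sub_zero, one_mul]
    have h3 : CliffordAlgebra.ι (negForm d) u * spinEl (wedgeMat (Pi.single i 1) u) =
        CliffordAlgebra.ι (negForm d) ((-(1 / 2) * (u ⬝ᵥ u)) • Pi.single i 1 + ((1 / 2) * u i) • u) := by
      have e1 := ι_sq u
      have e2 := ι_mul_ι_add_swap' u (Pi.single i 1)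
      rw [dotProduct_single_one] at e2
      rw [spinEl_wedgeMat, map_add, map_smul, map_smul]
      set U := CliffordAlgebra.ι (negForm d) u
      set V := CliffordAlgebra.ι (negForm d) (Pi.single i 1)
      have e3 : U * V = (-2 * u i) • (1 : Cl d) - V * U := eq_sub_of_add_eq e2
      have e4 : U * (V * U) = (-2 * u i) • U + (u ⬝ᵥ u) • V := by
        rw [← mul_assoc, e3, sub_mul, mul_assoc, e1, smul_mul_assoc, one_mul, mul_smul_comm, mul_one]
        module
      have e5 : U * (U * V) = -(u ⬝ᵥ u) • V := by
        rw [← mul_assoc, e1, smul_mul_assoc, one_mul]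
      rw [mul_smul_comm, mul_sub, e4, e5]
      module
    have h2 : hB.vecMap μ u * hB.bivMap k i u = -(k * u i) • hB.vecMap μ u -
        hB.vecMap μ ((u ⬝ᵥ u) • Pi.single i 1 - u i • u) := by
      have e1 : hB.vecMap μ u * hB.bivMap k i u = (2 : ℝ) • (hB.vecMap μ u *
          hB.soHom ⟨wedgeMat (Pi.single i 1) u, wedgeMat_mem _ _⟩) +
          (k * u i) • (hB.vecMap μ u * (1 - (2 : ℝ) • B.proj)) := by
        rw [← mul_smul_comm, ← mul_smul_comm, ← mul_add]; rfl
      have e2 : hB.vecMap μ u * hB.ρ (spinEl (wedgeMat (Pi.single i 1) u)) =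
          hB.vecMap μ ((-(1 / 2) * (u ⬝ᵥ u)) • Pi.single i 1 + ((1 / 2) * u i) • u) := by
        change B.γ _ * _ * _ * _ = B.γ _ * hB.ρ (CliffordAlgebra.ι (negForm d) _) * _
        rw [← h3, mul_assoc _ B.proj, ← hB.even_mul_proj (spinEl_mem_even _), map_mul]
        simp only [mul_assoc]
      rw [e1, hB.nil_mul_soHom _ hn, e2, mul_sub, mul_one, mul_smul_comm, hB.nil_mul_proj hn,
        map_add, map_sub, map_smul, map_smul, map_smul, map_smul]
      module
    rw [map_smul, mul_smul_comm, smul_mul_assoc, h1, h2, ← smul_sub, map_add, map_smul, hui]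
    congr 1
    module
  rw [add_sub_assoc]
  have hcv := LinearMap.congr_fun hcomm v
  simp only [LinearMap.sub_apply, Module.End.mul_apply] at hcv
  rw [hcv, ← LinearMap.add_apply]
  congr 1
  rw [← map_smul, ← map_smul, ← map_add]
  congr 1
  funext j
  simp only [Pi.smul_apply, Pi.add_apply, Pi.sub_apply, smul_eq_mul]
  have h5 := hB.pd_ratio hk i j (ypart x)
  change _ = pd i (fun z => 2 * k * (B.f₁ z / B.f₂ z) * B.Y j z) _ + _
  rw [h5, ← hg]
  simp only [K, Matrix.of_apply, Yvec, dotProduct, Pi.single_apply, eq_comm (a := j), pow_two]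
  split_ifs <;> ring

/-- The transversal curvature of the connection is `2 φ(e_j ∧ K e_i - e_i ∧ K e_j)`. The summands
`k Y_i (1 - 2 Π)` of the connection form do not contribute: they commute with `φ(𝔰𝔬(d))`, and `Y` is a
gradient. -/
theorem curvature_inr_inr (hB : B.IsBrane) (hk : ((d : ℂ) - 1) * B.β / (2 * B.α) = (k : ℂ))
    (i j : Fin d) (x : Pt p d) :
    (2 : ℝ) • (hB.soHom ⟨wedgeMat (Pi.single j 1) (B.K (ypart x) i), wedgeMat_mem _ _⟩ -
      hB.soHom ⟨wedgeMat (Pi.single i 1) (B.K (ypart x) j), wedgeMat_mem _ _⟩) ∈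
      holonomyAlgebra B.connC x := by
  refine curvature_mem_holonomyAlgebra hB.contDiff_connC x (Sum.inr i) (Sum.inr j) fun v => ?_
  have hY : ∀ j, Differentiable ℝ fun y => B.Yvec y j := fun j =>
    (hB.contDiff_Y j).differentiable (by simp)
  simp only [hB.connC_inr_eq hk]
  rw [fderiv_linear_inr _ hY, fderiv_linear_inr _ hY]
  set u := B.Yvec (ypart x) with hu
  set a : Fin d → ℝ := Pi.single i 1
  set b : Fin d → ℝ := Pi.single j 1
  have hQ : ∀ M, (1 - (2 : ℝ) • B.proj) * hB.soHom M = hB.soHom M * (1 - (2 : ℝ) • B.proj) := fun M => by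
    rw [sub_mul, mul_sub, one_mul, mul_one, smul_mul_assoc, mul_smul_comm, hB.proj_mul_soHom,
      hB.soHom_mul_proj]
  have hcomm : hB.bivMap k i u * hB.bivMap k j u - hB.bivMap k j u * hB.bivMap k i u =
      (4 : ℝ) • (hB.ρ (spinEl (u j • wedgeMat a u - (u ⬝ᵥ u) • wedgeMat a b -
        u i • wedgeMat b u)) * B.proj) := by
    have h1 : ∀ (M N : LieAlgebra.Orthogonal.so (Fin d) ℝ) (r s : ℝ),
        ((2 : ℝ) • hB.soHom M + r • (1 - (2 : ℝ) • B.proj)) *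
          ((2 : ℝ) • hB.soHom N + s • (1 - (2 : ℝ) • B.proj)) -
        ((2 : ℝ) • hB.soHom N + s • (1 - (2 : ℝ) • B.proj)) *
          ((2 : ℝ) • hB.soHom M + r • (1 - (2 : ℝ) • B.proj)) = (4 : ℝ) • hB.soHom ⁅M, N⁆ := by
      intro M N r s
      have h2 : hB.soHom ⁅M, N⁆ = hB.soHom M * hB.soHom N - hB.soHom N * hB.soHom M :=
        LieHom.map_lie _ _ _
      rw [h2]
      have hM := hQ M
      have hN := hQ N
      generalize (1 - (2 : ℝ) • B.proj) = q at hM hN ⊢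
      simp only [add_mul, mul_add, smul_mul_smul_comm, hM, hN]
      module
    have h3 := h1 ⟨wedgeMat a u, wedgeMat_mem _ _⟩ ⟨wedgeMat b u, wedgeMat_mem _ _⟩ (k * u i) (k * u j)
    refine h3.trans ?_
    rw [soHom_apply]
    have h4 : ((⁅(⟨wedgeMat a u, wedgeMat_mem _ _⟩ : LieAlgebra.Orthogonal.so (Fin d) ℝ),
        ⟨wedgeMat b u, wedgeMat_mem _ _⟩⁆ : LieAlgebra.Orthogonal.so (Fin d) ℝ) :
          Matrix (Fin d) (Fin d) ℝ) =
        wedgeMat a u * wedgeMat b u - wedgeMat b u * wedgeMat a u := rfl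
    rw [h4, wedgeMat_lie, dotProduct_single_one, single_one_dotProduct]
  have hcv := LinearMap.congr_fun hcomm v
  simp only [LinearMap.sub_apply, Module.End.mul_apply] at hcv
  rw [add_sub_assoc, hcv, ← LinearMap.sub_apply, ← LinearMap.add_apply]
  congr 1
  have h6 : hB.bivMap k j (fun l => pd i (fun y => B.Yvec y l) (ypart x)) -
      hB.bivMap k i (fun l => pd j (fun y => B.Yvec y l) (ypart x)) =
      (2 : ℝ) • (hB.ρ (spinEl (wedgeMat b fun l => pd i (B.Y l) (ypart x))) * B.proj -
        hB.ρ (spinEl (wedgeMat a fun l => pd j (B.Y l) (ypart x))) * B.proj) := by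
    change ((2 : ℝ) • (hB.ρ (spinEl (wedgeMat b fun l => pd i (B.Y l) (ypart x))) * B.proj) +
      (k * pd i (B.Y j) (ypart x)) • (1 - (2 : ℝ) • B.proj)) -
      ((2 : ℝ) • (hB.ρ (spinEl (wedgeMat a fun l => pd j (B.Y l) (ypart x))) * B.proj) +
      (k * pd j (B.Y i) (ypart x)) • (1 - (2 : ℝ) • B.proj)) = _
    rw [hB.pd_Y_comm i j]
    module
  rw [h6, soHom_apply, soHom_apply]
  rw [← sub_mul, ← sub_mul, ← map_sub, ← map_sub, ← smul_mul_assoc, ← smul_mul_assoc, ← smul_mul_assoc,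
    ← map_smul, ← map_smul, ← map_smul, ← add_mul, ← map_add]
  congr 2
  change (2 : ℝ) • (spinElₗ _ - spinElₗ _) = (2 : ℝ) • (spinElₗ _ - spinElₗ _) + (4 : ℝ) • spinElₗ _
  rw [← map_sub, ← map_sub, ← map_smul, ← map_smul, ← map_smul, ← map_add]
  congr 1
  have hK : ∀ i, B.K (ypart x) i = (fun l => pd i (B.Y l) (ypart x)) + ((-2 * u i) • u +
      (u ⬝ᵥ u) • Pi.single i 1) := fun i => by
    funext l
    simp only [K, Matrix.of_apply, Yvec, dotProduct, Pi.single_apply, eq_comm (a := l), pow_two, hu,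
      Pi.add_apply, Pi.smul_apply, smul_eq_mul]
    split_ifs <;> ring
  rw [hK, hK]
  simp only [wedgeMat_add_right, wedgeMat_smul_right]
  rw [wedgeMat_swap (Pi.single j 1) (Pi.single i 1)]
  module

end IsBrane

end Data

end Brane

/-! ### The lower bound for the holonomy algebra at a generic point -/

namespace Brane

variable {d : ℕ}

theorem wedgeMat_add_left (u v w : Fin d → ℝ) : wedgeMat (u + v) w = wedgeMat u w + wedgeMat v w := by
  rw [wedgeMat_swap, wedgeMat_add_right, neg_add, ← wedgeMat_swap, ← wedgeMat_swap]

theorem wedgeMat_smul_left (r : ℝ) (u v : Fin d → ℝ) : wedgeMat (r • u) v = r • wedgeMat u v := by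
  rw [wedgeMat_swap, wedgeMat_smul_right, ← smul_neg, ← wedgeMat_swap]

/-- The bivector `u ∧ v`, as a bilinear map into `𝔰𝔬(d)`. -/
def wedge : (Fin d → ℝ) →ₗ[ℝ] (Fin d → ℝ) →ₗ[ℝ] LieAlgebra.Orthogonal.so (Fin d) ℝ :=
  LinearMap.mk₂ ℝ (fun u v => ⟨wedgeMat u v, wedgeMat_mem u v⟩)
    (fun u u' v => Subtype.ext (wedgeMat_add_left u u' v))
    (fun r u v => Subtype.ext (wedgeMat_smul_left r u v))
    (fun u v v' => Subtype.ext (wedgeMat_add_right u v v'))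
    (fun r u v => Subtype.ext (wedgeMat_smul_right r u v))

theorem wedge_swap (u v : Fin d → ℝ) : wedge u v = -wedge v u := Subtype.ext (wedgeMat_swap u v)

theorem wedge_self (u : Fin d → ℝ) : wedge u u = 0 :=
  Subtype.ext (sub_self (Matrix.vecMulVec u u))

theorem wedge_lie (a b c : Fin d → ℝ) :
    ⁅wedge a b, wedge c b⁆ = (b ⬝ᵥ c) • wedge a b - (b ⬝ᵥ b) • wedge a c - (a ⬝ᵥ b) • wedge c b :=
  Subtype.ext (wedgeMat_lie a b c)

theorem so_eq_sum_wedge (M : LieAlgebra.Orthogonal.so (Fin d) ℝ) :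
    M = (1 / 2 : ℝ) • ∑ i, ∑ j, (M : Matrix (Fin d) (Fin d) ℝ) i j •
      wedge (Pi.single i 1) (Pi.single j 1) := by
  have hskew : ∀ i k, (M : Matrix (Fin d) (Fin d) ℝ) k i = -(M : Matrix (Fin d) (Fin d) ℝ) i k :=
    fun i k => by
      have := congrFun (congrFun ((LieAlgebra.Orthogonal.mem_so (Fin d) ℝ _).mp M.2) i) k
      simpa using this
  refine Subtype.ext (Matrix.ext fun a b => ?_)
  have h1 : (((1 / 2 : ℝ) • ∑ i, ∑ j, (M : Matrix (Fin d) (Fin d) ℝ) i j •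
      wedge (Pi.single i 1) (Pi.single j 1) : LieAlgebra.Orthogonal.so (Fin d) ℝ) :
        Matrix (Fin d) (Fin d) ℝ) = (1 / 2 : ℝ) • ∑ i, ∑ j, (M : Matrix (Fin d) (Fin d) ℝ) i j •
      wedgeMat (Pi.single i 1) (Pi.single j 1) := by
    have h2 : ∀ N : LieAlgebra.Orthogonal.so (Fin d) ℝ, (N : Matrix (Fin d) (Fin d) ℝ) =
      (LieAlgebra.Orthogonal.so (Fin d) ℝ).toSubmodule.subtype N := fun N => rfl
    rw [h2]
    simp only [map_smul, map_sum]
    rfl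
  rw [h1]
  simp only [Matrix.smul_apply, Matrix.sum_apply, wedgeMat_apply, smul_eq_mul, mul_sub,
    Finset.sum_sub_distrib, Pi.single_apply]
  simp only [mul_ite, mul_one, mul_zero, Finset.mem_univ, if_true, eq_comm (a := a),
    eq_comm (a := b), Finset.sum_ite_eq']
  have := hskew a b
  simp
  linarith

/-- If `K` is not proportional to an orthogonal involution `≠ ±1`, then the bivectors
`v ∧ K u - u ∧ K v` generate `𝔰𝔬(d)`. -/
theorem eq_top_of_curvature {K : Matrix (Fin d) (Fin d) ℝ} (hK : K.IsSymm)
    (hgen : ¬ ∃ (c : ℝ) (J : Matrix (Fin d) (Fin d) ℝ),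
      J.IsSymm ∧ J * J = 1 ∧ J ≠ 1 ∧ J ≠ -1 ∧ K = c • J)
    (L : LieSubalgebra ℝ (LieAlgebra.Orthogonal.so (Fin d) ℝ))
    (hL : ∀ i j, wedge (Pi.single j 1) (K i) - wedge (Pi.single i 1) (K j) ∈ L) (M) : M ∈ L := by
  classical
  -- the hypothesis for arbitrary vectors
  have hL2 : ∀ u v, wedge v (K.mulVec u) - wedge u (K.mulVec v) ∈ L := by
    let b : (Fin d → ℝ) →ₗ[ℝ] (Fin d → ℝ) →ₗ[ℝ]
        (LieAlgebra.Orthogonal.so (Fin d) ℝ ⧸ L.toSubmodule) :=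
      LinearMap.mk₂ ℝ (fun u v => L.toSubmodule.mkQ (wedge v (K.mulVec u) - wedge u (K.mulVec v)))
        (fun u u' v => by
          rw [← map_add, Matrix.mulVec_add, map_add, map_add, LinearMap.add_apply]; congr 1; abel)
        (fun r u v => by
          rw [← map_smul, Matrix.mulVec_smul, map_smul, map_smul, LinearMap.smul_apply, smul_sub])
        (fun u v v' => by
          rw [← map_add, Matrix.mulVec_add, map_add, map_add, LinearMap.add_apply]; congr 1; abel)
        (fun r u v => by
          rw [← map_smul, Matrix.mulVec_smul, map_smul, map_smul, LinearMap.smul_apply, smul_sub])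
    have hb : b = 0 := LinearMap.ext_basis (Pi.basisFun ℝ (Fin d)) (Pi.basisFun ℝ (Fin d))
      fun i j => by
        rw [Pi.basisFun_apply, Pi.basisFun_apply]
        change L.toSubmodule.mkQ _ = 0
        rw [Submodule.mkQ_apply, Submodule.Quotient.mk_eq_zero, Matrix.mulVec_single_one,
          Matrix.mulVec_single_one]
        have hrow : ∀ i, K.col i = K i := fun i => by
          funext j; exact hK.apply i j
        rw [hrow, hrow]
        exact hL i j
    intro u v
    have h1 := LinearMap.congr_fun (LinearMap.congr_fun hb u) v
    exact (Submodule.Quotient.mk_eq_zero _).mp h1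
  -- an orthonormal basis of eigenvectors
  have hH : K.IsHermitian := by
    rw [Matrix.IsHermitian, Matrix.conjTranspose_eq_transpose_of_trivial]; exact hK
  set U : Matrix (Fin d) (Fin d) ℝ := (hH.eigenvectorUnitary : Matrix (Fin d) (Fin d) ℝ) with hU
  set l := hH.eigenvalues with hl
  have hU1 : U.transpose * U = 1 := by
    have := Unitary.coe_star_mul_self hH.eigenvectorUnitary
    rwa [Matrix.star_eq_conjTranspose, Matrix.conjTranspose_eq_transpose_of_trivial] at this
  have hU2 : U * U.transpose = 1 := mul_eq_one_comm.mp hU1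
  have hKU : K = U * Matrix.diagonal l * U.transpose := by
    have := hH.spectral_theorem
    rw [Unitary.conjStarAlgAut_apply, Matrix.star_eq_conjTranspose,
      Matrix.conjTranspose_eq_transpose_of_trivial] at this
    exact this
  set u : Fin d → Fin d → ℝ := fun k => U.mulVec (Pi.single k 1) with hu
  have hKu : ∀ k, K.mulVec (u k) = l k • u k := fun k => by
    rw [hu, hKU]
    simp only [Matrix.mulVec_mulVec]
    rw [mul_assoc, hU1, mul_one, ← Matrix.mulVec_mulVec, Matrix.diagonal_mulVec_single, mul_one,
      ← Matrix.mulVec_smul]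
    congr 1
    rw [← Pi.single_smul, smul_eq_mul, mul_one]
  have hdot : ∀ k m, u k ⬝ᵥ u m = if k = m then 1 else 0 := fun k m => by
    rw [hu]
    simp only
    rw [Matrix.dotProduct_mulVec, Matrix.vecMul_mulVec, hU1, Matrix.vecMul_one,
      single_one_dotProduct, Pi.single_apply]
  -- on eigenvectors the hypothesis reads `(l k + l m) u_k ∧ u_m ∈ L`
  have hne : ∀ k m, l k + l m ≠ 0 → wedge (u k) (u m) ∈ L := fun k m h => by
    have h1 := hL2 (u k) (u m)
    rw [hKu, hKu, map_smul, map_smul, wedge_swap (u m), smul_neg, ← neg_add', ← add_smul] at h1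
    have h2 := L.smul_mem (-(l k + l m)⁻¹) h1
    rwa [smul_neg, neg_smul, neg_neg, smul_smul, inv_mul_cancel₀ h, one_smul] at h2
  have hall : ∀ k m, wedge (u k) (u m) ∈ L := fun k m => by
    by_cases hkm : k = m
    · rw [hkm, wedge_self]; exact L.zero_mem
    by_cases h0 : l k + l m = 0
    swap
    · exact hne k m h0
    by_cases hc : ∃ c, l c ≠ l k ∧ l c ≠ -l k
    · -- a third eigenvector gives `u_k ∧ u_m` as the commutator of `u_k ∧ u_c` and `u_m ∧ u_c`
      obtain ⟨c, hc1, hc2⟩ := hc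
      have hck : k ≠ c := fun h => hc1 (by rw [h])
      have hcm : m ≠ c := fun h => hc2 (by rw [← h]; linarith)
      have h1 := L.lie_mem (hne k c fun h => hc2 (by linarith)) (hne m c fun h => hc1 (by linarith))
      rw [wedge_lie, hdot, hdot, hdot, if_neg hcm.symm, if_pos rfl, if_neg hck, zero_smul, zero_smul,
        one_smul, zero_sub, sub_zero] at h1
      have := L.neg_mem h1
      rwa [neg_neg] at this
    · -- all eigenvalues agree up to the sign
      exfalso
      push Not at hc
      refine hgen ⟨l k, U * Matrix.diagonal (fun c => if c = k then 1 else
        if c ≠ m ∧ l c = l k then 1 else -1) * U.transpose, ?_, ?_, ?_, ?_, ?_⟩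
      · rw [Matrix.IsSymm, Matrix.transpose_mul, Matrix.transpose_mul, Matrix.transpose_transpose,
          Matrix.diagonal_transpose, mul_assoc]
      · rw [show ∀ D : Matrix (Fin d) (Fin d) ℝ, U * D * U.transpose * (U * D * U.transpose) =
          U * (D * (U.transpose * U) * D) * U.transpose from fun D => by simp only [mul_assoc], hU1,
          mul_one, Matrix.diagonal_mul_diagonal]
        rw [show (fun c => (if c = k then (1 : ℝ) else if c ≠ m ∧ l c = l k then 1 else -1) *
          (if c = k then 1 else if c ≠ m ∧ l c = l k then 1 else -1)) = fun _ => 1 from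
            funext fun c => by split_ifs <;> norm_num, Matrix.diagonal_one, mul_one, hU2]
      · intro h
        have h1 := congrArg (fun N => U.transpose * N * U) h
        simp only [mul_one] at h1
        rw [hU1, show ∀ D : Matrix (Fin d) (Fin d) ℝ, U.transpose * (U * D * U.transpose) * U =
          (U.transpose * U) * D * (U.transpose * U) from fun D => by simp only [mul_assoc], hU1,
          one_mul, mul_one] at h1
        have h2 := congrFun (congrFun h1 m) m
        rw [Matrix.diagonal_apply_eq, Matrix.one_apply_eq, if_neg (Ne.symm hkm)] at h2
        simp at h2
        norm_num at h2
      · intro h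
        have h1 := congrArg (fun N => U.transpose * N * U) h
        simp only [mul_one, mul_neg, neg_mul] at h1
        rw [hU1, show ∀ D : Matrix (Fin d) (Fin d) ℝ, U.transpose * (U * D * U.transpose) * U =
          (U.transpose * U) * D * (U.transpose * U) from fun D => by simp only [mul_assoc], hU1,
          one_mul, mul_one] at h1
        have h2 := congrFun (congrFun h1 k) k
        rw [Matrix.diagonal_apply_eq, Matrix.neg_apply, Matrix.one_apply_eq, if_pos rfl] at h2
        norm_num at h2
      · rw [← smul_mul_assoc, ← mul_smul_comm, ← Matrix.diagonal_smul]
        refine hKU.trans ?_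
        congr 3
        funext c
        rw [Pi.smul_apply, smul_eq_mul]
        split_ifs with h1 h2
        · rw [h1, mul_one]
        · rw [h2.2, mul_one]
        · by_cases hcm : c = m
          · rw [hcm]; linarith
          · have := hc c fun h => h2 ⟨hcm, h⟩
            linarith
  have hw : ∀ a b, wedge a b ∈ L := by
    let b : (Fin d → ℝ) →ₗ[ℝ] (Fin d → ℝ) →ₗ[ℝ]
        (LieAlgebra.Orthogonal.so (Fin d) ℝ ⧸ L.toSubmodule) :=
      (wedge.compl₁₂ U.mulVecLin U.mulVecLin).compr₂ L.toSubmodule.mkQ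
    have hb : b = 0 := LinearMap.ext_basis (Pi.basisFun ℝ (Fin d)) (Pi.basisFun ℝ (Fin d))
      fun i j => by
        rw [Pi.basisFun_apply, Pi.basisFun_apply]
        exact (Submodule.Quotient.mk_eq_zero _).mpr (hall i j)
    intro x y
    have h1 := LinearMap.congr_fun (LinearMap.congr_fun hb (U.transpose.mulVec x))
      (U.transpose.mulVec y)
    have h2 : wedge (U.mulVec (U.transpose.mulVec x)) (U.mulVec (U.transpose.mulVec y)) ∈ L :=
      (Submodule.Quotient.mk_eq_zero _).mp h1
    rwa [Matrix.mulVec_mulVec, Matrix.mulVec_mulVec, hU2, Matrix.one_mulVec, Matrix.one_mulVec] at h2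
  rw [so_eq_sum_wedge M]
  exact L.smul_mem _ (sum_mem fun i _ => sum_mem fun j _ => L.smul_mem _ (hw _ _))

/-- A subspace that contains `ι w` for some `w ≠ 0`, and with each odd element `a` also the products
`a σ(M)` with the spin elements, contains all odd elements. -/
theorem odd_le_of_mul_spinEl {N : Submodule ℝ (Cl d)}
    (hN : ∀ a ∈ N, a ∈ CliffordAlgebra.evenOdd (negForm d) 1 →
      ∀ M : LieAlgebra.Orthogonal.so (Fin d) ℝ, a * spinEl (M : Matrix (Fin d) (Fin d) ℝ) ∈ N)
    {w : Fin d → ℝ} (hw : w ≠ 0) (hwN : CliffordAlgebra.ι (negForm d) w ∈ N) :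
    CliffordAlgebra.evenOdd (negForm d) 1 ≤ N := by
  have key : ∀ b ∈ CliffordAlgebra.evenOdd (negForm d) 0, ∀ a ∈ N,
      a ∈ CliffordAlgebra.evenOdd (negForm d) 1 → a * b ∈ N := by
    intro b hb
    induction b, hb using CliffordAlgebra.even_induction with
    | algebraMap r =>
      intro a ha _
      rw [Algebra.algebraMap_eq_smul_one, mul_smul_comm, mul_one]
      exact N.smul_mem _ ha
    | add x y hx hy ihx ihy =>
      intro a ha ha'
      rw [mul_add]
      exact N.add_mem (ihx a ha ha') (ihy a ha ha')
    | ι_mul_ι_mul m₁ m₂ x hx ih =>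
      intro a ha ha'
      rw [← mul_assoc]
      refine ih _ ?_ ?_
      · rw [ι_mul_ι_eq, mul_sub, mul_smul_comm, mul_smul_comm, mul_one]
        exact N.sub_mem (N.smul_mem _ (hN a ha ha' ⟨wedgeMat m₁ m₂, wedgeMat_mem _ _⟩))
          (N.smul_mem _ ha)
      · have := mul_mem_evenOdd ha' (CliffordAlgebra.ι_mul_ι_mem_evenOdd_zero (negForm d) m₁ m₂)
        simpa using this
  -- every odd `c` is `ι w` times the even element `-|w|⁻² (ι w) c`
  intro c hc
  have hww : w ⬝ᵥ w ≠ 0 := fun h => hw (dotProduct_self_eq_zero.mp h)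
  have h1 : c = CliffordAlgebra.ι (negForm d) w *
      ((-(w ⬝ᵥ w)⁻¹) • (CliffordAlgebra.ι (negForm d) w * c)) := by
    rw [mul_smul_comm, ← mul_assoc, ι_sq, smul_mul_assoc, one_mul, smul_smul, neg_mul_neg,
      inv_mul_cancel₀ hww, one_smul]
  rw [h1]
  refine key _ (Submodule.smul_mem _ _ ?_) _ hwN (CliffordAlgebra.ι_mem_evenOdd_one _ _)
  have := mul_mem_evenOdd (CliffordAlgebra.ι_mem_evenOdd_one (negForm d) w) hc
  rwa [show (1 : ZMod 2) + 1 = 0 from rfl] at this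

namespace Data

variable {p : ℕ} {S : Type*} [NormedAddCommGroup S] [NormedSpace ℂ S] [FiniteDimensional ℂ S]
  {B : Data p d S} {k : ℝ}

namespace IsBrane

/-- `K = 0` is excluded by genericity: it is `0 · J` for a reflection `J`. -/
theorem K_ne_zero (hB : B.IsBrane) {y : Fin d → ℝ} (hy : B.IsGenericAt y) : B.K y ≠ 0 := by
  intro h
  have hd := hB.two_le
  have h0 : (⟨0, by omega⟩ : Fin d) ≠ ⟨1, by omega⟩ := by simp
  refine hy ⟨0, Matrix.diagonal fun i => if i = ⟨0, by omega⟩ then 1 else -1, ?_, ?_, ?_, ?_, ?_⟩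
  · exact Matrix.isSymm_diagonal _
  · rw [Matrix.diagonal_mul_diagonal, ← Matrix.diagonal_one]
    congr 1
    funext i
    split_ifs <;> norm_num
  · intro h1
    have := congrFun (congrFun h1 ⟨1, by omega⟩) ⟨1, by omega⟩
    rw [Matrix.diagonal_apply_eq, if_neg h0.symm, Matrix.one_apply_eq] at this
    norm_num at this
  · intro h1
    have := congrFun (congrFun h1 ⟨0, by omega⟩) ⟨0, by omega⟩
    rw [Matrix.diagonal_apply_eq, if_pos rfl, Matrix.neg_apply, Matrix.one_apply_eq] at this
    norm_num at this
  · rw [h, zero_smul]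

/-- If `∂ ln f₂` does not vanish identically, the coefficient `(d - 1) β / (2 α)` is real. -/
theorem exists_real_coefficient (hB : B.IsBrane) (hβ : B.β ≠ 0) {y : Fin d → ℝ}
    (hy : B.IsGenericAt y) :
    ∃ k : ℝ, k ≠ 0 ∧ ((d : ℂ) - 1) * B.β / (2 * B.α) = (k : ℂ) := by
  have hY : ∃ z i, B.Y i z ≠ 0 := by
    by_contra! h
    refine hB.K_ne_zero hy (Matrix.ext fun i j => ?_)
    have h1 : B.Y j = fun _ => 0 := funext fun z => h z j
    have h2 : pd i (B.Y j) y = 0 := by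
      rw [h1, pd, fderiv_fun_const]; rfl
    simp only [K, Matrix.of_apply, h2, h y, Matrix.zero_apply]
    simp
  obtain ⟨z, i, hz⟩ := hY
  have h := X_eq_Y hB i z
  have hf := (hB.pos₁ z).ne'
  have hα := hB.α_ne
  have hz' : ((B.f₁ z * B.Y i z : ℝ) : ℂ) ≠ 0 := by
    exact_mod_cast mul_ne_zero hf hz
  have hk : ((d : ℂ) - 1) * B.β / (2 * B.α) =
      ((-(B.f₂ z * B.X i z) / (2 * (B.f₁ z * B.Y i z)) : ℝ) : ℂ) := by
    rw [Complex.ofReal_div, Complex.ofReal_neg, h, Complex.ofReal_mul 2, Complex.ofReal_ofNat]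
    field_simp
  refine ⟨_, fun h0 => ?_, hk⟩
  rw [h0, Complex.ofReal_zero] at hk
  have hd : ((d : ℂ) - 1) ≠ 0 := by
    have := hB.two_le
    rw [sub_ne_zero]
    exact_mod_cast (by omega : d ≠ 1)
  exact div_ne_zero (mul_ne_zero hd hβ) (mul_ne_zero two_ne_zero hα) hk

/-- At a generic point curvature generates everything: the transversal curvature generates `φ(𝔰𝔬(d))`,
the mixed curvature contains a nonzero element `γ_μ u Π` of `V`, and the brackets with `φ(𝔰𝔬(d))`
produce all odd elements from it. -/
theorem holo_le_at_generic (hB : B.IsBrane) (hk : ((d : ℂ) - 1) * B.β / (2 * B.α) = (k : ℂ))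
    (hk0 : k ≠ 0) {x : Pt p d} (hx : B.IsGenericAt (ypart x)) :
    hB.holo ≤ (holonomyAlgebra B.connC x).toSubmodule := by
  have hso : ∀ M, hB.soHom M ∈ holonomyAlgebra B.connC x :=
    eq_top_of_curvature (hB.K_symm (ypart x)) hx ((holonomyAlgebra B.connC x).comap hB.soHom)
      fun i j => by
        rw [LieSubalgebra.mem_comap, map_sub]
        have h := (holonomyAlgebra B.connC x).smul_mem (1 / 2 : ℝ) (hB.curvature_inr_inr hk i j x)
        rw [smul_smul, one_div, inv_mul_cancel₀ two_ne_zero, one_smul] at h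
        exact h
  obtain ⟨i, hi⟩ : ∃ i, B.K (ypart x) i ≠ 0 := by
    by_contra! h
    exact hB.K_ne_zero hx (funext h)
  refine sup_le ?_ (hB.nil_induction fun μ c hc => ?_)
  · rintro _ ⟨M, rfl⟩
    exact hso M
  · let L : Cl d →ₗ[ℝ] Module.End ℂ S := (LinearMap.mulRight ℝ B.proj).comp
      ((LinearMap.mulLeft ℝ (B.γ (Sum.inl μ))).comp hB.ρ.toLinearMap)
    have hsub : CliffordAlgebra.evenOdd (negForm d) 1 ≤
        (holonomyAlgebra B.connC x).toSubmodule.comap L := by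
      refine odd_le_of_mul_spinEl (fun a ha ha' M => ?_) hi ?_
      · have h1 : B.γ (Sum.inl μ) * hB.ρ a * B.proj ∈ holonomyAlgebra B.connC x := ha
        have hn := hB.gamma_odd_mem_nil μ ha'
        have h2 := (holonomyAlgebra B.connC x).lie_mem h1 (hso M)
        rw [LieRing.of_associative_ring_bracket, hB.soHom_mul_nil M hn, sub_zero,
          hB.nil_mul_soHom M hn, mul_assoc, ← hB.even_mul_proj (spinEl_mem_even _), ← mul_assoc,
          mul_assoc (B.γ _), ← map_mul] at h2
        exact h2
      · have hg : 2 * k * (B.f₁ (ypart x) / B.f₂ (ypart x)) ≠ 0 :=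
          mul_ne_zero (mul_ne_zero two_ne_zero hk0)
            (div_ne_zero (hB.pos₁ _).ne' (hB.pos₂ _).ne')
        have h := (holonomyAlgebra B.connC x).smul_mem
          (2 * k * (B.f₁ (ypart x) / B.f₂ (ypart x)))⁻¹ (hB.curvature_inr_inl hk i μ x)
        rw [smul_smul, inv_mul_cancel₀ hg, one_smul] at h
        exact h
    exact hsub hc

/-- The holonomy algebra at every point: at a generic point it is generated by curvature, and
parallel transport carries it to the other points. -/
theorem holonomyAlgebra_eq (hB : B.IsBrane) (hβ : B.β ≠ 0) (hgen : ∃ y, B.IsGenericAt y)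
    (x : Pt p d) : (holonomyAlgebra B.connC x).toSubmodule = hB.holo := by
  obtain ⟨y, hy⟩ := hgen
  obtain ⟨k, hk0, hk⟩ := hB.exists_real_coefficient hβ hy
  refine le_antisymm (hB.holonomyAlgebra_le hk x) fun w hw => ?_
  obtain ⟨P, P', hP, hP', h1, h2⟩ := exists_transport hB.contDiff_connC x
    (Sum.elim 0 y : Pt p d)
  obtain ⟨w', hw', h3⟩ := hB.transport_normalises hk hP w hw
  have h4 := holonomyAlgebra_conj hP hP' h1 h2
    (hB.holo_le_at_generic hk hk0 (x := (Sum.elim 0 y : Pt p d)) hy hw')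
  rw [mul_assoc, ← h3, ← mul_assoc, h2, one_mul] at h4
  exact h4

end IsBrane

end Data

end Brane

/-! ### Complexifications of real modules -/

namespace Brane

section Complexification

variable {d : ℕ} {S T : Type*} [NormedAddCommGroup S] [NormedSpace ℂ S] [FiniteDimensional ℂ S]
  [AddCommGroup T] [Module ℂ T] [FiniteDimensional ℂ T]

/-- A criterion for the shape of the complexification: `V` is parametrised by `s`, the real maps
`t k` factor through `s` and span the target over `ℂ`, and `V` is not larger than the target. -/
theorem complexificationIsSum_of {X : Type*} [AddCommGroup X] [Module ℝ X]
    {φ : LieAlgebra.Orthogonal.so (Fin d) ℝ →ₗ⁅ℝ⁆ Module.End ℂ S}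
    {V : Submodule ℝ (Module.End ℂ S)} {τ : Fin d → Module.End ℂ T} {κ : Type} [Fintype κ]
    {W : κ → Submodule ℂ T} (s : X →ₗ[ℝ] Module.End ℂ S) (hs : LinearMap.range s = V)
    (t : X →ₗ[ℝ] κ → T) (htW : ∀ x k, t x k ∈ W k) (hker : ∀ x, s x = 0 → t x = 0)
    (hspan : ∀ w : κ → T, (∀ k, w k ∈ W k) → w ∈ Submodule.span ℂ (Set.range t))
    (hdim : Module.finrank ℝ V ≤ ∑ k, Module.finrank ℂ (W k))
    (hact : ∀ M x, ∃ x', s x' = φ M * s x - s x * φ M ∧ ∀ k, t x' k = spinRep τ M (t x k)) :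
    ComplexificationIsSum φ V τ W := by
  have hfin : FiniteDimensional ℝ (Module.End ℂ S) := FiniteDimensional.trans ℝ ℂ _
  let t' : X →ₗ[ℝ] (k : κ) → W k :=
    { toFun := fun x k => ⟨t x k, htW x k⟩
      map_add' := fun x y => by ext k; simp
      map_smul' := fun r x => by ext k; simp }
  have hmem : ∀ x, s x ∈ V := fun x => hs ▸ ⟨x, rfl⟩
  let s' : X →ₗ[ℝ] V := s.codRestrict V hmem
  have hs' : Function.Surjective s' := fun v => by
    have hv : (v : Module.End ℂ S) ∈ LinearMap.range s := by rw [hs]; exact v.2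
    obtain ⟨x, hx⟩ := hv
    exact ⟨x, Subtype.ext hx⟩
  have hker' : LinearMap.ker s' ≤ LinearMap.ker t' := fun x hx => by
    have h1 : s x = 0 := congrArg Subtype.val (LinearMap.mem_ker.mp hx)
    have h2 := hker x h1
    rw [LinearMap.mem_ker]
    funext k
    exact Subtype.ext (congrFun h2 k)
  let tV : V →ₗ[ℝ] (k : κ) → W k :=
    ((LinearMap.ker s').liftQ t' hker').comp (s'.quotKerEquivOfSurjective hs').symm.toLinearMap
  have htV : ∀ x, tV (s' x) = t' x := fun x => by
    have h1 : (s'.quotKerEquivOfSurjective hs').symm (s' x) = (LinearMap.ker s').mkQ x := by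
      rw [LinearEquiv.symm_apply_eq]; rfl
    change (LinearMap.ker s').liftQ t' hker' ((s'.quotKerEquivOfSurjective hs').symm (s' x)) = _
    rw [h1]
    simp
  let Ψ : ℂ ⊗[ℝ] V →ₗ[ℂ] (k : κ) → W k := LinearMap.liftBaseChange ℂ tV
  have hΨ : ∀ v, Ψ (1 ⊗ₜ v) = tV v := fun v => by
    change LinearMap.liftBaseChange ℂ tV (1 ⊗ₜ v) = _
    rw [LinearMap.liftBaseChange_tmul, one_smul]
  have hsurj : Function.Surjective Ψ := fun w => by
    let j : ((k : κ) → W k) →ₗ[ℂ] κ → T := LinearMap.pi fun k => (W k).subtype.comp (LinearMap.proj k)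
    have h1 : Submodule.span ℂ (Set.range t) ≤ (LinearMap.range Ψ).map j := by
      rw [Submodule.span_le]
      rintro _ ⟨x, rfl⟩
      refine ⟨_, ⟨1 ⊗ₜ s' x, rfl⟩, ?_⟩
      rw [hΨ, htV]
      rfl
    obtain ⟨w', ⟨z, rfl⟩, hw'⟩ := h1 (hspan (fun k => w k) fun k => (w k).2)
    refine ⟨z, funext fun k => Subtype.ext ?_⟩
    exact congrFun hw' k
  have hfinrank : Module.finrank ℂ (ℂ ⊗[ℝ] V) = Module.finrank ℂ ((k : κ) → W k) := by
    refine le_antisymm ?_ (LinearMap.finrank_le_finrank_of_surjective hsurj)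
    rw [Module.finrank_baseChange, Module.finrank_pi_fintype]
    exact hdim
  have hinj : Function.Injective Ψ :=
    (LinearMap.injective_iff_surjective_of_finrank_eq_finrank hfinrank).mpr hsurj
  have hbij : Function.Bijective Ψ := ⟨hinj, hsurj⟩
  refine ⟨LinearEquiv.ofBijective Ψ hbij, fun M v w hw k => ?_⟩
  obtain ⟨x, rfl⟩ := hs' v
  obtain ⟨x', hx', ht'⟩ := hact M x
  have hwx : w = s' x' := Subtype.ext (hw.trans hx'.symm)
  rw [hwx]
  change ((Ψ (1 ⊗ₜ s' x') k : W k) : T) = spinRep τ M (Ψ (1 ⊗ₜ s' x) k : T)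
  rw [hΨ, hΨ, htV, htV]
  exact ht' k

theorem ComplexificationIsSum.reindex {φ : LieAlgebra.Orthogonal.so (Fin d) ℝ →ₗ⁅ℝ⁆ Module.End ℂ S}
    {V : Submodule ℝ (Module.End ℂ S)} {τ : Fin d → Module.End ℂ T} {κ κ' : Type}
    {W : κ → Submodule ℂ T} (h : ComplexificationIsSum φ V τ W) (e : κ' ≃ κ)
    {W' : κ' → Submodule ℂ T} (hW : W' = fun k => W (e k)) : ComplexificationIsSum φ V τ W' := by
  subst hW
  obtain ⟨Ψ, hΨ⟩ := h
  refine ⟨Ψ.trans (LinearEquiv.piCongrLeft ℂ (fun k => W k) e).symm, fun M v w hw k => ?_⟩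
  exact hΨ M v w hw (e k)

end Complexification

end Brane

/-! ### Odd elements that vanish on the image of the projection -/

namespace Brane

variable {d : ℕ}

/-- An odd element of the Clifford algebra vanishes if its products with all odd monomials are killed
by a functional that, among the even monomials, only sees the unit. -/
theorem odd_eq_zero_of_functional (F : Cl d →ₗ[ℝ] ℝ) (h1 : F 1 ≠ 0)
    (hF : ∀ I : Finset (Fin d), Even I.card → I ≠ ∅ → F (mon I) = 0) {b : Cl d}
    (hb : b ∈ CliffordAlgebra.evenOdd (negForm d) 1)
    (h : ∀ I : Finset (Fin d), Odd I.card → F (mon I * b) = 0) : b = 0 := by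
  have h2 := (evenOdd_le_span b).2 hb
  rw [Set.image_eq_range, Submodule.mem_span_range_iff_exists_fun] at h2
  obtain ⟨c, rfl⟩ := h2
  refine Finset.sum_eq_zero fun I _ => ?_
  have h3 := h I.1 I.2
  rw [Finset.mul_sum, map_sum, Finset.sum_eq_single I] at h3
  · rw [mul_smul_comm, map_smul] at h3
    rcases mul_eq_zero.mp h3 with h4 | h4
    · rw [h4, zero_smul]
    · exfalso
      rcases mon_mul_self I.1 with h5 | h5
      · rw [h5] at h4; exact h1 h4
      · rw [h5, map_neg, neg_eq_zero] at h4; exact h1 h4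
  · intro J _ hJ
    have hne : I.1 ≠ J.1 := fun h => hJ (Subtype.ext h.symm)
    have he : Even (I.1.card + J.1.card) := Odd.add_odd I.2 J.2
    have h6 := hF _ (symmDiff_card_even he) (symmDiff_ne_empty hne)
    rw [mul_smul_comm, map_smul]
    rcases mon_mul_mon I.1 J.1 with h5 | h5
    · rw [h5, h6, smul_zero]
    · rw [h5, map_neg, h6, neg_zero, smul_zero]
  · simp

theorem finrank_odd_le (hd : 0 < d) :
    Module.finrank ℝ (CliffordAlgebra.evenOdd (negForm d) 1) ≤ 2 ^ (d - 1) := by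
  have h : CliffordAlgebra.evenOdd (negForm d) 1 ≤
      Submodule.span ℝ (Set.range fun I : {I : Finset (Fin d) // Odd I.card} => mon I.1) := by
    intro x hx
    have := (evenOdd_le_span x).2 hx
    rwa [Set.image_eq_range] at this
  have hfin : FiniteDimensional ℝ
      (Submodule.span ℝ (Set.range fun I : {I : Finset (Fin d) // Odd I.card} => mon I.1)) :=
    FiniteDimensional.span_of_finite ℝ (Set.finite_range _)
  refine (Submodule.finrank_mono h).trans ?_
  refine (finrank_range_le_card _).trans ?_
  rw [card_odd_subsets hd]

namespace Data

variable {p : ℕ} {S : Type*} [NormedAddCommGroup S] [NormedSpace ℂ S] {B : Data p d S}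

namespace IsBrane

theorem eps_sq_mul_sign (hB : B.IsBrane) : B.ε * B.ε * ((-1) ^ (d * (d - 1) / 2) * (-1) ^ d) = 1 := by
  have h1 := hB.eps_sq
  have h2 : B.gvol * B.gvol = _ := hB.space.vol_sq
  have hS : Nontrivial S := by
    refine Module.nontrivial_of_finrank_pos (R := ℂ) ?_
    rw [hB.dim]; positivity
  have h3 : ((-1) ^ (d * (d - 1) / 2) * (-1) ^ d : Module.End ℂ S) =
      algebraMap ℂ _ ((-1) ^ (d * (d - 1) / 2) * (-1) ^ d : ℂ) := by simp
  rw [smul_mul_smul_comm, h2, h3, Algebra.algebraMap_eq_smul_one, smul_smul,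
    ← Algebra.algebraMap_eq_smul_one, ← map_one (algebraMap ℂ (Module.End ℂ S))] at h1
  exact FaithfulSMul.algebraMap_injective ℂ (Module.End ℂ S) h1

theorem eps_of_mod_two (hB : B.IsBrane) (hd : d % 4 = 2) : B.ε = Complex.I := by
  refine hB.eps.resolve_left fun h => ?_
  have h1 := hB.eps_sq_mul_sign
  obtain ⟨m, rfl⟩ : ∃ m, d = 4 * m + 2 := ⟨d / 4, by omega⟩
  have h2 : (4 * m + 2) * (4 * m + 2 - 1) / 2 = 2 * (4 * m * m + 3 * m) + 1 := by
    rw [show 4 * m + 2 - 1 = 4 * m + 1 by omega,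
      show (4 * m + 2) * (4 * m + 1) = 2 * (2 * (4 * m * m + 3 * m) + 1) by ring]
    simp
  rw [h, h2, pow_succ, pow_mul, show 4 * m + 2 = 2 * (2 * m + 1) by ring, pow_mul] at h1
  norm_num at h1

theorem eps_of_mod_zero (hB : B.IsBrane) (hd : d % 4 = 0) : B.ε = 1 := by
  refine hB.eps.resolve_right fun h => ?_
  have h1 := hB.eps_sq_mul_sign
  obtain ⟨m, rfl⟩ : ∃ m, d = 4 * m := ⟨d / 4, by omega⟩
  have h0 : 4 * m ≠ 0 := by have := hB.two_le; omega
  have h2 : (4 * m) * (4 * m - 1) / 2 = 2 * (m * (4 * m - 1)) := by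
    rw [show (4 * m) * (4 * m - 1) = 2 * (2 * (m * (4 * m - 1))) by ring]
    simp
  rw [h, h2, pow_mul, show 4 * m = 2 * (2 * m) by ring, pow_mul] at h1
  norm_num at h1

theorem eps_vol_sq (hB : B.IsBrane) {T : Type*} [AddCommGroup T] [Module ℂ T]
    {τ : Fin d → Module.End ℂ T} (hτ : IsEuclideanClifford τ) :
    (B.ε • vol τ) * (B.ε • vol τ) = 1 := by
  have h3 : ((-1) ^ (d * (d - 1) / 2) * (-1) ^ d : Module.End ℂ T) =
      algebraMap ℂ _ ((-1) ^ (d * (d - 1) / 2) * (-1) ^ d : ℂ) := by simp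
  rw [smul_mul_smul_comm, hτ.vol_sq, h3, Algebra.algebraMap_eq_smul_one, smul_smul,
    hB.eps_sq_mul_sign, one_smul]

variable [FiniteDimensional ℂ S]

/-- For `d` not divisible by `4`, an odd element of the Clifford algebra that vanishes on `Π(S)` is
zero. -/
theorem odd_eq_zero_of_mul_proj (hB : B.IsBrane) (hd : d % 4 ≠ 0) {b : Cl d}
    (hb : b ∈ CliffordAlgebra.evenOdd (negForm d) 1) (h : hB.ρ b * B.proj = 0) : b = 0 := by
  let F : Cl d →ₗ[ℝ] ℝ :=
    { toFun := fun x => (LinearMap.trace ℂ S (hB.ρ x * B.proj)).re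
      map_add' := fun x y => by rw [map_add, add_mul, map_add, Complex.add_re]
      map_smul' := fun r x => by
        rw [map_smul, smul_mul_assoc, real_smul_end, map_smul, smul_eq_mul, Complex.re_ofReal_mul]
        rfl }
  have hF : ∀ x, F x = (LinearMap.trace ℂ S (hB.ρ x * B.proj)).re := fun _ => rfl
  have htrP : LinearMap.trace ℂ S B.proj = ((2 ^ ((p + 1 + d) / 2) / 2 : ℝ) : ℂ) := by
    rw [hB.trace_proj]; push_cast; rfl
  refine odd_eq_zero_of_functional F ?_ (fun I hI h0 => ?_) hb fun I _ => ?_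
  · rw [hF, map_one, one_mul, htrP, Complex.ofReal_re]
    positivity
  · by_cases h1 : I = Finset.univ
    · subst h1
      rw [Finset.card_univ, Fintype.card_fin] at hI
      have hI2 : d % 4 = 2 := by
        have := Nat.even_iff.mp hI
        omega
      rw [hF, show hB.ρ (mon Finset.univ) = B.gvol from rep_volCl hB.space, hB.gvol_mul_proj, map_smul,
        htrP, hB.eps_of_mod_two hI2, smul_eq_mul, Complex.re_mul_ofReal]
      rcases Int.units_eq_one_or B.δ₁ with h | h <;> simp [h]
    · rw [hF, hB.trace_mon_proj h0 h1 hI, Complex.zero_re]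
  · rw [hF, map_mul hB.ρ, mul_assoc, h, mul_zero, map_zero, Complex.zero_re]

/-- For `d` divisible by `4`, an odd element `b` that vanishes on `Π(S)` satisfies `b = ± b e_1 ⋯ e_d`.
-/
theorem odd_eq_mul_volCl_of_mul_proj (hB : B.IsBrane) (hd : d % 4 = 0) {b : Cl d}
    (hb : b ∈ CliffordAlgebra.evenOdd (negForm d) 1) (h : hB.ρ b * B.proj = 0) :
    b = ((B.δ₁ : ℤ) : ℝ) • (b * volCl d) := by
  have hev : Even d := Nat.even_iff.mpr (by omega)
  let F : Cl d →ₗ[ℝ] ℝ :=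
    { toFun := fun x => (LinearMap.trace ℂ S (hB.ρ x)).re
      map_add' := fun x y => by rw [map_add, map_add, Complex.add_re]
      map_smul' := fun r x => by
        rw [map_smul, real_smul_end, map_smul, smul_eq_mul, Complex.re_ofReal_mul]
        rfl }
  have hF : ∀ x, F x = (LinearMap.trace ℂ S (hB.ρ x)).re := fun _ => rfl
  rw [← sub_eq_zero]
  have hz : hB.ρ (b - ((B.δ₁ : ℤ) : ℝ) • (b * volCl d)) = 0 := by
    have h1 : hB.ρ (b - ((B.δ₁ : ℤ) : ℝ) • (b * volCl d)) = (2 : ℂ) • (hB.ρ b * B.proj) := by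
      rw [map_sub, map_smul, map_mul, rep_volCl hB.space, proj, hB.eps_of_mod_zero hd, mul_one,
        mul_smul_comm, smul_smul, real_smul_end, mul_sub, mul_one, mul_smul_comm]
      norm_num
      rfl
    rw [h1, h, smul_zero]
  refine odd_eq_zero_of_functional F ?_ (fun I hI h0 => ?_) ?_ fun I _ => ?_
  · rw [hF, map_one, LinearMap.trace_one, hB.dim]
    simp only [Nat.cast_pow, Nat.cast_ofNat]
    rw [show ((2 : ℂ) ^ ((p + 1 + d) / 2)) = ((2 ^ ((p + 1 + d) / 2) : ℝ) : ℂ) by push_cast; rfl,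
      Complex.ofReal_re]
    positivity
  · rw [hF, trace_rep_mon_even hB.space h0 hI, Complex.zero_re]
  · refine Submodule.sub_mem _ hb (Submodule.smul_mem _ _ ?_)
    have h1 := mon_mem_evenOdd (Finset.univ : Finset (Fin d))
    rw [Finset.card_univ, Fintype.card_fin, even_card_cast hev] at h1
    have h2 := mul_mem_evenOdd hb h1
    rwa [add_zero] at h2
  · rw [hF, map_mul, hz, mul_zero, map_zero, Complex.zero_re]

theorem inl_mul_odd (hB : B.IsBrane) (μ : Fin (p + 1)) {x : Cl d}
    (hx : x ∈ CliffordAlgebra.evenOdd (negForm d) 1) :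
    hB.ρ x * B.γ (Sum.inl μ) = -(B.γ (Sum.inl μ) * hB.ρ x) := by
  rw [mul_rep_odd_of_anticomm hB.space (fun i => hB.anticomm (by simp)) hx, neg_neg]

theorem odd_mul_proj_eq_zero (hB : B.IsBrane) {μ : Fin (p + 1)} {x : Cl d}
    (h : B.γ (Sum.inl μ) * hB.ρ x * B.proj = 0) : hB.ρ x * B.proj = 0 := by
  have h1 := congrArg (fun z => B.γ (Sum.inl μ) * z) h
  simp only [mul_zero] at h1
  rw [mul_assoc, ← mul_assoc, hB.sq, smul_mul_assoc, one_mul] at h1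
  exact (smul_eq_zero.mp h1).resolve_left (by exact_mod_cast neg_ne_zero.mpr (eta_ne_zero _))

/-- Independence of the matrices `γ_μ` over the odd part of the Clifford algebra on `Π(S)`, for even
`d`: conjugation with `γ_ν` changes the sign of the `ν`-th summand relative to the other ones. -/
theorem separate_even (hB : B.IsBrane) (hd : Even d)
    (b : Fin (p + 1) → CliffordAlgebra.evenOdd (negForm d) 1) (h : hB.nilMap b = 0)
    (ν : Fin (p + 1)) : hB.ρ (b ν) * B.proj = 0 := by
  have hP : B.proj * B.γ (Sum.inl ν) = B.γ (Sum.inl ν) * B.proj := by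
    rw [proj, smul_mul_assoc, mul_smul_comm, sub_mul, mul_sub, one_mul, mul_one, smul_mul_assoc,
      mul_smul_comm, hB.gvol_mul_inl, hd.neg_one_pow, one_smul]
  set c : ℂ := ((-eta (Sum.inl ν : Idx p d) : ℝ) : ℂ) with hc
  have hc0 : c ≠ 0 := by rw [hc]; exact_mod_cast neg_ne_zero.mpr (eta_ne_zero _)
  have hterm : ∀ μ, B.γ (Sum.inl ν) * (B.γ (Sum.inl μ) * hB.ρ (b μ) * B.proj) * B.γ (Sum.inl ν) =
      c • (B.γ (Sum.inl μ) * hB.ρ (b μ) * B.proj) -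
        if μ = ν then (2 * c) • (B.γ (Sum.inl ν) * hB.ρ (b ν) * B.proj) else 0 := fun μ => by
    have e1 : B.γ (Sum.inl ν) * (B.γ (Sum.inl μ) * hB.ρ (b μ) * B.proj) * B.γ (Sum.inl ν) =
        -(B.γ (Sum.inl ν) * B.γ (Sum.inl μ) * B.γ (Sum.inl ν) * (hB.ρ (b μ) * B.proj)) := by
      rw [mul_assoc, mul_assoc _ B.proj, hP, ← mul_assoc _ _ B.proj, mul_assoc _ (hB.ρ _),
        hB.inl_mul_odd ν (b μ).2]
      noncomm_ring
    rw [e1]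
    split_ifs with hμ
    · subst hμ
      rw [hB.sq, ← hc, smul_mul_assoc, one_mul, smul_mul_assoc, mul_assoc]
      module
    · rw [hB.anticomm (fun h => hμ (Sum.inl_injective h).symm : (Sum.inl ν : Idx p d) ≠ Sum.inl μ),
        neg_mul, mul_assoc _ (B.γ (Sum.inl ν)), hB.sq, ← hc, mul_smul_comm, mul_one, neg_mul,
        smul_mul_assoc, mul_assoc]
      module
  have h2 := congrArg (fun z => B.γ (Sum.inl ν) * z * B.γ (Sum.inl ν)) h
  simp only [nilMap_apply, mul_zero, zero_mul, Finset.mul_sum, Finset.sum_mul, hterm,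
    Finset.sum_sub_distrib, ← Finset.smul_sum] at h2
  rw [← nilMap_apply, h, smul_zero, zero_sub, neg_eq_zero, Finset.sum_ite_eq' Finset.univ ν] at h2
  simp only [Finset.mem_univ, if_true] at h2
  exact hB.odd_mul_proj_eq_zero ((smul_eq_zero.mp h2).resolve_left (mul_ne_zero two_ne_zero hc0))

/-- Independence of the matrices `γ_μ` over the odd part of the Clifford algebra on `Π(S)`, for odd `d`
and at least three of them: conjugation with `γ_ν γ_κ` changes the signs of two summands. -/
theorem separate_odd (hB : B.IsBrane) (hp : 2 ≤ p)
    (b : Fin (p + 1) → CliffordAlgebra.evenOdd (negForm d) 1) (h : hB.nilMap b = 0)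
    (ν : Fin (p + 1)) : hB.ρ (b ν) * B.proj = 0 := by
  set s : Fin (p + 1) → Module.End ℂ S := fun μ => B.γ (Sum.inl μ) * hB.ρ (b μ) * B.proj with hs
  have hsum : ∑ μ, s μ = 0 := h
  have hpair : ∀ ν κ, ν ≠ κ → s ν + s κ = 0 := fun ν κ hνκ => by
    set g := B.γ (Sum.inl ν) * B.γ (Sum.inl κ) with hg
    have hP : B.proj * g = g * B.proj := by
      have e : B.gvol * g = g * B.gvol := by
        rw [hg, ← mul_assoc, hB.gvol_mul_inl, smul_mul_assoc, mul_assoc, hB.gvol_mul_inl,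
          mul_smul_comm, smul_smul, sign_sq, one_smul, mul_assoc]
      rw [proj, smul_mul_assoc, mul_smul_comm, sub_mul, mul_sub, one_mul, mul_one, smul_mul_assoc,
        mul_smul_comm, e]
    have hr : ∀ μ, hB.ρ (b μ) * g = g * hB.ρ (b μ) := fun μ => by
      rw [hg, ← mul_assoc, hB.inl_mul_odd ν (b μ).2, neg_mul, mul_assoc, hB.inl_mul_odd κ (b μ).2,
        mul_neg, neg_neg, mul_assoc]
    have hanti : ∀ {μ ν : Fin (p + 1)}, μ ≠ ν → B.γ (Sum.inl μ) * B.γ (Sum.inl ν) =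
        -(B.γ (Sum.inl ν) * B.γ (Sum.inl μ)) := fun h => hB.anticomm fun h' => h (Sum.inl_injective h')
    set c : ℂ := -(((-eta (Sum.inl ν : Idx p d) : ℝ) : ℂ) * ((-eta (Sum.inl κ : Idx p d) : ℝ) : ℂ))
      with hc
    have hc0 : c ≠ 0 := by
      rw [hc]
      refine neg_ne_zero.mpr (mul_ne_zero ?_ ?_) <;>
        exact_mod_cast neg_ne_zero.mpr (eta_ne_zero _)
    have hgg : g * g = c • 1 := by
      rw [hg]
      nth_rewrite 2 [hanti hνκ]
      rw [mul_neg, mul_assoc, ← mul_assoc (B.γ (Sum.inl κ)), hB.sq, smul_mul_assoc, one_mul,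
        mul_smul_comm, hB.sq, smul_smul, ← neg_smul, mul_comm]
    have hgν : g * B.γ (Sum.inl ν) = -(B.γ (Sum.inl ν) * g) := by
      rw [hg, mul_assoc, hanti hνκ.symm, mul_neg]
    have hgκ : g * B.γ (Sum.inl κ) = -(B.γ (Sum.inl κ) * g) := by
      rw [hg, ← mul_assoc, hanti hνκ.symm, neg_mul, neg_neg]
    have hgμ : ∀ μ, μ ≠ ν → μ ≠ κ → g * B.γ (Sum.inl μ) = B.γ (Sum.inl μ) * g := fun μ h1 h2 => by
      rw [hg, mul_assoc, hanti h2.symm, mul_neg, ← mul_assoc, hanti h1.symm, neg_mul, neg_neg,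
        mul_assoc]
    have hgs : ∀ μ, g * s μ * g = (g * B.γ (Sum.inl μ)) * g * (hB.ρ (b μ) * B.proj) := fun μ => by
      have e : s μ * g = B.γ (Sum.inl μ) * g * (hB.ρ (b μ) * B.proj) := by
        simp only [hs]
        rw [mul_assoc, hP, ← mul_assoc, mul_assoc _ _ g, hr, ← mul_assoc, mul_assoc _ _ B.proj]
      rw [mul_assoc, e]; simp only [mul_assoc]
    have hterm : ∀ μ, g * s μ * g = c • s μ - ((if μ = ν then (2 * c) • s ν else 0) +
        if μ = κ then (2 * c) • s κ else 0) := fun μ => by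
      rw [hgs]
      have hpos : B.γ (Sum.inl μ) * g * g * (hB.ρ (b μ) * B.proj) = c • s μ := by
        rw [mul_assoc _ g g, hgg, mul_smul_comm, mul_one, smul_mul_assoc, ← mul_assoc]
      by_cases h1 : μ = ν
      · subst h1
        rw [hgν, if_pos rfl, if_neg hνκ, neg_mul, neg_mul, hpos]
        module
      · by_cases h2 : μ = κ
        · subst h2
          rw [hgκ, if_pos rfl, if_neg h1, neg_mul, neg_mul, hpos]
          module
        · rw [hgμ μ h1 h2, if_neg h1, if_neg h2, hpos]
          module
    have h2 := congrArg (fun z => g * z * g) hsum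
    simp only [mul_zero, zero_mul, Finset.mul_sum, Finset.sum_mul, hterm, Finset.sum_sub_distrib,
      Finset.sum_add_distrib, ← Finset.smul_sum, Finset.sum_ite_eq', Finset.mem_univ, if_true] at h2
    rw [hsum, smul_zero, zero_sub, neg_eq_zero, ← smul_add] at h2
    exact (smul_eq_zero.mp h2).resolve_left (mul_ne_zero two_ne_zero hc0)
  obtain ⟨κ, l, h1, h2, h3⟩ : ∃ κ l : Fin (p + 1), ν ≠ κ ∧ ν ≠ l ∧ κ ≠ l := by
    obtain ⟨κ, hκ, l, hl, hne⟩ := Finset.one_lt_card.mp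
      (show 1 < (Finset.univ.erase ν).card by
        rw [Finset.card_erase_of_mem (Finset.mem_univ ν), Finset.card_univ, Fintype.card_fin]; omega)
    exact ⟨κ, l, (Finset.ne_of_mem_erase hκ).symm, (Finset.ne_of_mem_erase hl).symm, hne⟩
  have e1 := hpair ν κ h1
  have e2 := hpair ν l h2
  have e3 := hpair κ l h3
  have e4 : (2 : ℂ) • s ν = 0 := by
    have : (2 : ℂ) • s ν = (s ν + s κ) + (s ν + s l) - (s κ + s l) := by module
    rw [this, e1, e2, e3]; simp
  exact hB.odd_mul_proj_eq_zero ((smul_eq_zero.mp e4).resolve_left two_ne_zero)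

end IsBrane

end Data

end Brane

/-! ### Half-spinors -/

namespace Brane

variable {d : ℕ}

section HalfSpin

variable {T : Type*} [AddCommGroup T] [Module ℂ T] {τ : Fin d → Module.End ℂ T} {ε : ℂ}

theorem mem_halfSpin {s : ℤˣ} {v : T} : v ∈ halfSpin τ ε s ↔ (ε • vol τ) v = ((s : ℤ) : ℂ) • v :=
  Module.End.mem_eigenspace_iff

theorem odd_mem_halfSpin (hτ : IsEuclideanClifford τ) (hd : Even d) {s : ℤˣ} {a : Cl d}
    (ha : a ∈ CliffordAlgebra.evenOdd (negForm d) 1) {v : T} (hv : v ∈ halfSpin τ ε s) :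
    rep hτ a v ∈ halfSpin τ ε (-s) := by
  have h : vol τ * rep hτ a = -(rep hτ a * vol τ) := by
    rw [vol_mul_rep_odd hτ ha, hd.neg_one_pow, neg_one_mul]
  have h1 := LinearMap.congr_fun h v
  rw [mem_halfSpin] at hv ⊢
  simp only [LinearMap.smul_apply, LinearMap.neg_apply, Module.End.mul_apply] at h1 hv ⊢
  rw [h1, smul_neg, ← map_smul, hv, map_smul]
  simp

/-- The projection of the spinors onto the half-spinors. -/
noncomputable def halfProj (τ : Fin d → Module.End ℂ T) (ε : ℂ) (s : ℤˣ) : Module.End ℂ T :=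
  (1 / 2 : ℂ) • (1 + ((s : ℤ) : ℂ) • (ε • vol τ))

theorem halfProj_mem (h2 : (ε • vol τ) * (ε • vol τ) = 1) (s : ℤˣ) (v : T) :
    halfProj τ ε s v ∈ halfSpin τ ε s := by
  rw [mem_halfSpin]
  have h : (ε • vol τ) * halfProj τ ε s = ((s : ℤ) : ℂ) • halfProj τ ε s := by
    rw [halfProj]
    generalize ε • vol τ = w at h2
    rw [mul_smul_comm, mul_add, mul_one, mul_smul_comm, h2, smul_comm ((s : ℤ) : ℂ) (1 / 2 : ℂ)]
    congr 1
    rw [smul_add, smul_smul, Data.IsBrane.unit_sq, one_smul, add_comm]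
  exact LinearMap.congr_fun h v

theorem halfProj_of_mem {s : ℤˣ} {v : T} (hv : v ∈ halfSpin τ ε s) : halfProj τ ε s v = v := by
  rw [mem_halfSpin] at hv
  rw [halfProj, LinearMap.smul_apply, LinearMap.add_apply, LinearMap.smul_apply, hv, smul_smul,
    Data.IsBrane.unit_sq, one_smul, Module.End.one_apply]
  module

theorem halfProj_of_mem_neg {s : ℤˣ} {v : T} (hv : v ∈ halfSpin τ ε (-s)) :
    halfProj τ ε s v = 0 := by
  rw [mem_halfSpin] at hv
  rw [halfProj, LinearMap.smul_apply, LinearMap.add_apply, LinearMap.smul_apply, hv, smul_smul,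
    Units.val_neg, Int.cast_neg, mul_neg, Data.IsBrane.unit_sq, Module.End.one_apply]
  module

theorem halfProj_mul (h2 : (ε • vol τ) * (ε • vol τ) = 1) (s : ℤˣ) :
    halfProj τ ε s * (ε • vol τ) = ((s : ℤ) : ℂ) • halfProj τ ε s := by
  rw [halfProj]
  generalize ε • vol τ = w at h2
  rw [smul_mul_assoc, add_mul, one_mul, smul_mul_assoc, h2, smul_comm ((s : ℤ) : ℂ) (1 / 2 : ℂ)]
  congr 1
  rw [smul_add, smul_smul, Data.IsBrane.unit_sq, one_smul, add_comm]

/-- The half-spinor modules have equal dimensions, since `τ_1 ⋯ τ_d` is trace free. -/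
theorem finrank_halfSpin [FiniteDimensional ℂ T] (hτ : IsEuclideanClifford τ) (hd : Even d)
    (hd2 : 2 ≤ d) (hT : Module.finrank ℂ T = 2 ^ (d / 2)) (h2 : (ε • vol τ) * (ε • vol τ) = 1)
    (s : ℤˣ) : Module.finrank ℂ (halfSpin τ ε s) = 2 ^ (d / 2 - 1) := by
  have hproj : LinearMap.IsProj (halfSpin τ ε s) (halfProj τ ε s) :=
    ⟨halfProj_mem h2 s, fun _ => halfProj_of_mem⟩
  have h1 := hproj.trace
  have hv : LinearMap.trace ℂ T (vol τ) = 0 := by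
    rw [← rep_volCl hτ]
    refine trace_rep_mon_even hτ ?_ (by simpa using hd)
    have : Nonempty (Fin d) := ⟨⟨0, by omega⟩⟩
    exact Finset.univ_nonempty.ne_empty
  rw [halfProj, map_smul, map_add, map_smul, map_smul, hv, smul_zero, smul_zero, add_zero,
    LinearMap.trace_one, hT] at h1
  obtain ⟨m, hm⟩ : ∃ m, d / 2 = m + 1 := ⟨d / 2 - 1, by omega⟩
  rw [hm] at h1 ⊢
  have h3 : ((Module.finrank ℂ (halfSpin τ ε s) : ℕ) : ℂ) = ((2 ^ m : ℕ) : ℂ) := by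
    rw [← h1]
    push_cast
    rw [smul_eq_mul, pow_succ]
    ring
  rw [Nat.add_sub_cancel]
  exact_mod_cast h3

/-- Every map between the half-spinors of opposite signs is, after extension by zero, a complex
combination of odd elements of the Clifford algebra. -/
theorem exists_odd_map [FiniteDimensional ℂ T] (hτ : IsEuclideanClifford τ) (hd : Even d)
    (hT : Module.finrank ℂ T = 2 ^ (d / 2)) (hε : ε ≠ 0) (h2 : (ε • vol τ) * (ε • vol τ) = 1)
    {s : ℤˣ} {K : Type*} (b : Module.Basis K ℂ (halfSpin τ ε s)) (w : K → T)
    (hw : ∀ k, w k ∈ halfSpin τ ε (-s)) :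
    ∃ x ∈ Submodule.span ℂ
      (rep hτ '' (CliffordAlgebra.evenOdd (negForm d) 1 : Set (Cl d))),
      (∀ k, x (b k : T) = w k) ∧ ∀ v ∈ halfSpin τ ε (-s), x v = 0 := by
  let g : halfSpin τ ε s →ₗ[ℂ] halfSpin τ ε (-s) := b.constr ℂ fun k => ⟨w k, hw k⟩
  let q : T →ₗ[ℂ] halfSpin τ ε s := (halfProj τ ε s).codRestrict _ (halfProj_mem h2 s)
  let x : Module.End ℂ T := (halfSpin τ ε (-s)).subtype.comp (g.comp q)
  have hq : ∀ v, ((q v : halfSpin τ ε s) : T) = halfProj τ ε s v := fun v => rfl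
  refine ⟨x, mem_span_rep_odd hτ hd hT ?_, fun k => ?_, fun v hv => ?_⟩
  · have h3 : (ε • vol τ) * x = -(x * (ε • vol τ)) := by
      ext v
      have e1 : (ε • vol τ) (x v) = (((-s : ℤˣ) : ℤ) : ℂ) • x v :=
        mem_halfSpin.mp (g (q v)).2
      have e2 : q ((ε • vol τ) v) = ((s : ℤ) : ℂ) • q v := Subtype.ext (by
        rw [hq, Submodule.coe_smul, hq]
        exact LinearMap.congr_fun (halfProj_mul h2 s) v)
      rw [Module.End.mul_apply, e1, LinearMap.neg_apply, Module.End.mul_apply]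
      change _ = -((g (q ((ε • vol τ) v)) : halfSpin τ ε (-s)) : T)
      rw [e2, map_smul]
      simp [x]
    rw [smul_mul_assoc, mul_smul_comm, ← smul_neg] at h3
    exact smul_right_injective _ hε h3
  · have e1 : q (b k) = b k := Subtype.ext (halfProj_of_mem (b k).2)
    change ((g (q (b k)) : halfSpin τ ε (-s)) : T) = w k
    rw [e1, Module.Basis.constr_basis]
  · have e1 : q v = 0 := Subtype.ext (halfProj_of_mem_neg hv)
    change ((g (q v) : halfSpin τ ε (-s)) : T) = 0
    rw [e1, map_zero]
    rfl

end HalfSpin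

theorem finite_Cl : Module.Finite ℝ (Cl d) :=
  ⟨by rw [← span_mon]; exact Submodule.fg_span (Set.finite_range _)⟩

namespace Data

variable {p : ℕ} {S : Type*} [NormedAddCommGroup S] [NormedSpace ℂ S] [FiniteDimensional ℂ S]
  {B : Data p d S}

namespace IsBrane

/-- `(b_j) ↦ ∑ γ_{σ j} b_j Π`, for a selection `σ` of the indices of the brane directions. -/
noncomputable def nilMapOn (hB : B.IsBrane) {m : ℕ} (σ : Fin m → Fin (p + 1)) :
    (Fin m → CliffordAlgebra.evenOdd (negForm d) 1) →ₗ[ℝ] Module.End ℂ S where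
  toFun b := ∑ j, B.γ (Sum.inl (σ j)) * hB.ρ (b j) * B.proj
  map_add' b c := by
    simp only [Pi.add_apply, Submodule.coe_add, map_add, mul_add, add_mul, Finset.sum_add_distrib]
  map_smul' r b := by
    simp only [Pi.smul_apply, Submodule.coe_smul, map_smul, mul_smul_comm, smul_mul_assoc,
      Finset.smul_sum, RingHom.id_apply]

theorem nilMapOn_apply (hB : B.IsBrane) {m : ℕ} (σ : Fin m → Fin (p + 1))
    (b : Fin m → CliffordAlgebra.evenOdd (negForm d) 1) :
    hB.nilMapOn σ b = ∑ j, B.γ (Sum.inl (σ j)) * hB.ρ (b j) * B.proj := rfl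

theorem finrank_nil_le (hB : B.IsBrane) {m : ℕ} {σ : Fin m → Fin (p + 1)}
    (hV : LinearMap.range (hB.nilMapOn σ) = hB.nil) :
    Module.finrank ℝ hB.nil ≤ m * 2 ^ (d - 1) := by
  have := finite_Cl (d := d)
  rw [← hV]
  refine (LinearMap.finrank_range_le _).trans ?_
  rw [Module.finrank_pi_fintype, Finset.sum_const, Finset.card_univ, Fintype.card_fin, smul_eq_mul]
  exact Nat.mul_le_mul_left _ (finrank_odd_le (by have := hB.two_le; omega))

/-- The complexification of `V` as a sum of modules `W k`: the reversed odd elements act on spinors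
`e k`, and the reversal turns the right action of `𝔰𝔬(d)` into the spin representation. -/
theorem complexification_nil (hB : B.IsBrane) {T : Type*} [AddCommGroup T] [Module ℂ T]
    [FiniteDimensional ℂ T] {τ : Fin d → Module.End ℂ T} (hτ : IsEuclideanClifford τ) {m : ℕ}
    (σ : Fin m → Fin (p + 1)) (hV : LinearMap.range (hB.nilMapOn σ) = hB.nil) {K : Type}
    [Fintype K] (e : K → T) (W : K → Submodule ℂ T)
    (hker : ∀ b, hB.nilMapOn σ b = 0 → ∀ j k, rep hτ (CliffordAlgebra.reverse (b j : Cl d)) (e k) = 0)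
    (hW : ∀ a ∈ CliffordAlgebra.evenOdd (negForm d) 1, ∀ k, rep hτ a (e k) ∈ W k)
    (hsurj : ∀ w : K → T, (∀ k, w k ∈ W k) → ∃ x ∈ Submodule.span ℂ
      (rep hτ '' (CliffordAlgebra.evenOdd (negForm d) 1 : Set (Cl d))), ∀ k, x (e k) = w k)
    (hdim : Module.finrank ℝ hB.nil ≤ m * ∑ k, Module.finrank ℂ (W k)) :
    ComplexificationIsSum hB.soHom hB.nil τ (fun q : Fin m × K => W q.2) := by
  classical
  let t : (Fin m → CliffordAlgebra.evenOdd (negForm d) 1) →ₗ[ℝ] Fin m × K → T :=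
    { toFun := fun b q => rep hτ (CliffordAlgebra.reverse (b q.1 : Cl d)) (e q.2)
      map_add' := fun b c => by
        funext q
        simp only [Pi.add_apply, Submodule.coe_add, map_add, LinearMap.add_apply]
      map_smul' := fun r b => by
        funext q
        simp only [Pi.smul_apply, Submodule.coe_smul, map_smul, LinearMap.smul_apply,
          RingHom.id_apply] }
  refine complexificationIsSum_of (hB.nilMapOn σ) hV t (fun b q => ?_) (fun b hb => ?_)
    (fun w hw => ?_) ?_ fun M b => ?_
  · exact hW _ ((CliffordAlgebra.reverse_mem_evenOdd_iff _).mpr (b q.1).2) _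
  · funext q
    exact hker b hb q.1 q.2
  · have hx : ∀ j, ∃ x ∈ Submodule.span ℂ
        (rep hτ '' (CliffordAlgebra.evenOdd (negForm d) 1 : Set (Cl d))), ∀ k, x (e k) = w (j, k) :=
      fun j => hsurj (fun k => w (j, k)) fun k => hw (j, k)
    choose x hx hxe using hx
    let Θ : Fin m → Module.End ℂ T →ₗ[ℂ] Fin m × K → T := fun j =>
      { toFun := fun y q => if q.1 = j then y (e q.2) else 0
        map_add' := fun y z => by funext q; by_cases h : q.1 = j <;> simp [h]
        map_smul' := fun r y => by funext q; by_cases h : q.1 = j <;> simp [h] }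
    have hΘ : ∀ j, Θ j (x j) ∈ Submodule.span ℂ (Set.range t) := fun j => by
      have h1 := Submodule.mem_map_of_mem (f := Θ j) (hx j)
      rw [Submodule.map_span] at h1
      refine Submodule.span_mono ?_ h1
      rintro _ ⟨_, ⟨a, ha, rfl⟩, rfl⟩
      refine ⟨Pi.single j ⟨CliffordAlgebra.reverse a,
        (CliffordAlgebra.reverse_mem_evenOdd_iff _).mpr ha⟩, ?_⟩
      funext q
      change rep hτ (CliffordAlgebra.reverse _) (e q.2) = if q.1 = j then rep hτ a (e q.2) else 0
      split_ifs with h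
      · rw [h, Pi.single_eq_same, CliffordAlgebra.reverse_reverse]
      · rw [Pi.single_eq_of_ne h]
        simp
    have hsum : w = ∑ j, Θ j (x j) := by
      funext q
      rw [Finset.sum_apply, Finset.sum_eq_single q.1]
      · change w q = if q.1 = q.1 then x q.1 (e q.2) else 0
        rw [if_pos rfl, hxe]
      · intro j _ hj
        exact if_neg hj.symm
      · simp
    rw [hsum]
    exact Submodule.sum_mem _ fun j _ => hΘ j
  · have h1 : ∑ _j : Fin m, ∑ k, Module.finrank ℂ (W k) = m * ∑ k, Module.finrank ℂ (W k) := by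
      rw [Finset.sum_const, Finset.card_univ, Fintype.card_fin, smul_eq_mul]
    rw [Fintype.sum_prod_type]
    exact hdim.trans h1.symm.le
  · have hskew : (M : Matrix (Fin d) (Fin d) ℝ).transpose = -(M : Matrix (Fin d) (Fin d) ℝ) :=
      (LieAlgebra.Orthogonal.mem_so (Fin d) ℝ _).mp M.2
    have hmem : ∀ j, -((b j : Cl d) * spinEl (M : Matrix (Fin d) (Fin d) ℝ)) ∈
        CliffordAlgebra.evenOdd (negForm d) 1 := fun j => by
      have := mul_mem_evenOdd (b j).2 (spinEl_mem_even (M : Matrix (Fin d) (Fin d) ℝ))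
      rw [add_zero] at this
      exact Submodule.neg_mem _ this
    refine ⟨fun j => ⟨_, hmem j⟩, ?_, fun q => ?_⟩
    · have hn : hB.nilMapOn σ b ∈ hB.nil := by rw [← hV]; exact ⟨b, rfl⟩
      rw [hB.soHom_mul_nil M hn, zero_sub, hB.nil_mul_soHom M hn, nilMapOn_apply, nilMapOn_apply,
        Finset.sum_mul, ← Finset.sum_neg_distrib]
      refine Finset.sum_congr rfl fun j _ => ?_
      rw [mul_assoc _ B.proj, ← hB.even_mul_proj (spinEl_mem_even _), map_neg, map_mul]
      noncomm_ring
    · have h1 : t (fun j => ⟨_, hmem j⟩) q = rep hτ (CliffordAlgebra.reverse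
          (-((b q.1 : Cl d) * spinEl (M : Matrix (Fin d) (Fin d) ℝ)))) (e q.2) := rfl
      rw [h1, map_neg, CliffordAlgebra.reverse.map_mul, spinEl_reverse hskew, neg_mul, neg_neg, map_mul,
        rep_spinEl]
      rfl

end IsBrane

end Data

end Brane

/-! ### The complexification of `V` -/

namespace Brane

variable {d : ℕ}

namespace Data

variable {p : ℕ} {S : Type*} [NormedAddCommGroup S] [NormedSpace ℂ S] [FiniteDimensional ℂ S]

namespace IsBrane

/-- For `p = 1` and odd `d`, the product `γ_0 γ_1 γ^{[d]}` is central, hence a scalar, and `γ_1` is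
`± γ_0` on `V`. -/
theorem exists_gamma_one {B : Data 1 d S} (hB : B.IsBrane) (hd : Odd d) :
    ∃ r : ℝ, ∀ b ∈ CliffordAlgebra.evenOdd (negForm d) 1,
      B.γ (Sum.inl 1) * hB.ρ b * B.proj = r • (B.γ (Sum.inl 0) * hB.ρ b * B.proj) := by
  set g0 := B.γ (Sum.inl 0) with hg0
  set g1 := B.γ (Sum.inl 1) with hg1
  have h00 : g0 * g0 = 1 := by rw [hg0, hB.sq]; simp [eta]
  have h11 : g1 * g1 = -1 := by rw [hg1, hB.sq]; simp [eta]
  have h01 : g0 * g1 = -(g1 * g0) := hB.anticomm (by simp)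
  have h0i : ∀ i, g0 * B.γ (Sum.inr i) = -(B.γ (Sum.inr i) * g0) := fun i => hB.anticomm (by simp)
  have h1i : ∀ i, g1 * B.γ (Sum.inr i) = -(B.γ (Sum.inr i) * g1) := fun i => hB.anticomm (by simp)
  have hv0 : B.gvol * g0 = -(g0 * B.gvol) := by
    rw [hg0, hB.gvol_mul_inl, hd.neg_one_pow, neg_one_smul]
  have hv1 : B.gvol * g1 = -(g1 * B.gvol) := by
    rw [hg1, hB.gvol_mul_inl, hd.neg_one_pow, neg_one_smul]
  have hvi : ∀ i, B.gvol * B.γ (Sum.inr i) = B.γ (Sum.inr i) * B.gvol := fun i => by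
    rw [hB.mul_gvol, hd.neg_one_pow, neg_neg, one_smul]
  have hvv : (B.ε * B.ε) • (B.gvol * B.gvol) = 1 := by
    rw [← smul_mul_smul_comm]; exact hB.eps_sq
  -- the Euclidean gamma matrices of the whole space
  let Γ : Fin (d + 2) → Module.End ℂ S :=
    Fin.cons (Complex.I • g0) (Fin.cons g1 fun i => B.γ (Sum.inr i))
  have hΓ : IsEuclideanClifford Γ := by
    have e0 : (Complex.I • g0) * (Complex.I • g0) = -1 := by
      rw [smul_mul_smul_comm, h00, Complex.I_mul_I, neg_one_smul]
    have e01 : (Complex.I • g0) * g1 + g1 * (Complex.I • g0) = 0 := by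
      rw [smul_mul_assoc, mul_smul_comm, h01]; simp
    have e0i : ∀ i, (Complex.I • g0) * B.γ (Sum.inr i) + B.γ (Sum.inr i) * (Complex.I • g0) = 0 :=
      fun i => by rw [smul_mul_assoc, mul_smul_comm, h0i]; simp
    have e1i : ∀ i, g1 * B.γ (Sum.inr i) + B.γ (Sum.inr i) * g1 = 0 := fun i => by
      rw [h1i]; simp
    intro i j
    refine Fin.cases ?_ (fun i => Fin.cases ?_ (fun i => ?_) i) i <;>
    refine Fin.cases ?_ (fun j => Fin.cases ?_ (fun j => ?_) j) j
    · simp only [Γ, Fin.cons_zero, e0, if_true]; module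
    · simpa [Γ, Fin.ext_iff] using e01
    · simpa [Γ, Fin.ext_iff] using e0i j
    · rw [add_comm]; simpa [Γ, Fin.ext_iff] using e01
    · simp only [Γ, Fin.cons_succ, Fin.cons_zero, h11, if_true]; module
    · have := e1i j
      simpa [Γ, Fin.ext_iff] using this
    · rw [add_comm]; simpa [Γ, Fin.ext_iff] using e0i i
    · rw [add_comm]; simpa [Γ, Fin.ext_iff] using e1i i
    · simpa [Γ] using hB.space i j
  set w := g0 * g1 * B.gvol with hw
  have hw0 : w * g0 = g0 * w := by
    rw [hw, mul_assoc, hv0, mul_neg, ← mul_assoc, mul_assoc g0 g1 g0]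
    nth_rewrite 1 [← neg_neg (g1 * g0), ← h01]
    noncomm_ring
  have hw1 : w * g1 = g1 * w := by
    rw [hw, mul_assoc, hv1, mul_neg, ← mul_assoc, ← mul_assoc, ← mul_assoc, mul_assoc g0 g1 g1, h11,
      ← neg_neg (g1 * g0), ← h01, neg_mul, mul_assoc g0 g1 g1, h11]
    noncomm_ring
  have hwi : ∀ i, w * B.γ (Sum.inr i) = B.γ (Sum.inr i) * w := fun i => by
    rw [hw, mul_assoc, hvi, ← mul_assoc, mul_assoc g0, h1i, mul_neg, ← mul_assoc, h0i]
    noncomm_ring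
  have hcomm : ∀ i, w * Γ i = Γ i * w := by
    refine Fin.cases ?_ (Fin.cases ?_ fun i => ?_)
    · simp only [Γ, Fin.cons_zero]
      rw [mul_smul_comm, smul_mul_assoc, hw0]
    · simpa [Γ] using hw1
    · simpa [Γ] using hwi i
  have hdim : Module.finrank ℂ S = 2 ^ ((d + 2 - 1) / 2) := by
    obtain ⟨m, hm⟩ := hd
    rw [hB.dim]
    congr 1
    omega
  have hspan := span_rep_odd_eq_top hΓ (by rw [Nat.odd_add]; simp [hd]) hdim
  have hcenter : ∀ x : Module.End ℂ S, w * x = x * w := fun x => by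
    have hx : x ∈ Submodule.span ℂ
        (rep hΓ '' (CliffordAlgebra.evenOdd (negForm (d + 2)) 1 : Set (Cl (d + 2)))) := by
      rw [hspan]; trivial
    induction hx using Submodule.span_induction with
    | mem x h =>
      obtain ⟨a, -, rfl⟩ := h
      exact mul_rep_of_comm hΓ hcomm a
    | zero => simp
    | add x y _ _ hx hy => rw [mul_add, add_mul, hx, hy]
    | smul r x _ hx => rw [mul_smul_comm, smul_mul_assoc, hx]
  obtain ⟨c, hcc, hc⟩ := Module.End.mem_center_iff.mp
    (Semigroup.mem_center_iff.mpr fun x => (hcenter x).symm : w ∈ Set.center (Module.End ℂ S))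
  have hwc : w = c • 1 := by
    rw [hc]; ext v; simp
  have hg : g0 * g1 = (c * (B.ε * B.ε)) • B.gvol := by
    have h1 : w * B.gvol = c • B.gvol := by rw [hwc, smul_mul_assoc, one_mul]
    rw [hw, mul_assoc] at h1
    calc g0 * g1 = g0 * g1 * ((B.ε * B.ε) • (B.gvol * B.gvol)) := by rw [hvv, mul_one]
      _ = (B.ε * B.ε) • (g0 * g1 * (B.gvol * B.gvol)) := mul_smul_comm _ _ _
      _ = (c * (B.ε * B.ε)) • B.gvol := by
        rw [h1, smul_smul, mul_comm (B.ε * B.ε) c]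
  have hcε : (c * B.ε) * (c * B.ε) = 1 := by
    have h1 : (g0 * g1) * (g0 * g1) = 1 := by
      nth_rewrite 2 [h01]
      rw [mul_neg, mul_assoc, ← mul_assoc g1, h11, neg_one_mul, mul_neg, h00, neg_neg]
    rw [hg, smul_mul_smul_comm, show c * (B.ε * B.ε) * (c * (B.ε * B.ε)) =
      ((c * B.ε) * (c * B.ε)) * (B.ε * B.ε) by ring, ← smul_smul, hvv,
      ← Algebra.algebraMap_eq_smul_one, ← map_one (algebraMap ℂ (Module.End ℂ S))] at h1
    have hS : Nontrivial S := by
      refine Module.nontrivial_of_finrank_pos (R := ℂ) ?_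
      rw [hB.dim]; positivity
    exact FaithfulSMul.algebraMap_injective ℂ (Module.End ℂ S) h1
  obtain ⟨r, hr⟩ : ∃ r : ℝ, -(c * B.ε) * ((B.δ₁ : ℤ) : ℂ) = (r : ℂ) := by
    rcases mul_self_eq_one_iff.mp hcε with h | h
    · exact ⟨-((B.δ₁ : ℤ) : ℝ), by rw [h]; push_cast; ring⟩
    · exact ⟨((B.δ₁ : ℤ) : ℝ), by rw [h]; push_cast; ring⟩
  have hP : g0 * g1 * B.proj = (r : ℂ) • B.proj := by
    rw [hg, smul_mul_assoc, hB.gvol_mul_proj, smul_smul, ← hr]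
    congr 1
    have hε := hB.eps_ne_zero
    have hδ : ((B.δ₁ : ℤ) : ℂ)⁻¹ = ((B.δ₁ : ℤ) : ℂ) := inv_eq_of_mul_eq_one_left (unit_sq _)
    rw [mul_inv, hδ]
    field_simp
  refine ⟨r, fun b hb => ?_⟩
  have h1 : g1 * B.proj = (r : ℂ) • (g0 * B.proj) := by
    rw [← mul_smul_comm, ← hP, ← mul_assoc, ← mul_assoc, h00, one_mul]
  have h2 : ∀ μ : Fin 2, B.γ (Sum.inl μ) * hB.ρ b * B.proj =
      -(hB.ρ b * (B.γ (Sum.inl μ) * B.proj)) := fun μ => by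
    rw [← mul_assoc, hB.inl_mul_odd μ hb]; noncomm_ring
  rw [h2 1, h2 0, ← hg1, ← hg0, h1, real_smul_end]
  rw [mul_smul_comm, smul_neg]

/-- For odd `d`, the odd elements of the Clifford algebra are complexified to all endomorphisms of the
spinor module, one copy for each independent `γ_μ`. -/
theorem complexification_odd {B : Data p d S} (hB : B.IsBrane) {T : Type*} [AddCommGroup T]
    [Module ℂ T] {τ : Fin d → Module.End ℂ T} (hτ : IsEuclideanClifford τ)
    (hT : Module.finrank ℂ T = 2 ^ (d / 2)) (hd : Odd d) :
    ComplexificationIsSum hB.soHom hB.nil τ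
      (fun _ : Fin (spaceTimeMult p d * 2 ^ ((d - 1) / 2)) => (⊤ : Submodule ℂ T)) := by
  have hfin : FiniteDimensional ℂ T := Module.finite_of_finrank_pos (by rw [hT]; positivity)
  have hmod : d % 4 ≠ 0 := by
    have := Nat.odd_iff.mp hd
    omega
  have hd2 : (d - 1) / 2 = d / 2 := by
    have := Nat.odd_iff.mp hd
    omega
  have hd3 : d / 2 + d / 2 = d - 1 := by
    have := Nat.odd_iff.mp hd
    omega
  -- an index family that is independent on `V`
  obtain ⟨σ, hV, hsep⟩ : ∃ σ : Fin (spaceTimeMult p d) → Fin (p + 1),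
      LinearMap.range (hB.nilMapOn σ) = hB.nil ∧
        ∀ b, hB.nilMapOn σ b = 0 → ∀ j, hB.ρ (b j) * B.proj = 0 := by
    by_cases hp : p = 1
    · subst hp
      have h1 : spaceTimeMult 1 d = 1 := if_pos ⟨rfl, hd⟩
      rw [h1]
      refine ⟨fun _ => 0, le_antisymm ?_ ?_, fun b hb j => ?_⟩
      · rintro _ ⟨b, rfl⟩
        rw [nilMapOn_apply]
        exact Submodule.sum_mem _ fun j _ => hB.gamma_odd_mem_nil 0 (b j).2
      · obtain ⟨r, hr⟩ := hB.exists_gamma_one hd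
        have h0 : ∀ x ∈ CliffordAlgebra.evenOdd (negForm d) 1,
            B.γ (Sum.inl 0) * hB.ρ x * B.proj ∈
              LinearMap.range (hB.nilMapOn fun _ : Fin 1 => (0 : Fin 2)) := fun x hx =>
          ⟨fun _ => ⟨x, hx⟩, by rw [nilMapOn_apply]; simp⟩
        refine hB.nil_induction fun μ x hx => ?_
        fin_cases μ
        · exact h0 x hx
        · have h2 := hr x hx
          change B.γ (Sum.inl 1) * hB.ρ x * B.proj ∈ _
          rw [h2]
          exact Submodule.smul_mem _ _ (h0 x hx)
      · rw [nilMapOn_apply, Fin.sum_univ_one] at hb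
        rw [Subsingleton.elim j 0]
        exact hB.odd_mul_proj_eq_zero hb
    · have h1 : spaceTimeMult p d = p + 1 := if_neg fun h => hp h.1
      rw [h1]
      refine ⟨fun j => j, rfl, fun b hb j => hB.separate_odd ?_ b hb j⟩
      have hpe : Even (p + 1) := hB.parity.resolve_left (Nat.not_even_iff_odd.mpr hd)
      have := Nat.even_iff.mp hpe
      omega
  let e := Module.finBasisOfFinrankEq ℂ T hT
  have hmain := hB.complexification_nil hτ σ hV (K := Fin (2 ^ (d / 2))) (fun k => e k)
    (fun _ => ⊤) (fun b hb j k => ?_) (fun _ _ _ => trivial) (fun w _ => ?_) ?_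
  · rw [hd2]
    exact hmain.reindex finProdFinEquiv.symm rfl
  · rw [hB.odd_eq_zero_of_mul_proj hmod (b j).2 (hsep b hb j), map_zero, map_zero,
      LinearMap.zero_apply]
  · refine ⟨e.constr ℂ w, ?_, fun k => Module.Basis.constr_basis _ _ _ _⟩
    rw [span_rep_odd_eq_top hτ hd (by rw [hT, hd2])]
    trivial
  · refine (hB.finrank_nil_le hV).trans (Nat.mul_le_mul_left _ ?_)
    rw [Finset.sum_const, finrank_top, hT, Finset.card_univ, Fintype.card_fin, smul_eq_mul, ← pow_add,
      hd3]

/-- For `d ≡ 2 mod 4`, the odd elements are complexified to all maps between the half-spinors of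
opposite signs, and act faithfully on `Π(S)`. -/
theorem complexification_mod_two {B : Data p d S} (hB : B.IsBrane) {T : Type*} [AddCommGroup T]
    [Module ℂ T] {τ : Fin d → Module.End ℂ T} (hτ : IsEuclideanClifford τ)
    (hT : Module.finrank ℂ T = 2 ^ (d / 2)) (hd : d % 4 = 2) :
    ComplexificationIsSum hB.soHom hB.nil τ
      (fun k : Fin ((p + 1) * 2 ^ (d / 2 - 1)) ⊕ Fin ((p + 1) * 2 ^ (d / 2 - 1)) =>
        Sum.elim (fun _ => halfSpin τ B.ε 1) (fun _ => halfSpin τ B.ε (-1)) k) := by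
  have hfin : FiniteDimensional ℂ T := Module.finite_of_finrank_pos (by rw [hT]; positivity)
  have hev : Even d := Nat.even_iff.mpr (by omega)
  have h2 := hB.eps_vol_sq hτ
  have hdim := finrank_halfSpin hτ hev hB.two_le hT h2
  let ep := Module.finBasisOfFinrankEq ℂ _ (hdim 1)
  let em := Module.finBasisOfFinrankEq ℂ _ (hdim (-1))
  let r := 2 ^ (d / 2 - 1)
  have hmain := hB.complexification_nil hτ (fun j => j) rfl (K := Fin r ⊕ Fin r)
    (Sum.elim (fun k => (em k : T)) fun k => (ep k : T))
    (Sum.elim (fun _ => halfSpin τ B.ε 1) (fun _ => halfSpin τ B.ε (-1)))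
    (fun b hb j k => ?_) (fun a ha k => ?_) (fun w hw => ?_) ?_
  · refine hmain.reindex (((finProdFinEquiv (m := p + 1) (n := r)).sumCongr
      (finProdFinEquiv (m := p + 1) (n := r))).symm.trans
      (Equiv.prodSumDistrib (Fin (p + 1)) (Fin r) (Fin r)).symm) ?_
    funext k
    rcases k with k | k <;> rfl
  · rw [hB.odd_eq_zero_of_mul_proj (by omega) (b j).2 (hB.separate_even hev b hb j), map_zero,
      map_zero, LinearMap.zero_apply]
  · rcases k with k | k
    · have := odd_mem_halfSpin hτ hev ha (em k).2
      rwa [neg_neg] at this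
    · exact odd_mem_halfSpin hτ hev ha (ep k).2
  · obtain ⟨x, hx, hx1, hx2⟩ := exists_odd_map hτ hev hT hB.eps_ne_zero h2 em (fun k => w (Sum.inl k))
      fun k => by rw [neg_neg]; exact hw (Sum.inl k)
    obtain ⟨y, hy, hy1, hy2⟩ := exists_odd_map hτ hev hT hB.eps_ne_zero h2 ep (fun k => w (Sum.inr k))
      fun k => hw (Sum.inr k)
    rw [neg_neg] at hx2
    refine ⟨x + y, Submodule.add_mem _ hx hy, fun k => ?_⟩
    rcases k with k | k
    · simp only [LinearMap.add_apply, Sum.elim_inl, hx1, hy2 _ (em k).2, add_zero]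
    · simp only [LinearMap.add_apply, Sum.elim_inr, hy1, hx2 _ (ep k).2, zero_add]
  · refine (hB.finrank_nil_le rfl).trans (Nat.mul_le_mul_left _ ?_)
    have hsum : ∑ k : Fin r ⊕ Fin r, Module.finrank ℂ (Sum.elim (fun _ => halfSpin τ B.ε 1)
        (fun _ => halfSpin τ B.ε (-1)) k : Submodule ℂ T) = r * r + r * r := by
      rw [Fintype.sum_sum_type]
      congr 1
      · exact (Finset.sum_congr rfl fun _ _ => hdim 1).trans (by simp [r])
      · exact (Finset.sum_congr rfl fun _ _ => hdim (-1)).trans (by simp [r])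
    refine le_of_le_of_eq ?_ hsum.symm
    simp only [r]
    rw [← two_mul, ← pow_add, ← pow_succ']
    exact Nat.pow_le_pow_right two_pos (by omega)

/-- For `d` divisible by `4`, complementary odd monomials agree on `Π(S)` up to the sign, which halves
the dimension of `V`. -/
theorem finrank_nil_le_of_mod_zero {B : Data p d S} (hB : B.IsBrane) (hd : d % 4 = 0) :
    Module.finrank ℝ hB.nil ≤ (p + 1) * 2 ^ (d - 2) := by
  have hev : Even d := Nat.even_iff.mpr (by omega)
  have h2 := hB.two_le
  let i0 : Fin d := ⟨0, by omega⟩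
  let f : Fin (p + 1) × {I : Finset (Fin d) // Odd I.card ∧ i0 ∈ I} → Module.End ℂ S :=
    fun q => B.γ (Sum.inl q.1) * hB.ρ (mon q.2.1) * B.proj
  have hfin : FiniteDimensional ℝ (Submodule.span ℝ (Set.range f)) :=
    FiniteDimensional.span_of_finite ℝ (Set.finite_range _)
  -- here `ε = 1`, and `Π` absorbs the volume element up to the sign
  have hP : B.proj = (-((B.δ₁ : ℤ) : ℝ)) • (hB.ρ (volCl d) * B.proj) := by
    rw [rep_volCl hB.space]
    change _ = _ • (B.gvol * B.proj)
    rw [hB.gvol_mul_proj, hB.eps_of_mod_zero hd, mul_one, real_smul_end, smul_smul]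
    push_cast
    rw [neg_mul_neg, mul_inv_cancel₀, one_smul]
    intro h0
    have := unit_sq B.δ₁
    rw [h0] at this
    simp at this
  have hle : hB.nil ≤ Submodule.span ℝ (Set.range f) := by
    refine hB.nil_induction fun μ x hx => ?_
    let L : Cl d →ₗ[ℝ] Module.End ℂ S := (LinearMap.mulRight ℝ B.proj).comp
      ((LinearMap.mulLeft ℝ (B.γ (Sum.inl μ))).comp hB.ρ.toLinearMap)
    have h1 := Submodule.mem_map_of_mem (f := L) ((evenOdd_le_span x).2 hx)
    rw [Submodule.map_span] at h1
    refine (Submodule.span_le.mpr ?_ : Submodule.span ℝ _ ≤ _) h1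
    rintro _ ⟨_, ⟨I, hI, rfl⟩, rfl⟩
    have hI' : Odd I.card := hI
    change B.γ (Sum.inl μ) * hB.ρ (mon I) * B.proj ∈ _
    by_cases h0 : i0 ∈ I
    · exact Submodule.subset_span ⟨(μ, ⟨I, hI', h0⟩), rfl⟩
    · have hIc : Odd Iᶜ.card := by
        rw [Finset.card_compl, Fintype.card_fin]
        exact Nat.Even.sub_odd ((Finset.card_le_univ I).trans (by simp)) hev hI'
      have hmem : B.γ (Sum.inl μ) * hB.ρ (mon Iᶜ) * B.proj ∈ Submodule.span ℝ (Set.range f) :=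
        Submodule.subset_span ⟨(μ, ⟨Iᶜ, hIc, by simpa using h0⟩), rfl⟩
      rw [hP, mul_smul_comm, ← mul_assoc, mul_assoc _ (hB.ρ (mon I)), ← map_mul]
      refine Submodule.smul_mem _ _ ?_
      rcases volCl_mul_mon I with h | h
      · rw [h]; exact hmem
      · rw [h, map_neg, mul_neg, neg_mul]; exact Submodule.neg_mem _ hmem
  refine (Submodule.finrank_mono hle).trans ((finrank_range_le_card f).trans ?_)
  rw [Fintype.card_prod, Fintype.card_fin, card_odd_subsets_mem h2 hev i0]

/-- For `d` divisible by `4`, `γ^{[d]}` is a real scalar on `Π(S)`, and only the half-spinors of one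
sign contribute. -/
theorem complexification_mod_zero {B : Data p d S} (hB : B.IsBrane) {T : Type*} [AddCommGroup T]
    [Module ℂ T] {τ : Fin d → Module.End ℂ T} (hτ : IsEuclideanClifford τ)
    (hT : Module.finrank ℂ T = 2 ^ (d / 2)) (hd : d % 4 = 0) :
    ∃ s : ℤˣ, ComplexificationIsSum hB.soHom hB.nil τ
      (fun _ : Fin ((p + 1) * 2 ^ (d / 2 - 1)) => halfSpin τ B.ε s) := by
  have hfin : FiniteDimensional ℂ T := Module.finite_of_finrank_pos (by rw [hT]; positivity)
  have hev : Even d := Nat.even_iff.mpr (by omega)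
  have h2 := hB.eps_vol_sq hτ
  have hdim := finrank_halfSpin hτ hev hB.two_le hT h2
  have hd2 := hB.two_le
  let e := Module.finBasisOfFinrankEq ℂ _ (hdim B.δ₁)
  refine ⟨-B.δ₁, ?_⟩
  have hmain := hB.complexification_nil hτ (fun j => j) rfl (K := Fin (2 ^ (d / 2 - 1)))
    (fun k => (e k : T)) (fun _ => halfSpin τ B.ε (-B.δ₁))
    (fun b hb j k => ?_) (fun a ha k => odd_mem_halfSpin hτ hev ha (e k).2) (fun w hw => ?_) ?_
  · exact hmain.reindex finProdFinEquiv.symm rfl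
  · -- the reversal turns `b = δ b vol` into `b' = -δ b' vol`
    set a := CliffordAlgebra.reverse (b j : Cl d) with ha
    have hao : a ∈ CliffordAlgebra.evenOdd (negForm d) 1 :=
      (CliffordAlgebra.reverse_mem_evenOdd_iff _).mpr (b j).2
    have h3 := hB.odd_eq_mul_volCl_of_mul_proj hd (b j).2 (hB.separate_even hev b hb j)
    have h4 : a = ((B.δ₁ : ℤ) : ℝ) • (volCl d * a) := by
      have h5 := congrArg CliffordAlgebra.reverse h3
      have hexp : Even (d * (d - 1) / 2) := by
        obtain ⟨m, rfl⟩ : ∃ m, d = 4 * m := ⟨d / 4, by omega⟩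
        rw [show 4 * m * (4 * m - 1) = 2 * (2 * (m * (4 * m - 1))) by ring,
          Nat.mul_div_cancel_left _ two_pos]
        exact even_two_mul _
      rwa [map_smul, CliffordAlgebra.reverse.map_mul, reverse_volCl, hexp.neg_one_pow, one_mul,
        ← ha] at h5
    have h6 : rep hτ a = -(((B.δ₁ : ℤ) : ℂ) • (rep hτ a * vol τ)) := by
      nth_rewrite 1 [h4]
      rw [map_smul, map_mul, rep_volCl, vol_mul_rep_odd hτ hao, hev.neg_one_pow, neg_one_mul,
        real_smul_end, smul_neg]
      norm_num
    have hv : vol τ (e k : T) = ((B.δ₁ : ℤ) : ℂ) • (e k : T) := by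
      have hall : ∀ v ∈ halfSpin τ B.ε B.δ₁, vol τ v = ((B.δ₁ : ℤ) : ℂ) • v := fun v hv => by
        have := mem_halfSpin.mp hv
        rwa [hB.eps_of_mod_zero hd, one_smul] at this
      exact hall _ (e k).2
    have h7 := LinearMap.congr_fun h6 (e k : T)
    rw [LinearMap.neg_apply, LinearMap.smul_apply, Module.End.mul_apply, hv, map_smul, smul_smul,
      unit_sq, one_smul] at h7
    exact eq_zero_of_eq_neg_self h7
  · obtain ⟨x, hx, hx1, -⟩ := exists_odd_map hτ hev hT hB.eps_ne_zero h2 e w hw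
    exact ⟨x, hx, hx1⟩
  · refine (hB.finrank_nil_le_of_mod_zero hd).trans (Nat.mul_le_mul_left _ ?_)
    simp only [hdim, Finset.sum_const, Finset.card_univ, Fintype.card_fin, smul_eq_mul]
    rw [← pow_add]
    exact Nat.pow_le_pow_right two_pos (by omega)

end IsBrane

end Data

end Brane

theorem proposition5p11 {p d : ℕ}
    {S : Type*} [NormedAddCommGroup S] [NormedSpace ℂ S] [FiniteDimensional ℂ S]
    (B : Brane.Data p d S) (hB : B.IsBrane)
    {T : Type*} [AddCommGroup T] [Module ℂ T]
    (τ : Fin d → Module.End ℂ T) (hτ : Brane.IsEuclideanClifford τ)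
    (hT : Module.finrank ℂ T = 2 ^ (d / 2)) :
    -- explicit form of the connection
    (∀ x,
      (∀ μ, B.connC (Sum.inl μ) x = -∑ i, ((B.X i (Brane.ypart x) : ℝ) : ℂ) •
        (Brane.asym ![B.γ (Sum.inl μ), B.γ (Sum.inr i)] * B.proj)) ∧
      (∀ i, B.connC (Sum.inr i) x = -∑ j, ((B.Y j (Brane.ypart x) : ℝ) : ℂ) •
          (Brane.asym ![B.γ (Sum.inr i), B.γ (Sum.inr j)] * B.proj) +
        (((B.δ₂ : ℤ) : ℂ) * B.ε * (((d : ℂ) - 1) * B.β / (2 * B.α)) *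
          ((B.Y i (Brane.ypart x) : ℝ) : ℂ)) • B.gvol)) ∧
    -- holonomy
    (B.β ≠ 0 → (∃ y, B.IsGenericAt y) →
      ∃ (φ : LieAlgebra.Orthogonal.so (Fin d) ℝ →ₗ⁅ℝ⁆ Module.End ℂ S)
        (V : Submodule ℝ (Module.End ℂ S)),
        (∀ M, φ M = Brane.spinRep (fun i => B.γ (Sum.inr i)) M * B.proj) ∧
        (∀ M, B.proj * φ M = φ M ∧ φ M * B.proj = φ M) ∧
        (3 ≤ d → ∀ M, LinearMap.trace ℂ S (φ M) = 0) ∧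
        (d ≠ 4 → Function.Injective φ) ∧
        (∀ v ∈ V, ∀ w ∈ V, v * w - w * v = 0) ∧
        (∀ M, ∀ v ∈ V, φ M * v - v * φ M ∈ V) ∧
        Disjoint φ.range.toSubmodule V ∧
        (∀ x, (Brane.holonomyAlgebra B.connC x).toSubmodule = φ.range.toSubmodule ⊔ V) ∧
        (Odd d → Brane.ComplexificationIsSum φ V τ
          (fun _ : Fin (Brane.spaceTimeMult p d * 2 ^ ((d - 1) / 2)) => (⊤ : Submodule ℂ T))) ∧
        (d % 4 = 0 → ∃ s : ℤˣ, Brane.ComplexificationIsSum φ V τ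
          (fun _ : Fin ((p + 1) * 2 ^ (d / 2 - 1)) => Brane.halfSpin τ B.ε s)) ∧
        (d % 4 = 2 → Brane.ComplexificationIsSum φ V τ
          (fun k : Fin ((p + 1) * 2 ^ (d / 2 - 1)) ⊕ Fin ((p + 1) * 2 ^ (d / 2 - 1)) =>
            Sum.elim (fun _ => Brane.halfSpin τ B.ε 1) (fun _ => Brane.halfSpin τ B.ε (-1)) k))) ∧
    -- torsion, and the torsion free space of parallel spinors
    (∀ (C : LinearMap.BilinForm ℂ S) (Δ₀ Δ₁ : ℤˣ) (hC : B.IsChargeConjugation C Δ₀ Δ₁),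
      Brane.Delta Δ₀ Δ₁ (d - 1) * Δ₁ = -1 →
      B.IsAdmissible C hC.nondeg ∧
      (∀ ξ : Brane.Pt p d → S, ContDiff ℝ ∞ ξ → ∀ x,
        (∀ A E, B.torsion C hC.nondeg A E ξ x = (2 : ℂ) • B.hatD C hC.nondeg A E ξ x) ∧
        (∀ μ ν, B.torsion C hC.nondeg (Sum.inl μ) (Sum.inl ν) ξ x =
          (2 * (((B.δ₁ : ℤ) : ℂ) * B.ε *
            ((B.f₁ (Brane.ypart x) * B.f₂ (Brane.ypart x) : ℝ) : ℂ))) •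
            (B.cliff (B.raise (fun i => B.X i (Brane.ypart x)) x) x *
              Brane.asym ![B.γ (Sum.inl μ), B.γ (Sum.inl ν)] * B.gvol) (ξ x)) ∧
        (∀ μ i, B.torsion C hC.nondeg (Sum.inl μ) (Sum.inr i) ξ x =
          (2 * -(((B.δ₁ : ℤ) : ℂ) * B.ε *
            ((B.f₂ (Brane.ypart x) * B.X i (Brane.ypart x) : ℝ) : ℂ))) •
            (B.γ (Sum.inl μ) * B.gvol) (ξ x)) ∧
        (∀ μ i, B.torsion C hC.nondeg (Sum.inl μ) (Sum.inr i) ξ x =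
          (2 * (((B.δ₂ : ℤ) : ℂ) * B.ε * ((d : ℂ) - 1) * B.β * B.α⁻¹ *
            ((B.f₁ (Brane.ypart x) * B.Y i (Brane.ypart x) : ℝ) : ℂ))) •
            (B.γ (Sum.inl μ) * B.gvol) (ξ x)) ∧
        (∀ i j, B.torsion C hC.nondeg (Sum.inr i) (Sum.inr j) ξ x =
          ∑ k, (2 * (((B.δ₂ : ℤ) : ℂ) * B.ε *
            ((B.f₂ (Brane.ypart x) * B.Y k (Brane.ypart x) : ℝ) : ℂ))) •
            (Brane.asym ![B.γ (Sum.inr k), B.γ (Sum.inr i), B.γ (Sum.inr j)] * B.gvol) (ξ x))) ∧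
      B.IsAdmissibleSet C hC.nondeg (B.parallelKernel : Set (Brane.Pt p d → S)) ∧
      B.IsTorsionFreeSet C hC.nondeg (B.parallelKernel : Set (Brane.Pt p d → S))) := by
  refine ⟨fun x => ⟨fun μ => hB.connC_inl μ x, fun i => hB.connC_inr i x⟩, ?_, ?_⟩
  · intro hβ hgen
    refine ⟨hB.soHom, hB.nil, fun M => ?_, fun M => ⟨hB.proj_mul_soHom M, hB.soHom_mul_proj M⟩,
      hB.trace_soHom, hB.soHom_injective, fun v hv w hw => ?_, fun M v hv => hB.lie_nil_mem M hv,
      hB.disjoint_soHom_nil, fun x => Brane.Data.IsBrane.holonomyAlgebra_eq hB hβ hgen x,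
      fun hd => hB.complexification_odd hτ hT hd, fun hd => hB.complexification_mod_zero hτ hT hd,
      fun hd => hB.complexification_mod_two hτ hT hd⟩
    · rw [hB.soHom_apply, ← Brane.rep_spinEl hB.space]
    · rw [hB.nil_mul_nil hv hw, hB.nil_mul_nil hw hv, sub_zero]
  · intro C Δ₀ Δ₁ hC hΔ
    refine ⟨Brane.Data.isAdmissible hB hC hΔ, fun ξ hξ x =>
      ⟨fun A E => Brane.Data.torsion_eq hB hC hΔ A E hξ x, fun μ ν => ?_, fun μ i => ?_,
        fun μ i => ?_, fun i j => ?_⟩,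
      Brane.Data.isAdmissibleSet_parallelKernel hB hC hΔ,
      Brane.Data.isTorsionFreeSet_parallelKernel hB hC hΔ⟩
    · rw [Brane.Data.torsion_eq hB hC hΔ _ _ hξ, Brane.Data.hatD_inl_inl hB hC hΔ μ ν hξ, smul_smul]
    · rw [Brane.Data.torsion_eq hB hC hΔ _ _ hξ, Brane.Data.hatD_inl_inr hB hC hΔ μ i hξ, smul_smul]
    · rw [Brane.Data.torsion_eq hB hC hΔ _ _ hξ, Brane.Data.hatD_inl_inr hB hC hΔ μ i hξ, smul_smul,
        Brane.Data.X_eq_Y hB, hB.signs]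
      congr 1
      ring
    · rw [Brane.Data.torsion_eq hB hC hΔ _ _ hξ, Brane.Data.hatD_inr_inr hB hC hΔ i j hξ,
        Finset.smul_sum]
      simp only [smul_smul]
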